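/- Let $n\ge 1$ and let $(M,\mathcal Q)$ be an almost quaternionic manifold of dimension $4n$: $M$ is a smooth (Hausdorff, $\sigma$-compact) $4n$-manifold and $\mathcal Q\subset \mathrm{End}(TM)$ is a rank-3 subbundle that is locally spanned by a smooth triple $(J_1,J_2,J_3)$ with $J_a^2=-1$, $J_1J_2=-J_2J_1=J_3$. A quaternionic connection is a smooth linear connection $\nabla$ on $TM$, with arbitrary torsion, such that $\nabla_X\sigma\in\Gamma(\mathcal Q)$ for all vector fields $X$ and all $\sigma\in\Gamma(\mathcal Q)$. $(M,\mathcal Q)$ is called quaternionic if it admits a torsion-free quaternionic connection. For $n=1$, $\mathcal Q$ is the same as an oriented conformal structure $[g]$: $g$ is a $\mathcal Q$-Hermitian metric, and the frames $(X,J_1X,J_2X,J_3X)$ are positively oriented; it is anti-self-dual if the self-dual part $W^+$ of the Weyl tensor of $g$ vanishes. Let $Z=\{J\in\mathcal Q_p : p\in M,\ J^2=-1\}$ be the twistor space, an $S^2$-bundle over $M$. A quaternionic connection $\nabla$ splits $T_JZ=V_J\oplus H_J$ into the vertical space $V_J=\{A\in\mathcal Q_p: AJ+JA=0\}$ and the horizontal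 space $H_J\cong T_pM$, and defines an almost complex structure $I_1^\nabla$ on $Z$ by $$I_1^\nabla(A)=JA\quad (A\in V_J),\qquad I_1^\nabla(X^h)=(JX)^h\quad (X\in T_pM),$$ where $X^h$ is the horizontal lift of $X$ to $J$. It is integrable if its Nijenhuis tensor vanishes. Theorem. The following two conditions are equivalent. 1) Either $n\ge 2$ and $(M,\mathcal Q)$ is a quaternionic manifold, or $n=1$ and the oriented conformal structure $[g]$ given by $\mathcal Q$ is anti-self-dual. 2) There is an integrable almost complex structure on $Z$ of the form $I_1^\nabla$ for some quaternionic connection $\nabla$, and it does not depend on $\nabla$: if $I_1^{\nabla}$ and $I_1^{\nabla'}$ are both integrable, for quaternionic connections $\nabla,\nabla'$, then $I_1^\nabla=I_1^{\nabla'}$. In other words, among the almost complex structures $I_1^\nabla$, with $\nabla$ a quaternionic connection, exactly one is integrable. -/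

import Mathlib

open Bundle Set Filter
open scoped Manifold ContDiff Topology

namespace AlmostQuaternionic

noncomputable section

/-- The model space of a `4n`-dimensional manifold. -/
abbrev Model (n : ℕ) : Type := EuclideanSpace ℝ (Fin (4 * n))

section Bundles

variable (n : ℕ) (M : Type*) [TopologicalSpace M] [ChartedSpace (Model n) M]

/-- The tangent space `T_x M`. -/
abbrev TM (x : M) : Type := TangentSpace (𝓡 (4 * n)) x

/-- The endomorphisms of `T_x M`. -/
abbrev EndT (x : M) : Type := TM n M x →L[ℝ] TM n M x

/-- The fibre model of `End(TM)`. -/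
abbrev EndModel : Type := Model n →L[ℝ] Model n

variable [IsManifold (𝓡 (4 * n)) ∞ M]

/-- The total space of the vector bundle `End(TM)`. -/
abbrev EndTM : Type _ := TotalSpace (EndModel n) (EndT n M)

/-- The model with corners of the manifold `End(TM)`. -/
abbrev endI : ModelWithCorners ℝ (Model n × EndModel n) (ModelProd (Model n) (EndModel n)) :=
  (𝓡 (4 * n)).prod 𝓘(ℝ, EndModel n)

/-- Linear connections on `TM` (as operators; smoothness is `IsSmoothConnection`). -/
abbrev Connection : Type _ := CovariantDerivative (𝓡 (4 * n)) (Model n) (TM n M)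

end Bundles

variable {n : ℕ} {M : Type*} [TopologicalSpace M] [ChartedSpace (Model n) M]
  [IsManifold (𝓡 (4 * n)) ∞ M]

/-! ### Smooth tensor fields -/

/-- The vector field `Y` is smooth at `x`. -/
def SmoothVFAt (Y : ∀ y : M, TM n M y) (x : M) : Prop :=
  ContMDiffAt (𝓡 (4 * n)) ((𝓡 (4 * n)).prod 𝓘(ℝ, Model n)) ∞
    (fun y ↦ (TotalSpace.mk' (Model n) y (Y y) : TotalSpace (Model n) (TM n M))) x

/-- A field of endomorphisms, as a map into the total space of `End(TM)`. -/
def endMap (σ : ∀ y : M, EndT n M y) (y : M) : EndTM n M := TotalSpace.mk' (EndModel n) y (σ y)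

/-- The field of endomorphisms `σ` is smooth at `x`. -/
def SmoothEndAt (σ : ∀ y : M, EndT n M y) (x : M) : Prop :=
  ContMDiffAt (𝓡 (4 * n)) (endI n) ∞ (endMap σ) x

/-! ### Almost quaternionic structures -/

/-- The triple `J₁ = J 0, J₂ = J 1, J₃ = J 2` of endomorphisms of `T_x M` satisfies the
quaternionic identities `J_a² = -1`, `J₁ J₂ = - J₂ J₁ = J₃`. -/
structure IsQuaternionicTriple {x : M} (J : Fin 3 → EndT n M x) : Prop where
  sq : ∀ a, (J a).comp (J a) = -ContinuousLinearMap.id ℝ (TM n M x)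
  mul : (J 0).comp (J 1) = J 2
  mul_swap : (J 1).comp (J 0) = -J 2

variable (n M) in
/-- An almost quaternionic structure: a subbundle `𝒬 ⊆ End(TM)` which is locally spanned by a
smooth almost hyper-complex structure `(J₁, J₂, J₃)` (an admissible local basis).  The rank is
automatically three when `n ≥ 1`. -/
structure AlmostQuaternionicStructure where
  fiber : ∀ x : M, Submodule ℝ (EndT n M x)
  exists_admissible : ∀ x : M, ∃ U : Set M, IsOpen U ∧ x ∈ U ∧
    ∃ J : Fin 3 → ∀ y : M, EndT n M y,
      (∀ a, ∀ y ∈ U, SmoothEndAt (J a) y) ∧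
      (∀ y ∈ U, IsQuaternionicTriple (fun a ↦ J a y)) ∧
      (∀ y ∈ U, fiber y = Submodule.span ℝ (Set.range fun a ↦ J a y))

/-! ### Connections -/

/-- `∇` maps smooth sections to smooth sections. -/
def IsSmoothConnection (D : Connection n M) : Prop :=
  CovariantDerivative.ContMDiffCovariantDerivative D ∞

/-- `(∇_X σ)_x = q`, for a field of endomorphisms `σ` and `X ∈ T_x M`, where as usual
`(∇_X σ) Y = ∇_X (σ Y) - σ (∇_X Y)`.  (In Mathlib `D Y x X` is `(∇_X Y)_x`.) -/
def IsEndCovDeriv (D : Connection n M) (σ : ∀ y : M, EndT n M y) (x : M) (X : TM n M x)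
    (q : EndT n M x) : Prop :=
  ∀ Y : ∀ y : M, TM n M y, SmoothVFAt Y x →
    D (fun y ↦ σ y (Y y)) x X - σ x (D Y x X) = q (Y x)

namespace AlmostQuaternionicStructure

variable (Q : AlmostQuaternionicStructure n M)

/-- A quaternionic connection: a smooth linear connection with `∇_X σ ∈ Γ(𝒬)` for all vectors `X`
and all smooth sections `σ ∈ Γ(𝒬)`. -/
structure IsQuaternionicConnection (D : Connection n M) : Prop where
  smooth : IsSmoothConnection D
  preserves : ∀ σ : ∀ y : M, EndT n M y, (∀ y, SmoothEndAt σ y) → (∀ y, σ y ∈ Q.fiber y) →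
    ∀ (x : M) (X : TM n M x), ∃ q ∈ Q.fiber x, IsEndCovDeriv D σ x X q

/-- `(M, 𝒬)` is quaternionic: there is a torsion-free quaternionic connection. -/
def IsQuaternionic : Prop :=
  ∃ D : Connection n M, Q.IsQuaternionicConnection D ∧ D.torsion = 0

end AlmostQuaternionicStructure

/-! ### Riemannian geometry and anti-self-duality in dimension four -/

variable (n M) in
/-- Smooth Riemannian metrics on `M`. -/
abbrev Metric : Type _ := ContMDiffRiemannianMetric (𝓡 (4 * n)) ∞ (Model n) (TM n M)

/-- `∇` is the Levi-Civita connection of `g`. -/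
structure IsLeviCivita (g : Metric n M) (D : Connection n M) : Prop where
  smooth : IsSmoothConnection D
  torsion_free : D.torsion = 0
  metric : ∀ (x : M) (X : TM n M x) (Y Z : ∀ y : M, TM n M y), SmoothVFAt Y x → SmoothVFAt Z x →
    mfderiv (𝓡 (4 * n)) 𝓘(ℝ, ℝ) (fun y ↦ g.inner y (Y y) (Z y)) x X =
      g.inner x (D Y x X) (Z x) + g.inner x (Y x) (D Z x X)

/-- A vector field with value `v` at `x` which is smooth near `x` (constant in a chart). -/
def extendVF {x : M} (v : TM n M x) : ∀ y : M, TM n M y := FiberBundle.extend (Model n) v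

/-- The curvature `R(X,Y)Z = ∇_X ∇_Y Z - ∇_Y ∇_X Z - ∇_{[X,Y]} Z` at `x`, computed with extensions
of `X, Y, Z ∈ T_x M` to vector fields that are smooth near `x`; it is a tensor, so the choice of
the extensions does not matter. -/
def curvature (D : Connection n M) (x : M) (X Y Z : TM n M x) : TM n M x :=
  D (fun y ↦ D (extendVF Z) y (extendVF Y y)) x X - D (fun y ↦ D (extendVF Z) y (extendVF X y)) x Y
    - D (extendVF Z) x (VectorField.mlieBracket (𝓡 (4 * n)) (extendVF X) (extendVF Y) x)

/-- `Rm(X,Y,Z,V) = g(R(X,Y)Z, V)`. -/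
def curv (g : Metric n M) (D : Connection n M) (x : M) (X Y Z V : TM n M x) : ℝ :=
  g.inner x (curvature D x X Y Z) V

/-- The Ricci tensor `Ric(Y,Z) = ∑ᵢ Rm(eᵢ,Y,Z,eᵢ)`, for an orthonormal frame `e` of a four-dimensional
`T_x M`. -/
def ricci (g : Metric n M) (D : Connection n M) (x : M) (e : Fin 4 → TM n M x)
    (Y Z : TM n M x) : ℝ :=
  ∑ i, curv g D x (e i) Y Z (e i)

/-- The scalar curvature, for an orthonormal frame `e` of a four-dimensional `T_x M`. -/
def scal (g : Metric n M) (D : Connection n M) (x : M) (e : Fin 4 → TM n M x) : ℝ :=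
  ∑ i, ricci g D x e (e i) (e i)

/-- The Weyl tensor (with all indices lowered) of a metric `g` with Levi-Civita connection `∇` on
a four-dimensional manifold; `e` is an orthonormal frame of `T_x M`, used for the traces. -/
def weyl (g : Metric n M) (D : Connection n M) (x : M) (e : Fin 4 → TM n M x)
    (X Y Z V : TM n M x) : ℝ :=
  curv g D x X Y Z V
    - (1 / 2 : ℝ) * (ricci g D x e Y Z * g.inner x X V - ricci g D x e X Z * g.inner x Y V
        + g.inner x Y Z * ricci g D x e X V - g.inner x X Z * ricci g D x e Y V)
    + scal g D x e / 6 * (g.inner x Y Z * g.inner x X V - g.inner x X Z * g.inner x Y V)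

namespace AlmostQuaternionicStructure

variable (Q : AlmostQuaternionicStructure n M)

/-- The metric `g` is `𝒬`-Hermitian: Hermitian for every almost complex structure in `𝒬`.  For
`n = 1` these metrics form the conformal class determined by `𝒬`. -/
def IsHermitian (g : Metric n M) : Prop :=
  ∀ (x : M) (J : EndT n M x), J ∈ Q.fiber x → J.comp J = -ContinuousLinearMap.id ℝ (TM n M x) →
    ∀ X Y : TM n M x, g.inner x (J X) (J Y) = g.inner x X Y

/-- The orthonormal frame `(X, J₁X, J₂X, J₃X)` of a four-dimensional `T_x M`, for a unit vector
`X` and a quaternionic triple in `𝒬_x`.  These frames are exactly the orthonormal frames that are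
positive for the orientation of `M` defined by `𝒬`. -/
def frame {x : M} (J : Fin 3 → EndT n M x) (X : TM n M x) : Fin 4 → TM n M x :=
  ![X, J 0 X, J 1 X, J 2 X]

/-- `W⁺ = 0` for the `𝒬`-Hermitian metric `g` with Levi-Civita connection `∇` on the four-manifold
`M`, oriented by `𝒬`.  The bivectors `e₀ ∧ e₁ + e₂ ∧ e₃`, with `e` a positive orthonormal frame,
span the self-dual bivectors, and `W⁺` is the restriction of the Weyl tensor to these. -/
def SelfDualWeylVanishes (g : Metric n M) (D : Connection n M) : Prop :=
  ∀ (x : M) (J : Fin 3 → EndT n M x), (∀ a, J a ∈ Q.fiber x) → IsQuaternionicTriple J →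
    ∀ X : TM n M x, g.inner x X X = 1 → ∀ Z V : TM n M x,
      weyl g D x (frame J X) (frame J X 0) (frame J X 1) Z V
        + weyl g D x (frame J X) (frame J X 2) (frame J X 3) Z V = 0

/-- For `n = 1`: the oriented conformal structure `[g]` given by `𝒬` is anti-self-dual.  (`W⁺` is
conformally invariant, so one metric of the class decides.) -/
def IsAntiSelfDual : Prop :=
  ∃ (g : Metric n M) (D : Connection n M),
    Q.IsHermitian g ∧ IsLeviCivita g D ∧ Q.SelfDualWeylVanishes g D

end AlmostQuaternionicStructure

/-! ### The twistor space -/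

/-- The tangent vector `W ∈ T_z End(TM)` is the velocity at time `0` of the curve `γ`. -/
def IsVelocity (γ : ℝ → EndTM n M) (z : EndTM n M) (W : TangentSpace (endI n) z) : Prop :=
  (⟨γ 0, mfderiv 𝓘(ℝ, ℝ) (endI n) γ 0 (1 : ℝ)⟩ : TangentBundle (endI n) (EndTM n M)) = ⟨z, W⟩

/-- `W ∈ T_z End(TM)`, `z = (p, J)`, is the vertical vector given by `A ∈ End(T_p M)`. -/
def IsVerticalLift (z : EndTM n M) (A : EndT n M z.1) (W : TangentSpace (endI n) z) : Prop :=
  IsVelocity (fun t : ℝ ↦ TotalSpace.mk' (EndModel n) z.1 (z.2 + t • A)) z W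

/-- `W ∈ T_z End(TM)`, `z = (p, J)`, is the horizontal lift of `X ∈ T_p M` for the connection that
`∇` induces on `End(TM)`: `W = dσ(X)` for a local section `σ` with `σ_p = J` and
`(∇_X σ)_p = 0`. -/
def IsHorizontalLift (D : Connection n M) (z : EndTM n M) (X : TM n M z.1)
    (W : TangentSpace (endI n) z) : Prop :=
  ∃ σ : ∀ y : M, EndT n M y, SmoothEndAt σ z.1 ∧ IsEndCovDeriv D σ z.1 X 0 ∧
    (⟨endMap σ z.1, mfderiv (𝓡 (4 * n)) (endI n) (endMap σ) z.1 X⟩ :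
      TangentBundle (endI n) (EndTM n M)) = ⟨z, W⟩

/-- The vector field `U` on (an open part of) the manifold `End(TM)` is smooth at `z`. -/
def SmoothAmbientVFAt (U : ∀ y : EndTM n M, TangentSpace (endI n) y) (z : EndTM n M) : Prop :=
  ContMDiffAt (endI n) (endI n).tangent ∞
    (fun y ↦ (⟨y, U y⟩ : TangentBundle (endI n) (EndTM n M))) z

/-- The Lie bracket of vector fields on the manifold `End(TM)`. -/
def bracket (U W : ∀ y : EndTM n M, TangentSpace (endI n) y) (z : EndTM n M) :
    TangentSpace (endI n) z :=
  VectorField.mlieBracket (endI n) U W z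

namespace AlmostQuaternionicStructure

variable (Q : AlmostQuaternionicStructure n M)

/-- The twistor space `Z`: all `(p, J)` with `J ∈ 𝒬_p` and `J² = -1`.  It is a sphere bundle over
`M` and an embedded submanifold of the manifold `End(TM)`, whose smooth structure it carries. -/
def twistorSpace : Set (EndTM n M) :=
  {z | z.2 ∈ Q.fiber z.1 ∧ z.2.comp z.2 = -ContinuousLinearMap.id ℝ (TM n M z.1)}

/-- The tangent space `T_z Z ⊆ T_z End(TM)`: the velocities of smooth curves in `Z` through `z`.
(They form a linear space already; the span makes it one by definition.) -/
def twistorTangent (z : EndTM n M) : Submodule ℝ (TangentSpace (endI n) z) :=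
  Submodule.span ℝ {W | ∃ γ : ℝ → EndTM n M, ContMDiffAt 𝓘(ℝ, ℝ) (endI n) ∞ γ 0 ∧
    (∀ᶠ t in 𝓝 (0 : ℝ), γ t ∈ Q.twistorSpace) ∧ IsVelocity γ z W}

/-- `U` restricts to a smooth vector field on `Z` near `z`.  Every vector field on `Z` that is
smooth near `z` arises in this way, and the bracket on `Z` is the restriction of `bracket`. -/
def IsTwistorVFAt (U : ∀ y : EndTM n M, TangentSpace (endI n) y) (z : EndTM n M) : Prop :=
  SmoothAmbientVFAt U z ∧ ∀ᶠ y in 𝓝 z, y ∈ Q.twistorSpace → U y ∈ Q.twistorTangent y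

/-- `U' = I U` on `Z` near `z`, for a field `I` of endomorphisms of `TZ`. -/
def IsImageNear (I : ∀ y : Q.twistorSpace, Q.twistorTangent y.1 →ₗ[ℝ] Q.twistorTangent y.1)
    (U U' : ∀ y : EndTM n M, TangentSpace (endI n) y) (z : EndTM n M) : Prop :=
  ∀ᶠ y in 𝓝 z, ∀ (hy : y ∈ Q.twistorSpace) (hU : U y ∈ Q.twistorTangent y),
    U' y = (I ⟨y, hy⟩ ⟨U y, hU⟩ : TangentSpace (endI n) y)

/-- A (smooth) almost complex structure on the manifold `Z`. -/
structure TwistorAlmostComplexStructure where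
  toEnd : ∀ z : Q.twistorSpace, Q.twistorTangent z.1 →ₗ[ℝ] Q.twistorTangent z.1
  sq : ∀ z W, toEnd z (toEnd z W) = -W
  smooth : ∀ z ∈ Q.twistorSpace, ∀ U, Q.IsTwistorVFAt U z →
    ∃ U', Q.IsTwistorVFAt U' z ∧ Q.IsImageNear toEnd U U' z

variable {Q}

/-- Integrability: the Nijenhuis tensor
`N(U,W) = [IU,IW] - [U,W] - I[IU,W] - I[U,IW]` vanishes on `Z`. -/
def TwistorAlmostComplexStructure.IsIntegrable (I : Q.TwistorAlmostComplexStructure) : Prop :=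
  ∀ (z : EndTM n M) (hz : z ∈ Q.twistorSpace) (U W IU IW : ∀ y, TangentSpace (endI n) y),
    Q.IsTwistorVFAt U z → Q.IsTwistorVFAt W z → Q.IsTwistorVFAt IU z → Q.IsTwistorVFAt IW z →
    Q.IsImageNear I.toEnd U IU z → Q.IsImageNear I.toEnd W IW z →
    ∃ (h₁ : bracket IU W z ∈ Q.twistorTangent z) (h₂ : bracket U IW z ∈ Q.twistorTangent z),
      bracket IU IW z - bracket U W z
        - (I.toEnd ⟨z, hz⟩ ⟨bracket IU W z, h₁⟩ : TangentSpace (endI n) z)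
        - (I.toEnd ⟨z, hz⟩ ⟨bracket U IW z, h₂⟩ : TangentSpace (endI n) z) = 0

/-- `I` is the almost complex structure `I₁^∇` on `Z`: at `z = (p, J)` it sends the vertical vector
given by `A` to the one given by `J A`, and the horizontal lift of `X` to that of `J X`.  As
`TZ` is the sum of its vertical and its (`∇`-)horizontal part, this determines `I`. -/
structure TwistorAlmostComplexStructure.IsI₁ (I : Q.TwistorAlmostComplexStructure)
    (D : Connection n M) : Prop where
  vertical : ∀ (z : Q.twistorSpace) (A : EndT n M z.1.1) (W : Q.twistorTangent z.1),
    IsVerticalLift z.1 A W.1 → IsVerticalLift z.1 (z.1.2.comp A) (I.toEnd z W).1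
  horizontal : ∀ (z : Q.twistorSpace) (X : TM n M z.1.1) (W : Q.twistorTangent z.1),
    IsHorizontalLift D z.1 X W.1 → IsHorizontalLift D z.1 (z.1.2 X) (I.toEnd z W).1

end AlmostQuaternionicStructure

end

end AlmostQuaternionic

/-!
# Integrable almost complex structures on the twistor space

In the chart of `End(TM)` over a chart of `M`, let `Γ` be the Christoffel symbols of a quaternionic
connection `∇`.  The horizontal lift of `X` to `(p, A)` is `(X, -[Γ X, A])`
(`isHorizontalLift_iff`), and the tangent space of the twistor space `Z` consists of the vectors
`(X, B)` whose vertical part `B + [Γ X, A]` lies in `𝒬` and anticommutes with `A`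
(`mem_twistorTangent_iff`).  Hence `I₁^∇` is the restriction to `Z` of an explicit field `iE` of
endomorphisms.  Vector fields on `Z` are closed under the bracket (`lieBracket_mem_tanE`), and the
Nijenhuis tensor of `I₁^∇` is a universal expression `nijE` in `Γ` and its derivative.  Its horizontal
part at `(p, J)` is, up to sign, the component
`T(JX, JY) - T(X, Y) - J T(JX, Y) - J T(X, JY)` of the torsion (`tE`), and its vertical part is the
analogous component of the two-form `[R, J]`, where `R` is the curvature (`eE`).  So `I₁^∇` is
integrable if and only if `tE` and `eE` vanish on `Z` (`isIntegrable_iff`).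

*Uniqueness.*  For two quaternionic connections with `tE = 0`, the difference of the structures `I₁`
at `J` is a symmetric bilinear map with values in the endomorphisms in `𝒬` that anticommute with `J`.
Such a map is zero, since a nonzero quaternion has no kernel; thus the two structures agree
(`isI₁_unique`).

*From an integrable structure to a torsion-free connection.*  If `tE = 0` for all `J` in the sphere
of `𝒬`, then the torsion can be removed by adding to `∇` a tensor that commutes with `𝒬`
(`isQuaternionic_of_tE_eq_zero`).  The tensor is unique, hence the local formulas for it fit together.

*Dimension at least eight.*  For a torsion-free `∇`, the two-form `eE` satisfies the first Bianchi
identity and has values in a plane of endomorphisms whose nonzero elements are invertible.  If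
`eE X Y` were not zero, its image would lie in a space of dimension four, by the Bianchi identity;
so `eE = 0` for `n ≥ 2` (`eE_eq_zero_of_torsion`), and torsion-free quaternionic connections define
integrable structures.

*Dimension four.*  There is a `𝒬`-Hermitian metric (`exists_hermitian_metric`), and its Levi-Civita
connection (`exists_isLeviCivita`) is quaternionic, since the skew endomorphisms that anticommute with
an element of the sphere of `𝒬` lie in `𝒬` (`IsLeviCivita.isQuaternionicConnection`).  By uniqueness, an
integrable structure `I₁^∇` is the one given by the Levi-Civita connection.  For the latter, `eE = 0`
at `J₁` means that the curvature form, restricted to the self-dual bivectors orthogonal to the one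
given by `J₁`, is a multiple of the identity.  This holds for all triples if and only if the curvature
form on self-dual bivectors is a multiple of the identity, which is `W⁺ = 0`
(`IsLeviCivita.selfDualWeylVanishes_iff`).
-/

namespace AlmostQuaternionic

noncomputable section

set_option maxSynthPendingDepth 3

section
/-! ### Tangent vectors in charts -/

section TangentCoordinates

variable {E : Type*} [NormedAddCommGroup E] [NormedSpace ℝ E]
  {H : Type*} [TopologicalSpace H] {I : ModelWithCorners ℝ E H}
  {N : Type*} [TopologicalSpace N] [ChartedSpace H N]

variable (I) in
/-- The components of tangent vectors at `y` in the chart around `z`: the derivative of this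
chart. -/
def tcoord (z y : N) : TangentSpace I y →L[ℝ] E := mfderiv I 𝓘(ℝ, E) (extChartAt I z) y

variable (I) in
/-- The vector field `U` in the chart around `z`. -/
def vfCoord (z : N) (U : ∀ y : N, TangentSpace I y) (q : E) : E :=
  tcoord I z ((extChartAt I z).symm q) (U ((extChartAt I z).symm q))

section
variable [IsManifold I 1 N]
variable (I) in
/-- The tangent vector at `y` with given components in the chart around `z`. -/
def tcoordInv (z y : N) : E →L[ℝ] TangentSpace I y :=
  (trivializationAt E (TangentSpace I) z).symmL ℝ y

lemma tcoord_eq_trivialization {z y : N} (hy : y ∈ (chartAt H z).source) :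
    tcoord I z y = (trivializationAt E (TangentSpace I) z).continuousLinearMapAt ℝ y :=
  (TangentBundle.continuousLinearMapAt_trivializationAt hy).symm

lemma tcoord_tcoordInv {z y : N} (hy : y ∈ (chartAt H z).source) (v : E) :
    tcoord I z y (tcoordInv I z y v) = v := by
  rw [tcoord_eq_trivialization hy, tcoordInv]
  exact Trivialization.continuousLinearMapAt_symmL _ (by simpa using hy) v

lemma tcoordInv_tcoord {z y : N} (hy : y ∈ (chartAt H z).source) (v : TangentSpace I y) :
    tcoordInv I z y (tcoord I z y v) = v := by
  rw [tcoord_eq_trivialization hy, tcoordInv]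
  exact Trivialization.symmL_continuousLinearMapAt _ (by simpa using hy) v

lemma tcoord_injective {z y : N} (hy : y ∈ (chartAt H z).source) :
    Function.Injective (tcoord I z y) :=
  Function.LeftInverse.injective (g := tcoordInv I z y) (tcoordInv_tcoord hy)

lemma tcoord_self (z : N) (v : TangentSpace I z) : tcoord I z z v = v := by
  rw [tcoord, mfderiv_extChartAt_self]; rfl

lemma tcoordInv_self (z : N) (v : E) : tcoordInv I z z v = v := by
  have h := tcoordInv_tcoord (I := I) (mem_chart_source H z) (v : TangentSpace I z)
  exact (congrArg (tcoordInv I z z) (tcoord_self z (v : TangentSpace I z))).symm.trans h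

lemma tcoord_mfderiv {E' : Type*} [NormedAddCommGroup E'] [NormedSpace ℝ E']
    {H' : Type*} [TopologicalSpace H'] {I' : ModelWithCorners ℝ E' H'}
    {N' : Type*} [TopologicalSpace N'] [ChartedSpace H' N'] {f : N' → N} {x : N'} {z : N}
    (hf : MDifferentiableAt I' I f x) (hx : f x ∈ (chartAt H z).source) (v : TangentSpace I' x) :
    tcoord I z (f x) (mfderiv I' I f x v) =
      mfderiv I' 𝓘(ℝ, E) (fun x' ↦ extChartAt I z (f x')) x v := by
  have := mfderiv_comp (I'' := 𝓘(ℝ, E)) x (mdifferentiableAt_extChartAt hx) hf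
  exact (congrArg (fun L ↦ L v) this).symm

lemma contMDiffAt_vf_iff [IsManifold I ∞ N] [I.Boundaryless] {U : ∀ y : N, TangentSpace I y} {z y : N}
    (hy : y ∈ (chartAt H z).source) :
    ContMDiffAt I I.tangent ∞ (fun y ↦ (⟨y, U y⟩ : TangentBundle I N)) y ↔
      ContDiffAt ℝ ∞ (vfCoord I z U) (extChartAt I z y) := by
  have h1 := Trivialization.contMDiffAt_section_iff (IB := I) (n := ∞) (E := (TangentSpace I : N → Type _))
    (e := trivializationAt E (TangentSpace I) z) (s := U) (x₀ := y) (by simpa using hy)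
  refine h1.trans ?_
  have h2 := contMDiffAt_iff_source_of_mem_source (I := I) (I' := 𝓘(ℝ, E)) (n := ∞) (x := z) (x' := y)
    (f := fun y ↦ tcoord I z y (U y)) hy
  rw [I.range_eq_univ, contMDiffWithinAt_univ, contMDiffAt_iff_contDiffAt] at h2
  refine Iff.trans ?_ h2
  refine Filter.EventuallyEq.contMDiffAt_iff ?_
  filter_upwards [(chartAt H z).open_source.mem_nhds hy] with w hw
  rw [tcoord_eq_trivialization hw]
  rw [Trivialization.continuousLinearMapAt_apply]
  rw [Trivialization.coe_linearMapAt_of_mem _ (by simpa using hw)]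

/-- The Lie bracket of vector fields is computed in the chart around the point. -/
lemma tcoord_mlieBracket [IsManifold I ∞ N] [I.Boundaryless] (U W : ∀ y : N, TangentSpace I y) (z : N) :
    VectorField.mlieBracket I U W z =
      VectorField.lieBracket ℝ (vfCoord I z U) (vfCoord I z W) (extChartAt I z z) := by
  have key : ∀ V : ∀ y : N, TangentSpace I y,
      VectorField.mpullbackWithin 𝓘(ℝ, E) I (extChartAt I z).symm V (range I)
        =ᶠ[𝓝 (extChartAt I z z)] vfCoord I z V := by
    intro V
    filter_upwards [extChartAt_target_mem_nhds (I := I) z] with q hq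
    have h := mfderiv_extChartAt_comp_mfderivWithin_extChartAt_symm (I := I) hq
    have h' := mfderivWithin_extChartAt_symm_comp_mfderiv_extChartAt (I := I) hq
    rw [VectorField.mpullbackWithin_apply, ContinuousLinearMap.inverse_eq h' h]
    rfl
  have k1 := key U
  have k2 := key W
  rw [← VectorField.mlieBracketWithin_univ, VectorField.mlieBracketWithin_apply,
    mfderiv_extChartAt_self]
  simp only [preimage_univ, univ_inter, I.range_eq_univ] at k1 k2 ⊢
  refine (congrArg (fun L : E →L[ℝ] E ↦ L _) ContinuousLinearMap.inverse_id).trans ?_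
  refine Eq.trans ?_ (Filter.EventuallyEq.lieBracket_vectorField_eq (𝕜 := ℝ) (E := E) k1 k2)
  exact congrFun (VectorField.lieBracketWithin_univ (𝕜 := ℝ) (E := E)) _

end
end TangentCoordinates

end

section
/-! ### Charts of the manifold of endomorphisms -/

variable {n : ℕ} {M : Type*} [TopologicalSpace M] [ChartedSpace (Model n) M]
  [IsManifold (𝓡 (4 * n)) ∞ M]

-- Shortcuts for the instance search.
section Instances

instance : NormedAddCommGroup (EndModel n) := inferInstance
instance : SeminormedAddCommGroup (EndModel n) := inferInstance
instance : NormedSpace ℝ (EndModel n) := inferInstance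
instance : AddCommGroup (EndModel n) := inferInstance
instance : AddCommMonoid (EndModel n) := inferInstance
instance : Module ℝ (EndModel n) := inferInstance
instance : TopologicalSpace (EndModel n) := inferInstance
instance : IsTopologicalAddGroup (EndModel n) := inferInstance
instance : ContinuousAdd (EndModel n) := inferInstance
instance : ContinuousSMul ℝ (EndModel n) := inferInstance
instance : ContinuousConstSMul ℝ (EndModel n) := inferInstance
instance : T2Space (EndModel n) := inferInstance
instance : Ring (EndModel n) := inferInstance
instance : NormedAddCommGroup (Model n →L[ℝ] EndModel n) := inferInstance
instance : NormedSpace ℝ (Model n →L[ℝ] EndModel n) := inferInstance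
instance : AddCommGroup (Model n →L[ℝ] EndModel n) := inferInstance
instance : Module ℝ (Model n →L[ℝ] EndModel n) := inferInstance
instance : TopologicalSpace (Model n →L[ℝ] EndModel n) := inferInstance
instance : NormedAddCommGroup (Model n × EndModel n) := inferInstance
instance : NormedSpace ℝ (Model n × EndModel n) := inferInstance
instance : AddCommGroup (Model n × EndModel n) := inferInstance
instance : Module ℝ (Model n × EndModel n) := inferInstance
instance : TopologicalSpace (Model n × EndModel n) := inferInstance

instance : TopologicalSpace (EndTM n M) := inferInstance
instance : ContinuousSMul ℝ (Model n) := inferInstance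
instance : Module ℤ (EndModel n) := inferInstance
instance (x : M) : AddCommGroup (TM n M x →L[ℝ] ℝ) := inferInstance
instance (x : M) : TopologicalSpace (TM n M x →L[ℝ] ℝ) := inferInstance
instance (x : M) : Module ℝ (TM n M x →L[ℝ] ℝ) := inferInstance
instance (x : M) : ContinuousAdd (TM n M x →L[ℝ] ℝ) := inferInstance
instance (x : M) : IsTopologicalAddGroup (TM n M x →L[ℝ] ℝ) := inferInstance
instance (x : M) : ContinuousConstSMul ℝ (TM n M x →L[ℝ] ℝ) := inferInstance
instance (x : M) : AddCommGroup (TM n M x →L[ℝ] TM n M x →L[ℝ] ℝ) := inferInstance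
instance (x : M) : TopologicalSpace (TM n M x →L[ℝ] TM n M x →L[ℝ] ℝ) := inferInstance
instance (x : M) : Module ℝ (TM n M x →L[ℝ] TM n M x →L[ℝ] ℝ) := inferInstance
instance : NormedAddCommGroup (Model n →L[ℝ] Model n →L[ℝ] ℝ) := inferInstance
instance : NormedSpace ℝ (Model n →L[ℝ] Model n →L[ℝ] ℝ) := inferInstance
instance : IsManifold (𝓡 (4 * n)) 1 M := IsManifold.of_le (n := ∞) (by simp)

end Instances

instance : IsManifold (endI n) ∞ (EndTM n M) := inferInstance
instance : (endI n).Boundaryless := inferInstance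

instance : IsManifold (endI n) 1 (EndTM n M) := IsManifold.of_le (n := ∞) (by simp)

variable (n) in
/-- The domain of the chart of `M` around `x₀`. -/
abbrev dom (x₀ : M) : Set M := (chartAt (Model n) x₀).source

/-- The chart of `M` around `x₀`. -/
abbrev crd (n : ℕ) {M : Type*} [TopologicalSpace M] [ChartedSpace (Model n) M] (x₀ : M) : PartialEquiv M (Model n) := extChartAt (𝓡 (4 * n)) x₀

/-- The components of tangent vectors of `M` at `y` in the chart around `x₀`. -/
abbrev tc (x₀ y : M) : TM n M y →L[ℝ] Model n := tcoord (𝓡 (4 * n)) x₀ y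

/-- The inverse of `tc x₀ y`, for `y` in the domain of the chart around `x₀`. -/
abbrev tcInv (x₀ y : M) : Model n →L[ℝ] TM n M y := tcoordInv (𝓡 (4 * n)) x₀ y

/-- The matrix of an endomorphism of `T_y M` in the chart around `x₀`. -/
def hatE (x₀ y : M) (A : EndT n M y) : EndModel n := (tc x₀ y).comp (A.comp (tcInv x₀ y))

/-- The endomorphism of `T_y M` with a given matrix in the chart around `x₀`. -/
def unhatE (x₀ y : M) (B : EndModel n) : EndT n M y := (tcInv x₀ y).comp (B.comp (tc x₀ y))

section hat
variable {x₀ y : M}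

lemma hatE_apply (A : EndT n M y) (v : Model n) : hatE x₀ y A v = tc x₀ y (A (tcInv x₀ y v)) := rfl

lemma hatE_tc (hy : y ∈ dom n x₀) (A : EndT n M y) (X : TM n M y) :
    hatE x₀ y A (tc x₀ y X) = tc x₀ y (A X) := by
  rw [hatE_apply, tcoordInv_tcoord hy]

lemma hatE_unhatE (hy : y ∈ dom n x₀) (B : EndModel n) : hatE x₀ y (unhatE x₀ y B) = B := by
  ext1 v
  simp only [hatE, unhatE, ContinuousLinearMap.comp_apply, tcoord_tcoordInv hy]

lemma unhatE_hatE (hy : y ∈ dom n x₀) (A : EndT n M y) : unhatE x₀ y (hatE x₀ y A) = A := by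
  ext1 v
  simp only [hatE, unhatE, ContinuousLinearMap.comp_apply, tcoordInv_tcoord hy]

lemma hatE_injective (hy : y ∈ dom n x₀) : Function.Injective (hatE (n := n) x₀ y) :=
  Function.LeftInverse.injective (unhatE_hatE hy)

lemma hatE_comp (hy : y ∈ dom n x₀) (A B : EndT n M y) :
    hatE x₀ y (A.comp B) = hatE x₀ y A * hatE x₀ y B := by
  ext1 v
  simp only [hatE, ContinuousLinearMap.comp_apply, mul_apply_eq_comp, tcoordInv_tcoord hy]

lemma hatE_add (A B : EndT n M y) : hatE x₀ y (A + B) = hatE x₀ y A + hatE x₀ y B := by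
  ext1 v
  simp only [hatE, ContinuousLinearMap.comp_apply, add_apply, map_add]

lemma hatE_smul (c : ℝ) (A : EndT n M y) : hatE x₀ y (c • A) = c • hatE x₀ y A := by
  ext1 v
  simp only [hatE, ContinuousLinearMap.comp_apply, smul_apply, map_smul]

lemma hatE_neg (A : EndT n M y) : hatE x₀ y (-A) = -hatE x₀ y A := by
  ext1 v
  simp only [hatE, ContinuousLinearMap.comp_apply, neg_apply, map_neg]

lemma hatE_zero : hatE x₀ y (0 : EndT n M y) = 0 := by
  ext1 v
  simp only [hatE, ContinuousLinearMap.comp_apply, zero_apply, map_zero]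

lemma hatE_id (hy : y ∈ dom n x₀) : hatE x₀ y (ContinuousLinearMap.id ℝ (TM n M y)) = 1 := by
  ext1 v
  simp only [hatE, ContinuousLinearMap.comp_apply, ContinuousLinearMap.id_apply, tcoord_tcoordInv hy,
    one_apply_eq_self]

lemma hatE_self (x : M) (A : EndT n M x) : hatE x x A = A := by
  ext1 v
  rw [hatE_apply, tcoord_self, tcoordInv_self]
  rfl

end hat

/-- The chart of the manifold `End(TM)` over the chart of `M` around `x₀`. -/
abbrev endCrd (x₀ : M) : PartialEquiv (EndTM n M) (Model n × EndModel n) :=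
  extChartAt (endI n) (TotalSpace.mk' (EndModel n) x₀ 0 : EndTM n M)

/-- The charts of `End(TM)` are defined over the whole fibres. -/
lemma mem_endChart_source {x₀ : M} {z : EndTM n M} :
    z ∈ (chartAt (ModelProd (Model n) (EndModel n))
      (TotalSpace.mk' (EndModel n) x₀ 0 : EndTM n M)).source ↔ z.1 ∈ dom n x₀ := by
  rw [FiberBundle.chartedSpace_chartAt]
  have hb : (trivializationAt (EndModel n) (fun x ↦ TM n M x →L[ℝ] TM n M x) x₀).baseSet = dom n x₀ := by
    simp
  constructor
  · intro h
    have h1 := h.1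
    rw [← hb]
    exact (Trivialization.mem_source _).1 h1
  · intro h
    have h1 := h
    rw [← hb] at h1
    refine ⟨(Trivialization.mem_source _).2 h1, ?_, mem_univ _⟩
    have h2 := Trivialization.coe_fst
      (trivializationAt (EndModel n) (fun x ↦ TM n M x →L[ℝ] TM n M x) x₀) ((Trivialization.mem_source _).2 h1)
    change ((trivializationAt (EndModel n) (fun x ↦ TM n M x →L[ℝ] TM n M x) x₀) z).1 ∈ dom n x₀
    rw [h2]
    exact h

lemma mem_endCrd_source {x₀ : M} {z : EndTM n M} : z ∈ (endCrd x₀).source ↔ z.1 ∈ dom n x₀ := by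
  rw [extChartAt_source, mem_endChart_source]

lemma endCrd_apply (x₀ : M) (z : EndTM n M) :
    endCrd x₀ z = (crd n x₀ z.1, (((trivializationAt (Model n) (TM n M) x₀).continuousLinearMapAt ℝ z.1).comp
      (z.2.comp (tcInv x₀ z.1)))) := by
  rfl

lemma endCrd_eq {x₀ : M} {z : EndTM n M} (hz : z.1 ∈ dom n x₀) :
    endCrd x₀ z = (crd n x₀ z.1, hatE x₀ z.1 z.2) := by
  rw [endCrd_apply, hatE, tc, tcoord_eq_trivialization hz]

/-- The components of tangent vectors of `End(TM)` in the chart over the chart around `x₀`. -/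
abbrev vc (x₀ : M) (z : EndTM n M) : TangentSpace (endI n) z →L[ℝ] Model n × EndModel n :=
  tcoord (endI n) (TotalSpace.mk' (EndModel n) x₀ 0 : EndTM n M) z

/-- The matrix-valued function that represents a field of endomorphisms. -/
def hatF (x₀ : M) (σ : ∀ y : M, EndT n M y) (p : Model n) : EndModel n :=
  hatE x₀ ((crd n x₀).symm p) (σ ((crd n x₀).symm p))

lemma crd_symm_crd {x₀ y : M} (hy : y ∈ dom n x₀) : (crd n x₀).symm (crd n x₀ y) = y :=
  (crd n x₀).left_inv (by simpa using hy)

lemma hatF_crd {x₀ y : M} (hy : y ∈ dom n x₀) (σ : ∀ y : M, EndT n M y) :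
    hatF x₀ σ (crd n x₀ y) = hatE x₀ y (σ y) := by
  rw [hatF, crd_symm_crd hy]


lemma contMDiffAt_source_iff {F : Type*} [NormedAddCommGroup F] [NormedSpace ℝ F] {k : ℕ∞ω} (hk : k ≤ ∞)
    {x₀ y : M} (hy : y ∈ dom n x₀) {f : M → F} :
    ContMDiffAt (𝓡 (4 * n)) 𝓘(ℝ, F) k f y ↔ ContDiffAt ℝ k (fun p ↦ f ((crd n x₀).symm p)) (crd n x₀ y) := by
  have : IsManifold (𝓡 (4 * n)) k M := IsManifold.of_le hk
  have h2 := contMDiffAt_iff_source_of_mem_source (I := 𝓡 (4 * n)) (I' := 𝓘(ℝ, F)) (n := k)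
    (x := x₀) (x' := y) (f := f) hy
  rw [ModelWithCorners.range_eq_univ, contMDiffWithinAt_univ, contMDiffAt_iff_contDiffAt] at h2
  exact h2

lemma differentiableAt_crd_symm {F : Type*} [NormedAddCommGroup F] [NormedSpace ℝ F]
    {x₀ y : M} (hy : y ∈ dom n x₀) {f : M → F} (hf : MDifferentiableAt (𝓡 (4 * n)) 𝓘(ℝ, F) f y) :
    DifferentiableAt ℝ (fun p ↦ f ((crd n x₀).symm p)) (crd n x₀ y) := by
  have hyt : crd n x₀ y ∈ (crd n x₀).target := (crd n x₀).map_source (by simpa using hy)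
  rw [← mdifferentiableAt_iff_differentiableAt]
  have h := mdifferentiableWithinAt_extChartAt_symm (I := 𝓡 (4 * n)) hyt
  rw [ModelWithCorners.range_eq_univ, mdifferentiableWithinAt_univ] at h
  exact MDifferentiableAt.comp (I' := 𝓡 (4 * n)) (g := f) _ (by rwa [crd_symm_crd hy]) h

lemma mfderiv_crd_symm {F : Type*} [NormedAddCommGroup F] [NormedSpace ℝ F]
    {x₀ y : M} (hy : y ∈ dom n x₀) {f : M → F} (hf : MDifferentiableAt (𝓡 (4 * n)) 𝓘(ℝ, F) f y) (X : TM n M y) :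
    mfderiv (𝓡 (4 * n)) 𝓘(ℝ, F) f y X =
      fderiv ℝ (fun p ↦ f ((crd n x₀).symm p)) (crd n x₀ y) (tc x₀ y X) := by
  have h1 : HasMFDerivAt (𝓡 (4 * n)) 𝓘(ℝ, F) (fun y' ↦ (fun p ↦ f ((crd n x₀).symm p)) (crd n x₀ y')) y
      (mfderiv (𝓡 (4 * n)) 𝓘(ℝ, F) f y) := by
    refine hf.hasMFDerivAt.congr_of_eventuallyEq ?_
    filter_upwards [(chartAt (Model n) x₀).open_source.mem_nhds hy] with w hw
    simp only [crd_symm_crd hw]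
  have hd := (differentiableAt_crd_symm hy hf).mdifferentiableAt
  have h2 := hd.hasMFDerivAt.comp y (mdifferentiableAt_extChartAt (I := 𝓡 (4 * n)) hy).hasMFDerivAt
  have h3 := hasMFDerivAt_unique h1 h2
  rw [h3, mfderiv_eq_fderiv]
  rfl

lemma smoothEndAt_iff {x₀ y : M} (hy : y ∈ dom n x₀) {σ : ∀ y : M, EndT n M y} :
    SmoothEndAt σ y ↔ ContDiffAt ℝ ∞ (hatF x₀ σ) (crd n x₀ y) := by
  have h1 := Trivialization.contMDiffAt_section_iff (IB := 𝓡 (4 * n)) (n := ∞) (E := EndT n M)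
    (e := trivializationAt (EndModel n) (EndT n M) x₀) (s := σ) (x₀ := y) (by simpa using hy)
  refine h1.trans ?_
  refine Iff.trans ?_ (contMDiffAt_source_iff le_rfl hy (f := fun y ↦ hatE x₀ y (σ y)))
  refine Filter.EventuallyEq.contMDiffAt_iff ?_
  filter_upwards [(chartAt (Model n) x₀).open_source.mem_nhds hy] with w hw
  rw [hatE, tc, tcoord_eq_trivialization hw]
  rfl

lemma SmoothEndAt.mdiff {y : M} {σ : ∀ y : M, EndT n M y} (h : SmoothEndAt σ y) :
    MDifferentiableAt (𝓡 (4 * n)) (endI n) (endMap σ) y :=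
  ContMDiffAt.mdifferentiableAt h (by simp)

lemma smoothVFAt_iff {x₀ y : M} (hy : y ∈ dom n x₀) {Y : ∀ y : M, TM n M y} :
    SmoothVFAt Y y ↔ ContDiffAt ℝ ∞ (vfCoord (𝓡 (4 * n)) x₀ Y) (crd n x₀ y) :=
  contMDiffAt_vf_iff hy

lemma vc_mfderiv_endMap {x₀ y : M} (hy : y ∈ dom n x₀) {σ : ∀ y : M, EndT n M y}
    (hσ : SmoothEndAt σ y) (X : TM n M y) :
    vc x₀ (endMap σ y) (mfderiv (𝓡 (4 * n)) (endI n) (endMap σ) y X) =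
      (tc x₀ y X, fderiv ℝ (hatF x₀ σ) (crd n x₀ y) (tc x₀ y X)) := by
  have hs := mem_endChart_source (x₀ := x₀) (z := endMap σ y) |>.2 hy
  rw [tcoord_mfderiv hσ.mdiff hs]
  have hmd : MDifferentiableAt (𝓡 (4 * n)) 𝓘(ℝ, Model n × EndModel n)
      (fun y' ↦ endCrd x₀ (endMap σ y')) y :=
    (mdifferentiableAt_extChartAt hs).comp y hσ.mdiff
  have hF := (smoothEndAt_iff hy).1 hσ
  have hyt : crd n x₀ y ∈ (crd n x₀).target := (crd n x₀).map_source (by simpa using hy)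
  rw [mfderiv_crd_symm hy hmd]
  have : (fun p ↦ endCrd x₀ (endMap σ ((crd n x₀).symm p))) =ᶠ[𝓝 (crd n x₀ y)]
      fun p ↦ (p, hatF x₀ σ p) := by
    filter_upwards [(isOpen_extChartAt_target (I := 𝓡 (4 * n)) x₀).mem_nhds hyt] with p hp
    have hp' : (crd n x₀).symm p ∈ dom n x₀ := by simpa using (crd n x₀).map_target hp
    rw [endCrd_eq (show (endMap σ ((crd n x₀).symm p)).1 ∈ dom n x₀ from hp')]
    exact Prod.ext ((crd n x₀).right_inv hp) rfl
  rw [this.fderiv_eq, DifferentiableAt.fderiv_prodMk differentiableAt_fun_id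
    (hF.differentiableAt (by simp))]
  simp

lemma vc_of_isVelocity {x₀ : M} {γ : ℝ → EndTM n M} {z : EndTM n M} {W : TangentSpace (endI n) z}
    (hz : z.1 ∈ dom n x₀) (hγ : MDifferentiableAt 𝓘(ℝ, ℝ) (endI n) γ 0) (h : IsVelocity γ z W) :
    γ 0 = z ∧ vc x₀ z W = deriv (fun t ↦ endCrd x₀ (γ t)) 0 := by
  have h0 : γ 0 = z := congrArg TotalSpace.proj h
  subst h0
  refine ⟨rfl, ?_⟩
  have hW := eq_of_heq (TotalSpace.mk.inj h).2
  have hs := mem_endChart_source (x₀ := x₀) (z := γ 0) |>.2 hz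
  rw [← hW]
  refine (tcoord_mfderiv hγ hs (1 : ℝ)).trans ?_
  rw [mfderiv_eq_fderiv]
  rfl

/-- Curves in the chart of `End(TM)` give curves with the expected velocity. -/
lemma isVelocity_of_coord {x₀ : M} {z : EndTM n M} {W : TangentSpace (endI n) z}
    (hz : z.1 ∈ dom n x₀) {c : ℝ → Model n × EndModel n} (hc : ContDiffAt ℝ ∞ c 0)
    (hc0 : c 0 = endCrd x₀ z) (hW : deriv c 0 = vc x₀ z W) :
    ContMDiffAt 𝓘(ℝ, ℝ) (endI n) ∞ (fun t ↦ (endCrd x₀).symm (c t)) 0 ∧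
      IsVelocity (fun t ↦ (endCrd x₀).symm (c t)) z W := by
  have hzs : z ∈ (endCrd x₀).source := mem_endCrd_source.2 hz
  have hzt : c 0 ∈ (endCrd x₀).target := by rw [hc0]; exact (endCrd x₀).map_source hzs
  have hsm : ContMDiffAt 𝓘(ℝ, ℝ) (endI n) ∞ (fun t ↦ (endCrd x₀).symm (c t)) 0 := by
    have h1 := contMDiffOn_extChartAt_symm (I := endI n) (n := ∞)
      (TotalSpace.mk' (EndModel n) x₀ 0 : EndTM n M)
    have h2 := h1.contMDiffAt ((isOpen_extChartAt_target (I := endI n) _).mem_nhds hzt)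
    exact h2.comp (0 : ℝ) hc.contMDiffAt
  refine ⟨hsm, ?_⟩
  have h0 : (endCrd x₀).symm (c 0) = z := by rw [hc0]; exact (endCrd x₀).left_inv hzs
  have hmd := hsm.mdifferentiableAt (by simp)
  generalize hγ : (fun t ↦ (endCrd x₀).symm (c t)) = γ at *
  have h0' : γ 0 = z := by rw [← hγ]; exact h0
  have hcγ : (fun t ↦ endCrd x₀ (γ t)) =ᶠ[𝓝 0] c := by
    have := hc.continuousAt.preimage_mem_nhds ((isOpen_extChartAt_target (I := endI n) _).mem_nhds hzt)
    filter_upwards [this] with t ht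
    rw [← hγ]
    exact (endCrd x₀).right_inv ht
  subst h0'
  have hs := mem_endChart_source (x₀ := x₀) (z := γ 0) |>.2 hz
  unfold IsVelocity
  congr 1
  apply tcoord_injective hs
  rw [← hW]
  refine (tcoord_mfderiv hmd hs (1 : ℝ)).trans ?_
  rw [mfderiv_eq_fderiv, ← hcγ.deriv_eq]
  rfl

end

section
variable {n : ℕ} {M : Type*} [TopologicalSpace M] [ChartedSpace (Model n) M]
  [IsManifold (𝓡 (4 * n)) ∞ M]

/-! ### Extension of local sections -/

/-- A local section of a vector bundle can be modified away from a point to become a global one. -/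
lemma exists_global_section [T2Space M] [SigmaCompactSpace M] {F : Type*} [NormedAddCommGroup F]
    [NormedSpace ℝ F] (V : M → Type*) [∀ x, AddCommGroup (V x)] [∀ x, TopologicalSpace (V x)]
    [∀ x, Module ℝ (V x)] [TopologicalSpace (TotalSpace F V)] [FiberBundle F V] [VectorBundle ℝ F V]
    (t : ∀ x, Submodule ℝ (V x)) (s : ∀ x, V x) {x : M} {U : Set M} (hU : U ∈ 𝓝 x)
    (hs : ∀ y ∈ U, ContMDiffAt (𝓡 (4 * n)) ((𝓡 (4 * n)).prod 𝓘(ℝ, F)) ∞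
      (fun y ↦ (TotalSpace.mk' F y (s y) : TotalSpace F V)) y)
    (ht : ∀ y ∈ U, s y ∈ t y) :
    ∃ s' : ∀ x, V x, (∀ y, ContMDiffAt (𝓡 (4 * n)) ((𝓡 (4 * n)).prod 𝓘(ℝ, F)) ∞
      (fun y ↦ (TotalSpace.mk' F y (s' y) : TotalSpace F V)) y) ∧ (∀ y, s' y ∈ t y) ∧
      ∀ᶠ y in 𝓝 x, s' y = s y := by
  classical
  have : LocallyCompactSpace M := Manifold.locallyCompact_of_finiteDimensional (𝓡 (4 * n))
  obtain ⟨K, hK, hKU, hKc⟩ := local_compact_nhds (interior_mem_nhds.2 hU)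
  have hKcl : IsClosed K := hKc.isClosed
  obtain ⟨s', hs'⟩ := exists_contMDiffSection_forall_mem_convex_of_local (n := ⊤) (𝓡 (4 * n))
    (F_fiber := F) V (fun y ↦ if y ∈ K then {s y} else (t y : Set (V y))) (fun y ↦ by
      by_cases hy : y ∈ K
      · simp only [hy, if_true]; exact convex_singleton _
      · simp only [hy, if_false]; exact (t y).convex) (fun y ↦ by
      by_cases hy : y ∈ interior U
      · refine ⟨interior U, isOpen_interior.mem_nhds hy, s, fun w hw ↦
          (hs w (interior_subset hw)).contMDiffWithinAt, fun w hw ↦ ?_⟩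
        by_cases hwK : w ∈ K
        · simp [hwK]
        · simpa [hwK] using ht w (interior_subset hw)
      · have hyK : y ∉ K := fun h ↦ hy (hKU h)
        refine ⟨Kᶜ, hKcl.isOpen_compl.mem_nhds hyK, fun _ ↦ 0, ?_, fun w hw ↦ ?_⟩
        · exact (contMDiff_zeroSection ℝ V).contMDiffOn
        · have : w ∉ K := hw
          simp [this])
  refine ⟨s', fun y ↦ s'.contMDiff y, fun y ↦ ?_, ?_⟩
  · have := hs' y
    by_cases hy : y ∈ K
    · simp only [hy, if_true, mem_singleton_iff] at this
      rw [this]; exact ht y (interior_subset (hKU hy))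
    · simpa [hy] using this
  · filter_upwards [hK] with y hy
    simpa [hy] using hs' y

/-! ### Christoffel symbols -/

lemma mdifferentiableAt_vf_iff {x₀ y : M} (hy : y ∈ dom n x₀) {Y : ∀ y : M, TM n M y} :
    MDifferentiableAt (𝓡 (4 * n)) ((𝓡 (4 * n)).prod 𝓘(ℝ, Model n))
      (fun y ↦ (TotalSpace.mk' (Model n) y (Y y) : TotalSpace (Model n) (TM n M))) y ↔
    MDifferentiableAt (𝓡 (4 * n)) 𝓘(ℝ, Model n) (fun y ↦ tc x₀ y (Y y)) y := by
  have h1 := Trivialization.mdifferentiableAt_section_iff (IB := 𝓡 (4 * n)) (E := TM n M)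
    (e := trivializationAt (Model n) (TM n M) x₀) (s := Y) (b₀ := y) (by simpa using hy)
  refine h1.trans ?_
  refine Filter.EventuallyEq.mdifferentiableAt_iff ?_
  filter_upwards [(chartAt (Model n) x₀).open_source.mem_nhds hy] with w hw
  rw [tc, tcoord_eq_trivialization hw, Trivialization.continuousLinearMapAt_apply,
    Trivialization.coe_linearMapAt_of_mem _ (by simpa using hw)]

lemma differentiableAt_vfCoord {x₀ y : M} (hy : y ∈ dom n x₀) {Y : ∀ y : M, TM n M y}
    (hY : MDifferentiableAt (𝓡 (4 * n)) ((𝓡 (4 * n)).prod 𝓘(ℝ, Model n))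
      (fun y ↦ (TotalSpace.mk' (Model n) y (Y y) : TotalSpace (Model n) (TM n M))) y) :
    DifferentiableAt ℝ (vfCoord (𝓡 (4 * n)) x₀ Y) (crd n x₀ y) :=
  differentiableAt_crd_symm hy ((mdifferentiableAt_vf_iff hy).1 hY)

lemma vfCoord_crd {x₀ y : M} (hy : y ∈ dom n x₀) (Y : ∀ y : M, TM n M y) :
    vfCoord (𝓡 (4 * n)) x₀ Y (crd n x₀ y) = tc x₀ y (Y y) := by
  rw [vfCoord, crd_symm_crd hy]

/-- The connection on the domain of the chart around `x₀` for which the coordinate fields are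
parallel. -/
def flatConn (x₀ : M) (Y : ∀ y : M, TM n M y) (y : M) : TM n M y →L[ℝ] TM n M y :=
  unhatE x₀ y (fderiv ℝ (vfCoord (𝓡 (4 * n)) x₀ Y) (crd n x₀ y))

lemma flatConn_apply (x₀ : M) (Y : ∀ y : M, TM n M y) (y : M) (X : TM n M y) :
    flatConn x₀ Y y X = tcInv x₀ y (fderiv ℝ (vfCoord (𝓡 (4 * n)) x₀ Y) (crd n x₀ y) (tc x₀ y X)) :=
  rfl

lemma flatConn_isCovariantDerivativeOn (x₀ : M) :
    IsCovariantDerivativeOn (I := 𝓡 (4 * n)) (Model n) (V := TM n M) (flatConn x₀) (dom n x₀) where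
  add {σ σ' y} hσ hσ' hy := by
    have h4 : vfCoord (𝓡 (4 * n)) x₀ (σ + σ') =
        vfCoord (𝓡 (4 * n)) x₀ σ + vfCoord (𝓡 (4 * n)) x₀ σ' := by
      ext1 p; exact map_add (tc x₀ ((crd n x₀).symm p)) _ _
    ext1 X
    rw [flatConn_apply, h4, fderiv_add (differentiableAt_vfCoord hy hσ) (differentiableAt_vfCoord hy hσ')]
    simp only [add_apply, map_add, flatConn_apply]
  leibniz {σ g y} hσ hg hy := by
    have h4 : vfCoord (𝓡 (4 * n)) x₀ (g • σ) =
        (fun p ↦ g ((crd n x₀).symm p)) • vfCoord (𝓡 (4 * n)) x₀ σ := by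
      ext1 p; exact map_smul (tc x₀ ((crd n x₀).symm p)) _ _
    have h5 : ∀ X : TM n M y, mvfderiv (𝓡 (4 * n)) g y X =
        fderiv ℝ (fun p ↦ g ((crd n x₀).symm p)) (crd n x₀ y) (tc x₀ y X) :=
      fun X ↦ mfderiv_crd_symm hy hg X
    ext1 X
    rw [flatConn_apply, h4, fderiv_smul (differentiableAt_crd_symm hy hg) (differentiableAt_vfCoord hy hσ)]
    simp only [add_apply, smul_apply, map_add, map_smul, flatConn_apply,
      ContinuousLinearMap.smulRight_apply, h5, vfCoord_crd hy, tcoordInv_tcoord hy, crd_symm_crd hy]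

/-- The difference tensor of the connection `D` and the coordinate connection; it is meaningful for `y` in the domain of
the chart around `x₀`. -/
def connDiff (D : Connection n M) (x₀ y : M) : TM n M y →L[ℝ] TM n M y →L[ℝ] TM n M y :=
  (D.isCovariantDerivativeOn (s := dom n x₀)).difference (flatConn_isCovariantDerivativeOn x₀) y

/-- The Christoffel symbols of `D` in the chart around `x₀`: `Γ X v` is the derivative of the
coordinate field `v` in the direction `X`. -/
def christoffel (D : Connection n M) (x₀ : M) (p : Model n) : Model n →L[ℝ] Model n →L[ℝ] Model n :=
  LinearMap.toContinuousLinearMap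
    { toFun := fun X ↦ LinearMap.toContinuousLinearMap
        { toFun := fun v ↦ tc x₀ ((crd n x₀).symm p) (connDiff D x₀ ((crd n x₀).symm p)
            (tcInv x₀ ((crd n x₀).symm p) v) (tcInv x₀ ((crd n x₀).symm p) X))
          map_add' := fun v w ↦ by simp
          map_smul' := fun c v ↦ by simp }
      map_add' := fun X Y ↦ by ext1 v; simp
      map_smul' := fun c X ↦ by ext1 v; simp }

lemma christoffel_apply (D : Connection n M) (x₀ : M) (p X v : Model n) :
    christoffel D x₀ p X v = tc x₀ ((crd n x₀).symm p) (connDiff D x₀ ((crd n x₀).symm p)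
            (tcInv x₀ ((crd n x₀).symm p) v) (tcInv x₀ ((crd n x₀).symm p) X)) := rfl

/-- The covariant derivative in coordinates. -/
lemma tc_conn (D : Connection n M) {x₀ y : M} (hy : y ∈ dom n x₀) {Y : ∀ y : M, TM n M y}
    (hY : MDifferentiableAt (𝓡 (4 * n)) ((𝓡 (4 * n)).prod 𝓘(ℝ, Model n))
      (fun y ↦ (TotalSpace.mk' (Model n) y (Y y) : TotalSpace (Model n) (TM n M))) y) (X : TM n M y) :
    tc x₀ y (D Y y X) = fderiv ℝ (vfCoord (𝓡 (4 * n)) x₀ Y) (crd n x₀ y) (tc x₀ y X)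
      + christoffel D x₀ (crd n x₀ y) (tc x₀ y X) (tc x₀ y (Y y)) := by
  have h := IsCovariantDerivativeOn.difference_apply (D.isCovariantDerivativeOn (s := dom n x₀))
    (flatConn_isCovariantDerivativeOn x₀) hy hY
  have h' : D Y y X = flatConn x₀ Y y X + connDiff D x₀ y (Y y) X := by
    rw [connDiff, h]; simp
  rw [h', map_add, christoffel_apply, crd_symm_crd hy, tcoordInv_tcoord hy, tcoordInv_tcoord hy,
    flatConn_apply, tcoord_tcoordInv hy]

/-- The vector field with constant components in the chart around `x₀`. -/
def coordVF (x₀ : M) (v : Model n) (y : M) : TM n M y := tcInv x₀ y v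

lemma vfCoord_coordVF {x₀ : M} {p : Model n} (hp : p ∈ (crd n x₀).target) (v : Model n) :
    vfCoord (𝓡 (4 * n)) x₀ (coordVF x₀ v) p = v := by
  have hp' : (crd n x₀).symm p ∈ dom n x₀ := by simpa using (crd n x₀).map_target hp
  exact tcoord_tcoordInv hp' v

lemma crd_mem_target {x₀ y : M} (hy : y ∈ dom n x₀) : crd n x₀ y ∈ (crd n x₀).target :=
  (crd n x₀).map_source (by simpa using hy)

lemma target_mem_nhds {x₀ : M} {p : Model n} (hp : p ∈ (crd n x₀).target) :
    (crd n x₀).target ∈ 𝓝 p := (isOpen_extChartAt_target (I := 𝓡 (4 * n)) x₀).mem_nhds hp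

lemma smooth_coordVF {x₀ y : M} (hy : y ∈ dom n x₀) (v : Model n) : SmoothVFAt (coordVF x₀ v) y := by
  rw [smoothVFAt_iff hy]
  refine (contDiffAt_const (c := v)).congr_of_eventuallyEq ?_
  filter_upwards [target_mem_nhds (crd_mem_target hy)] with p hp
  exact vfCoord_coordVF hp v

lemma SmoothVFAt.mdiff {y : M} {Y : ∀ y : M, TM n M y} (h : SmoothVFAt Y y) :
    MDifferentiableAt (𝓡 (4 * n)) ((𝓡 (4 * n)).prod 𝓘(ℝ, Model n))
      (fun y ↦ (TotalSpace.mk' (Model n) y (Y y) : TotalSpace (Model n) (TM n M))) y :=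
  ContMDiffAt.mdifferentiableAt h (by simp)

lemma conn_congr (D : Connection n M) {y : M} {Y Y' : ∀ y : M, TM n M y} (hY : SmoothVFAt Y y)
    (h : ∀ᶠ w in 𝓝 y, Y' w = Y w) : D Y' y = D Y y := by
  have hY' : SmoothVFAt Y' y := by
    refine ContMDiffAt.congr_of_eventuallyEq hY ?_
    filter_upwards [h] with w hw
    rw [hw]
  exact D.isCovariantDerivativeOnUniv.congr_of_eventuallyEq hY'.mdiff hY.mdiff univ_mem h

lemma smooth_conn_coordVF [T2Space M] [SigmaCompactSpace M] {D : Connection n M}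
    (hD : IsSmoothConnection D) {x₀ y : M} (hy : y ∈ dom n x₀) (v : Model n) :
    SmoothEndAt (fun y ↦ D (coordVF x₀ v) y) y := by
  obtain ⟨s, hs, -, hsv⟩ := exists_global_section (TM n M) (fun _ ↦ ⊤) (coordVF x₀ v)
    ((chartAt (Model n) x₀).open_source.mem_nhds hy) (fun w hw ↦ smooth_coordVF hw v) (fun _ _ ↦ trivial)
  have h1 := hD.contMDiff.contMDiff (σ := s) (fun w _ ↦ (hs w).contMDiffWithinAt)
  have h2 := h1.contMDiffAt univ_mem (x := y)
  refine ContMDiffAt.congr_of_eventuallyEq h2 ?_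
  filter_upwards [hsv.eventually_nhds, (chartAt (Model n) x₀).open_source.mem_nhds hy] with w hw hw'
  simp only [endMap]
  rw [← conn_congr D (smooth_coordVF hw' v) hw]

/-- Smoothness of the Christoffel symbols.  The smoothness of `D` concerns global vector fields, so the coordinate fields
have to be extended first. -/
lemma contDiffOn_christoffel [T2Space M] [SigmaCompactSpace M] {D : Connection n M}
    (hD : IsSmoothConnection D) (x₀ : M) : ContDiffOn ℝ ∞ (christoffel D x₀) (crd n x₀).target := by
  refine contDiffOn_clm_apply.2 fun X ↦ contDiffOn_clm_apply.2 fun v ↦ ?_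
  intro p hp
  have hp' : (crd n x₀).symm p ∈ dom n x₀ := by simpa using (crd n x₀).map_target hp
  have hpp : crd n x₀ ((crd n x₀).symm p) = p := (crd n x₀).right_inv hp
  have h := (smoothEndAt_iff hp').1 (smooth_conn_coordVF hD hp' v)
  rw [hpp] at h
  refine ContDiffAt.contDiffWithinAt ?_
  refine (h.clm_apply (contDiffAt_const (c := X))).congr_of_eventuallyEq ?_
  filter_upwards [target_mem_nhds hp] with q hq
  have hq' : (crd n x₀).symm q ∈ dom n x₀ := by simpa using (crd n x₀).map_target hq
  have hqq : crd n x₀ ((crd n x₀).symm q) = q := (crd n x₀).right_inv hq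
  rw [hatF, hatE_apply, tc_conn D hq' (smooth_coordVF hq' v).mdiff, tcoord_tcoordInv hq', hqq]
  have h0 : vfCoord (𝓡 (4 * n)) x₀ (coordVF x₀ v) =ᶠ[𝓝 q] fun _ ↦ v := by
    filter_upwards [target_mem_nhds hq] with r hr using vfCoord_coordVF hr v
  rw [h0.fderiv_eq, coordVF, tcoord_tcoordInv hq']
  simp

/-- The connection induced on `End(TM)` in coordinates: `∇_X σ = dσ(X) + [Γ X, σ]`. -/
lemma isEndCovDeriv_iff {D : Connection n M} {x₀ y : M} (hy : y ∈ dom n x₀)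
    {σ : ∀ y : M, EndT n M y} (hσ : SmoothEndAt σ y) {X : TM n M y} {q : EndT n M y} :
    IsEndCovDeriv D σ y X q ↔ hatE x₀ y q = fderiv ℝ (hatF x₀ σ) (crd n x₀ y) (tc x₀ y X)
      + (christoffel D x₀ (crd n x₀ y) (tc x₀ y X) * hatE x₀ y (σ y)
        - hatE x₀ y (σ y) * christoffel D x₀ (crd n x₀ y) (tc x₀ y X)) := by
  have hF := (smoothEndAt_iff hy).1 hσ
  have key : ∀ Y : ∀ y : M, TM n M y, SmoothVFAt Y y →
      tc x₀ y (D (fun y ↦ σ y (Y y)) y X - σ y (D Y y X)) =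
      (fderiv ℝ (hatF x₀ σ) (crd n x₀ y) (tc x₀ y X)
      + (christoffel D x₀ (crd n x₀ y) (tc x₀ y X) * hatE x₀ y (σ y)
        - hatE x₀ y (σ y) * christoffel D x₀ (crd n x₀ y) (tc x₀ y X))) (tc x₀ y (Y y)) := by
    intro Y hY
    have hYc := (smoothVFAt_iff hy).1 hY
    have hσY : SmoothVFAt (fun y ↦ σ y (Y y)) y := ContMDiffAt.clm_bundle_apply hσ hY
    have h1 : vfCoord (𝓡 (4 * n)) x₀ (fun y ↦ σ y (Y y)) =ᶠ[𝓝 (crd n x₀ y)]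
        fun p ↦ hatF x₀ σ p (vfCoord (𝓡 (4 * n)) x₀ Y p) := by
      filter_upwards [target_mem_nhds (crd_mem_target hy)] with p hp
      have hp' : (crd n x₀).symm p ∈ dom n x₀ := by simpa using (crd n x₀).map_target hp
      exact (hatE_tc hp' _ _).symm
    have h2 : vfCoord (𝓡 (4 * n)) x₀ Y (crd n x₀ y) = tc x₀ y (Y y) := by
      rw [vfCoord, crd_symm_crd hy]
    rw [map_sub, tc_conn D hy hσY.mdiff, h1.fderiv_eq, fderiv_clm_apply (hF.differentiableAt (by simp))
      (hYc.differentiableAt (by simp)), ← hatE_tc hy (σ y) (D Y y X), tc_conn D hy hY.mdiff,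
      ← hatE_tc hy (σ y), hatF_crd hy, h2]
    simp
    abel
  constructor
  · intro h
    ext1 v
    have h1 := h (coordVF x₀ v) (smooth_coordVF hy v)
    have h2 := key (coordVF x₀ v) (smooth_coordVF hy v)
    have h3 : tc x₀ y (coordVF x₀ v y) = v := tcoord_tcoordInv hy v
    rw [h1, h3, ← hatE_tc hy, h3] at h2
    exact h2
  · intro h Y hY
    apply tcoord_injective hy
    rw [key Y hY, ← h, hatE_tc hy]

end

section
/-! ### Quaternionic triples and covariant derivatives of sections of the quaternionic bundle -/

section Algebra
variable {A : Type*} [Ring A] [Algebra ℝ A]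

/-- A triple of elements of a real algebra that multiply like the imaginary units `i, j, k`. -/
structure QTriple (J : Fin 3 → A) : Prop where
  sq : ∀ a, J a * J a = -1
  mul01 : J 0 * J 1 = J 2
  mul10 : J 1 * J 0 = -J 2

namespace QTriple
variable {J : Fin 3 → A} (h : QTriple J)
include h

lemma mul12 : J 1 * J 2 = J 0 := by
  rw [← h.mul01, ← mul_assoc, h.mul10, neg_mul, ← h.mul01, mul_assoc, h.sq]; simp

lemma mul02 : J 0 * J 2 = -J 1 := by
  rw [← h.mul01, ← mul_assoc, h.sq]; simp

lemma mul20 : J 2 * J 0 = J 1 := by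
  rw [← h.mul01, mul_assoc, h.mul10, mul_neg, h.mul02]; simp

lemma mul21 : J 2 * J 1 = -J 0 := by
  rw [← h.mul01, mul_assoc, h.sq]; simp

/-- Quaternionic triples may be permuted cyclically. -/
lemma rot : QTriple ![J 1, J 2, J 0] where
  sq a := by fin_cases a <;> simp [h.sq]
  mul01 := by simpa using h.mul12
  mul10 := by simpa using h.mul21

lemma anticomm (x y : Fin 3 → ℝ) :
    (∑ i, x i • J i) * (∑ i, y i • J i) + (∑ i, y i • J i) * (∑ i, x i • J i)
      = (-2 * ∑ i, x i * y i) • (1 : A) := by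
  simp only [Fin.sum_univ_three, add_mul, mul_add, smul_mul_smul_comm, h.sq, h.mul01, h.mul10, h.mul02,
    h.mul20, h.mul12, h.mul21]
  module

lemma sq_sum (x : Fin 3 → ℝ) :
    (∑ i, x i • J i) * (∑ i, x i • J i) = (-∑ i, x i * x i) • (1 : A) := by
  simp only [Fin.sum_univ_three, add_mul, mul_add, smul_mul_smul_comm, h.sq, h.mul01, h.mul10, h.mul02,
    h.mul20, h.mul12, h.mul21]
  module

end QTriple
end Algebra

variable {n : ℕ}

lemma endModel_mul_smul (c : ℝ) (B C : EndModel n) : B * (c • C) = c • (B * C) := by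
  ext1 v
  exact map_smul B c (C v)

lemma endModel_smul_mul (c : ℝ) (B C : EndModel n) : (c • B) * C = c • (B * C) := rfl

/-- The trace of an endomorphism of the model space. -/
def trE (n : ℕ) : EndModel n →L[ℝ] ℝ :=
  LinearMap.toContinuousLinearMap
    { toFun := fun B ↦ LinearMap.trace ℝ (Model n) (B : Model n →ₗ[ℝ] Model n)
      map_add' := fun B C ↦ by simp
      map_smul' := fun c B ↦ by simp }

lemma trE_mul_comm (B C : EndModel n) : trE n (B * C) = trE n (C * B) :=
  LinearMap.trace_mul_comm ℝ (B : Model n →ₗ[ℝ] Model n) (C : Model n →ₗ[ℝ] Model n)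

lemma trE_one : trE n 1 = 4 * n := by
  have : trE n 1 = LinearMap.trace ℝ (Model n) 1 := rfl
  rw [this, LinearMap.trace_one]
  simp

/-- The components of an element of `span (J 0, J 1, J 2)`, for a quaternionic triple `J`, by means of the trace form. -/
def coef (J : Fin 3 → EndModel n) (a : Fin 3) (B : EndModel n) : ℝ := -(4 * n : ℝ)⁻¹ * trE n (J a * B)

lemma QTriple.trE_mul {J : Fin 3 → EndModel n} (h : QTriple J) (a b : Fin 3) :
    trE n (J a * J b) = if a = b then -(4 * n : ℝ) else 0 := by
  have h1 : ∀ a b, J a * J b = -(J b * J a) → trE n (J a * J b) = 0 := fun a b hab ↦ by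
    have := trE_mul_comm (J a) (J b)
    rw [hab, map_neg] at this
    rw [hab, map_neg]
    linarith
  split_ifs with hab
  · rw [← hab, h.sq, map_neg, trE_one]
  · apply h1
    fin_cases a <;> fin_cases b <;> first
      | exact absurd rfl hab
      | simp [h.mul01, h.mul10, h.mul02, h.mul20, h.mul12, h.mul21]

lemma QTriple.norm_of_sq {J : Fin 3 → EndModel n} (h : QTriple J) (hn : 1 ≤ n) {x : Fin 3 → ℝ}
    (hx : (∑ i, x i • J i) * (∑ i, x i • J i) = -1) : ∑ i, x i * x i = 1 := by
  rw [h.sq_sum] at hx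
  have h3 := congrArg (trE n) hx
  rw [map_smul, map_neg, trE_one, smul_eq_mul] at h3
  have hn' : (4 * n : ℝ) ≠ 0 := by positivity
  have : (4 * n : ℝ) * (∑ i, x i * x i - 1) = 0 := by linarith
  rcases mul_eq_zero.1 this with h | h
  · exact absurd h hn'
  · linarith

lemma QTriple.coef_sum {J : Fin 3 → EndModel n} (h : QTriple J) (hn : 1 ≤ n) (x : Fin 3 → ℝ) (a : Fin 3) :
    coef J a (∑ i, x i • J i) = x a := by
  have hn' : (4 * n : ℝ) ≠ 0 := by positivity
  simp only [coef, Finset.mul_sum, endModel_mul_smul, map_sum, map_smul, h.trE_mul, smul_eq_mul, mul_ite,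
    mul_zero, Finset.sum_ite_eq, Finset.mem_univ, if_true]
  field_simp

lemma QTriple.sum_coef {J : Fin 3 → EndModel n} (h : QTriple J) (hn : 1 ≤ n) {B : EndModel n}
    (hB : B ∈ Submodule.span ℝ (range J)) : ∑ i, coef J i B • J i = B := by
  obtain ⟨x, rfl⟩ := (Submodule.mem_span_range_iff_exists_fun ℝ).1 hB
  simp only [h.coef_sum hn]

lemma contDiffAt_coef {F : Type*} [NormedAddCommGroup F] [NormedSpace ℝ F] {k : ℕ∞ω}
    {J : F → Fin 3 → EndModel n} {B : F → EndModel n}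
    {x : F} (a : Fin 3) (hJ : ContDiffAt ℝ k (fun y ↦ J y a) x) (hB : ContDiffAt ℝ k B x) :
    ContDiffAt ℝ k (fun y ↦ coef (J y) a (B y)) x := by
  unfold coef
  exact contDiffAt_const.mul ((trE n).contDiff.contDiffAt.comp x (hJ.mul hB))

lemma differentiableAt_coef {F : Type*} [NormedAddCommGroup F] [NormedSpace ℝ F]
    {J : F → Fin 3 → EndModel n} {B : F → EndModel n}
    {x : F} (a : Fin 3) (hJ : DifferentiableAt ℝ (fun y ↦ J y a) x) (hB : DifferentiableAt ℝ B x) :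
    DifferentiableAt ℝ (fun y ↦ coef (J y) a (B y)) x := by
  unfold coef
  exact (((trE n).differentiableAt.comp x (hJ.mul hB))).const_mul _

variable {M : Type*} [TopologicalSpace M] [ChartedSpace (Model n) M]
  [IsManifold (𝓡 (4 * n)) ∞ M]

/-- `hatE` as a linear map. -/
def hatL (x₀ y : M) : EndT n M y →ₗ[ℝ] EndModel n where
  toFun := hatE x₀ y
  map_add' := hatE_add
  map_smul' := hatE_smul

/-- The fibre of `𝒬` over the point with coordinates `p`, in the chart around `x₀`. -/
def fibE (Q : AlmostQuaternionicStructure n M) (x₀ : M) (p : Model n) : Submodule ℝ (EndModel n) :=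
  (Q.fiber ((crd n x₀).symm p)).map (hatL x₀ ((crd n x₀).symm p))

lemma hatE_mem_fibE {Q : AlmostQuaternionicStructure n M} {x₀ y : M} (hy : y ∈ dom n x₀) {A : EndT n M y} :
    hatE x₀ y A ∈ fibE Q x₀ (crd n x₀ y) ↔ A ∈ Q.fiber y := by
  rw [fibE, crd_symm_crd hy]
  constructor
  · rintro ⟨A', hA', h⟩
    rwa [← hatE_injective hy h]
  · exact fun h ↦ ⟨A, h, rfl⟩

lemma crd_tendsto_symm {x₀ : M} {y : M} (hy : y ∈ dom n x₀) {P : M → Prop} (h : ∀ᶠ w in 𝓝 y, P w) :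
    ∀ᶠ p in 𝓝 (crd n x₀ y), P ((crd n x₀).symm p) := by
  have h1 : ContinuousAt (crd n x₀).symm (crd n x₀ y) :=
    (continuousOn_extChartAt_symm x₀).continuousAt (target_mem_nhds (crd_mem_target hy))
  have h2 : Tendsto (crd n x₀).symm (𝓝 (crd n x₀ y)) (𝓝 y) := by
    have := h1.tendsto; rwa [crd_symm_crd hy] at this
  exact h2.eventually h

/-- Around every point, `𝒬` is spanned by a smooth field of quaternionic triples, in coordinates. -/
lemma exists_frame (Q : AlmostQuaternionicStructure n M) {x₀ y : M} (hy : y ∈ dom n x₀) :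
    ∃ J : Model n → Fin 3 → EndModel n, (∀ a, ∀ᶠ p in 𝓝 (crd n x₀ y), ContDiffAt ℝ ∞ (fun p ↦ J p a) p) ∧
      ∀ᶠ p in 𝓝 (crd n x₀ y), QTriple (J p) ∧ fibE Q x₀ p = Submodule.span ℝ (range (J p)) := by
  obtain ⟨U, hU, hyU, J, hJ, hJq, hJs⟩ := Q.exists_admissible y
  have hev : ∀ᶠ p in 𝓝 (crd n x₀ y), (crd n x₀).symm p ∈ U ∧ p ∈ (crd n x₀).target :=
    (crd_tendsto_symm hy (hU.mem_nhds hyU)).and (target_mem_nhds (crd_mem_target hy))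
  refine ⟨fun p a ↦ hatF x₀ (J a) p, fun a ↦ ?_, ?_⟩
  · filter_upwards [hev] with p ⟨hpU, hpt⟩
    have hp' : (crd n x₀).symm p ∈ dom n x₀ := by simpa using (crd n x₀).map_target hpt
    have := (smoothEndAt_iff hp').1 (hJ a _ hpU)
    rwa [(crd n x₀).right_inv hpt] at this
  · filter_upwards [hev] with p ⟨hpU, hpt⟩
    have hp' : (crd n x₀).symm p ∈ dom n x₀ := by simpa using (crd n x₀).map_target hpt
    have h := hJq _ hpU
    refine ⟨⟨fun a ↦ ?_, ?_, ?_⟩, ?_⟩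
    · rw [hatF, ← hatE_comp hp', h.sq, hatE_neg, hatE_id hp']
    · rw [hatF, hatF, ← hatE_comp hp', h.mul]; rfl
    · rw [hatF, hatF, ← hatE_comp hp', h.mul_swap, hatE_neg]; rfl
    · rw [fibE, hJs _ hpU, Submodule.map_span, ← range_comp]
      rfl

/-- The covariant derivative in coordinates of a curve of endomorphisms with value `A` and velocity `(X, B)` at `p`. -/
def covE (Γ : Model n → Model n →L[ℝ] Model n →L[ℝ] Model n) (p : Model n) (A : EndModel n)
    (X : Model n) (B : EndModel n) : EndModel n := B + (Γ p X * A - A * Γ p X)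

/-- If the covariant derivatives of a local frame of `𝒬` lie in `𝒬`, so do those of all curves in `𝒬`. -/
lemma covE_curve_mem_of_frame (hn : 1 ≤ n) {Q : AlmostQuaternionicStructure n M} {x₀ : M}
    {Γ : Model n → Model n →L[ℝ] Model n →L[ℝ] Model n} {J : Model n → Fin 3 → EndModel n}
    {c₁ : ℝ → Model n} {c₂ : ℝ → EndModel n} (hc₁ : DifferentiableAt ℝ c₁ 0) (hc₂ : DifferentiableAt ℝ c₂ 0)
    (hJd : ∀ a, DifferentiableAt ℝ (fun p ↦ J p a) (c₁ 0))
    (hJQ : ∀ᶠ p in 𝓝 (c₁ 0), QTriple (J p) ∧ fibE Q x₀ p = Submodule.span ℝ (range (J p)))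
    (hcov : ∀ a, covE Γ (c₁ 0) (J (c₁ 0) a) (deriv c₁ 0) (fderiv ℝ (fun p ↦ J p a) (c₁ 0) (deriv c₁ 0)) ∈
      fibE Q x₀ (c₁ 0))
    (hQ : ∀ᶠ t in 𝓝 0, c₂ t ∈ fibE Q x₀ (c₁ t)) :
    covE Γ (c₁ 0) (c₂ 0) (deriv c₁ 0) (deriv c₂ 0) ∈ fibE Q x₀ (c₁ 0) := by
  have hJc : ∀ a, DifferentiableAt ℝ (fun t ↦ J (c₁ t) a) 0 := fun a ↦ (hJd a).comp 0 hc₁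
  set f : Fin 3 → ℝ → ℝ := fun a t ↦ coef (J (c₁ t)) a (c₂ t) with hf
  have hfd : ∀ a, DifferentiableAt ℝ (f a) 0 := fun a ↦ differentiableAt_coef a (hJc a) hc₂
  have hev : c₂ =ᶠ[𝓝 0] fun t ↦ ∑ a, f a t • J (c₁ t) a := by
    filter_upwards [hc₁.continuousAt.eventually hJQ, hQ] with t ⟨ht1, ht2⟩ ht3
    rw [ht2] at ht3
    exact (ht1.sum_coef hn ht3).symm
  have hd : deriv c₂ 0 = ∑ a, (f a 0 • fderiv ℝ (fun p ↦ J p a) (c₁ 0) (deriv c₁ 0)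
      + deriv (f a) 0 • J (c₁ 0) a) := by
    rw [hev.deriv_eq]
    refine HasDerivAt.deriv (HasDerivAt.fun_sum fun a _ ↦ ?_)
    have h2 : HasDerivAt (fun t ↦ J (c₁ t) a) (fderiv ℝ (fun p ↦ J p a) (c₁ 0) (deriv c₁ 0)) 0 :=
      (hJd a).hasFDerivAt.comp_hasDerivAt 0 hc₁.hasDerivAt
    exact (hfd a).hasDerivAt.smul h2
  have h00 := hJQ.self_of_nhds
  have hJm : ∀ a, J (c₁ 0) a ∈ fibE Q x₀ (c₁ 0) := fun a ↦ by
    rw [h00.2]; exact Submodule.subset_span ⟨a, rfl⟩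
  have key : covE Γ (c₁ 0) (c₂ 0) (deriv c₁ 0) (deriv c₂ 0) =
      ∑ a, (f a 0 • covE Γ (c₁ 0) (J (c₁ 0) a) (deriv c₁ 0)
        (fderiv ℝ (fun p ↦ J p a) (c₁ 0) (deriv c₁ 0)) + deriv (f a) 0 • J (c₁ 0) a) := by
    rw [covE, hd]
    conv_lhs => rw [hev.self_of_nhds]
    simp only [covE, Finset.mul_sum, Finset.sum_mul, endModel_mul_smul, endModel_smul_mul,
      ← Finset.sum_sub_distrib, ← Finset.sum_add_distrib]
    refine Finset.sum_congr rfl fun a _ ↦ ?_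
    module
  rw [key]
  exact Submodule.sum_mem _ fun a _ ↦ Submodule.add_mem _ (Submodule.smul_mem _ _ (hcov a))
    (Submodule.smul_mem _ _ (hJm a))

/-- Covariant derivatives of sections of `𝒬` lie in `𝒬` if this holds for the curves in `𝒬`. -/
lemma covE_mem_of_curve {Q : AlmostQuaternionicStructure n M} {x₀ : M}
    {Γ : Model n → Model n →L[ℝ] Model n →L[ℝ] Model n} {p : Model n}
    {σ : Model n → EndModel n} (hσ : DifferentiableAt ℝ σ p) (hQ : ∀ᶠ q in 𝓝 p, σ q ∈ fibE Q x₀ q) (X : Model n)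
    (hcurve : ∀ (c₁ : ℝ → Model n) (c₂ : ℝ → EndModel n), DifferentiableAt ℝ c₁ 0 → DifferentiableAt ℝ c₂ 0 →
      c₁ 0 = p → (∀ᶠ t in 𝓝 0, c₂ t ∈ fibE Q x₀ (c₁ t)) → covE Γ p (c₂ 0) (deriv c₁ 0) (deriv c₂ 0) ∈ fibE Q x₀ p) :
    covE Γ p (σ p) X (fderiv ℝ σ p X) ∈ fibE Q x₀ p := by
  have hl : HasDerivAt (fun t : ℝ ↦ p + t • X) X 0 := by
    simpa using ((hasDerivAt_id (0 : ℝ)).smul_const X).const_add p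
  have h0 : p + (0 : ℝ) • X = p := by simp
  have hσ' : DifferentiableAt ℝ σ (p + (0 : ℝ) • X) := by rwa [h0]
  have hc2 : HasDerivAt (fun t : ℝ ↦ σ (p + t • X)) (fderiv ℝ σ p X) 0 := by
    have := hσ'.hasFDerivAt.comp_hasDerivAt (0 : ℝ) hl
    rwa [h0] at this
  have h := hcurve (fun t ↦ p + t • X) (fun t ↦ σ (p + t • X)) hl.differentiableAt hc2.differentiableAt h0 (by
      have : ContinuousAt (fun t : ℝ ↦ p + t • X) 0 := hl.continuousAt
      rw [← h0] at hQ
      exact this.eventually hQ)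
  rw [hl.deriv, hc2.deriv] at h
  simpa using h

variable [T2Space M] [SigmaCompactSpace M] {Q : AlmostQuaternionicStructure n M} {D : Connection n M}

/-- Covariant derivatives of smooth local sections of `𝒬` lie in `𝒬`. -/
lemma covE_section_mem (hD : Q.IsQuaternionicConnection D) {x₀ y : M} (hy : y ∈ dom n x₀)
    {J : Model n → EndModel n} (hJ : ∀ᶠ p in 𝓝 (crd n x₀ y), ContDiffAt ℝ ∞ J p)
    (hJQ : ∀ᶠ p in 𝓝 (crd n x₀ y), J p ∈ fibE Q x₀ p) (X : Model n) :
    covE (christoffel D x₀) (crd n x₀ y) (J (crd n x₀ y)) X (fderiv ℝ J (crd n x₀ y) X) ∈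
      fibE Q x₀ (crd n x₀ y) := by
  set U : Set M := {w | w ∈ dom n x₀ ∧ ContDiffAt ℝ ∞ J (crd n x₀ w) ∧
    J (crd n x₀ w) ∈ fibE Q x₀ (crd n x₀ w)} with hUdef
  have hU : U ∈ 𝓝 y := by
    have hc : ContinuousAt (crd n x₀) y := continuousAt_extChartAt' (by simpa using hy)
    filter_upwards [(chartAt (Model n) x₀).open_source.mem_nhds hy, hc.eventually hJ, hc.eventually hJQ]
      with w h1 h2 h3 using ⟨h1, h2, h3⟩
  set σ : ∀ y : M, EndT n M y := fun w ↦ unhatE x₀ w (J (crd n x₀ w)) with hσ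
  have hσF : ∀ p ∈ (crd n x₀).target, hatF x₀ σ p = J p := fun p hp ↦ by
    have hp' : (crd n x₀).symm p ∈ dom n x₀ := by simpa using (crd n x₀).map_target hp
    rw [hatF, hatE_unhatE hp', (crd n x₀).right_inv hp]
  have hσF' : ∀ w ∈ dom n x₀, hatF x₀ σ =ᶠ[𝓝 (crd n x₀ w)] J := fun w hw ↦ by
    filter_upwards [target_mem_nhds (crd_mem_target hw)] with p hp using hσF p hp
  have hσs : ∀ w ∈ U, SmoothEndAt σ w := fun w hw ↦
    (smoothEndAt_iff hw.1).2 (hw.2.1.congr_of_eventuallyEq (hσF' w hw.1))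
  obtain ⟨s, hs, hsQ, hse⟩ := exists_global_section (EndT n M) (fun w ↦ Q.fiber w) σ hU hσs
    (fun w hw ↦ by rw [← hatE_mem_fibE hw.1, hatE_unhatE hw.1]; exact hw.2.2)
  obtain ⟨q, hq, hqd⟩ := hD.preserves s hs hsQ y (tcInv x₀ y X)
  rw [isEndCovDeriv_iff hy (hs y)] at hqd
  rw [← hatE_mem_fibE hy, hqd] at hq
  have hsJ : hatF x₀ s =ᶠ[𝓝 (crd n x₀ y)] J := by
    filter_upwards [crd_tendsto_symm hy hse, target_mem_nhds (crd_mem_target hy)] with p h1 h2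
    rw [← hσF p h2, hatF, h1, hatF]
  rw [hsJ.fderiv_eq, tcoord_tcoordInv hy, ← hatF_crd hy, hsJ.self_of_nhds] at hq
  exact hq

/-- Covariant derivatives of curves in `𝒬` lie in `𝒬`. -/
lemma covE_curve_mem (hn : 1 ≤ n) (hD : Q.IsQuaternionicConnection D) {x₀ y : M} (hy : y ∈ dom n x₀)
    {c₁ : ℝ → Model n} {c₂ : ℝ → EndModel n} (hc₁ : DifferentiableAt ℝ c₁ 0) (hc₂ : DifferentiableAt ℝ c₂ 0)
    (h0 : c₁ 0 = crd n x₀ y) (hQ : ∀ᶠ t in 𝓝 0, c₂ t ∈ fibE Q x₀ (c₁ t)) :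
    covE (christoffel D x₀) (crd n x₀ y) (c₂ 0) (deriv c₁ 0) (deriv c₂ 0) ∈ fibE Q x₀ (crd n x₀ y) := by
  obtain ⟨J, hJ, hJQ⟩ := exists_frame Q hy
  have hmem : ∀ a, ∀ᶠ p in 𝓝 (crd n x₀ y), J p a ∈ fibE Q x₀ p := fun a ↦ by
    filter_upwards [hJQ] with p hp
    rw [hp.2]; exact Submodule.subset_span ⟨a, rfl⟩
  have hcov := fun a ↦ covE_section_mem hD hy (hJ a) (hmem a) (deriv c₁ 0)
  rw [← h0] at hJ hJQ hcov ⊢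
  exact covE_curve_mem_of_frame hn hc₁ hc₂ (fun a ↦ (hJ a).self_of_nhds.differentiableAt (by simp)) hJQ hcov hQ

/-- Covariant derivatives of sections of `𝒬` lie in `𝒬`, even if the sections are only
differentiable at the point. -/
lemma covE_mem (hn : 1 ≤ n) (hD : Q.IsQuaternionicConnection D) {x₀ y : M} (hy : y ∈ dom n x₀)
    {σ : Model n → EndModel n} (hσ : DifferentiableAt ℝ σ (crd n x₀ y))
    (hQ : ∀ᶠ p in 𝓝 (crd n x₀ y), σ p ∈ fibE Q x₀ p) (X : Model n) :
    covE (christoffel D x₀) (crd n x₀ y) (σ (crd n x₀ y)) X (fderiv ℝ σ (crd n x₀ y) X) ∈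
      fibE Q x₀ (crd n x₀ y) :=
  covE_mem_of_curve hσ hQ X fun _ _ hc₁ hc₂ h0 hQ ↦ covE_curve_mem hn hD hy hc₁ hc₂ h0 hQ

end

section
/-! ### The tangent space of the twistor space -/

variable {n : ℕ} {M : Type*} [TopologicalSpace M] [ChartedSpace (Model n) M]
  [IsManifold (𝓡 (4 * n)) ∞ M]

/-- The twistor space in the chart around `x₀`. -/
def twZ (Q : AlmostQuaternionicStructure n M) (x₀ : M) : Set (Model n × EndModel n) :=
  {q | q.2 ∈ fibE Q x₀ q.1 ∧ q.2 * q.2 = -1}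

lemma mem_twistorSpace_iff {Q : AlmostQuaternionicStructure n M} {x₀ : M} {z : EndTM n M}
    (hz : z.1 ∈ dom n x₀) : z ∈ Q.twistorSpace ↔ endCrd x₀ z ∈ twZ Q x₀ := by
  rw [endCrd_eq hz]
  refine and_congr (hatE_mem_fibE hz).symm ?_
  change _ ↔ hatE x₀ z.1 z.2 * hatE x₀ z.1 z.2 = -1
  rw [← hatE_comp hz, ← hatE_id hz, ← hatE_neg]
  exact (hatE_injective hz).eq_iff.symm

lemma endCrd_symm_eq {x₀ : M} {y : M} (hy : y ∈ dom n x₀) (B : EndModel n) :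
    (endCrd x₀).symm (crd n x₀ y, B) = TotalSpace.mk' (EndModel n) y (unhatE x₀ y B) := by
  have h := (endCrd x₀).left_inv (mem_endCrd_source.2 (show (TotalSpace.mk' (EndModel n) y (unhatE x₀ y B) :
    EndTM n M).1 ∈ dom n x₀ from hy))
  rw [← h, endCrd_eq hy]
  congr 2
  exact (hatE_unhatE hy B).symm

/-- The tangent space of the twistor space in coordinates, at `q = (p, A)`: the vertical part of `(X, B)` lies in `𝒬` and
anticommutes with `A`. -/
def tanE (Q : AlmostQuaternionicStructure n M) (D : Connection n M) (x₀ : M) (q : Model n × EndModel n) :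
    Submodule ℝ (Model n × EndModel n) where
  carrier := {w | covE (christoffel D x₀) q.1 q.2 w.1 w.2 ∈ fibE Q x₀ q.1 ∧
    covE (christoffel D x₀) q.1 q.2 w.1 w.2 * q.2 + q.2 * covE (christoffel D x₀) q.1 q.2 w.1 w.2 = 0}
  add_mem' {v w} hv hw := by
    have h : covE (christoffel D x₀) q.1 q.2 (v + w).1 (v + w).2 =
        covE (christoffel D x₀) q.1 q.2 v.1 v.2 + covE (christoffel D x₀) q.1 q.2 w.1 w.2 := by
      simp only [covE, Prod.fst_add, Prod.snd_add, map_add, add_mul, mul_add]; abel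
    refine ⟨by rw [h]; exact Submodule.add_mem _ hv.1 hw.1, ?_⟩
    rw [h, add_mul, mul_add, add_add_add_comm, hv.2, hw.2, add_zero]
  zero_mem' := by simp [covE]
  smul_mem' c w hw := by
    have h : covE (christoffel D x₀) q.1 q.2 (c • w).1 (c • w).2 =
        c • covE (christoffel D x₀) q.1 q.2 w.1 w.2 := by
      simp only [covE, Prod.smul_fst, Prod.smul_snd, map_smul, endModel_mul_smul, endModel_smul_mul]
      module
    refine ⟨by rw [h]; exact Submodule.smul_mem _ _ hw.1, ?_⟩
    rw [h, endModel_mul_smul, endModel_smul_mul]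
    refine (smul_add c _ _).symm.trans ?_
    rw [hw.2, smul_zero]

/-- The horizontal part does not matter for the condition of anticommuting with `J`. -/
lemma covE_anticomm {A : Type*} [Ring A] {J B G : A} (hJ : J * J = -1) :
    (B + (G * J - J * G)) * J + J * (B + (G * J - J * G)) = B * J + J * B := by
  have h1 : G * J * J = -G := by rw [mul_assoc, hJ]; simp
  have h2 : J * (J * G) = -G := by rw [← mul_assoc, hJ]; simp
  rw [add_mul, mul_add, sub_mul, mul_sub, h1, h2]
  noncomm_ring

lemma fderiv_affine {E F : Type*} [NormedAddCommGroup E] [NormedSpace ℝ E] [NormedAddCommGroup F]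
    [NormedSpace ℝ F] (c : F) (L : E →L[ℝ] F) (x : E) : fderiv ℝ (fun p ↦ c + L (p - x)) x = L := by
  have h1 : HasFDerivAt (fun p ↦ L (p - x)) L x := by
    have h2 : HasFDerivAt (fun p ↦ L p - L x) L x := L.hasFDerivAt.sub_const (L x)
    simpa only [map_sub] using h2
  exact (h1.const_add c).fderiv

/-- The vertical vectors in coordinates. -/
lemma isVerticalLift_iff {x₀ : M} {z : EndTM n M} (hz : z.1 ∈ dom n x₀) (A : EndT n M z.1)
    (W : TangentSpace (endI n) z) : IsVerticalLift z A W ↔ vc x₀ z W = (0, hatE x₀ z.1 A) := by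
  set c : ℝ → Model n × EndModel n := fun t ↦ (crd n x₀ z.1, hatE x₀ z.1 z.2 + t • hatE x₀ z.1 A) with hc
  have hcs : ContDiff ℝ ∞ c := by fun_prop
  have hcd : deriv c 0 = (0, hatE x₀ z.1 A) := by
    have h1 : HasDerivAt (fun t : ℝ ↦ hatE x₀ z.1 z.2 + t • hatE x₀ z.1 A) (hatE x₀ z.1 A) 0 := by
      simpa using ((hasDerivAt_id (0 : ℝ)).smul_const (hatE x₀ z.1 A)).const_add (hatE x₀ z.1 z.2)
    exact ((hasDerivAt_const _ _).prodMk h1).deriv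
  have hc0 : c 0 = endCrd x₀ z := by
    rw [endCrd_eq hz, hc]
    exact Prod.ext rfl ((congrArg _ (zero_smul ℝ (hatE x₀ z.1 A))).trans (add_zero _))
  have hγ : (fun t : ℝ ↦ TotalSpace.mk' (EndModel n) z.1 (z.2 + t • A)) = fun t ↦ (endCrd x₀).symm (c t) := by
    ext1 t
    rw [hc, endCrd_symm_eq hz, ← hatE_smul, ← hatE_add, unhatE_hatE hz]
  have hγs : ContMDiffAt 𝓘(ℝ, ℝ) (endI n) ∞ (fun t ↦ (endCrd x₀).symm (c t)) 0 :=
    (isVelocity_of_coord (W := tcoordInv (endI n) (TotalSpace.mk' (EndModel n) x₀ 0 : EndTM n M) z (deriv c 0))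
      hz hcs.contDiffAt hc0 (tcoord_tcoordInv (mem_endChart_source.2 hz) _).symm).1
  unfold IsVerticalLift
  rw [hγ]
  constructor
  · intro h
    rw [(vc_of_isVelocity hz (hγs.mdifferentiableAt (by simp)) h).2, ← hcd]
    refine Filter.EventuallyEq.deriv_eq (Eventually.of_forall fun t ↦ ?_)
    refine (endCrd x₀).right_inv ?_
    have : c t = endCrd x₀ (TotalSpace.mk' (EndModel n) z.1 (z.2 + t • A)) := by
      rw [endCrd_eq (z := TotalSpace.mk' (EndModel n) z.1 (z.2 + t • A)) hz, hatE_add, hatE_smul]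
    rw [this]
    exact (endCrd x₀).map_source (mem_endCrd_source.2 hz)
  · intro h
    exact (isVelocity_of_coord hz hcs.contDiffAt hc0 (by rw [hcd, h])).2

/-- A field of endomorphisms with prescribed value and derivative at a point. -/
lemma exists_smoothEndAt {x₀ y : M} (hy : y ∈ dom n x₀) (A : EndT n M y) (L : Model n →L[ℝ] EndModel n) :
    ∃ σ : ∀ y : M, EndT n M y, SmoothEndAt σ y ∧ σ y = A ∧ fderiv ℝ (hatF x₀ σ) (crd n x₀ y) = L := by
  let S : Model n → EndModel n := fun p ↦ hatE x₀ y A + L (p - crd n x₀ y)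
  have hSs : ContDiff ℝ ∞ S := contDiff_const.add (L.contDiff.comp (contDiff_id.sub contDiff_const))
  have hσF : hatF x₀ (fun w ↦ unhatE x₀ w (S (crd n x₀ w))) =ᶠ[𝓝 (crd n x₀ y)] S := by
    filter_upwards [target_mem_nhds (crd_mem_target hy)] with p hp
    have hp' : (crd n x₀).symm p ∈ dom n x₀ := by simpa using (crd n x₀).map_target hp
    rw [hatF, hatE_unhatE hp', (crd n x₀).right_inv hp]
  refine ⟨_, (smoothEndAt_iff hy).2 (hSs.contDiffAt.congr_of_eventuallyEq hσF), ?_, ?_⟩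
  · have hS : S (crd n x₀ y) = hatE x₀ y A := by
      change hatE x₀ y A + L (crd n x₀ y - crd n x₀ y) = _
      rw [sub_self, map_zero, add_zero]
    rw [hS, unhatE_hatE hy]
  · rw [hσF.fderiv_eq]
    exact fderiv_affine _ _ _

/-- The horizontal lift of `X` to `(p, A)` is `(X, -[Γ X, A])`, in coordinates. -/
lemma isHorizontalLift_iff {D : Connection n M} {x₀ : M} {z : EndTM n M} (hz : z.1 ∈ dom n x₀) (X : TM n M z.1)
    (W : TangentSpace (endI n) z) : IsHorizontalLift D z X W ↔
      vc x₀ z W = (tc x₀ z.1 X, -(christoffel D x₀ (crd n x₀ z.1) (tc x₀ z.1 X) * hatE x₀ z.1 z.2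
        - hatE x₀ z.1 z.2 * christoffel D x₀ (crd n x₀ z.1) (tc x₀ z.1 X))) := by
  obtain ⟨x, A⟩ := z
  simp only at hz X ⊢
  constructor
  · rintro ⟨σ, hσ, hσX, h⟩
    simp only at hσ hσX h
    have h1 : σ x = A := eq_of_heq (TotalSpace.mk.inj (congrArg TotalSpace.proj h)).2
    subst h1
    have hW := eq_of_heq (TotalSpace.mk.inj h).2
    rw [← hW]
    refine (vc_mfderiv_endMap hz hσ X).trans ?_
    rw [isEndCovDeriv_iff hz hσ, hatE_zero] at hσX
    rw [eq_neg_of_add_eq_zero_left hσX.symm]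
  · intro h
    set p₀ := crd n x₀ x with hp₀
    set L : Model n →L[ℝ] EndModel n := LinearMap.toContinuousLinearMap
      { toFun := fun v ↦ -(christoffel D x₀ p₀ v * hatE x₀ x A - hatE x₀ x A * christoffel D x₀ p₀ v)
        map_add' := fun v w ↦ by simp only [map_add, add_mul, mul_add]; abel
        map_smul' := fun c v ↦ by
          simp only [map_smul, endModel_mul_smul, endModel_smul_mul, RingHom.id_apply]
          module } with hL
    have hLa : ∀ v, L v = -(christoffel D x₀ p₀ v * hatE x₀ x A - hatE x₀ x A * christoffel D x₀ p₀ v) :=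
      fun v ↦ rfl
    obtain ⟨σ, hσs, hσx, hSd⟩ := exists_smoothEndAt hz A L
    refine ⟨σ, hσs, ?_, ?_⟩
    · simp only
      rw [isEndCovDeriv_iff hz hσs, hatE_zero, hSd, hLa, hσx]
      abel
    · simp only
      have h2 := vc_mfderiv_endMap hz hσs X
      rw [hSd, hLa, ← h] at h2
      subst hσx
      congr 1
      exact tcoord_injective (mem_endChart_source.2 hz) h2

variable [T2Space M] [SigmaCompactSpace M] {Q : AlmostQuaternionicStructure n M} {D : Connection n M}

/-- Velocities of curves in the twistor space are tangent to it. -/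
lemma curve_mem_tanE (hn : 1 ≤ n) (hD : Q.IsQuaternionicConnection D) {x₀ y : M} (hy : y ∈ dom n x₀)
    {c : ℝ → Model n × EndModel n} (hc : DifferentiableAt ℝ c 0)
    (h0 : (c 0).1 = crd n x₀ y) (hQ : ∀ᶠ t in 𝓝 0, c t ∈ twZ Q x₀) :
    deriv c 0 ∈ tanE Q D x₀ (c 0) := by
  have h1 : HasDerivAt (fun t ↦ (c t).1) (deriv c 0).1 0 :=
    (ContinuousLinearMap.fst ℝ (Model n) (EndModel n)).hasFDerivAt.comp_hasDerivAt (0 : ℝ) hc.hasDerivAt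
  have h2 : HasDerivAt (fun t ↦ (c t).2) (deriv c 0).2 0 :=
    (ContinuousLinearMap.snd ℝ (Model n) (EndModel n)).hasFDerivAt.comp_hasDerivAt (0 : ℝ) hc.hasDerivAt
  have h := covE_curve_mem hn hD hy h1.differentiableAt h2.differentiableAt h0
    (hQ.mono fun t ht ↦ ht.1)
  rw [h1.deriv, h2.deriv, ← h0] at h
  refine ⟨h, ?_⟩
  rw [covE, covE_anticomm hQ.self_of_nhds.2]
  have h3 : HasDerivAt (fun t ↦ (c t).2 * (c t).2) ((deriv c 0).2 * (c 0).2 + (c 0).2 * (deriv c 0).2) 0 :=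
    h2.mul h2
  have h4 : (fun t ↦ (c t).2 * (c t).2) =ᶠ[𝓝 0] fun _ ↦ -1 := hQ.mono fun t ht ↦ ht.2
  exact h3.unique ((hasDerivAt_const _ _).congr_of_eventuallyEq h4)

lemma smul_mul_smul_eq_neg_one {S : EndModel n} {r s : ℝ} (hS : S * S = (-s) • 1) (h : r * r * -s = -1) :
    (r • S) * (r • S) = -1 := by
  rw [endModel_mul_smul, endModel_smul_mul, hS, smul_smul, smul_smul, h]
  exact (neg_smul (1 : ℝ) (1 : EndModel n)).trans (congrArg _ (one_smul ℝ _))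

set_option maxHeartbeats 1000000 in
/-- Tangent vectors of the twistor space, in coordinates, are velocities of curves. -/
lemma exists_curve_of_mem_tanE (hn : 1 ≤ n) (hD : Q.IsQuaternionicConnection D) {x₀ y : M} (hy : y ∈ dom n x₀)
    {A : EndModel n} (hA : (crd n x₀ y, A) ∈ twZ Q x₀) {w : Model n × EndModel n}
    (hw : w ∈ tanE Q D x₀ (crd n x₀ y, A)) :
    ∃ c : ℝ → Model n × EndModel n, ContDiffAt ℝ ∞ c 0 ∧ c 0 = (crd n x₀ y, A) ∧ deriv c 0 = w ∧
      ∀ᶠ t in 𝓝 0, c t ∈ twZ Q x₀ := by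
  obtain ⟨J, hJ, hJQ⟩ := exists_frame Q hy
  set p₀ := crd n x₀ y with hp₀
  obtain ⟨hJ0, hJs⟩ := hJQ.self_of_nhds
  obtain ⟨X, B⟩ := w
  have hAm := hA.1
  simp only [hJs] at hAm
  obtain ⟨a, ha⟩ := (Submodule.mem_span_range_iff_exists_fun ℝ).1 hAm
  set S : Model n → EndModel n := fun p ↦ ∑ i, a i • J p i with hS
  have hJd : ∀ i, DifferentiableAt ℝ (fun p ↦ J p i) p₀ := fun i ↦
    (hJ i).self_of_nhds.differentiableAt (by simp)
  have hSd : DifferentiableAt ℝ S p₀ := DifferentiableAt.fun_sum fun i _ ↦ (hJd i).const_smul (a i)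
  have hSQ : ∀ᶠ p in 𝓝 p₀, S p ∈ fibE Q x₀ p := by
    filter_upwards [hJQ] with p hp
    rw [hp.2]
    exact Submodule.sum_mem _ fun i _ ↦ Submodule.smul_mem _ _ (Submodule.subset_span ⟨i, rfl⟩)
  have hnorm : ∑ i, a i * a i = 1 := hJ0.norm_of_sq hn (by rw [ha]; exact hA.2)
  have hSm := covE_mem hn hD hy hSd hSQ X
  have hE : B - fderiv ℝ S p₀ X ∈ fibE Q x₀ p₀ := by
    have h1 : covE (christoffel D x₀) p₀ A X B - covE (christoffel D x₀) p₀ (S p₀) X (fderiv ℝ S p₀ X) ∈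
      fibE Q x₀ p₀ := Submodule.sub_mem _ hw.1 hSm
    have hSp : S p₀ = A := ha
    rw [hSp, covE, covE, add_sub_add_right_eq_sub] at h1
    exact h1
  rw [hJs] at hE
  obtain ⟨b, hb⟩ := (Submodule.mem_span_range_iff_exists_fun ℝ).1 hE
  have hBA : B * A + A * B = 0 := by
    have := hw.2
    simp only [covE] at this
    rwa [covE_anticomm hA.2] at this
  have hSA : fderiv ℝ S p₀ X * A + A * fderiv ℝ S p₀ X = 0 := by
    have h2 : HasFDerivAt (fun p ↦ S p * S p) _ p₀ := hSd.hasFDerivAt.mul' hSd.hasFDerivAt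
    have h4 : (fun p ↦ S p * S p) =ᶠ[𝓝 p₀] fun _ ↦ -1 := by
      filter_upwards [hJQ] with p hp
      simp only [hS, hp.1.sq_sum a, hnorm]; simp
    have h3 := h2.unique ((hasFDerivAt_const _ _).congr_of_eventuallyEq h4)
    have h5 := congrArg (fun L ↦ L X) h3
    have hSp : S p₀ = A := ha
    simp only [hSp] at h5
    rw [add_comm]
    exact h5
  have hab : ∑ i, a i * b i = 0 := by
    have h1 := hJ0.anticomm b a
    rw [ha, hb, sub_mul, mul_sub] at h1
    have h2 : (-2 * ∑ i, b i * a i) • (1 : EndModel n) = 0 := by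
      rw [← h1]
      calc B * A - fderiv ℝ S p₀ X * A + (A * B - A * fderiv ℝ S p₀ X)
          = (B * A + A * B) - (fderiv ℝ S p₀ X * A + A * fderiv ℝ S p₀ X) := by abel
        _ = 0 := by rw [hBA, hSA, sub_zero]
    have h3 := congrArg (trE n) h2
    rw [map_smul, trE_one, map_zero, smul_eq_mul] at h3
    have hn' : (4 * n : ℝ) ≠ 0 := by positivity
    have h4 : ∑ i, b i * a i = 0 := by
      rcases mul_eq_zero.1 h3 with h | h
      · linarith
      · exact absurd h hn'
    rw [← h4]
    exact Finset.sum_congr rfl fun i _ ↦ mul_comm _ _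
  -- The components `b` of the vertical part of `w` are orthogonal to the components `a` of `A`: the curve rotates `a` in
  -- the direction `b`; dividing by the norm keeps it in the unit sphere without changing its velocity at `0`.
  set β : ℝ := ∑ i, b i * b i with hβ
  have hβ0 : 0 ≤ β := Finset.sum_nonneg fun i _ ↦ mul_self_nonneg _
  set r : ℝ → ℝ := fun t ↦ (√(1 + t ^ 2 * β))⁻¹ with hr
  set c₂ : ℝ → EndModel n := fun t ↦ r t • ∑ i, (a i + t * b i) • J (p₀ + t • X) i with hc₂
  have hpos : ∀ t : ℝ, 0 < 1 + t ^ 2 * β := fun t ↦ by positivity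
  have hrs : ContDiff ℝ ∞ r := by
    refine ContDiff.inv (ContDiff.sqrt (by fun_prop) fun t ↦ (hpos t).ne') fun t ↦ ?_
    exact (Real.sqrt_pos.2 (hpos t)).ne'
  have hl : ContDiff ℝ ∞ (fun t : ℝ ↦ p₀ + t • X) := by fun_prop
  have hl0 : p₀ + (0 : ℝ) • X = p₀ := by simp
  have hJl : ∀ i, ContDiffAt ℝ ∞ (fun t : ℝ ↦ J (p₀ + t • X) i) 0 := fun i ↦ by
    have h1 := (hJ i).self_of_nhds
    rw [← hl0] at h1
    exact h1.comp (0 : ℝ) hl.contDiffAt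
  have hc₂s : ContDiffAt ℝ ∞ c₂ 0 := by
    refine hrs.contDiffAt.smul (ContDiffAt.sum fun i _ ↦ ContDiffAt.smul
      (by fun_prop : ContDiff ℝ ∞ fun t : ℝ ↦ a i + t * b i).contDiffAt (hJl i))
  have hld : HasDerivAt (fun t : ℝ ↦ p₀ + t • X) X 0 := by
    simpa using ((hasDerivAt_id (0 : ℝ)).smul_const X).const_add p₀
  have hr0 : r 0 = 1 := by simp [hr]
  have hrd : HasDerivAt r 0 0 := by
    have h1 : HasDerivAt (fun t : ℝ ↦ 1 + t ^ 2 * β) 0 0 := by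
      have := ((hasDerivAt_pow 2 (0 : ℝ)).mul_const β).const_add 1
      simpa using this
    have h2 := (h1.sqrt (by simp)).inv (by simp)
    exact h2.congr_deriv (by simp)
  have hsum : HasDerivAt (fun t : ℝ ↦ ∑ i, (a i + t * b i) • J (p₀ + t • X) i) B 0 := by
    have h1 : ∀ i, HasDerivAt (fun t : ℝ ↦ (a i + t * b i) • J (p₀ + t • X) i)
        (a i • fderiv ℝ (fun p ↦ J p i) p₀ X + b i • J p₀ i) 0 := fun i ↦ by
      have h2 : HasDerivAt (fun t : ℝ ↦ a i + t * b i) (b i) 0 := by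
        simpa using ((hasDerivAt_id (0 : ℝ)).mul_const (b i)).const_add (a i)
      have h3 : HasDerivAt (fun t : ℝ ↦ J (p₀ + t • X) i) (fderiv ℝ (fun p ↦ J p i) p₀ X) 0 := by
        have h4 := hJd i
        rw [← hl0] at h4
        have := h4.hasFDerivAt.comp_hasDerivAt (0 : ℝ) hld
        rwa [hl0] at this
      exact (h2.smul h3).congr_deriv (by simp only [zero_mul, add_zero]; rw [hl0])
    have h5 := HasDerivAt.fun_sum (u := Finset.univ) fun i _ ↦ h1 i
    have h6 : ∑ i, (a i • fderiv ℝ (fun p ↦ J p i) p₀ X + b i • J p₀ i) = B := by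
      rw [Finset.sum_add_distrib, hb]
      have : fderiv ℝ S p₀ X = ∑ i, a i • fderiv ℝ (fun p ↦ J p i) p₀ X := by
        have h7 : HasFDerivAt S (∑ i, a i • fderiv ℝ (fun p ↦ J p i) p₀) p₀ :=
          HasFDerivAt.fun_sum fun i _ ↦ (hJd i).hasFDerivAt.const_smul (a i)
        rw [h7.fderiv]
        simp only [sum_apply, smul_apply]
      rw [this]; abel
    rwa [h6] at h5
  have hc₂d : HasDerivAt c₂ B 0 := by
    refine (hrd.smul hsum).congr_deriv ?_
    rw [hr0, one_smul]
    exact (congrArg _ (zero_smul ℝ (∑ i, (a i + 0 * b i) • J (p₀ + (0 : ℝ) • X) i))).trans (add_zero _)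
  refine ⟨fun t ↦ (p₀ + t • X, c₂ t), hl.contDiffAt.prodMk hc₂s, ?_, (hld.prodMk hc₂d).deriv, ?_⟩
  · have h1 : c₂ 0 = A := by
      simp only [hc₂, hr0, one_smul, zero_mul, add_zero, zero_smul]
      exact ha
    exact Prod.ext hl0 h1
  · have h1 : ∀ᶠ t in 𝓝 (0 : ℝ), QTriple (J (p₀ + t • X)) ∧
        fibE Q x₀ (p₀ + t • X) = Submodule.span ℝ (range (J (p₀ + t • X))) := by
      have hcont : ContinuousAt (fun t : ℝ ↦ p₀ + t • X) 0 := hld.continuousAt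
      rw [← hl0] at hJQ
      exact hcont.eventually hJQ
    filter_upwards [h1] with t ⟨ht1, ht2⟩
    refine ⟨?_, ?_⟩
    · simp only [ht2]
      exact Submodule.smul_mem _ _ (Submodule.sum_mem _ fun i _ ↦
        Submodule.smul_mem _ _ (Submodule.subset_span ⟨i, rfl⟩))
    · have hsq := ht1.sq_sum (fun i ↦ a i + t * b i)
      have h2 : ∑ i, (a i + t * b i) * (a i + t * b i) = 1 + t ^ 2 * β := by
        rw [hβ, ← hnorm]
        have : ∀ i, (a i + t * b i) * (a i + t * b i) = a i * a i + t ^ 2 * (b i * b i) + 2 * t * (a i * b i) :=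
          fun i ↦ by ring
        simp only [this, Finset.sum_add_distrib, ← Finset.mul_sum, hab]
        ring
      have h3 : r t * r t * -(1 + t ^ 2 * β) = -1 := by
        have h4 : √(1 + t ^ 2 * β) * √(1 + t ^ 2 * β) = 1 + t ^ 2 * β := Real.mul_self_sqrt (hpos t).le
        simp only [hr]
        rw [← mul_inv, h4, mul_neg, inv_mul_cancel₀ (hpos t).ne']
      rw [h2] at hsq
      exact smul_mul_smul_eq_neg_one hsq h3

/-- The tangent space of the twistor space, defined by velocities of curves, is given by `tanE` in every chart. -/
lemma mem_twistorTangent_iff (hn : 1 ≤ n) (hD : Q.IsQuaternionicConnection D) {x₀ : M} {z : EndTM n M}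
    (hz : z.1 ∈ dom n x₀) (hzQ : z ∈ Q.twistorSpace) (W : TangentSpace (endI n) z) :
    W ∈ Q.twistorTangent z ↔ vc x₀ z W ∈ tanE Q D x₀ (endCrd x₀ z) := by
  constructor
  · intro hW
    have : Q.twistorTangent z ≤ (tanE Q D x₀ (endCrd x₀ z)).comap (vc x₀ z).toLinearMap := by
      refine Submodule.span_le.2 ?_
      rintro W ⟨γ, hγ, hγQ, hW⟩
      obtain ⟨h0, hv⟩ := vc_of_isVelocity hz (hγ.mdifferentiableAt (by simp)) hW
      have hs := mem_endChart_source (x₀ := x₀) (z := z) |>.2 hz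
      have hmd : MDifferentiableAt 𝓘(ℝ, ℝ) 𝓘(ℝ, Model n × EndModel n) (fun t ↦ endCrd x₀ (γ t)) 0 := by
        rw [← h0] at hs
        exact (mdifferentiableAt_extChartAt hs).comp (0 : ℝ) (hγ.mdifferentiableAt (by simp))
      have h1 := curve_mem_tanE hn hD hz (c := fun t ↦ endCrd x₀ (γ t)) hmd.differentiableAt
        (by rw [h0, endCrd_eq hz]) (by
          have hopen : IsOpen {w : EndTM n M | w.1 ∈ dom n x₀} :=
            (chartAt (Model n) x₀).open_source.preimage (FiberBundle.continuous_proj (EndModel n) (EndT n M))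
          have h2 : ∀ᶠ t in 𝓝 0, (γ t).1 ∈ dom n x₀ :=
            hγ.continuousAt.eventually (hopen.mem_nhds (by rw [h0]; exact hz))
          filter_upwards [hγQ, h2] with t ht1 ht2
          exact (mem_twistorSpace_iff ht2).1 ht1)
      rw [h0, ← hv] at h1
      exact h1
    exact this hW
  · intro hW
    have hzt := (mem_twistorSpace_iff hz).1 hzQ
    rw [endCrd_eq hz] at hW hzt
    obtain ⟨c, hc, hc0, hcd, hcQ⟩ := exists_curve_of_mem_tanE hn hD hz hzt hW
    obtain ⟨h1, h2⟩ := isVelocity_of_coord hz hc (hc0.trans (endCrd_eq hz).symm) hcd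
    refine Submodule.subset_span ⟨_, h1, ?_, h2⟩
    have hzt' : c 0 ∈ (endCrd x₀).target := by
      rw [hc0, ← endCrd_eq hz]; exact (endCrd x₀).map_source (mem_endCrd_source.2 hz)
    have h3 := hc.continuousAt.eventually ((isOpen_extChartAt_target (I := endI n) _).mem_nhds hzt')
    filter_upwards [h3, hcQ] with t ht1 ht2
    have h4 := mem_endCrd_source.1 ((endCrd x₀).map_target ht1)
    rw [mem_twistorSpace_iff h4, (endCrd x₀).right_inv ht1]
    exact ht2

end

section
/-! ### The almost complex structure defined by a quaternionic connection -/

section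
variable {E : Type*} [NormedAddCommGroup E] [NormedSpace ℝ E]
  {H : Type*} [TopologicalSpace H] {I : ModelWithCorners ℝ E H}
  {N : Type*} [TopologicalSpace N] [ChartedSpace H N]

lemma tcoord_add (z y : N) (U V : TangentSpace I y) :
    tcoord I z y (U + V) = tcoord I z y U + tcoord I z y V := map_add _ _ _

lemma tcoord_neg (z y : N) (U : TangentSpace I y) : tcoord I z y (-U) = -tcoord I z y U := map_neg _ _


end

variable {n : ℕ} {M : Type*} [TopologicalSpace M] [ChartedSpace (Model n) M]
  [IsManifold (𝓡 (4 * n)) ∞ M]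


/-- The commutator `[Γ(X), A]`. -/
def adE (Γ : Model n → Model n →L[ℝ] Model n →L[ℝ] Model n) (p : Model n) (A : EndModel n)
    (X : Model n) : EndModel n := Γ p X * A - A * Γ p X

lemma covE_eq (Γ : Model n → Model n →L[ℝ] Model n →L[ℝ] Model n) (p : Model n) (A : EndModel n)
    (X : Model n) (B : EndModel n) : covE Γ p A X B = B + adE Γ p A X := rfl

lemma adE_add (Γ : Model n → Model n →L[ℝ] Model n →L[ℝ] Model n) (p : Model n) (A : EndModel n)
    (X Y : Model n) : adE Γ p A (X + Y) = adE Γ p A X + adE Γ p A Y := by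
  simp only [adE, map_add, add_mul, mul_add]; abel

lemma adE_smul (Γ : Model n → Model n →L[ℝ] Model n →L[ℝ] Model n) (p : Model n) (A : EndModel n)
    (c : ℝ) (X : Model n) : adE Γ p A (c • X) = c • adE Γ p A X := by
  simp only [adE, map_smul, endModel_mul_smul, endModel_smul_mul]; module

lemma adE_neg (Γ : Model n → Model n →L[ℝ] Model n →L[ℝ] Model n) (p : Model n) (A : EndModel n)
    (X : Model n) : adE Γ p A (-X) = -adE Γ p A X := by
  refine eq_neg_of_add_eq_zero_left ?_
  rw [← adE_add, neg_add_cancel]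
  simp [adE]

/-- The almost complex structure `I₁` in coordinates, at `q = (p, A)`: it multiplies the vertical
part of `(X, B)` by `A` and replaces `X` by `A X`. -/
def iE (Γ : Model n → Model n →L[ℝ] Model n →L[ℝ] Model n) (q : Model n × EndModel n) :
    Model n × EndModel n →ₗ[ℝ] Model n × EndModel n where
  toFun w := (q.2 w.1, q.2 * (w.2 + adE Γ q.1 q.2 w.1) - adE Γ q.1 q.2 (q.2 w.1))
  map_add' v w := by
    refine Prod.ext (map_add _ _ _) ?_
    simp only [Prod.fst_add, Prod.snd_add, map_add, adE_add, mul_add]; abel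
  map_smul' c w := by
    refine Prod.ext (map_smul q.2 c w.1) ?_
    simp only [Prod.smul_fst, Prod.smul_snd, map_smul, adE_smul, mul_add, endModel_mul_smul, RingHom.id_apply]
    module

lemma iE_apply (Γ : Model n → Model n →L[ℝ] Model n →L[ℝ] Model n) (q w : Model n × EndModel n) :
    iE Γ q w = (q.2 w.1, q.2 * (w.2 + adE Γ q.1 q.2 w.1) - adE Γ q.1 q.2 (q.2 w.1)) := rfl

/-- On vertical parts, `iE` is the multiplication by `A`. -/
lemma covE_iE (Γ : Model n → Model n →L[ℝ] Model n →L[ℝ] Model n) (q w : Model n × EndModel n) :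
    covE Γ q.1 q.2 (iE Γ q w).1 (iE Γ q w).2 = q.2 * covE Γ q.1 q.2 w.1 w.2 := by
  rw [covE_eq, covE_eq, iE_apply]; simp

lemma apply_apply_of_sq {A : EndModel n} (hA : A * A = -1) (X : Model n) : A (A X) = -X := by
  have := congrArg (fun L : EndModel n ↦ L X) hA
  exact this

lemma iE_iE (Γ : Model n → Model n →L[ℝ] Model n →L[ℝ] Model n) {q : Model n × EndModel n}
    (hq : q.2 * q.2 = -1) (w : Model n × EndModel n) : iE Γ q (iE Γ q w) = -w := by
  refine Prod.ext (apply_apply_of_sq hq w.1) ?_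
  have h : ∀ C : EndModel n, q.2 * (q.2 * C) = -C := fun C ↦ by rw [← mul_assoc, hq]; exact neg_one_mul C
  simp only [iE_apply, sub_add_cancel, h, apply_apply_of_sq hq, adE_neg, Prod.snd_neg]
  abel

lemma mul_sub_mul_mem {A : Type*} [Ring A] [Algebra ℝ A] {J : Fin 3 → A} (h : QTriple J) {B C : A}
    (hB : B ∈ Submodule.span ℝ (range J)) (hC : C ∈ Submodule.span ℝ (range J)) :
    B * C - C * B ∈ Submodule.span ℝ (range J) := by
  obtain ⟨x, rfl⟩ := (Submodule.mem_span_range_iff_exists_fun ℝ).1 hB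
  obtain ⟨y, rfl⟩ := (Submodule.mem_span_range_iff_exists_fun ℝ).1 hC
  have hm : ∀ a, J a ∈ Submodule.span ℝ (range J) := fun a ↦ Submodule.subset_span ⟨a, rfl⟩
  have : (∑ i, x i • J i) * (∑ i, y i • J i) - (∑ i, y i • J i) * (∑ i, x i • J i) =
      (2 * (x 1 * y 2 - x 2 * y 1)) • J 0 + (2 * (x 2 * y 0 - x 0 * y 2)) • J 1
        + (2 * (x 0 * y 1 - x 1 * y 0)) • J 2 := by
    simp only [Fin.sum_univ_three, add_mul, mul_add, smul_mul_smul_comm, h.sq, h.mul01, h.mul10, h.mul02,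
      h.mul20, h.mul12, h.mul21]
    module
  rw [this]
  exact Submodule.add_mem _ (Submodule.add_mem _ (Submodule.smul_mem _ _ (hm 0))
    (Submodule.smul_mem _ _ (hm 1))) (Submodule.smul_mem _ _ (hm 2))

/-- A product of anticommuting elements of `span(J₀,J₁,J₂)` lies in the span again. -/
lemma mul_mem_of_anticomm {A : Type*} [Ring A] [Algebra ℝ A] {J : Fin 3 → A} (h : QTriple J) {B C : A}
    (hB : B ∈ Submodule.span ℝ (range J)) (hC : C ∈ Submodule.span ℝ (range J)) (hBC : C * B + B * C = 0) :
    B * C ∈ Submodule.span ℝ (range J) := by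
  have h1 : B * C = (2⁻¹ : ℝ) • (B * C - C * B) := by
    rw [eq_neg_of_add_eq_zero_left hBC]
    module
  rw [h1]
  exact Submodule.smul_mem _ _ (mul_sub_mul_mem h hB hC)

lemma iE_mem_tanE {Q : AlmostQuaternionicStructure n M} {D : Connection n M} {x₀ y : M} (hy : y ∈ dom n x₀)
    {A : EndModel n} (hA : (crd n x₀ y, A) ∈ twZ Q x₀) {w : Model n × EndModel n}
    (hw : w ∈ tanE Q D x₀ (crd n x₀ y, A)) :
    iE (christoffel D x₀) (crd n x₀ y, A) w ∈ tanE Q D x₀ (crd n x₀ y, A) := by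
  obtain ⟨J, -, hJQ⟩ := exists_frame Q hy
  obtain ⟨hJ0, hJs⟩ := hJQ.self_of_nhds
  obtain ⟨h1, h2⟩ := hw
  obtain ⟨h3, h4⟩ := hA
  have key := covE_iE (christoffel D x₀) (crd n x₀ y, A) w
  simp only at h1 h2 h3 h4 key
  change covE _ _ _ _ _ ∈ fibE _ _ _ ∧ covE _ _ _ _ _ * A + A * covE _ _ _ _ _ = 0
  simp only
  rw [key]
  rw [hJs] at h1 h3 ⊢
  refine ⟨mul_mem_of_anticomm hJ0 h3 h1 h2, ?_⟩
  rw [mul_assoc, ← mul_add, h2, mul_zero]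

lemma vertical_mem_tanE {Q : AlmostQuaternionicStructure n M} {D : Connection n M} {x₀ : M}
    {q w : Model n × EndModel n} (hw : w ∈ tanE Q D x₀ q) :
    (0, covE (christoffel D x₀) q.1 q.2 w.1 w.2) ∈ tanE Q D x₀ q := by
  have h : covE (christoffel D x₀) q.1 q.2 0 (covE (christoffel D x₀) q.1 q.2 w.1 w.2) =
      covE (christoffel D x₀) q.1 q.2 w.1 w.2 := by
    rw [covE]; simp
  change covE _ _ _ _ _ ∈ fibE _ _ _ ∧ covE _ _ _ _ _ * _ + _ * covE _ _ _ _ _ = 0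
  simp only
  rw [h]
  exact hw

lemma horizontal_mem_tanE {Q : AlmostQuaternionicStructure n M} {D : Connection n M} {x₀ : M}
    (q : Model n × EndModel n) (X : Model n) :
    (X, -adE (christoffel D x₀) q.1 q.2 X) ∈ tanE Q D x₀ q := by
  have h : covE (christoffel D x₀) q.1 q.2 X (-adE (christoffel D x₀) q.1 q.2 X) = 0 := by
    rw [covE_eq]; simp
  change covE _ _ _ _ _ ∈ fibE _ _ _ ∧ covE _ _ _ _ _ * _ + _ * covE _ _ _ _ _ = 0
  simp only
  rw [h]
  exact ⟨Submodule.zero_mem _, by simp⟩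

lemma vertical_add_horizontal (Γ : Model n → Model n →L[ℝ] Model n →L[ℝ] Model n)
    (q w : Model n × EndModel n) : (0, covE Γ q.1 q.2 w.1 w.2) + (w.1, -adE Γ q.1 q.2 w.1) = w := by
  refine Prod.ext (by simp) ?_
  simp [covE_eq]

variable [T2Space M] [SigmaCompactSpace M] {Q : AlmostQuaternionicStructure n M} {D : Connection n M}

/-- The inverse of `vc x₀ z`, for `z` over the domain of the chart around `x₀`. -/
abbrev vcInv (x₀ : M) (z : EndTM n M) : Model n × EndModel n →L[ℝ] TangentSpace (endI n) z :=
  tcoordInv (endI n) (TotalSpace.mk' (EndModel n) x₀ 0 : EndTM n M) z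

lemma vc_vcInv {x₀ : M} {z : EndTM n M} (hz : z.1 ∈ dom n x₀) (w : Model n × EndModel n) :
    vc x₀ z (vcInv x₀ z w) = w := tcoord_tcoordInv (mem_endChart_source.2 hz) w

lemma vc_injective {x₀ : M} {z : EndTM n M} (hz : z.1 ∈ dom n x₀) : Function.Injective (vc (n := n) x₀ z) :=
  tcoord_injective (mem_endChart_source.2 hz)

set_option maxHeartbeats 1000000 in
lemma vc_apply_vertical {z : EndTM n M} {x₀ : M} (hz : z.1 ∈ dom n x₀)
    (T : Q.twistorTangent z →ₗ[ℝ] Q.twistorTangent z)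
    (hv : ∀ (A : EndT n M z.1) (W : Q.twistorTangent z),
      IsVerticalLift z A W.1 → IsVerticalLift z (z.2.comp A) (T W).1)
    (U : Q.twistorTangent z) (B : EndModel n) (hU : vc x₀ z U.1 = (0, B)) :
    vc x₀ z (T U).1 = (0, (endCrd x₀ z).2 * B) := by
  have h := hv (unhatE x₀ z.1 B) U ((isVerticalLift_iff hz _ _).2 (by rw [hU, hatE_unhatE hz]))
  rw [isVerticalLift_iff hz, hatE_comp hz, hatE_unhatE hz] at h
  rw [endCrd_eq hz]
  exact h

set_option maxHeartbeats 1000000 in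
lemma vc_apply_horizontal {z : EndTM n M} {x₀ : M} (hz : z.1 ∈ dom n x₀)
    (T : Q.twistorTangent z →ₗ[ℝ] Q.twistorTangent z)
    (hh : ∀ (X : TM n M z.1) (W : Q.twistorTangent z),
      IsHorizontalLift D z X W.1 → IsHorizontalLift D z (z.2 X) (T W).1)
    (U : Q.twistorTangent z) (X : Model n)
    (hU : vc x₀ z U.1 = (X, -adE (christoffel D x₀) (endCrd x₀ z).1 (endCrd x₀ z).2 X)) :
    vc x₀ z (T U).1 = ((endCrd x₀ z).2 X,
      -adE (christoffel D x₀) (endCrd x₀ z).1 (endCrd x₀ z).2 ((endCrd x₀ z).2 X)) := by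
  rw [endCrd_eq hz] at hU ⊢
  have h := hh (tcInv x₀ z.1 X) U ((isHorizontalLift_iff hz _ _).2 (by
    rw [hU, tcoord_tcoordInv hz]; rfl))
  rw [isHorizontalLift_iff hz, ← hatE_tc hz, tcoord_tcoordInv hz] at h
  exact h

lemma exists_vc_eq (hn : 1 ≤ n) (hD : Q.IsQuaternionicConnection D) {z : EndTM n M} (hzQ : z ∈ Q.twistorSpace)
    {x₀ : M} (hz : z.1 ∈ dom n x₀) {w : Model n × EndModel n} (hw : w ∈ tanE Q D x₀ (endCrd x₀ z)) :
    ∃ W : Q.twistorTangent z, vc x₀ z W.1 = w :=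
  ⟨⟨vcInv x₀ z w, (mem_twistorTangent_iff hn hD hz hzQ _).2 (by rw [vc_vcInv hz]; exact hw)⟩, vc_vcInv hz w⟩

set_option maxHeartbeats 1000000 in
/-- An endomorphism of `T_z Z` that acts as `I₁` on vertical vectors and on horizontal lifts is
given by `iE` in every chart. -/
lemma vc_eq_iE (hn : 1 ≤ n) (hD : Q.IsQuaternionicConnection D) {z : EndTM n M} (hzQ : z ∈ Q.twistorSpace)
    (T : Q.twistorTangent z →ₗ[ℝ] Q.twistorTangent z)
    (hv : ∀ (A : EndT n M z.1) (W : Q.twistorTangent z),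
      IsVerticalLift z A W.1 → IsVerticalLift z (z.2.comp A) (T W).1)
    (hh : ∀ (X : TM n M z.1) (W : Q.twistorTangent z),
      IsHorizontalLift D z X W.1 → IsHorizontalLift D z (z.2 X) (T W).1)
    {x₀ : M} (hz : z.1 ∈ dom n x₀) (W : Q.twistorTangent z) :
    vc x₀ z (T W).1 = iE (christoffel D x₀) (endCrd x₀ z) (vc x₀ z W.1) := by
  have hwt := (mem_twistorTangent_iff hn hD hz hzQ W.1).1 W.2
  obtain ⟨w, hw⟩ : ∃ w, w = vc x₀ z W.1 := ⟨_, rfl⟩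
  rw [← hw] at hwt ⊢
  obtain ⟨U₁, hU₁⟩ := exists_vc_eq hn hD hzQ hz (vertical_mem_tanE hwt)
  obtain ⟨U₂, hU₂⟩ := exists_vc_eq hn hD hzQ hz
    (horizontal_mem_tanE (Q := Q) (D := D) (x₀ := x₀) (endCrd x₀ z) w.1)
  have hW : W = U₁ + U₂ := by
    refine Subtype.ext (vc_injective hz (hw.symm.trans ?_))
    refine Eq.trans ?_ (tcoord_add _ z U₁.1 U₂.1).symm
    rw [hU₁, hU₂, vertical_add_horizontal]
  have h3 : vc x₀ z (T W).1 = vc x₀ z (T U₁).1 + vc x₀ z (T U₂).1 := by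
    rw [hW, map_add]; exact tcoord_add _ z _ _
  have h1 := vc_apply_vertical hz T hv U₁ _ hU₁
  have h2 := vc_apply_horizontal hz T hh U₂ w.1 hU₂
  rw [h3, h1, h2, iE_apply]
  exact Prod.ext (zero_add _) (sub_eq_add_neg _ _).symm

/-- Every almost complex structure of the form `I₁^∇` is given by `iE` in every chart. -/
lemma vc_isI₁ (hn : 1 ≤ n) (hD : Q.IsQuaternionicConnection D) {I : Q.TwistorAlmostComplexStructure}
    (hI : I.IsI₁ D) {z : EndTM n M} (hzQ : z ∈ Q.twistorSpace) {x₀ : M} (hz : z.1 ∈ dom n x₀)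
    (W : Q.twistorTangent z) :
    vc x₀ z (I.toEnd ⟨z, hzQ⟩ W).1 = iE (christoffel D x₀) (endCrd x₀ z) (vc x₀ z W.1) :=
  vc_eq_iE hn hD hzQ (I.toEnd ⟨z, hzQ⟩) (hI.vertical ⟨z, hzQ⟩) (hI.horizontal ⟨z, hzQ⟩) hz W

lemma vcInv_iE_mem (hn : 1 ≤ n) (hD : Q.IsQuaternionicConnection D) {z : EndTM n M} (hzQ : z ∈ Q.twistorSpace)
    {x₀ : M} (hz : z.1 ∈ dom n x₀) {W : TangentSpace (endI n) z} (hW : W ∈ Q.twistorTangent z) :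
    vcInv x₀ z (iE (christoffel D x₀) (endCrd x₀ z) (vc x₀ z W)) ∈ Q.twistorTangent z := by
  rw [mem_twistorTangent_iff hn hD hz hzQ, vc_vcInv hz]
  have h1 := (mem_twistorTangent_iff hn hD hz hzQ W).1 hW
  have h2 := (mem_twistorSpace_iff hz).1 hzQ
  rw [endCrd_eq hz] at h1 h2 ⊢
  exact iE_mem_tanE hz h2 h1

/-- The endomorphism `I₁^∇` of the tangent space of `Z` at `z`, defined in the chart around the base
point of `z`. -/
def twistorEnd (hn : 1 ≤ n) (hD : Q.IsQuaternionicConnection D) (z : Q.twistorSpace) :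
    Q.twistorTangent z.1 →ₗ[ℝ] Q.twistorTangent z.1 :=
  ((vcInv z.1.1 z.1).toLinearMap ∘ₗ iE (christoffel D z.1.1) (endCrd z.1.1 z.1) ∘ₗ
    (vc z.1.1 z.1).toLinearMap).restrict fun _ hW ↦ vcInv_iE_mem hn hD z.2 (mem_chart_source _ _) hW

lemma vc_twistorEnd_self (hn : 1 ≤ n) (hD : Q.IsQuaternionicConnection D) (z : Q.twistorSpace)
    (W : Q.twistorTangent z.1) : vc z.1.1 z.1 (twistorEnd hn hD z W).1 =
      iE (christoffel D z.1.1) (endCrd z.1.1 z.1) (vc z.1.1 z.1 W.1) :=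
  vc_vcInv (mem_chart_source _ _) _

lemma twistorEnd_vertical (hn : 1 ≤ n) (hD : Q.IsQuaternionicConnection D) (z : Q.twistorSpace)
    (A : EndT n M z.1.1) (W : Q.twistorTangent z.1) (h : IsVerticalLift z.1 A W.1) :
    IsVerticalLift z.1 (z.1.2.comp A) (twistorEnd hn hD z W).1 := by
  have hz : z.1.1 ∈ dom n z.1.1 := mem_chart_source _ _
  rw [isVerticalLift_iff hz] at h ⊢
  rw [vc_twistorEnd_self, h, iE_apply, hatE_comp hz, endCrd_eq hz]
  simp [adE]

lemma twistorEnd_horizontal (hn : 1 ≤ n) (hD : Q.IsQuaternionicConnection D) (z : Q.twistorSpace)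
    (X : TM n M z.1.1) (W : Q.twistorTangent z.1) (h : IsHorizontalLift D z.1 X W.1) :
    IsHorizontalLift D z.1 (z.1.2 X) (twistorEnd hn hD z W).1 := by
  have hz : z.1.1 ∈ dom n z.1.1 := mem_chart_source _ _
  rw [isHorizontalLift_iff hz] at h ⊢
  rw [vc_twistorEnd_self, h, iE_apply, ← hatE_tc hz, endCrd_eq hz]
  simp [adE]

lemma vc_twistorEnd (hn : 1 ≤ n) (hD : Q.IsQuaternionicConnection D) {z : EndTM n M} (hzQ : z ∈ Q.twistorSpace)
    {x₀ : M} (hz : z.1 ∈ dom n x₀) (W : Q.twistorTangent z) : vc x₀ z (twistorEnd hn hD ⟨z, hzQ⟩ W).1 =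
      iE (christoffel D x₀) (endCrd x₀ z) (vc x₀ z W.1) :=
  vc_eq_iE hn hD hzQ _ (twistorEnd_vertical hn hD ⟨z, hzQ⟩) (twistorEnd_horizontal hn hD ⟨z, hzQ⟩) hz W

lemma isOpen_over_dom (x₀ : M) : IsOpen {w : EndTM n M | w.1 ∈ dom n x₀} :=
  (chartAt (Model n) x₀).open_source.preimage (FiberBundle.continuous_proj (EndModel n) (EndT n M))

/-- The smooth field `iE` of endomorphisms maps smooth fields to smooth fields. -/
lemma contDiffAt_iE (hD : IsSmoothConnection D) {x₀ : M} {q : Model n × EndModel n}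
    (hq : q.1 ∈ (crd n x₀).target) {u : Model n × EndModel n → Model n × EndModel n} (hu : ContDiffAt ℝ ∞ u q) :
    ContDiffAt ℝ ∞ (fun q ↦ iE (christoffel D x₀) q (u q)) q := by
  have hΓ : ContDiffAt ℝ ∞ (fun q : Model n × EndModel n ↦ christoffel D x₀ q.1) q :=
    ((contDiffOn_christoffel hD x₀).contDiffAt (target_mem_nhds hq)).comp q contDiffAt_fst
  have hA : ContDiffAt ℝ ∞ (fun q : Model n × EndModel n ↦ q.2) q := contDiffAt_snd
  have had : ∀ X : Model n × EndModel n → Model n, ContDiffAt ℝ ∞ X q →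
      ContDiffAt ℝ ∞ (fun q ↦ adE (christoffel D x₀) q.1 q.2 (X q)) q := fun X hX ↦
    ((hΓ.clm_apply hX).mul hA).sub (hA.mul (hΓ.clm_apply hX))
  have hX : ContDiffAt ℝ ∞ (fun q ↦ (u q).1) q := contDiffAt_fst.comp q hu
  have hB : ContDiffAt ℝ ∞ (fun q ↦ (u q).2) q := contDiffAt_snd.comp q hu
  have hAX := hA.clm_apply hX
  exact hAX.prodMk ((hA.mul (hB.add (had _ hX))).sub (had _ hAX))

/-- The image of an ambient vector field under `iE`, in the chart around `x₀`. -/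
def iField (D : Connection n M) (x₀ : M) (U : ∀ y : EndTM n M, TangentSpace (endI n) y) (y : EndTM n M) :
    TangentSpace (endI n) y := vcInv x₀ y (iE (christoffel D x₀) (endCrd x₀ y) (vc x₀ y (U y)))

lemma vc_iField (D : Connection n M) {x₀ : M} (U : ∀ y : EndTM n M, TangentSpace (endI n) y) {y : EndTM n M}
    (hy : y.1 ∈ dom n x₀) :
    vc x₀ y (iField D x₀ U y) = iE (christoffel D x₀) (endCrd x₀ y) (vc x₀ y (U y)) := vc_vcInv hy _

lemma smoothAmbientVFAt_iff {x₀ : M} {z : EndTM n M} (hz : z.1 ∈ dom n x₀)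
    {U : ∀ y : EndTM n M, TangentSpace (endI n) y} : SmoothAmbientVFAt U z ↔
      ContDiffAt ℝ ∞ (vfCoord (endI n) (TotalSpace.mk' (EndModel n) x₀ 0 : EndTM n M) U) (endCrd x₀ z) :=
  contMDiffAt_vf_iff (mem_endChart_source.2 hz)

lemma endCrd_target_mem_nhds {x₀ : M} {z : EndTM n M} (hz : z.1 ∈ dom n x₀) :
    (endCrd x₀).target ∈ 𝓝 (endCrd x₀ z) :=
  extChartAt_target_mem_nhds' (I := endI n) ((endCrd x₀).map_source (mem_endCrd_source.2 hz))

lemma vfCoord_iField (D : Connection n M) {x₀ : M} (U : ∀ y : EndTM n M, TangentSpace (endI n) y)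
    {q : Model n × EndModel n} (hq : q ∈ (endCrd (n := n) x₀).target) :
    vfCoord (endI n) (TotalSpace.mk' (EndModel n) x₀ 0 : EndTM n M) (iField D x₀ U) q =
      iE (christoffel D x₀) q (vfCoord (endI n) (TotalSpace.mk' (EndModel n) x₀ 0 : EndTM n M) U q) := by
  have h := vc_iField D U (mem_endCrd_source.1 ((endCrd x₀).map_target hq))
  rw [(endCrd x₀).right_inv hq] at h
  exact h

/-- The field `iField D x₀ U` is again smooth and tangent to the twistor space. -/
lemma isTwistorVFAt_iField (hn : 1 ≤ n) (hD : Q.IsQuaternionicConnection D) {x₀ : M} {z : EndTM n M}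
    (hz : z.1 ∈ dom n x₀) {U : ∀ y : EndTM n M, TangentSpace (endI n) y} (hU : Q.IsTwistorVFAt U z) :
    Q.IsTwistorVFAt (iField D x₀ U) z := by
  refine ⟨?_, ?_⟩
  · have h1 := (smoothAmbientVFAt_iff hz).1 hU.1
    refine (smoothAmbientVFAt_iff hz).2 ?_
    have h2 : (endCrd x₀ z).1 ∈ (crd n x₀).target := by rw [endCrd_eq hz]; exact crd_mem_target hz
    refine (contDiffAt_iE hD.smooth h2 h1).congr_of_eventuallyEq ?_
    filter_upwards [endCrd_target_mem_nhds hz] with q hq using vfCoord_iField D U hq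
  · filter_upwards [hU.2, (isOpen_over_dom x₀).mem_nhds hz] with y hy hyd hyQ
      using vcInv_iE_mem hn hD hyQ hyd (hy hyQ)

/-- The almost complex structure `I₁^∇` on the twistor space. -/
def twistorACS (hn : 1 ≤ n) (hD : Q.IsQuaternionicConnection D) : Q.TwistorAlmostComplexStructure where
  toEnd := twistorEnd hn hD
  sq z W := by
    have hz : z.1.1 ∈ dom n z.1.1 := mem_chart_source _ _
    apply Subtype.ext
    apply vc_injective hz
    rw [vc_twistorEnd_self, vc_twistorEnd_self, iE_iE]
    · exact (tcoord_neg _ z.1 W.1).symm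
    · exact ((mem_twistorSpace_iff hz).1 z.2).2
  smooth z hzQ U hU := by
    refine ⟨iField D z.1 U, isTwistorVFAt_iField hn hD (mem_chart_source _ _) hU, ?_⟩
    filter_upwards [(isOpen_over_dom z.1).mem_nhds (mem_chart_source _ _)] with y hyd hyQ hyU
    apply vc_injective hyd
    exact (vc_iField D U hyd).trans (vc_twistorEnd hn hD hyQ hyd ⟨U y, hyU⟩).symm

lemma twistorACS_isI₁ (hn : 1 ≤ n) (hD : Q.IsQuaternionicConnection D) : (twistorACS hn hD).IsI₁ D :=
  ⟨twistorEnd_vertical hn hD, twistorEnd_horizontal hn hD⟩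

end

section
/-! ### The Nijenhuis tensor, torsion and curvature in coordinates -/

variable {n : ℕ} {M : Type*} [TopologicalSpace M] [ChartedSpace (Model n) M]
  [IsManifold (𝓡 (4 * n)) ∞ M]


section Calculus

variable {Γ : Model n → Model n →L[ℝ] Model n →L[ℝ] Model n}

/-- The derivative of the field `iE` of endomorphisms in the direction `v`, applied to `w`. -/
def dIE (Γ : Model n → Model n →L[ℝ] Model n →L[ℝ] Model n) (q v w : Model n × EndModel n) :
    Model n × EndModel n :=
  (v.2 w.1, v.2 * (w.2 + adE Γ q.1 q.2 w.1)
    + q.2 * ((fderiv ℝ Γ q.1 v.1 w.1 * q.2 - q.2 * fderiv ℝ Γ q.1 v.1 w.1)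
      + (Γ q.1 w.1 * v.2 - v.2 * Γ q.1 w.1))
    - ((fderiv ℝ Γ q.1 v.1 (q.2 w.1) * q.2 - q.2 * fderiv ℝ Γ q.1 v.1 (q.2 w.1))
      + (Γ q.1 (q.2 w.1) * v.2 - v.2 * Γ q.1 (q.2 w.1)) + adE Γ q.1 q.2 (v.2 w.1)))

set_option synthInstance.maxHeartbeats 200000 in
lemma hasDerivAt_adE {c : ℝ → Model n × EndModel n} {X : ℝ → Model n} {v : Model n × EndModel n} {X' : Model n}
    (hΓ : DifferentiableAt ℝ Γ (c 0).1) (hc : HasDerivAt c v 0) (hX : HasDerivAt X X' 0) :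
    HasDerivAt (fun t ↦ adE Γ (c t).1 (c t).2 (X t))
      ((fderiv ℝ Γ (c 0).1 v.1 (X 0) * (c 0).2 - (c 0).2 * fderiv ℝ Γ (c 0).1 v.1 (X 0))
        + (Γ (c 0).1 (X 0) * v.2 - v.2 * Γ (c 0).1 (X 0)) + adE Γ (c 0).1 (c 0).2 X') 0 := by
  have h1 : HasDerivAt (fun t ↦ (c t).1) v.1 0 :=
    (ContinuousLinearMap.fst ℝ (Model n) (EndModel n)).hasFDerivAt.comp_hasDerivAt (0 : ℝ) hc
  have h2 : HasDerivAt (fun t ↦ (c t).2) v.2 0 :=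
    (ContinuousLinearMap.snd ℝ (Model n) (EndModel n)).hasFDerivAt.comp_hasDerivAt (0 : ℝ) hc
  have h3 : HasDerivAt (fun t ↦ Γ (c t).1) (fderiv ℝ Γ (c 0).1 v.1) 0 :=
    HasFDerivAt.comp_hasDerivAt (l := Γ) (l' := fderiv ℝ Γ (c 0).1) (0 : ℝ) hΓ.hasFDerivAt h1
  have h4 : HasDerivAt (fun t ↦ Γ (c t).1 (X t)) (fderiv ℝ Γ (c 0).1 v.1 (X 0) + Γ (c 0).1 X') 0 :=
    h3.clm_apply hX
  have h5 := (h4.fun_mul h2).fun_sub (h2.fun_mul h4)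
  refine h5.congr_deriv ?_
  rw [add_mul, mul_add, adE]
  abel

lemma hasDerivAt_iE {c u : ℝ → Model n × EndModel n} {v u' : Model n × EndModel n}
    (hΓ : DifferentiableAt ℝ Γ (c 0).1) (hc : HasDerivAt c v 0) (hu : HasDerivAt u u' 0) :
    HasDerivAt (fun t ↦ iE Γ (c t) (u t)) (dIE Γ (c 0) v (u 0) + iE Γ (c 0) u') 0 := by
  have h2 : HasDerivAt (fun t ↦ (c t).2) v.2 0 :=
    (ContinuousLinearMap.snd ℝ (Model n) (EndModel n)).hasFDerivAt.comp_hasDerivAt (0 : ℝ) hc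
  have hX : HasDerivAt (fun t ↦ (u t).1) u'.1 0 :=
    (ContinuousLinearMap.fst ℝ (Model n) (EndModel n)).hasFDerivAt.comp_hasDerivAt (0 : ℝ) hu
  have hB : HasDerivAt (fun t ↦ (u t).2) u'.2 0 :=
    (ContinuousLinearMap.snd ℝ (Model n) (EndModel n)).hasFDerivAt.comp_hasDerivAt (0 : ℝ) hu
  have hAX : HasDerivAt (fun t ↦ (c t).2 (u t).1) (v.2 (u 0).1 + (c 0).2 u'.1) 0 := h2.clm_apply hX
  have h := hAX.prodMk ((h2.fun_mul (hB.fun_add (hasDerivAt_adE hΓ hc hX))).fun_sub (hasDerivAt_adE hΓ hc hAX))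
  refine h.congr_deriv ?_
  refine Prod.ext rfl ?_
  simp only [dIE, iE_apply, Prod.snd_add, adE_add, mul_add]
  abel

/-- The Nijenhuis tensor of the field `iE` of endomorphisms at `q`, in terms of the derivative `dIE` of this field. -/
def nijE (Γ : Model n → Model n →L[ℝ] Model n →L[ℝ] Model n) (q v w : Model n × EndModel n) :
    Model n × EndModel n :=
  dIE Γ q (iE Γ q v) w - dIE Γ q (iE Γ q w) v + iE Γ q (dIE Γ q w v - dIE Γ q v w)

/-- The torsion in coordinates. -/
def torE (Γ : Model n → Model n →L[ℝ] Model n →L[ℝ] Model n) (p X Y : Model n) : Model n :=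
  Γ p X Y - Γ p Y X

/-- The component of the torsion that obstructs the integrability of `I₁` at `(p, A)`: the part of `T` of type `(0, 2)` with
respect to `A`, up to a constant. -/
def tE (Γ : Model n → Model n →L[ℝ] Model n →L[ℝ] Model n) (p : Model n) (A : EndModel n) (X Y : Model n) :
    Model n :=
  torE Γ p (A X) (A Y) - torE Γ p X Y - A (torE Γ p (A X) Y) - A (torE Γ p X (A Y))

/-- The curvature in coordinates. -/
def curE (Γ : Model n → Model n →L[ℝ] Model n →L[ℝ] Model n) (p X Y : Model n) : EndModel n :=
  fderiv ℝ Γ p X Y - fderiv ℝ Γ p Y X + (Γ p X * Γ p Y - Γ p Y * Γ p X)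

/-- The component of the curvature that obstructs the integrability of `I₁` at `(p, A)`: the part of the vertical-valued
two-form `[R, A]` of type `(0, 2)`, up to a constant. -/
def eE (Γ : Model n → Model n →L[ℝ] Model n →L[ℝ] Model n) (p : Model n) (A : EndModel n) (X Y : Model n) :
    EndModel n :=
  (curE Γ p X Y * A - A * curE Γ p X Y) - (curE Γ p (A X) (A Y) * A - A * curE Γ p (A X) (A Y))
    + A * ((curE Γ p (A X) Y * A - A * curE Γ p (A X) Y) + (curE Γ p X (A Y) * A - A * curE Γ p X (A Y)))

/-- The horizontal part of the Nijenhuis tensor is given by the torsion. -/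
lemma nijE_fst {q : Model n × EndModel n} (hq : q.2 * q.2 = -1) (v w : Model n × EndModel n) :
    (nijE Γ q v w).1 = -tE Γ q.1 q.2 v.1 w.1 := by
  obtain ⟨p, A⟩ := q
  obtain ⟨X, B⟩ := v
  obtain ⟨Y, C⟩ := w
  simp only at hq ⊢
  have hA := apply_apply_of_sq hq
  change (A * (B + adE Γ p A X) - adE Γ p A (A X)) Y - (A * (C + adE Γ p A Y) - adE Γ p A (A Y)) X
    + A (C X - B Y) = _
  simp only [tE, torE, adE, sub_apply, add_apply, mul_apply_eq_comp, map_sub, map_add, hA]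
  abel

/-- The ring identity behind `covE_nijE`: `g` stands for values of `Γ`, `d` for derivatives of `Γ`, and `b`, `c` for the
vertical parts of the two vectors, which cancel. -/
lemma covE_nijE_ring {R : Type*} [Ring R] {A : R} (hA : A * A = -1)
    (gX gY gAX gAY b c dXY dXAY dAXY dAXAY dYX dYAX dAYX dAYAX : R) :
    ((A * b - (gAX * A - A * gAX)) * c
      + A * ((dAXY * A - A * dAXY) + (gY * (A * b - (gAX * A - A * gAX)) - (A * b - (gAX * A - A * gAX)) * gY))
      - ((dAXAY * A - A * dAXAY) + (gAY * (A * b - (gAX * A - A * gAX)) - (A * b - (gAX * A - A * gAX)) * gAY)))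
    - ((A * c - (gAY * A - A * gAY)) * b
      + A * ((dAYX * A - A * dAYX) + (gX * (A * c - (gAY * A - A * gAY)) - (A * c - (gAY * A - A * gAY)) * gX))
      - ((dAYAX * A - A * dAYAX) + (gAX * (A * c - (gAY * A - A * gAY)) - (A * c - (gAY * A - A * gAY)) * gAX)))
    + A * (((c - (gY * A - A * gY)) * b
      + A * ((dYX * A - A * dYX) + (gX * (c - (gY * A - A * gY)) - (c - (gY * A - A * gY)) * gX))
      - ((dYAX * A - A * dYAX) + (gAX * (c - (gY * A - A * gY)) - (c - (gY * A - A * gY)) * gAX)))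
    - ((b - (gX * A - A * gX)) * c
      + A * ((dXY * A - A * dXY) + (gY * (b - (gX * A - A * gX)) - (b - (gX * A - A * gX)) * gY))
      - ((dXAY * A - A * dXAY) + (gAY * (b - (gX * A - A * gX)) - (b - (gX * A - A * gX)) * gAY))))
    = ((dXY - dYX + (gX * gY - gY * gX)) * A - A * (dXY - dYX + (gX * gY - gY * gX)))
      - ((dAXAY - dAYAX + (gAX * gAY - gAY * gAX)) * A - A * (dAXAY - dAYAX + (gAX * gAY - gAY * gAX)))
      + A * (((dAXY - dYAX + (gAX * gY - gY * gAX)) * A - A * (dAXY - dYAX + (gAX * gY - gY * gAX)))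
        + ((dXAY - dAYX + (gX * gAY - gAY * gX)) * A - A * (dXAY - dAYX + (gX * gAY - gAY * gX)))) := by
  have h1 : ∀ x, A * (A * x) = -x := fun x ↦ by rw [← mul_assoc, hA, neg_one_mul]
  simp only [mul_add, mul_sub, add_mul, sub_mul, mul_assoc, h1, mul_neg]
  abel

/-- The vertical part of the Nijenhuis tensor is given by the curvature. -/
lemma covE_nijE {q : Model n × EndModel n} (hq : q.2 * q.2 = -1) (v w : Model n × EndModel n) :
    covE Γ q.1 q.2 (nijE Γ q v w).1 (nijE Γ q v w).2 = eE Γ q.1 q.2 v.1 w.1 := by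
  obtain ⟨p, A⟩ := q
  obtain ⟨X, B⟩ := v
  obtain ⟨Y, C⟩ := w
  simp only at hq ⊢
  obtain ⟨b, hb⟩ : ∃ b, B = b - (Γ p X * A - A * Γ p X) := ⟨B + (Γ p X * A - A * Γ p X), by abel⟩
  obtain ⟨c, hc⟩ : ∃ c, C = c - (Γ p Y * A - A * Γ p Y) := ⟨C + (Γ p Y * A - A * Γ p Y), by abel⟩
  have h := covE_nijE_ring hq (Γ p X) (Γ p Y) (Γ p (A X)) (Γ p (A Y)) b c (fderiv ℝ Γ p X Y)
    (fderiv ℝ Γ p X (A Y)) (fderiv ℝ Γ p (A X) Y) (fderiv ℝ Γ p (A X) (A Y)) (fderiv ℝ Γ p Y X)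
    (fderiv ℝ Γ p Y (A X)) (fderiv ℝ Γ p (A Y) X) (fderiv ℝ Γ p (A Y) (A X))
  rw [eE, curE, curE, curE, curE, ← h, covE_eq]
  have hsub : ∀ X Y : Model n, adE Γ p A (X - Y) = adE Γ p A X - adE Γ p A Y := fun X Y ↦ by
    rw [sub_eq_add_neg, adE_add, adE_neg, ← sub_eq_add_neg]
  have e1 : B + adE Γ p A X = b := by rw [hb, adE]; abel
  have e2 : C + adE Γ p A Y = c := by rw [hc, adE]; abel
  have e3 : (nijE Γ (p, A) (X, B) (Y, C)).2 = (dIE Γ (p, A) (iE Γ (p, A) (X, B)) (Y, C)).2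
      - (dIE Γ (p, A) (iE Γ (p, A) (Y, C)) (X, B)).2
      + (A * ((dIE Γ (p, A) (Y, C) (X, B)).2 - (dIE Γ (p, A) (X, B) (Y, C)).2
        + adE Γ p A (C X - B Y)) - adE Γ p A (A (C X - B Y))) := rfl
  have e4 : (nijE Γ (p, A) (X, B) (Y, C)).1 = (A * (B + adE Γ p A X) - adE Γ p A (A X)) Y
    - (A * (C + adE Γ p A Y) - adE Γ p A (A Y)) X + A (C X - B Y) := rfl
  rw [e3, e4]
  simp only [dIE, iE_apply, adE_add, hsub, map_sub, e1, e2, ← hb, ← hc]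
  have e5 : ∀ X, adE Γ p A X = Γ p X * A - A * Γ p X := fun _ ↦ rfl
  rw [e5 (A X), e5 (A Y)]
  simp only [mul_add, mul_sub]
  abel

lemma nijE_eq_zero_iff {q : Model n × EndModel n} (hq : q.2 * q.2 = -1) (v w : Model n × EndModel n) :
    nijE Γ q v w = 0 ↔ tE Γ q.1 q.2 v.1 w.1 = 0 ∧ eE Γ q.1 q.2 v.1 w.1 = 0 := by
  have h1 := nijE_fst (Γ := Γ) hq v w
  have h2 := covE_nijE (Γ := Γ) hq v w
  rw [← h2, ← neg_eq_zero (a := tE Γ q.1 q.2 v.1 w.1), ← h1]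
  constructor
  · intro h
    rw [h]
    exact ⟨rfl, by simp [covE]⟩
  · rintro ⟨h3, h4⟩
    rw [h3] at h4
    simp only [covE, map_zero, zero_mul, mul_zero, sub_zero, add_zero] at h4
    exact Prod.ext h3 h4

end Calculus

end

section
/-! ### Brackets of vector fields on the twistor space -/

variable {n : ℕ} {M : Type*} [TopologicalSpace M] [ChartedSpace (Model n) M]
  [IsManifold (𝓡 (4 * n)) ∞ M]


/-- If `u` and `w` annihilate the functions `F u` and `F w` at a point, then `[u, w] F = u (w F) - w (u F)` vanishes
there. -/
lemma fderiv_lieBracket_eq_zero {E G : Type*} [NormedAddCommGroup E] [NormedSpace ℝ E] [NormedAddCommGroup G]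
    [NormedSpace ℝ G] {F : E → G} {u w : E → E} {q : E} (hF : ContDiffAt ℝ 2 F q)
    (hu : DifferentiableAt ℝ u q) (hw : DifferentiableAt ℝ w q)
    (h1 : fderiv ℝ (fun x ↦ fderiv ℝ F x (u x)) q (w q) = 0)
    (h2 : fderiv ℝ (fun x ↦ fderiv ℝ F x (w x)) q (u q) = 0) :
    fderiv ℝ F q (VectorField.lieBracket ℝ u w q) = 0 := by
  have hd : DifferentiableAt ℝ (fderiv ℝ F) q :=
    (hF.fderiv_right (m := 1) (by norm_num)).differentiableAt (by norm_num)
  have hs := hF.isSymmSndFDerivAt (by simp) (u q) (w q)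
  rw [fderiv_clm_apply hd hu] at h1
  rw [fderiv_clm_apply hd hw] at h2
  simp only [add_apply, ContinuousLinearMap.comp_apply, ContinuousLinearMap.flip_apply] at h1 h2
  rw [VectorField.lieBracket, map_sub, eq_neg_of_add_eq_zero_left h1, eq_neg_of_add_eq_zero_left h2, hs]
  abel

variable [T2Space M] [SigmaCompactSpace M] {Q : AlmostQuaternionicStructure n M} {D : Connection n M}

/-- Tangent vectors of the twistor space are velocities of curves, stated in terms of points of the chart. -/
lemma exists_curve (hn : 1 ≤ n) (hD : Q.IsQuaternionicConnection D) {x₀ : M} {q : Model n × EndModel n}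
    (hq : q.1 ∈ (crd n x₀).target) (hqZ : q ∈ twZ Q x₀) {v : Model n × EndModel n} (hv : v ∈ tanE Q D x₀ q) :
    ∃ c : ℝ → Model n × EndModel n, HasDerivAt c v 0 ∧ c 0 = q ∧ ∀ᶠ t in 𝓝 0, c t ∈ twZ Q x₀ := by
  have hp' : (crd n x₀).symm q.1 ∈ dom n x₀ := by simpa using (crd n x₀).map_target hq
  have hpp : crd n x₀ ((crd n x₀).symm q.1) = q.1 := (crd n x₀).right_inv hq
  have hqq : q = (crd n x₀ ((crd n x₀).symm q.1), q.2) := by rw [hpp]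
  rw [hqq] at hqZ hv
  obtain ⟨c, hc, h0, hd, hc'⟩ := exists_curve_of_mem_tanE hn hD hp' hqZ hv
  refine ⟨c, ?_, by rw [h0, ← hqq], hc'⟩
  rw [← hd]
  exact (hc.differentiableAt (by simp)).hasDerivAt

/-- Functions that agree on the twistor space have the same derivative in its tangent directions. -/
lemma fderiv_eq_of_eq_on_twZ {G : Type*} [NormedAddCommGroup G] [NormedSpace ℝ G] (hn : 1 ≤ n)
    (hD : Q.IsQuaternionicConnection D) {x₀ : M} {q : Model n × EndModel n}
    (hq : q.1 ∈ (crd n x₀).target) (hqZ : q ∈ twZ Q x₀) {F : Model n × EndModel n → G} {k : G}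
    (hF : DifferentiableAt ℝ F q) (hFk : ∀ᶠ y in 𝓝 q, y ∈ twZ Q x₀ → F y = k)
    {v : Model n × EndModel n} (hv : v ∈ tanE Q D x₀ q) : fderiv ℝ F q v = 0 := by
  obtain ⟨c, hc, h0, hcZ⟩ := exists_curve hn hD hq hqZ hv
  rw [← h0] at hF hFk ⊢
  have h1 : HasDerivAt (fun t ↦ F (c t)) (fderiv ℝ F (c 0) v) 0 :=
    HasFDerivAt.comp_hasDerivAt (l := F) (l' := fderiv ℝ F (c 0)) (0 : ℝ) hF.hasFDerivAt hc
  have h2 : (fun t ↦ F (c t)) =ᶠ[𝓝 0] fun _ ↦ k := by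
    filter_upwards [hc.continuousAt.eventually hFk, hcZ] with t h3 h4 using h3 h4
  exact h1.unique ((hasDerivAt_const _ _).congr_of_eventuallyEq h2)

/-- The bracket of vector fields that are tangent to the twistor space annihilates the functions
that are constant on the twistor space. -/
lemma fderiv_lieBracket_of_eq_on_twZ {G : Type*} [NormedAddCommGroup G] [NormedSpace ℝ G] (hn : 1 ≤ n)
    (hD : Q.IsQuaternionicConnection D) {x₀ : M} {q : Model n × EndModel n}
    (hq : q.1 ∈ (crd n x₀).target) (hqZ : q ∈ twZ Q x₀) {F : Model n × EndModel n → G} {k : G}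
    (hF : ContDiffAt ℝ 2 F q) (hFk : ∀ᶠ y in 𝓝 q, y ∈ twZ Q x₀ → F y = k)
    {u w : Model n × EndModel n → Model n × EndModel n} (hu : DifferentiableAt ℝ u q)
    (hw : DifferentiableAt ℝ w q) (huT : ∀ᶠ y in 𝓝 q, y ∈ twZ Q x₀ → u y ∈ tanE Q D x₀ y)
    (hwT : ∀ᶠ y in 𝓝 q, y ∈ twZ Q x₀ → w y ∈ tanE Q D x₀ y) :
    fderiv ℝ F q (VectorField.lieBracket ℝ u w q) = 0 := by
  have hd : DifferentiableAt ℝ (fderiv ℝ F) q :=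
    (hF.fderiv_right (m := 1) (by norm_num)).differentiableAt (by norm_num)
  have hopen : ∀ᶠ y in 𝓝 q, y.1 ∈ (crd n x₀).target :=
    continuousAt_fst.eventually (target_mem_nhds hq)
  have key : ∀ u : Model n × EndModel n → Model n × EndModel n,
      (∀ᶠ y in 𝓝 q, y ∈ twZ Q x₀ → u y ∈ tanE Q D x₀ y) →
      ∀ᶠ y in 𝓝 q, y ∈ twZ Q x₀ → fderiv ℝ F y (u y) = 0 := fun u huT ↦ by
    filter_upwards [hopen, huT, hFk.eventually_nhds, hF.eventually (by simp)] with y h1 h2 h3 h4 h5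
    exact fderiv_eq_of_eq_on_twZ hn hD h1 h5 (h4.differentiableAt (by norm_num)) h3 (h2 h5)
  refine fderiv_lieBracket_eq_zero hF hu hw ?_ ?_
  · exact fderiv_eq_of_eq_on_twZ hn hD hq hqZ (hd.clm_apply hu) (key u huT) (hwT.self_of_nhds hqZ)
  · exact fderiv_eq_of_eq_on_twZ hn hD hq hqZ (hd.clm_apply hw) (key w hwT) (huT.self_of_nhds hqZ)

/-- The defining equation `A ∈ 𝒬_p` of the twistor space, for a local frame `J` of `𝒬`. -/
def defEq (J : Model n → Fin 3 → EndModel n) (q : Model n × EndModel n) : EndModel n :=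
  q.2 - ∑ a, coef (J q.1) a q.2 • J q.1 a

lemma contDiffAt_defEq {J : Model n → Fin 3 → EndModel n} {q : Model n × EndModel n}
    (hJ : ∀ a, ContDiffAt ℝ ∞ (fun p ↦ J p a) q.1) : ContDiffAt ℝ ∞ (defEq J) q := by
  have h : ∀ a, ContDiffAt ℝ ∞ (fun q : Model n × EndModel n ↦ J q.1 a) q :=
    fun a ↦ (hJ a).comp q contDiffAt_fst
  exact contDiffAt_snd.sub (ContDiffAt.sum fun a _ ↦ (contDiffAt_coef a (h a) contDiffAt_snd).smul (h a))

lemma defEq_eq_zero (hn : 1 ≤ n) {J : Model n → Fin 3 → EndModel n} {p : Model n} (hJ : QTriple (J p))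
    {A : EndModel n} (hA : A ∈ Submodule.span ℝ (range (J p))) : defEq J (p, A) = 0 := by
  rw [defEq, hJ.sum_coef hn hA, sub_self]

lemma coef_add (J : Fin 3 → EndModel n) (a : Fin 3) (A B : EndModel n) :
    coef J a (A + B) = coef J a A + coef J a B := by
  simp only [coef, mul_add, map_add]

lemma coef_smul (J : Fin 3 → EndModel n) (a : Fin 3) (c : ℝ) (B : EndModel n) :
    coef J a (c • B) = c * coef J a B := by
  simp only [coef, endModel_mul_smul, map_smul, smul_eq_mul]
  ring

lemma sub_sum_add_mul_smul {V : Type*} [AddCommGroup V] [Module ℝ V] (A C : V) (t : ℝ) (x y : Fin 3 → ℝ)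
    (v : Fin 3 → V) : A + t • C - ∑ i, (x i + t * y i) • v i =
      A - ∑ i, x i • v i + t • (C - ∑ i, y i • v i) := by
  simp only [Fin.sum_univ_three]
  module

/-- Vectors that are annihilated by the derivatives of the defining equations are tangent to the
twistor space. -/
lemma mem_tanE_of_fderiv_eq_zero (hn : 1 ≤ n) (hD : Q.IsQuaternionicConnection D) {x₀ y : M} (hy : y ∈ dom n x₀)
    {J : Model n → Fin 3 → EndModel n} (hJ : ∀ a, ContDiffAt ℝ ∞ (fun p ↦ J p a) (crd n x₀ y))
    (hJQ : ∀ᶠ p in 𝓝 (crd n x₀ y), QTriple (J p) ∧ fibE Q x₀ p = Submodule.span ℝ (range (J p)))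
    {A : EndModel n} (hA : (crd n x₀ y, A) ∈ twZ Q x₀) {w : Model n × EndModel n}
    (h1 : fderiv ℝ (defEq J) (crd n x₀ y, A) w = 0) (h2 : w.2 * A + A * w.2 = 0) :
    w ∈ tanE Q D x₀ (crd n x₀ y, A) := by
  obtain ⟨hJ0, hJs⟩ := hJQ.self_of_nhds
  obtain ⟨X, B⟩ := w
  have hAm := hA.1
  simp only [hJs] at hAm
  obtain ⟨a, ha⟩ := (Submodule.mem_span_range_iff_exists_fun ℝ).1 hAm
  have hJd : ∀ i, DifferentiableAt ℝ (fun p ↦ J p i) (crd n x₀ y) := fun i ↦ (hJ i).differentiableAt (by simp)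
  obtain ⟨S, hS⟩ : ∃ S : Model n → EndModel n, S = fun p ↦ ∑ i, a i • J p i := ⟨_, rfl⟩
  have hSd : DifferentiableAt ℝ S (crd n x₀ y) := by
    rw [hS]; exact DifferentiableAt.fun_sum fun i _ ↦ (hJd i).const_smul (a i)
  have hSp : ∀ p, S p ∈ Submodule.span ℝ (range (J p)) := fun p ↦ by
    rw [hS]
    exact Submodule.sum_mem _ fun i _ ↦ Submodule.smul_mem _ _ (Submodule.subset_span ⟨i, rfl⟩)
  have hSA : S (crd n x₀ y) = A := by rw [hS]; exact ha
  have hSm := covE_mem hn hD hy hSd (by filter_upwards [hJQ] with p hp; rw [hp.2]; exact hSp p) X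
  rw [hSA] at hSm
  have hFd : DifferentiableAt ℝ (defEq J) (crd n x₀ y, A) :=
    (contDiffAt_defEq (q := (crd n x₀ y, A)) hJ).differentiableAt (by simp)
  -- The section `S` of `𝒬` solves the equation.
  have h3 : fderiv ℝ (defEq J) (crd n x₀ y, A) (X, fderiv ℝ S (crd n x₀ y) X) = 0 := by
    have e1 : HasFDerivAt (fun p ↦ (p, S p)) ((ContinuousLinearMap.id ℝ (Model n)).prod
        (fderiv ℝ S (crd n x₀ y))) (crd n x₀ y) := (hasFDerivAt_id _).prodMk hSd.hasFDerivAt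
    have e2 : HasFDerivAt (fun p ↦ defEq J (p, S p)) _ (crd n x₀ y) :=
      HasFDerivAt.comp (g := defEq J) (g' := fderiv ℝ (defEq J) (crd n x₀ y, A)) (crd n x₀ y)
        (by rw [← hSA] at hFd ⊢; exact hFd.hasFDerivAt) e1
    have e3 : (fun p ↦ defEq J (p, S p)) =ᶠ[𝓝 (crd n x₀ y)] fun _ ↦ 0 := by
      filter_upwards [hJQ] with p hp using defEq_eq_zero hn hp.1 (hSp p)
    have e4 := e2.unique ((hasFDerivAt_const _ _).congr_of_eventuallyEq e3)
    exact congrArg (fun L : Model n →L[ℝ] EndModel n ↦ L X) e4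
  -- On the fibre the equation is linear, with kernel `𝒬`.
  obtain ⟨C, hC⟩ : ∃ C, C = B - fderiv ℝ S (crd n x₀ y) X := ⟨_, rfl⟩
  have h4 : fderiv ℝ (defEq J) (crd n x₀ y, A) (0, C) = 0 := by
    have : ((0 : Model n), C) = (X, B) - (X, fderiv ℝ S (crd n x₀ y) X) := by
      rw [Prod.mk_sub_mk, sub_self, hC]
    rw [this, map_sub, h1, h3, sub_zero]
  have h5 : C = ∑ i, coef (J (crd n x₀ y)) i C • J (crd n x₀ y) i := by
    have e0 : A + (0 : ℝ) • C = A := by rw [zero_smul ℝ C, add_zero]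
    have e1 : HasDerivAt (fun t : ℝ ↦ A + t • C) C 0 := by
      simpa using ((hasDerivAt_id (0 : ℝ)).smul_const C).const_add A
    have e2 : HasDerivAt (fun t : ℝ ↦ (crd n x₀ y, A + t • C)) (0, C) 0 := (hasDerivAt_const _ _).prodMk e1
    have e3 : HasDerivAt (fun t : ℝ ↦ defEq J (crd n x₀ y, A + t • C)) 0 0 := by
      rw [← h4]
      exact HasFDerivAt.comp_hasDerivAt (l := defEq J) (l' := fderiv ℝ (defEq J) (crd n x₀ y, A)) (0 : ℝ)
        (show HasFDerivAt _ _ (crd n x₀ y, A + (0 : ℝ) • C) by rw [e0]; exact hFd.hasFDerivAt) e2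
    have e4 : (fun t : ℝ ↦ defEq J (crd n x₀ y, A + t • C)) =
        fun t ↦ defEq J (crd n x₀ y, A) + t • (C - ∑ i, coef (J (crd n x₀ y)) i C • J (crd n x₀ y) i) := by
      ext1 t
      simp only [defEq, coef_add, coef_smul]
      exact sub_sum_add_mul_smul A C t _ _ _
    have e5 : HasDerivAt (fun t : ℝ ↦ defEq J (crd n x₀ y, A + t • C))
        (C - ∑ i, coef (J (crd n x₀ y)) i C • J (crd n x₀ y) i) 0 := by
      rw [e4]
      simpa using ((hasDerivAt_id (0 : ℝ)).smul_const
        (C - ∑ i, coef (J (crd n x₀ y)) i C • J (crd n x₀ y) i)).const_add (defEq J (crd n x₀ y, A))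
    exact sub_eq_zero.1 (e5.unique e3)
  have h6 : C ∈ fibE Q x₀ (crd n x₀ y) := by
    rw [h5, hJs]
    exact Submodule.sum_mem _ fun i _ ↦ Submodule.smul_mem _ _ (Submodule.subset_span ⟨i, rfl⟩)
  refine ⟨?_, ?_⟩
  · have e6 : covE (christoffel D x₀) (crd n x₀ y) A X B =
        C + covE (christoffel D x₀) (crd n x₀ y) A X (fderiv ℝ S (crd n x₀ y) X) := by
      rw [covE, covE, hC]; abel
    change covE (christoffel D x₀) (crd n x₀ y) A X B ∈ fibE Q x₀ (crd n x₀ y)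
    rw [e6]
    exact Submodule.add_mem _ h6 hSm
  · exact (covE_anticomm hA.2).trans h2

/-- Vector fields that are tangent to the twistor space are closed under the bracket. -/
lemma lieBracket_mem_tanE (hn : 1 ≤ n) (hD : Q.IsQuaternionicConnection D) {x₀ y : M} (hy : y ∈ dom n x₀)
    {A : EndModel n} (hA : (crd n x₀ y, A) ∈ twZ Q x₀)
    {u w : Model n × EndModel n → Model n × EndModel n} (hu : DifferentiableAt ℝ u (crd n x₀ y, A))
    (hw : DifferentiableAt ℝ w (crd n x₀ y, A))
    (huT : ∀ᶠ q in 𝓝 (crd n x₀ y, A), q ∈ twZ Q x₀ → u q ∈ tanE Q D x₀ q)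
    (hwT : ∀ᶠ q in 𝓝 (crd n x₀ y, A), q ∈ twZ Q x₀ → w q ∈ tanE Q D x₀ q) :
    VectorField.lieBracket ℝ u w (crd n x₀ y, A) ∈ tanE Q D x₀ (crd n x₀ y, A) := by
  obtain ⟨J, hJ, hJQ⟩ := exists_frame Q hy
  have hJ' : ∀ a, ContDiffAt ℝ ∞ (fun p ↦ J p a) (crd n x₀ y) := fun a ↦ (hJ a).self_of_nhds
  have hJQ' : ∀ᶠ q in 𝓝 (crd n x₀ y, A),
      QTriple (J q.1) ∧ fibE Q x₀ q.1 = Submodule.span ℝ (range (J q.1)) :=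
    (continuous_fst.continuousAt (x := (crd n x₀ y, A))).eventually hJQ
  refine mem_tanE_of_fderiv_eq_zero hn hD hy hJ' hJQ hA ?_ ?_
  · refine fderiv_lieBracket_of_eq_on_twZ hn hD (crd_mem_target hy) hA (k := 0)
      ((contDiffAt_defEq (q := (crd n x₀ y, A)) hJ').of_le (WithTop.coe_le_coe.2 (le_top : (2 : ℕ∞) ≤ ⊤))) ?_ hu hw huT hwT
    filter_upwards [hJQ'] with q hq hqZ
    exact defEq_eq_zero hn hq.1 (by rw [← hq.2]; exact hqZ.1)
  · have hsq : HasFDerivAt (fun q : Model n × EndModel n ↦ q.2 * q.2) _ (crd n x₀ y, A) :=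
      (ContinuousLinearMap.snd ℝ (Model n) (EndModel n)).hasFDerivAt.mul'
        (ContinuousLinearMap.snd ℝ (Model n) (EndModel n)).hasFDerivAt
    have h := fderiv_lieBracket_of_eq_on_twZ hn hD (crd_mem_target hy) hA (k := -1)
      (F := fun q : Model n × EndModel n ↦ q.2 * q.2) (contDiffAt_snd.mul contDiffAt_snd)
      (Eventually.of_forall fun q hq ↦ hq.2) hu hw huT hwT
    rw [hsq.fderiv] at h
    rw [add_comm]
    exact h

/-- Derivatives, in tangent directions, of a vector field that is the image of another one under
`iE` along the twistor space. -/
lemma fderiv_image (hn : 1 ≤ n) (hD : Q.IsQuaternionicConnection D) {x₀ : M} {q : Model n × EndModel n}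
    (hq : q.1 ∈ (crd n x₀).target) (hqZ : q ∈ twZ Q x₀) {u u' : Model n × EndModel n → Model n × EndModel n}
    (hu : DifferentiableAt ℝ u q) (hu' : DifferentiableAt ℝ u' q)
    (h : ∀ᶠ y in 𝓝 q, y ∈ twZ Q x₀ → u' y = iE (christoffel D x₀) y (u y))
    {v : Model n × EndModel n} (hv : v ∈ tanE Q D x₀ q) :
    fderiv ℝ u' q v = dIE (christoffel D x₀) q v (u q) + iE (christoffel D x₀) q (fderiv ℝ u q v) := by
  obtain ⟨c, hc, h0, hcZ⟩ := exists_curve hn hD hq hqZ hv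
  have hΓ : DifferentiableAt ℝ (christoffel D x₀) q.1 :=
    ((contDiffOn_christoffel hD.smooth x₀).contDiffAt (target_mem_nhds hq)).differentiableAt (by simp)
  subst h0
  have h1 : HasDerivAt (fun t ↦ u (c t)) (fderiv ℝ u (c 0) v) 0 :=
    HasFDerivAt.comp_hasDerivAt (l := u) (l' := fderiv ℝ u (c 0)) (0 : ℝ) hu.hasFDerivAt hc
  have h2 : HasDerivAt (fun t ↦ u' (c t)) (fderiv ℝ u' (c 0) v) 0 :=
    HasFDerivAt.comp_hasDerivAt (l := u') (l' := fderiv ℝ u' (c 0)) (0 : ℝ) hu'.hasFDerivAt hc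
  have h3 : (fun t ↦ u' (c t)) =ᶠ[𝓝 0] fun t ↦ iE (christoffel D x₀) (c t) (u (c t)) := by
    filter_upwards [hc.continuousAt.eventually h, hcZ] with t h4 h5 using h4 h5
  exact h2.unique ((hasDerivAt_iE hΓ hc h1).congr_of_eventuallyEq h3)

/-- The Nijenhuis tensor, computed with vector fields that are tangent to the twistor space, is `nijE`; in particular it
is a tensor. -/
lemma nijenhuis_eq_nijE (hn : 1 ≤ n) (hD : Q.IsQuaternionicConnection D) {x₀ : M} {q : Model n × EndModel n}
    (hq : q.1 ∈ (crd n x₀).target) (hqZ : q ∈ twZ Q x₀)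
    {u u' w w' : Model n × EndModel n → Model n × EndModel n}
    (hu : DifferentiableAt ℝ u q) (hu' : DifferentiableAt ℝ u' q)
    (hw : DifferentiableAt ℝ w q) (hw' : DifferentiableAt ℝ w' q)
    (huT : u q ∈ tanE Q D x₀ q) (hwT : w q ∈ tanE Q D x₀ q)
    (huT' : u' q ∈ tanE Q D x₀ q) (hwT' : w' q ∈ tanE Q D x₀ q)
    (h : ∀ᶠ y in 𝓝 q, y ∈ twZ Q x₀ → u' y = iE (christoffel D x₀) y (u y))
    (h' : ∀ᶠ y in 𝓝 q, y ∈ twZ Q x₀ → w' y = iE (christoffel D x₀) y (w y)) :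
    VectorField.lieBracket ℝ u' w' q - VectorField.lieBracket ℝ u w q
      - iE (christoffel D x₀) q (VectorField.lieBracket ℝ u' w q)
      - iE (christoffel D x₀) q (VectorField.lieBracket ℝ u w' q) =
    nijE (christoffel D x₀) q (u q) (w q) := by
  have hi := iE_iE (christoffel D x₀) hqZ.2
  have e1 := h.self_of_nhds hqZ
  have e2 := h'.self_of_nhds hqZ
  have f1 := fun v hv ↦ fderiv_image hn hD hq hqZ hu hu' h (v := v) hv
  have f2 := fun v hv ↦ fderiv_image hn hD hq hqZ hw hw' h' (v := v) hv
  simp only [VectorField.lieBracket]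
  rw [f2 _ huT', f1 _ hwT', f1 _ hwT, f2 _ huT, e1, e2, nijE]
  simp only [LinearMap.map_sub, LinearMap.map_add, hi]
  abel

end

section
/-! ### The integrability criterion -/

variable {n : ℕ} {M : Type*} [TopologicalSpace M] [ChartedSpace (Model n) M]
  [IsManifold (𝓡 (4 * n)) ∞ M]


variable [T2Space M] [SigmaCompactSpace M] {Q : AlmostQuaternionicStructure n M} {D : Connection n M}

lemma endCrd_tendsto_symm {x₀ : M} {z : EndTM n M} (hz : z.1 ∈ dom n x₀) {P : EndTM n M → Prop}
    (h : ∀ᶠ w in 𝓝 z, P w) : ∀ᶠ q in 𝓝 (endCrd x₀ z), P ((endCrd x₀).symm q) := by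
  have h1 : ContinuousAt (endCrd (n := n) x₀).symm (endCrd x₀ z) :=
    (continuousOn_extChartAt_symm _).continuousAt (endCrd_target_mem_nhds hz)
  have h2 : Tendsto (endCrd (n := n) x₀).symm (𝓝 (endCrd x₀ z)) (𝓝 z) := by
    have := h1.tendsto; rwa [(endCrd x₀).left_inv (mem_endCrd_source.2 hz)] at this
  exact h2.eventually h

/-- A vector field on `End(TM)` in the chart over the chart around `x₀`. -/
abbrev vf (x₀ : M) (U : ∀ y : EndTM n M, TangentSpace (endI n) y) :
    Model n × EndModel n → Model n × EndModel n :=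
  vfCoord (endI n) (TotalSpace.mk' (EndModel n) x₀ 0 : EndTM n M) U

lemma vf_endCrd {x₀ : M} {z : EndTM n M} (hz : z.1 ∈ dom n x₀)
    (U : ∀ y : EndTM n M, TangentSpace (endI n) y) : vf x₀ U (endCrd x₀ z) = vc x₀ z (U z) := by
  change vc x₀ ((endCrd x₀).symm (endCrd x₀ z)) (U ((endCrd x₀).symm (endCrd x₀ z))) = _
  rw [(endCrd x₀).left_inv (mem_endCrd_source.2 hz)]

lemma vc_self (z : EndTM n M) (W : TangentSpace (endI n) z) : vc z.1 z W = W := tcoord_self z W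

lemma bracket_eq (U W : ∀ y : EndTM n M, TangentSpace (endI n) y) (z : EndTM n M) :
    bracket U W z = VectorField.lieBracket ℝ (vf z.1 U) (vf z.1 W) (endCrd z.1 z) :=
  tcoord_mlieBracket U W z


lemma vf_mem_tanE (hn : 1 ≤ n) (hD : Q.IsQuaternionicConnection D) {x₀ : M} {z : EndTM n M}
    (hz : z.1 ∈ dom n x₀) {U : ∀ y : EndTM n M, TangentSpace (endI n) y} (hU : Q.IsTwistorVFAt U z) :
    ∀ᶠ q in 𝓝 (endCrd x₀ z), q ∈ twZ Q x₀ → vf x₀ U q ∈ tanE Q D x₀ q := by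
  filter_upwards [endCrd_tendsto_symm hz hU.2, endCrd_target_mem_nhds hz] with q h1 h2 h3
  have h4 := mem_endCrd_source.1 ((endCrd x₀).map_target h2)
  have h5 := (endCrd x₀).right_inv h2
  have h6 := h1 ((mem_twistorSpace_iff h4).2 (by rw [h5]; exact h3))
  rw [mem_twistorTangent_iff hn hD h4 ((mem_twistorSpace_iff h4).2 (by rw [h5]; exact h3)), h5] at h6
  exact h6

lemma differentiableAt_vf {x₀ : M} {z : EndTM n M} (hz : z.1 ∈ dom n x₀)
    {U : ∀ y : EndTM n M, TangentSpace (endI n) y} (hU : Q.IsTwistorVFAt U z) :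
    DifferentiableAt ℝ (vf x₀ U) (endCrd x₀ z) :=
  ((smoothAmbientVFAt_iff hz).1 hU.1).differentiableAt (by simp)

lemma vf_image (hn : 1 ≤ n) (hD : Q.IsQuaternionicConnection D) {I : Q.TwistorAlmostComplexStructure}
    (hI : I.IsI₁ D) {x₀ : M} {z : EndTM n M} (hz : z.1 ∈ dom n x₀)
    {U U' : ∀ y : EndTM n M, TangentSpace (endI n) y} (hU : Q.IsTwistorVFAt U z)
    (h : Q.IsImageNear I.toEnd U U' z) :
    ∀ᶠ q in 𝓝 (endCrd x₀ z), q ∈ twZ Q x₀ → vf x₀ U' q = iE (christoffel D x₀) q (vf x₀ U q) := by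
  filter_upwards [endCrd_tendsto_symm hz h, endCrd_tendsto_symm hz hU.2, endCrd_target_mem_nhds hz]
    with q h0 h1 h2 h3
  have h4 := mem_endCrd_source.1 ((endCrd x₀).map_target h2)
  have h5 := (endCrd x₀).right_inv h2
  have h7 := (mem_twistorSpace_iff h4).2 (show endCrd x₀ ((endCrd x₀).symm q) ∈ twZ Q x₀ by rw [h5]; exact h3)
  have h8 := vc_isI₁ hn hD hI h7 h4 ⟨_, h1 h7⟩
  rw [← h0 h7 (h1 h7), h5] at h8
  exact h8

/-- The vector field on `End(TM)` whose value at `(p, A)` is the horizontal lift of the vector with components `X`. -/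
def horField (D : Connection n M) (x₀ : M) (X : Model n) (y : EndTM n M) : TangentSpace (endI n) y :=
  vcInv x₀ y (X, -adE (christoffel D x₀) (endCrd x₀ y).1 (endCrd x₀ y).2 X)

lemma vc_horField (D : Connection n M) {x₀ : M} (X : Model n) {y : EndTM n M} (hy : y.1 ∈ dom n x₀) :
    vc x₀ y (horField D x₀ X y) = (X, -adE (christoffel D x₀) (endCrd x₀ y).1 (endCrd x₀ y).2 X) :=
  vc_vcInv hy _

lemma isTwistorVFAt_horField (hn : 1 ≤ n) (hD : Q.IsQuaternionicConnection D) {x₀ : M} (X : Model n)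
    {z : EndTM n M} (hz : z.1 ∈ dom n x₀) : Q.IsTwistorVFAt (horField D x₀ X) z := by
  refine ⟨(smoothAmbientVFAt_iff hz).2 ?_, ?_⟩
  · have hq : (endCrd x₀ z).1 ∈ (crd n x₀).target := by rw [endCrd_eq hz]; exact crd_mem_target hz
    have hΓ : ContDiffAt ℝ ∞ (fun q : Model n × EndModel n ↦ christoffel D x₀ q.1) (endCrd x₀ z) :=
      ((contDiffOn_christoffel hD.smooth x₀).contDiffAt (target_mem_nhds hq)).comp _ contDiffAt_fst
    have hG := hΓ.clm_apply (contDiffAt_const (c := X))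
    have hA : ContDiffAt ℝ ∞ (fun q : Model n × EndModel n ↦ q.2) (endCrd x₀ z) := contDiffAt_snd
    refine ((contDiffAt_const (c := X)).prodMk ((hG.mul hA).sub (hA.mul hG)).neg).congr_of_eventuallyEq ?_
    filter_upwards [endCrd_target_mem_nhds hz] with q hq
    have h1 := vc_horField D X (mem_endCrd_source.1 ((endCrd x₀).map_target hq))
    rw [(endCrd x₀).right_inv hq] at h1
    exact h1
  · filter_upwards [(isOpen_over_dom x₀).mem_nhds hz] with y hy hyQ
    rw [mem_twistorTangent_iff hn hD hy hyQ, vc_horField D X hy]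
    exact horizontal_mem_tanE _ _

lemma isImageNear_iField (hn : 1 ≤ n) (hD : Q.IsQuaternionicConnection D) {I : Q.TwistorAlmostComplexStructure}
    (hI : I.IsI₁ D) {x₀ : M} {z : EndTM n M} (hz : z.1 ∈ dom n x₀)
    (U : ∀ y : EndTM n M, TangentSpace (endI n) y) : Q.IsImageNear I.toEnd U (iField D x₀ U) z := by
  filter_upwards [(isOpen_over_dom x₀).mem_nhds hz] with y hyd hyQ hyU
  apply vc_injective hyd
  exact (vc_iField D U hyd).trans (vc_isI₁ hn hD hI hyQ hyd ⟨U y, hyU⟩).symm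

set_option maxHeartbeats 1000000 in
/-- The Nijenhuis tensor of `I₁^∇` in coordinates. -/
lemma nijenhuis_eq (hn : 1 ≤ n) (hD : Q.IsQuaternionicConnection D) {I : Q.TwistorAlmostComplexStructure}
    (hI : I.IsI₁ D) {z : EndTM n M} (hz : z ∈ Q.twistorSpace)
    {U W IU IW : ∀ y : EndTM n M, TangentSpace (endI n) y}
    (hU : Q.IsTwistorVFAt U z) (hW : Q.IsTwistorVFAt W z) (hIU : Q.IsTwistorVFAt IU z)
    (hIW : Q.IsTwistorVFAt IW z) (hU' : Q.IsImageNear I.toEnd U IU z) (hW' : Q.IsImageNear I.toEnd W IW z)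
    (h₁ : bracket IU W z ∈ Q.twistorTangent z) (h₂ : bracket U IW z ∈ Q.twistorTangent z) :
    bracket IU IW z - bracket U W z
        - (I.toEnd ⟨z, hz⟩ ⟨bracket IU W z, h₁⟩ : TangentSpace (endI n) z)
        - (I.toEnd ⟨z, hz⟩ ⟨bracket U IW z, h₂⟩ : TangentSpace (endI n) z) =
      nijE (christoffel D z.1) (endCrd z.1 z) (vc z.1 z (U z)) (vc z.1 z (W z)) := by
  have hzd : z.1 ∈ dom n z.1 := mem_chart_source _ _
  have hzZ := (mem_twistorSpace_iff hzd).1 hz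
  have hq : (endCrd z.1 z).1 ∈ (crd n z.1).target := by rw [endCrd_eq hzd]; exact crd_mem_target hzd
  have h := nijenhuis_eq_nijE hn hD hq hzZ (differentiableAt_vf hzd hU) (differentiableAt_vf hzd hIU)
    (differentiableAt_vf hzd hW) (differentiableAt_vf hzd hIW)
    ((vf_mem_tanE hn hD hzd hU).self_of_nhds hzZ) ((vf_mem_tanE hn hD hzd hW).self_of_nhds hzZ)
    ((vf_mem_tanE hn hD hzd hIU).self_of_nhds hzZ) ((vf_mem_tanE hn hD hzd hIW).self_of_nhds hzZ)
    (vf_image hn hD hI hzd hU hU') (vf_image hn hD hI hzd hW hW')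
  have e1 := vc_isI₁ hn hD hI hz hzd ⟨bracket IU W z, h₁⟩
  have e2 := vc_isI₁ hn hD hI hz hzd ⟨bracket U IW z, h₂⟩
  simp only [vc_self] at e1 e2
  rw [e1, e2, bracket_eq, bracket_eq, bracket_eq, bracket_eq, ← vf_endCrd hzd U, ← vf_endCrd hzd W]
  exact h

lemma bracket_mem_twistorTangent (hn : 1 ≤ n) (hD : Q.IsQuaternionicConnection D) {z : EndTM n M}
    (hz : z ∈ Q.twistorSpace) {U W : ∀ y : EndTM n M, TangentSpace (endI n) y}
    (hU : Q.IsTwistorVFAt U z) (hW : Q.IsTwistorVFAt W z) : bracket U W z ∈ Q.twistorTangent z := by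
  have hzd : z.1 ∈ dom n z.1 := mem_chart_source _ _
  have hzZ := (mem_twistorSpace_iff hzd).1 hz
  have h1 := differentiableAt_vf hzd hU
  have h2 := differentiableAt_vf hzd hW
  have h3 := vf_mem_tanE hn hD hzd hU
  have h4 := vf_mem_tanE hn hD hzd hW
  rw [mem_twistorTangent_iff hn hD hzd hz, vc_self, bracket_eq]
  rw [endCrd_eq hzd] at hzZ h1 h2 h3 h4 ⊢
  exact lieBracket_mem_tanE hn hD hzd hzZ h1 h2 h3 h4

/-- The almost complex structure `I₁^∇` is integrable if and only if the components `tE` of the torsion and `eE` of the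
curvature of `∇` vanish along the twistor space. -/
theorem isIntegrable_iff (hn : 1 ≤ n) (hD : Q.IsQuaternionicConnection D)
    {I : Q.TwistorAlmostComplexStructure} (hI : I.IsI₁ D) :
    I.IsIntegrable ↔ ∀ z ∈ Q.twistorSpace, ∀ X Y : Model n,
      tE (christoffel D z.1) (endCrd z.1 z).1 (endCrd z.1 z).2 X Y = 0 ∧
      eE (christoffel D z.1) (endCrd z.1 z).1 (endCrd z.1 z).2 X Y = 0 := by
  constructor
  · intro h z hz X Y
    have hzd : z.1 ∈ dom n z.1 := mem_chart_source _ _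
    have hzZ := (mem_twistorSpace_iff hzd).1 hz
    have hX := isTwistorVFAt_horField hn hD X hzd
    have hY := isTwistorVFAt_horField hn hD Y hzd
    have hIX := isTwistorVFAt_iField hn hD hzd hX
    have hIY := isTwistorVFAt_iField hn hD hzd hY
    have hX' := isImageNear_iField hn hD hI hzd (horField D z.1 X)
    have hY' := isImageNear_iField hn hD hI hzd (horField D z.1 Y)
    obtain ⟨h₁, h₂, h3⟩ := h z hz _ _ _ _ hX hY hIX hIY hX' hY'
    have h4 := (nijenhuis_eq hn hD hI hz hX hY hIX hIY hX' hY' h₁ h₂).symm.trans h3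
    have h5 := (nijE_eq_zero_iff hzZ.2 _ _).1 h4
    rwa [vc_horField D X hzd, vc_horField D Y hzd] at h5
  · intro h z hz U W IU IW hU hW hIU hIW hU' hW'
    have hzd : z.1 ∈ dom n z.1 := mem_chart_source _ _
    have hzZ := (mem_twistorSpace_iff hzd).1 hz
    refine ⟨bracket_mem_twistorTangent hn hD hz hIU hW, bracket_mem_twistorTangent hn hD hz hU hIW, ?_⟩
    rw [nijenhuis_eq hn hD hI hz hU hW hIU hIW hU' hW']
    exact (nijE_eq_zero_iff hzZ.2 _ _).2 (h z hz _ _)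

end

section
/-! ### Correcting the torsion: linear algebra -/

variable {n : ℕ} {M : Type*} [TopologicalSpace M] [ChartedSpace (Model n) M]
  [IsManifold (𝓡 (4 * n)) ∞ M]


namespace QTriple

variable {J : Fin 3 → EndModel n}

/-- The multiplication table of a quaternionic triple, applied to a vector. -/
lemma app (h : QTriple J) (v : Model n) : J 0 (J 0 v) = -v ∧ J 1 (J 1 v) = -v ∧ J 2 (J 2 v) = -v ∧
    J 0 (J 1 v) = J 2 v ∧ J 1 (J 0 v) = -J 2 v ∧ J 1 (J 2 v) = J 0 v ∧ J 2 (J 1 v) = -J 0 v ∧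
    J 2 (J 0 v) = J 1 v ∧ J 0 (J 2 v) = -J 1 v := by
  have e : ∀ {B C : EndModel n}, B = C → B v = C v := fun h ↦ by rw [h]
  exact ⟨e (h.sq 0), e (h.sq 1), e (h.sq 2), e h.mul01, e h.mul10, e h.mul12, e h.mul21, e h.mul20, e h.mul02⟩

/-- A nonzero quaternion acts injectively. -/
lemma eq_zero_of_smul_add (h : QTriple J) {X : Model n} (hX : X ≠ 0) {a b c d : ℝ}
    (h0 : a • X + b • J 0 X + c • J 1 X + d • J 2 X = 0) : a = 0 ∧ b = 0 ∧ c = 0 ∧ d = 0 := by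
  have h1 := congrArg (fun v ↦ a • v - b • J 0 v - c • J 1 v - d • J 2 v) h0
  obtain ⟨e0, e1, e2, e3, e4, e5, e6, e7, e8⟩ := h.app X
  simp only [map_add, map_smul, e0, e1, e2, e3, e4, e5, e6, e7, e8, map_zero, smul_zero, sub_zero] at h1
  have h2 : (a * a + b * b + c * c + d * d) • X = 0 := by
    rw [← h1]; module
  have h3 := (smul_eq_zero.1 h2).resolve_right hX
  have ha := mul_self_nonneg a
  have hb := mul_self_nonneg b
  have hc := mul_self_nonneg c
  have hd := mul_self_nonneg d
  exact ⟨mul_self_eq_zero.1 (by linarith), mul_self_eq_zero.1 (by linarith), mul_self_eq_zero.1 (by linarith),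
    mul_self_eq_zero.1 (by linarith)⟩

/-- If the endomorphisms `K X` are combinations of `J 1` and `J 2`, and `K X Y = K Y X`, then `K` vanishes: compare
`K X (J 1 X)` and `K (J 1 X) X`. -/
lemma eq_zero_of_symm (h : QTriple J) {K : Model n → EndModel n}
    (hK : ∀ X, ∃ k l : ℝ, ∀ Y, K X Y = k • J 1 Y + l • J 2 Y) (hs : ∀ X Y, K X Y = K Y X) (X : Model n) : K X = 0 := by
  by_cases hX : X = 0
  · subst hX
    ext1 Y
    rw [hs]; simp
  · obtain ⟨k, l, h1⟩ := hK X
    obtain ⟨k', l', h2⟩ := hK (J 1 X)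
    have h3 := hs X (J 1 X)
    obtain ⟨e0, e1, e2, e3, e4, e5, e6, e7, e8⟩ := h.app X
    rw [h1, h2] at h3
    rw [e1, e6] at h3
    have h4 : k • X + l • J 0 X + k' • J 1 X + l' • J 2 X = 0 := by
      rw [add_assoc, ← h3]; module
    obtain ⟨rfl, rfl, -, -⟩ := h.eq_zero_of_smul_add hX h4
    ext1 Y
    rw [h1]; simp

/-- A symmetric bilinear map that commutes with `J` in one argument vanishes.  Hence the tensor that corrects the torsion
is unique. -/
lemma eq_zero_of_symm_of_comm (h : QTriple J) {b : Model n → Model n → Model n}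
    (hs : ∀ X Y, b X Y = b Y X) (hc : ∀ a X Y, b X (J a Y) = J a (b X Y)) (X Y : Model n) : b X Y = 0 := by
  have h1 : ∀ a X Y, b (J a X) Y = J a (b X Y) := fun a X Y ↦ by rw [hs, hc, hs]
  have h2 : J 0 (J 1 (b X Y)) = J 1 (J 0 (b X Y)) := by
    rw [← hc 1, ← h1 0, ← h1 0, ← hc 1]
  obtain ⟨e0, e1, e2, e3, e4, e5, e6, e7, e8⟩ := h.app (b X Y)
  rw [e3, e4] at h2
  have h3 : J 2 (b X Y) = 0 := by
    have h4 : (2 : ℝ) • J 2 (b X Y) = 0 := by rw [two_smul]; exact add_eq_zero_iff_eq_neg.2 h2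
    exact (smul_eq_zero.1 h4).resolve_left two_ne_zero
  rw [h3, map_zero] at e2
  exact neg_eq_zero.1 e2.symm

section Correction

variable (t : Model n →L[ℝ] Model n →L[ℝ] Model n)

/-- The torsion component `tE`, for an arbitrary bilinear map `t` in place of the torsion. -/
def obst (A : EndModel n) (X Y : Model n) : Model n :=
  t (A X) (A Y) - t X Y - A (t (A X) Y) - A (t X (A Y))

/-- A bilinear map that commutes with `J 0` in the second argument, provided that `obst t (J 0)` vanishes. -/
def corrAux (J : Fin 3 → EndModel n) (X Y : Model n) : Model n := t X Y + J 0 (t (J 0 X) Y)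

/-- The tensor that turns a connection with torsion `t` into a torsion-free one: `corrAux` is averaged over `J 1`, so that
the tensor commutes with the whole triple in the second argument. -/
def corr (J : Fin 3 → EndModel n) (X Y : Model n) : Model n :=
  (-(1 / 2 : ℝ)) • (corrAux t J X Y - J 1 (corrAux t J X (J 1 Y)))

/-- The correction tensor commutes with the triple, so that adding it to a quaternionic connection gives a quaternionic
connection. -/
lemma corr_comm (h : QTriple J) (h0 : ∀ X Y, obst t (J 0) X Y = 0) (a : Fin 3) (X Y : Model n) :
    corr t J X (J a Y) = J a (corr t J X Y) := by
  have c0 : ∀ X Y, corrAux t J X (J 0 Y) = J 0 (corrAux t J X Y) := fun X Y ↦ by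
    have h1 := h0 X Y
    have e0 := fun v ↦ (h.app v).1
    rw [obst] at h1
    have h2 := congrArg (J 0) h1
    simp only [map_sub, e0, map_zero] at h2
    simp only [corrAux, map_add, e0]
    linear_combination (norm := module) h2
  have k0 : ∀ X Y, corr t J X (J 0 Y) = J 0 (corr t J X Y) := fun X Y ↦ by
    obtain ⟨e0, e1, e2, e3, e4, e5, e6, e7, e8⟩ := h.app (corrAux t J X (J 1 Y))
    have e9 : J 1 (J 0 Y) = -J 0 (J 1 Y) := by
      rw [(h.app Y).2.2.2.2.1, (h.app Y).2.2.2.1]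
    have c3 : corrAux t J X (-J 0 (J 1 Y)) = -corrAux t J X (J 0 (J 1 Y)) := by
      simp only [corrAux, map_neg, neg_add]
    simp only [corr, map_smul, map_sub, e9, c3, c0, map_neg, e4, e3, neg_neg]
  have k1 : ∀ X Y, corr t J X (J 1 Y) = J 1 (corr t J X Y) := fun X Y ↦ by
    have e1 := fun v ↦ (h.app v).2.1
    have c3 : corrAux t J X (-Y) = -corrAux t J X Y := by
      simp only [corrAux, map_neg, neg_add]
    simp only [corr, map_smul, map_sub, e1, c3, map_neg]
    module
  fin_cases a
  · exact k0 X Y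
  · exact k1 X Y
  · have e := fun v ↦ (h.app v).2.2.2.1
    change corr t J X (J 2 Y) = J 2 (corr t J X Y)
    rw [← e, k0, k1, e]

/-- The skew part of the correction tensor cancels the torsion. -/
lemma corr_sub (h : QTriple J) (ht : ∀ X Y, t X Y = -t Y X)
    (h01 : ∀ X Y, t (J 0 X) (J 1 Y) + t (J 1 X) (J 0 Y) - J 0 (t (J 1 X) Y) - J 1 (t (J 0 X) Y)
      - J 0 (t X (J 1 Y)) - J 1 (t X (J 0 Y)) = 0) (X Y : Model n) :
    corr t J X Y - corr t J Y X = -t X Y := by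
  have a2 := congrArg (J 2) (h01 X Y)
  have r1 : ∀ v, J 1 (J 0 v) = -J 2 v := fun v ↦ (h.app v).2.2.2.2.1
  have r2 : ∀ v, J 2 (J 1 v) = -J 0 v := fun v ↦ (h.app v).2.2.2.2.2.2.1
  have r3 : ∀ v, J 2 (J 0 v) = J 1 v := fun v ↦ (h.app v).2.2.2.2.2.2.2.1
  simp only [map_sub, map_add, r2, r3, map_zero] at a2
  simp only [corr, corrAux, map_add, r1]
  rw [ht Y X, ht (J 0 Y) X, ht Y (J 1 X), ht (J 0 Y) (J 1 X)]
  simp only [map_neg]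
  linear_combination (norm := module) (-(1 / 2 : ℝ)) • a2

/-- Polarization of the condition `obst t A = 0` for `A` in the unit circle of `span (J 0, J 1)`: the three given points of
the circle suffice. -/
lemma obst_polar (h0 : ∀ X Y, obst t (J 0) X Y = 0) (h1 : ∀ X Y, obst t (J 1) X Y = 0)
    (h2 : ∀ X Y, obst t ((√2)⁻¹ • (J 0 + J 1)) X Y = 0) (X Y : Model n) :
    t (J 0 X) (J 1 Y) + t (J 1 X) (J 0 Y) - J 0 (t (J 1 X) Y) - J 1 (t (J 0 X) Y)
      - J 0 (t X (J 1 Y)) - J 1 (t X (J 0 Y)) = 0 := by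
  have hs : (√2)⁻¹ * (√2)⁻¹ = (1 / 2 : ℝ) := by
    rw [← mul_inv, Real.mul_self_sqrt (by norm_num)]; norm_num
  have a0 := h0 X Y
  have a1 := h1 X Y
  have a2 := h2 X Y
  rw [obst] at a0 a1 a2
  simp only [smul_apply, add_apply, map_add, map_smul, smul_add, smul_smul, hs] at a2
  linear_combination (norm := module) (2 : ℝ) • a2 - a0 - a1

end Correction

end QTriple

end

section
/-! ### Uniqueness of the integrable structure -/

variable {n : ℕ} {M : Type*} [TopologicalSpace M] [ChartedSpace (Model n) M]
  [IsManifold (𝓡 (4 * n)) ∞ M]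


namespace QTriple

lemma mul_self_mul_eq_neg_one {R : Type*} [Ring R] {A B : R} (hA : A * A = -1) (hB : B * B = -1)
    (hBA : B * A = -(A * B)) : A * B * (A * B) = -1 := by
  rw [mul_assoc, ← mul_assoc B, hBA, neg_mul, mul_assoc, hB, mul_neg, mul_neg, mul_neg, mul_one,
    neg_neg, hA]

/-- The elements of the span of the triple that anticommute with `J 0` are combinations of `J 1` and `J 2`. -/
lemma eq_of_anticomm {J : Fin 3 → EndModel n} (h : QTriple J) (hn : 1 ≤ n) {B : EndModel n}
    (hB : B ∈ Submodule.span ℝ (range J)) (hc : B * J 0 + J 0 * B = 0) :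
    ∃ k l : ℝ, ∀ Y, B Y = k • J 1 Y + l • J 2 Y := by
  obtain ⟨x, rfl⟩ := (Submodule.mem_span_range_iff_exists_fun ℝ).1 hB
  have h1 := h.anticomm x ![1, 0, 0]
  have h2 : ∑ i, (![1, 0, 0] : Fin 3 → ℝ) i • J i = J 0 := by
    simp only [Fin.sum_univ_three, Matrix.cons_val_zero, Matrix.cons_val_one, Matrix.cons_val]
    module
  rw [h2, hc] at h1
  have h3 := congrArg (trE n) h1
  rw [map_zero, map_smul, trE_one, smul_eq_mul] at h3
  have hn' : (4 * n : ℝ) ≠ 0 := by positivity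
  have h4 := (mul_eq_zero.1 h3.symm).resolve_right hn'
  have h5 : x 0 = 0 := by
    simp only [Fin.sum_univ_three, Matrix.cons_val_zero, Matrix.cons_val_one, Matrix.cons_val] at h4
    linarith
  refine ⟨x 1, x 2, fun Y ↦ ?_⟩
  rw [Fin.sum_univ_three, h5]
  change (0 : ℝ) • J 0 Y + x 1 • J 1 Y + x 2 • J 2 Y = _
  module

lemma sum_eq_zero {J : Fin 3 → EndModel n} (h : QTriple J) (hn : 1 ≤ n) {x : Fin 3 → ℝ}
    (hx : ∑ i, x i • J i = 0) (a : Fin 3) : x a = 0 := by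
  rw [← h.coef_sum hn x a, hx]
  simp [coef]

lemma finrank_span {J : Fin 3 → EndModel n} (h : QTriple J) (hn : 1 ≤ n) :
    Module.finrank ℝ (Submodule.span ℝ (range J)) = 3 := by
  have hl : LinearIndependent ℝ J := Fintype.linearIndependent_iff.2 fun _ hx ↦ h.sum_eq_zero hn hx
  rw [finrank_span_eq_card hl, Fintype.card_fin]

lemma exists_orthogonal (x : Fin 3 → ℝ) :
    ∃ y : Fin 3 → ℝ, ∑ i, y i * y i = 1 ∧ ∑ i, x i * y i = 0 := by
  by_cases h0 : x 0 * x 0 + x 1 * x 1 = 0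
  · have ha : x 0 = 0 := mul_self_eq_zero.1 (by linarith [mul_self_nonneg (x 0), mul_self_nonneg (x 1)])
    exact ⟨![1, 0, 0], by simp [Fin.sum_univ_three], by simp [Fin.sum_univ_three, ha]⟩
  · have hpos : 0 < x 0 * x 0 + x 1 * x 1 :=
      lt_of_le_of_ne (add_nonneg (mul_self_nonneg _) (mul_self_nonneg _)) (Ne.symm h0)
    have hs := Real.mul_self_sqrt hpos.le
    have hs0 : √(x 0 * x 0 + x 1 * x 1) ≠ 0 := (Real.sqrt_pos.2 hpos).ne'
    obtain ⟨s, hs'⟩ : ∃ s, s = √(x 0 * x 0 + x 1 * x 1) := ⟨_, rfl⟩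
    rw [← hs'] at hs hs0
    refine ⟨![-x 1 / s, x 0 / s, 0], ?_, ?_⟩
    · simp only [Fin.sum_univ_three, Matrix.cons_val_zero, Matrix.cons_val_one, Matrix.cons_val]
      field_simp
      linear_combination -hs
    · simp only [Fin.sum_univ_three, Matrix.cons_val_zero, Matrix.cons_val_one, Matrix.cons_val]
      field_simp
      ring

/-- Every `A ∈ 𝒬` with `A² = -1` is the first member of a quaternionic triple that spans `𝒬`. -/
lemma exists_adapted {J : Fin 3 → EndModel n} (h : QTriple J) (hn : 1 ≤ n) {A : EndModel n}
    (hA : A ∈ Submodule.span ℝ (range J)) (hA2 : A * A = -1) :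
    ∃ J' : Fin 3 → EndModel n, QTriple J' ∧ J' 0 = A ∧
      Submodule.span ℝ (range J') = Submodule.span ℝ (range J) := by
  obtain ⟨x, rfl⟩ := (Submodule.mem_span_range_iff_exists_fun ℝ).1 hA
  -- For a unit vector `y` that is orthogonal to the components `x` of `A`, the triple `A, B, A B` with `B = ∑ yᵢ Jᵢ` is
  -- quaternionic.
  obtain ⟨y, hy1, hy2⟩ := exists_orthogonal x
  obtain ⟨B, hB⟩ : ∃ B, B = ∑ i, y i • J i := ⟨_, rfl⟩
  have hBm : B ∈ Submodule.span ℝ (range J) := by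
    rw [hB]; exact Submodule.sum_mem _ fun i _ ↦ Submodule.smul_mem _ _ (Submodule.subset_span ⟨i, rfl⟩)
  have hB2 : B * B = -1 := by
    rw [hB, h.sq_sum, hy1]
    exact (neg_smul (1 : ℝ) (1 : EndModel n)).trans (congrArg _ (one_smul ℝ _))
  have hAB := h.anticomm x y
  rw [hy2, mul_zero, ← hB] at hAB
  obtain ⟨A, hA'⟩ : ∃ A, A = ∑ i, x i • J i := ⟨_, rfl⟩
  rw [← hA'] at hA hA2 hAB ⊢
  have hAB' : A * B + B * A = 0 := hAB.trans (zero_smul ℝ (1 : EndModel n))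
  have hBA : B * A = -(A * B) := (neg_eq_of_add_eq_zero_right hAB').symm
  have hq : QTriple ![A, B, A * B] := by
    refine ⟨fun a ↦ ?_, rfl, hBA⟩
    fin_cases a
    · exact hA2
    · exact hB2
    · change A * B * (A * B) = -1
      exact mul_self_mul_eq_neg_one hA2 hB2 hBA
  refine ⟨_, hq, rfl, ?_⟩
  refine Submodule.eq_of_le_of_finrank_eq (Submodule.span_le.2 ?_) (by rw [hq.finrank_span hn, h.finrank_span hn])
  rintro _ ⟨i, rfl⟩
  fin_cases i
  · exact hA
  · exact hBm
  · exact mul_mem_of_anticomm h hA hBm ((add_comm _ _).trans hAB')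

end QTriple

/-- The torsion in coordinates, as a bilinear map. -/
def torL (Γ : Model n → Model n →L[ℝ] Model n →L[ℝ] Model n) (p : Model n) :
    Model n →L[ℝ] Model n →L[ℝ] Model n := Γ p - (Γ p).flip

lemma obst_torL (Γ : Model n → Model n →L[ℝ] Model n →L[ℝ] Model n) (p : Model n) (A : EndModel n) (X Y : Model n) :
    QTriple.obst (torL Γ p) A X Y = tE Γ p A X Y := rfl

lemma mlieBracket_coordVF {x₀ y : M} (hy : y ∈ dom n x₀) (v w : Model n) :
    VectorField.mlieBracket (𝓡 (4 * n)) (coordVF x₀ v) (coordVF x₀ w) y = 0 := by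
  have : IsManifold (𝓡 (4 * n)) (minSmoothness ℝ 2) M := by
    rw [minSmoothness_of_isRCLikeNormedField]
    exact IsManifold.of_le (n := ∞) (WithTop.coe_le_coe.2 (le_top : (2 : ℕ∞) ≤ ⊤))
  have : IsManifold (𝓡 (4 * n)) (minSmoothness ℝ 3) M := by
    rw [minSmoothness_of_isRCLikeNormedField]
    exact IsManifold.of_le (n := ∞) (WithTop.coe_le_coe.2 (le_top : (3 : ℕ∞) ≤ ⊤))
  let V : Model n → ∀ q : Model n, TangentSpace 𝓘(ℝ, Model n) q := fun v _ ↦ v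
  have key : ∀ v : Model n, coordVF x₀ v =ᶠ[𝓝 y]
      VectorField.mpullback (𝓡 (4 * n)) 𝓘(ℝ, Model n) (crd n x₀) (V v) := fun v ↦ by
    filter_upwards [(chartAt (Model n) x₀).open_source.mem_nhds hy] with w hw
    have h1 : (tcInv (n := n) x₀ w).comp (tc x₀ w) = ContinuousLinearMap.id ℝ _ := by
      ext1 u; exact tcoordInv_tcoord hw u
    have h2 : (tc (n := n) x₀ w).comp (tcInv x₀ w) = ContinuousLinearMap.id ℝ _ := by
      ext1 u; exact tcoord_tcoordInv hw u
    have h3 := ContinuousLinearMap.inverse_eq h2 h1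
    exact (congrArg (fun L ↦ L v) h3).symm
  rw [(key v).mlieBracket_vectorField_eq (key w)]
  have hc : ∀ v : Model n, MDifferentiableAt 𝓘(ℝ, Model n) (𝓘(ℝ, Model n)).tangent
      (fun q ↦ (⟨q, V v q⟩ : TangentBundle 𝓘(ℝ, Model n) (Model n))) (crd n x₀ y) := fun v ↦ by
    have : ContMDiffAt 𝓘(ℝ, Model n) (𝓘(ℝ, Model n)).tangent 1
        (fun q ↦ (⟨q, V v q⟩ : TangentBundle 𝓘(ℝ, Model n) (Model n))) (crd n x₀ y) := by
      rw [contMDiffAt_vectorSpace_iff_contDiffAt]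
      exact contDiffAt_const
    exact this.mdifferentiableAt (by simp)
  rw [← VectorField.mpullback_mlieBracket (n := 2) (hc v) (hc w)
    ((contMDiffAt_extChartAt' hy).of_le (WithTop.coe_le_coe.2 (le_top : (2 : ℕ∞) ≤ ⊤))) (by simp)]
  have h0 : VectorField.mlieBracket 𝓘(ℝ, Model n) (V v) (V w) (crd n x₀ y) = 0 := by
    rw [← VectorField.mlieBracketWithin_univ, VectorField.mlieBracketWithin_eq_lieBracketWithin, VectorField.lieBracketWithin_univ]
    simp only [VectorField.lieBracket, fderiv_fun_const, Pi.zero_apply, zero_apply, sub_self]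
    rfl
  rw [VectorField.mpullback_apply, h0]
  exact map_zero _

lemma tc_conn_coordVF (D : Connection n M) {x₀ y : M} (hy : y ∈ dom n x₀) (v : Model n) (X : TM n M y) :
    tc x₀ y (D (coordVF x₀ v) y X) = christoffel D x₀ (crd n x₀ y) (tc x₀ y X) v := by
  have h0 : vfCoord (𝓡 (4 * n)) x₀ (coordVF x₀ v) =ᶠ[𝓝 (crd n x₀ y)] fun _ ↦ v := by
    filter_upwards [target_mem_nhds (crd_mem_target hy)] with r hr using vfCoord_coordVF hr v
  rw [tc_conn D hy (smooth_coordVF hy v).mdiff, h0.fderiv_eq, coordVF, tcoord_tcoordInv hy]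
  simp

lemma tc_torsion (D : Connection n M) {x₀ y : M} (hy : y ∈ dom n x₀) (X Y : TM n M y) :
    tc x₀ y (D.torsion y X Y) = torE (christoffel D x₀) (crd n x₀ y) (tc x₀ y X) (tc x₀ y Y) := by
  have hX : coordVF x₀ (tc x₀ y X) y = X := tcoordInv_tcoord hy X
  have hY : coordVF x₀ (tc x₀ y Y) y = Y := tcoordInv_tcoord hy Y
  have h := D.torsion_apply (smooth_coordVF hy (tc x₀ y X)).mdiff (smooth_coordVF hy (tc x₀ y Y)).mdiff
  rw [mlieBracket_coordVF hy, hX, hY, sub_zero] at h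
  rw [h, map_sub, tc_conn_coordVF D hy, tc_conn_coordVF D hy, torE]

lemma torE_eq_zero {D : Connection n M} (h : D.torsion = 0) {x₀ : M} {p : Model n}
    (hp : p ∈ (crd n x₀).target) (X Y : Model n) : torE (christoffel D x₀) p X Y = 0 := by
  have hp' : (crd n x₀).symm p ∈ dom n x₀ := by simpa using (crd n x₀).map_target hp
  have h1 := tc_torsion D hp' (tcInv x₀ _ X) (tcInv x₀ _ Y)
  rw [tcoord_tcoordInv hp', tcoord_tcoordInv hp', (crd n x₀).right_inv hp] at h1
  rw [← h1, h]
  exact map_zero _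

variable [T2Space M] [SigmaCompactSpace M] {Q : AlmostQuaternionicStructure n M} {D D' : Connection n M}

lemma exists_adapted_frame (hn : 1 ≤ n) {x₀ y : M} (hy : y ∈ dom n x₀) {A : EndModel n}
    (hA : (crd n x₀ y, A) ∈ twZ Q x₀) : ∃ J : Fin 3 → EndModel n, QTriple J ∧ J 0 = A ∧
      fibE Q x₀ (crd n x₀ y) = Submodule.span ℝ (range J) := by
  obtain ⟨J, -, hJQ⟩ := exists_frame Q hy
  obtain ⟨hJ0, hJs⟩ := hJQ.self_of_nhds
  obtain ⟨hA1, hA2⟩ := hA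
  simp only [hJs] at hA1
  obtain ⟨J', h1, h2, h3⟩ := hJ0.exists_adapted hn hA1 hA2
  exact ⟨J', h1, h2, by rw [hJs, h3]⟩

/-- The space `tanE` does not depend on the quaternionic connection. -/
lemma mem_tanE_of_mem_tanE (hn : 1 ≤ n) (hD : Q.IsQuaternionicConnection D) (hD' : Q.IsQuaternionicConnection D')
    {x₀ y : M} (hy : y ∈ dom n x₀) {A : EndModel n} (hA : (crd n x₀ y, A) ∈ twZ Q x₀)
    {w : Model n × EndModel n} (hw : w ∈ tanE Q D x₀ (crd n x₀ y, A)) :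
    w ∈ tanE Q D' x₀ (crd n x₀ y, A) := by
  obtain ⟨c, hc, h0, hcZ⟩ := exists_curve hn hD (crd_mem_target hy) hA hw
  have h := curve_mem_tanE hn hD' hy hc.differentiableAt (by rw [h0]) hcZ
  rwa [hc.deriv, h0] at h

/-- For the difference `L = [Γ' - Γ, A]` of two connections for which `tE` vanishes, `A ∘ L X - L (A X)` is symmetric in `X`
and the argument. -/
lemma adE_sub_symm {Γ Γ' : Model n → Model n →L[ℝ] Model n →L[ℝ] Model n} {p : Model n} {A : EndModel n}
    (hA : ∀ v, A (A v) = -v) {L : Model n → EndModel n} (hL : ∀ X, L X = adE Γ' p A X - adE Γ p A X)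
    (ht : ∀ X Y, tE Γ p A X Y = 0) (ht' : ∀ X Y, tE Γ' p A X Y = 0) (X Y : Model n) :
    A (L X Y) - L (A X) Y = A (L Y X) - L (A Y) X := by
  have h1 := ht X Y
  have h2 := ht' X Y
  simp only [tE, torE, map_sub] at h1 h2
  simp only [hL, adE, sub_apply, mul_apply_eq_comp, map_sub, hA]
  linear_combination (norm := module) h1 - h2

lemma iE_snd_sub {R : Type*} [Ring R] {A B a a' b b' : R} (h : A * (a' - a) - (b' - b) = 0) :
    A * (B + a') - b' = A * (B + a) - b := by
  rw [mul_sub] at h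
  rw [← sub_eq_zero, mul_add, mul_add, ← h]
  abel

lemma adE_sub_mem (hn : 1 ≤ n) (hD : Q.IsQuaternionicConnection D) (hD' : Q.IsQuaternionicConnection D')
    {x₀ y : M} (hy : y ∈ dom n x₀) {A : EndModel n} (hA : (crd n x₀ y, A) ∈ twZ Q x₀) (X : Model n) :
    adE (christoffel D' x₀) (crd n x₀ y) A X - adE (christoffel D x₀) (crd n x₀ y) A X ∈ fibE Q x₀ (crd n x₀ y) ∧
    (adE (christoffel D' x₀) (crd n x₀ y) A X - adE (christoffel D x₀) (crd n x₀ y) A X) * A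
      + A * (adE (christoffel D' x₀) (crd n x₀ y) A X - adE (christoffel D x₀) (crd n x₀ y) A X) = 0 := by
  have h1 := mem_tanE_of_mem_tanE hn hD hD' hy hA (horizontal_mem_tanE (Q := Q) (D := D) (x₀ := x₀)
    (crd n x₀ y, A) X)
  have h2 : covE (christoffel D' x₀) (crd n x₀ y) A X (-adE (christoffel D x₀) (crd n x₀ y) A X) =
      adE (christoffel D' x₀) (crd n x₀ y) A X - adE (christoffel D x₀) (crd n x₀ y) A X := by
    rw [covE_eq]; abel
  rw [← h2]
  exact h1

/-- If the torsion conditions hold for two quaternionic connections, then these define the same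
almost complex structure. -/
lemma iE_eq_of_tE_eq_zero (hn : 1 ≤ n) (hD : Q.IsQuaternionicConnection D) (hD' : Q.IsQuaternionicConnection D')
    {x₀ y : M} (hy : y ∈ dom n x₀) {A : EndModel n} (hA : (crd n x₀ y, A) ∈ twZ Q x₀)
    (ht : ∀ X Y, tE (christoffel D x₀) (crd n x₀ y) A X Y = 0)
    (ht' : ∀ X Y, tE (christoffel D' x₀) (crd n x₀ y) A X Y = 0) (w : Model n × EndModel n) :
    iE (christoffel D' x₀) (crd n x₀ y, A) w = iE (christoffel D x₀) (crd n x₀ y, A) w := by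
  obtain ⟨J, hJ, rfl, hJs⟩ := exists_adapted_frame hn hy hA
  have hLm := adE_sub_mem hn hD hD' hy hA
  rw [hJs] at hLm
  obtain ⟨L, hL⟩ : ∃ L : Model n → EndModel n, ∀ X, L X =
    adE (christoffel D' x₀) (crd n x₀ y) (J 0) X - adE (christoffel D x₀) (crd n x₀ y) (J 0) X :=
    ⟨_, fun _ ↦ rfl⟩
  have hLs := adE_sub_symm (fun v ↦ (hJ.app v).1) hL ht ht'
  simp only [← hL] at hLm
  have hJm : J 0 ∈ Submodule.span ℝ (range J) := Submodule.subset_span ⟨0, rfl⟩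
  -- The difference of the two structures `I₁` is given by `A ∘ L X - L (A X)`.  It has values in `𝒬`, anticommutes with
  -- `A`, and is symmetric, hence it vanishes.
  have hKm : ∀ X, ∃ k l : ℝ, ∀ Y, (J 0 * L X - L (J 0 X)) Y = k • J 1 Y + l • J 2 Y := fun X ↦ by
    obtain ⟨h1, h2⟩ := hLm X
    obtain ⟨h3, h4⟩ := hLm (J 0 X)
    refine hJ.eq_of_anticomm hn ?_ ?_
    · exact Submodule.sub_mem _ (mul_mem_of_anticomm hJ hJm h1 h2) h3
    · have e : (J 0 * L X - L (J 0 X)) * J 0 + J 0 * (J 0 * L X - L (J 0 X)) = J 0 * (L X * J 0 + J 0 * L X)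
          - (L (J 0 X) * J 0 + J 0 * L (J 0 X)) := by
        rw [sub_mul, mul_sub, mul_add, mul_assoc]; abel
      rw [e, h2, h4, mul_zero, sub_zero]
  have hK0 := hJ.eq_zero_of_symm (K := fun X ↦ J 0 * L X - L (J 0 X)) hKm hLs w.1
  simp only [hL] at hK0
  rw [iE_apply, iE_apply, iE_snd_sub hK0]

/-- Two quaternionic connections that satisfy the torsion condition define the same almost complex structure. -/
lemma isI₁_unique (hn : 1 ≤ n) (hD : Q.IsQuaternionicConnection D) (hD' : Q.IsQuaternionicConnection D')
    {I I' : Q.TwistorAlmostComplexStructure} (hI : I.IsI₁ D) (hI' : I'.IsI₁ D')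
    (ht : ∀ z ∈ Q.twistorSpace, ∀ X Y : Model n,
      tE (christoffel D z.1) (endCrd z.1 z).1 (endCrd z.1 z).2 X Y = 0)
    (ht' : ∀ z ∈ Q.twistorSpace, ∀ X Y : Model n,
      tE (christoffel D' z.1) (endCrd z.1 z).1 (endCrd z.1 z).2 X Y = 0) : I' = I := by
  have h : I'.toEnd = I.toEnd := by
    ext1 ⟨z, hz⟩
    ext1 W
    have hzd : z.1 ∈ dom n z.1 := mem_chart_source _ _
    apply Subtype.ext
    apply vc_injective hzd
    rw [vc_isI₁ hn hD' hI' hz hzd, vc_isI₁ hn hD hI hz hzd]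
    have h1 := (mem_twistorSpace_iff hzd).1 hz
    have h2 := ht z hz
    have h3 := ht' z hz
    rw [endCrd_eq hzd] at h1 h2 h3 ⊢
    exact iE_eq_of_tE_eq_zero hn hD hD' hzd h1 h2 h3 _
  cases I; cases I'
  congr

end

section
/-! ### The first Bianchi identity in dimension at least eight -/

variable {n : ℕ} {M : Type*} [TopologicalSpace M] [ChartedSpace (Model n) M]
  [IsManifold (𝓡 (4 * n)) ∞ M]

lemma commutator_anticomm {R : Type*} [Ring R] {A B : R} (hA : A * A = -1) :
    (B * A - A * B) * A + A * (B * A - A * B) = 0 := by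
  have h1 : B * A * A = -B := by rw [mul_assoc, hA]; simp
  have h2 : A * (A * B) = -B := by rw [← mul_assoc, hA]; simp
  rw [sub_mul, mul_sub, h1, h2, mul_assoc]; abel

/-- The bracket of two horizontal fields is given by the curvature. -/
lemma lieBracket_horizontal {Γ : Model n → Model n →L[ℝ] Model n →L[ℝ] Model n} {q : Model n × EndModel n}
    (hΓ : DifferentiableAt ℝ Γ q.1)
    (hd : ∀ X : Model n, DifferentiableAt ℝ (fun q : Model n × EndModel n ↦ (X, -adE Γ q.1 q.2 X)) q)
    (X Y : Model n) :
    VectorField.lieBracket ℝ (fun q : Model n × EndModel n ↦ (X, -adE Γ q.1 q.2 X))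
      (fun q : Model n × EndModel n ↦ (Y, -adE Γ q.1 q.2 Y)) q =
      (0, -(curE Γ q.1 X Y * q.2 - q.2 * curE Γ q.1 X Y)) := by
  have key : ∀ (Y : Model n) (v : Model n × EndModel n),
      fderiv ℝ (fun q : Model n × EndModel n ↦ (Y, -adE Γ q.1 q.2 Y)) q v =
      (0, -((fderiv ℝ Γ q.1 v.1 Y * q.2 - q.2 * fderiv ℝ Γ q.1 v.1 Y) + (Γ q.1 Y * v.2 - v.2 * Γ q.1 Y))) := by
    intro Y v
    have hl : HasDerivAt (fun t : ℝ ↦ q + t • v) v 0 := by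
      simpa using ((hasDerivAt_id (0 : ℝ)).smul_const v).const_add q
    have h0 : q + (0 : ℝ) • v = q := (congrArg _ (zero_smul ℝ v)).trans (add_zero _)
    have hd' : HasFDerivAt (fun q : Model n × EndModel n ↦ (Y, -adE Γ q.1 q.2 Y))
        (fderiv ℝ (fun q : Model n × EndModel n ↦ (Y, -adE Γ q.1 q.2 Y)) q) (q + (0 : ℝ) • v) := by
      rw [h0]; exact (hd Y).hasFDerivAt
    have h1 := HasFDerivAt.comp_hasDerivAt (0 : ℝ) hd' hl
    have h2 := hasDerivAt_adE (Γ := Γ) (c := fun t : ℝ ↦ q + t • v) (X := fun _ ↦ Y) (X' := 0)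
      (by rw [h0]; exact hΓ) hl (hasDerivAt_const _ _)
    have h3 := (hasDerivAt_const (0 : ℝ) Y).prodMk h2.fun_neg
    have h4 := h1.unique h3
    rw [h4, h0]
    refine Prod.ext rfl ?_
    simp [adE]
  rw [VectorField.lieBracket, key, key]
  refine Prod.ext (sub_self _) ?_
  have hr : ∀ {R : Type _} [Ring R] (dX dY gX gY A : R),
      -((dX * A - A * dX) + (gY * -(gX * A - A * gX) - -(gX * A - A * gX) * gY))
      - -((dY * A - A * dY) + (gX * -(gY * A - A * gY) - -(gY * A - A * gY) * gX)) =
      -((dX - dY + (gX * gY - gY * gX)) * A - A * (dX - dY + (gX * gY - gY * gX))) := by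
    intro R _ dX dY gX gY A
    noncomm_ring
  exact hr _ _ _ _ _

variable {Γ : Model n → Model n →L[ℝ] Model n →L[ℝ] Model n} {p : Model n}

/-- The first Bianchi identity. -/
lemma curE_bianchi (hΓ : DifferentiableAt ℝ Γ p) (ht : ∀ᶠ r in 𝓝 p, ∀ X Y, torE Γ r X Y = 0) (X Y Z : Model n) :
    curE Γ p X Y Z + curE Γ p Y Z X + curE Γ p Z X Y = 0 := by
  have h0 : ∀ X Y, Γ p X Y = Γ p Y X := fun X Y ↦ sub_eq_zero.1 (ht.self_of_nhds X Y)
  have h1 : ∀ X Y Z, fderiv ℝ Γ p X Y Z = fderiv ℝ Γ p X Z Y := by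
    have h2 : ∀ X Y Z, fderiv ℝ (fun r ↦ Γ r Y Z) p X = fderiv ℝ Γ p X Y Z := fun X Y Z ↦ by
      have h3 : HasFDerivAt (fun r ↦ Γ r Y Z) ((fderiv ℝ Γ p).flip Y |>.flip Z) p := by
        have := (hΓ.hasFDerivAt.clm_apply (hasFDerivAt_const Y p)).clm_apply (hasFDerivAt_const Z p)
        refine this.congr_fderiv ?_
        ext1 X; simp
      rw [h3.fderiv]; rfl
    intro X Y Z
    rw [← h2, ← h2]
    congr 1
    refine Filter.EventuallyEq.fderiv_eq ?_
    filter_upwards [ht] with r hr using sub_eq_zero.1 (hr Y Z)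
  simp only [curE, add_apply, sub_apply, mul_apply_eq_comp]
  rw [h1 X Y Z, h1 Y X Z, h1 Y Z X, h1 Z Y X, h0 Y Z, h0 X Z, h0 Y X]
  abel

/-- The curvature obstruction inherits the first Bianchi identity from the curvature. -/
lemma eE_bianchi (hb : ∀ X Y Z, curE Γ p X Y Z + curE Γ p Y Z X + curE Γ p Z X Y = 0) {A : EndModel n}
    (hA : ∀ v, A (A v) = -v) (X Y Z : Model n) :
    eE Γ p A X Y Z + eE Γ p A Y Z X + eE Γ p A Z X Y = 0 := by
  have b1 := congrArg A (hb X Y Z)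
  have b2 := hb (A X) (A Y) (A Z)
  have b3 := hb X Y (A Z)
  have b4 := hb X (A Y) Z
  have b5 := hb (A X) Y Z
  have b6 := congrArg A (hb X (A Y) (A Z))
  have b7 := congrArg A (hb (A X) Y (A Z))
  have b8 := congrArg A (hb (A X) (A Y) Z)
  simp only [map_add, map_zero] at b1 b6 b7 b8
  simp only [eE, add_apply, sub_apply, mul_apply_eq_comp, map_add, map_sub, hA]
  linear_combination (norm := module) -b1 - b2 + b3 + b4 + b5 + b6 + b7 + b8

namespace QTriple

/-- In dimension at least eight, a two-form with values in `span (J 1, J 2)` that satisfies the first Bianchi identity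
vanishes. -/
lemma eq_zero_of_bianchi {J : Fin 3 → EndModel n} (h : QTriple J) (hn : 2 ≤ n)
    {E : Model n → Model n → EndModel n}
    (hE : ∀ X Y, ∃ k l : ℝ, ∀ Z, E X Y Z = k • J 1 Z + l • J 2 Z)
    (hb : ∀ X Y Z, E X Y Z + E Y Z X + E Z X Y = 0) (X Y : Model n) : E X Y = 0 := by
  by_contra hne
  obtain ⟨k, l, hkl⟩ := hE X Y
  have hkl0 : k * k + l * l ≠ 0 := fun h0 ↦ hne <| by
    have hk : k = 0 := mul_self_eq_zero.1 (by linarith [mul_self_nonneg k, mul_self_nonneg l])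
    have hl : l = 0 := mul_self_eq_zero.1 (by linarith [mul_self_nonneg k, mul_self_nonneg l])
    ext1 Z
    rw [hkl, hk, hl]; simp
  -- If `E X Y` is not zero, it is invertible, but by the Bianchi identity its image lies in the span of `J 1 X`, `J 2 X`,
  -- `J 1 Y`, `J 2 Y`.
  have hsurj : ∀ W, ∃ Z, E X Y Z = W := fun W ↦ by
    refine ⟨(-(k * k + l * l)⁻¹) • (k • J 1 W + l • J 2 W), ?_⟩
    obtain ⟨e0, e1, e2, e3, e4, e5, e6, e7, e8⟩ := h.app W
    rw [hkl]
    simp only [map_smul, map_add, e1, e2, e5, e6]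
    have : (k * k + l * l)⁻¹ * (k * k + l * l) = 1 := inv_mul_cancel₀ hkl0
    have h2 : W = ((k * k + l * l)⁻¹ * (k * k + l * l)) • W := by rw [this, one_smul]
    conv_rhs => rw [h2]
    module
  have htop : (⊤ : Submodule ℝ (Model n)) ≤ Submodule.span ℝ (range ![J 1 X, J 2 X, J 1 Y, J 2 Y]) := by
    intro W _
    obtain ⟨Z, rfl⟩ := hsurj W
    obtain ⟨a, b, h1⟩ := hE Y Z
    obtain ⟨c, d, h2⟩ := hE Z X
    have h3 : E X Y Z = -(a • J 1 X + b • J 2 X) - (c • J 1 Y + d • J 2 Y) := by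
      rw [← h1, ← h2, ← sub_eq_zero, ← hb X Y Z]; abel
    rw [h3]
    have hm : ∀ i, ![J 1 X, J 2 X, J 1 Y, J 2 Y] i ∈ Submodule.span ℝ (range ![J 1 X, J 2 X, J 1 Y, J 2 Y]) :=
      fun i ↦ Submodule.subset_span ⟨i, rfl⟩
    exact Submodule.sub_mem _ (Submodule.neg_mem _ (Submodule.add_mem _ (Submodule.smul_mem _ _ (hm 0))
      (Submodule.smul_mem _ _ (hm 1)))) (Submodule.add_mem _ (Submodule.smul_mem _ _ (hm 2))
      (Submodule.smul_mem _ _ (hm 3)))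
  have h1 : Module.finrank ℝ (Submodule.span ℝ (range ![J 1 X, J 2 X, J 1 Y, J 2 Y])) ≤ 4 :=
    finrank_range_le_card _
  rw [top_le_iff.1 htop, finrank_top, finrank_euclideanSpace, Fintype.card_fin] at h1
  omega

end QTriple

variable [T2Space M] [SigmaCompactSpace M] {Q : AlmostQuaternionicStructure n M} {D : Connection n M}

set_option synthInstance.maxHeartbeats 200000 in
/-- The curvature of a quaternionic connection normalizes `𝒬`: the vector `[R(X, Y), A]` is, up to sign, the bracket of two
horizontal fields on the twistor space, hence tangent to it. -/
lemma curE_commutator_mem (hn : 1 ≤ n) (hD : Q.IsQuaternionicConnection D) {x₀ y : M} (hy : y ∈ dom n x₀)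
    {A : EndModel n} (hA : (crd n x₀ y, A) ∈ twZ Q x₀) (X Y : Model n) :
    curE (christoffel D x₀) (crd n x₀ y) X Y * A - A * curE (christoffel D x₀) (crd n x₀ y) X Y ∈
      fibE Q x₀ (crd n x₀ y) := by
  have hΓ := (contDiffOn_christoffel hD.smooth x₀).contDiffAt (target_mem_nhds (crd_mem_target hy))
  have hd : ∀ X : Model n, DifferentiableAt ℝ
      (fun q : Model n × EndModel n ↦ (X, -adE (christoffel D x₀) q.1 q.2 X)) (crd n x₀ y, A) := fun X ↦ by
    have h1 : DifferentiableAt ℝ (fun q : Model n × EndModel n ↦ christoffel D x₀ q.1) (crd n x₀ y, A) :=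
      DifferentiableAt.comp (f := fun q : Model n × EndModel n ↦ q.1) (g := christoffel D x₀) (crd n x₀ y, A)
        (hΓ.differentiableAt (by simp)) differentiableAt_fst
    have h2 : DifferentiableAt ℝ (fun q : Model n × EndModel n ↦ q.2) (crd n x₀ y, A) := differentiableAt_snd
    have h3 := h1.clm_apply (differentiableAt_const X)
    exact (differentiableAt_const X).prodMk ((h3.mul h2).sub (h2.mul h3)).neg
  have h := lieBracket_mem_tanE hn hD hy hA (hd X) (hd Y)
    (Eventually.of_forall fun q _ ↦ horizontal_mem_tanE q X)
    (Eventually.of_forall fun q _ ↦ horizontal_mem_tanE q Y)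
  rw [lieBracket_horizontal (q := (crd n x₀ y, A)) (hΓ.differentiableAt (by simp)) hd] at h
  have h1 := h.1
  simp only [covE, map_zero, zero_mul, mul_zero, sub_zero, add_zero] at h1
  exact (Submodule.neg_mem_iff _).1 h1

/-- The curvature obstruction at `J 0` takes values in `span (J 1, J 2)`. -/
lemma exists_eE_eq (hn : 1 ≤ n) (hD : Q.IsQuaternionicConnection D) {x₀ y : M}
    (hy : y ∈ dom n x₀) {J : Fin 3 → EndModel n} (hJ : QTriple J) (hA : (crd n x₀ y, J 0) ∈ twZ Q x₀)
    (hJs : fibE Q x₀ (crd n x₀ y) = Submodule.span ℝ (range J)) (X Y : Model n) :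
    ∃ k l : ℝ, ∀ Z, eE (christoffel D x₀) (crd n x₀ y) (J 0) X Y Z = k • J 1 Z + l • J 2 Z := by
  have hc := curE_commutator_mem hn hD hy hA
  rw [hJs] at hc
  have hJm : J 0 ∈ Submodule.span ℝ (range J) := Submodule.subset_span ⟨0, rfl⟩
  refine hJ.eq_of_anticomm hn ?_ ?_
  · have ha := Submodule.add_mem _ (hc (J 0 X) Y) (hc X (J 0 Y))
    refine Submodule.add_mem _ (Submodule.sub_mem _ (hc _ _) (hc _ _)) (mul_mem_of_anticomm hJ hJm ha ?_)
    rw [add_mul, mul_add, add_add_add_comm, commutator_anticomm (hJ.sq 0), commutator_anticomm (hJ.sq 0), add_zero]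
  · have hr : ∀ {R : Type _} [Ring R] {A C1 C2 C3 C4 : R}, C1 * A + A * C1 = 0 → C2 * A + A * C2 = 0 →
        C3 * A + A * C3 = 0 → C4 * A + A * C4 = 0 →
        (C1 - C2 + A * (C3 + C4)) * A + A * (C1 - C2 + A * (C3 + C4)) = 0 := by
      intro R _ A C1 C2 C3 C4 h1 h2 h3 h4
      have : (C1 - C2 + A * (C3 + C4)) * A + A * (C1 - C2 + A * (C3 + C4)) =
        (C1 * A + A * C1) - (C2 * A + A * C2) + A * ((C3 * A + A * C3) + (C4 * A + A * C4)) := by noncomm_ring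
      rw [this, h1, h2, h3, h4]; simp
    exact hr (commutator_anticomm (hJ.sq 0)) (commutator_anticomm (hJ.sq 0)) (commutator_anticomm (hJ.sq 0))
      (commutator_anticomm (hJ.sq 0))

/-- In dimension at least eight, the curvature obstruction vanishes for torsion-free quaternionic
connections. -/
lemma eE_eq_zero_of_torsion (hn : 2 ≤ n) (hD : Q.IsQuaternionicConnection D) (ht : D.torsion = 0) {x₀ y : M}
    (hy : y ∈ dom n x₀) {A : EndModel n} (hA : (crd n x₀ y, A) ∈ twZ Q x₀) (X Y : Model n) :
    eE (christoffel D x₀) (crd n x₀ y) A X Y = 0 := by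
  have hn1 : 1 ≤ n := le_trans one_le_two hn
  obtain ⟨J, hJ, rfl, hJs⟩ := exists_adapted_frame hn1 hy hA
  have hΓ := (contDiffOn_christoffel hD.smooth x₀).contDiffAt (target_mem_nhds (crd_mem_target hy))
  have hb := curE_bianchi (hΓ.differentiableAt (by simp))
    (by filter_upwards [target_mem_nhds (crd_mem_target hy)] with r hr using torE_eq_zero ht hr)
  exact hJ.eq_zero_of_bianchi hn (E := fun X Y ↦ eE (christoffel D x₀) (crd n x₀ y) (J 0) X Y)
    (exists_eE_eq hn1 hD hy hJ hA hJs) (eE_bianchi hb fun v ↦ (hJ.app v).1) X Y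

end

section
/-! ### Torsion-free quaternionic connections -/

variable {n : ℕ} {M : Type*} [TopologicalSpace M] [ChartedSpace (Model n) M]
  [IsManifold (𝓡 (4 * n)) ∞ M]

set_option synthInstance.maxHeartbeats 200000 in
lemma contDiffAt_flip {E F G H : Type*} [NormedAddCommGroup E] [NormedSpace ℝ E] [NormedAddCommGroup F]
    [NormedSpace ℝ F] [NormedAddCommGroup G] [NormedSpace ℝ G] [NormedAddCommGroup H] [NormedSpace ℝ H]
    {k : ℕ∞ω} {f : H → E →L[ℝ] F →L[ℝ] G} {x : H} (hf : ContDiffAt ℝ k f x) :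
    ContDiffAt ℝ k (fun p ↦ (f p).flip) x := by
  have h := LinearIsometryEquiv.contDiff (𝕜 := ℝ) (n := k) (E := E →L[ℝ] F →L[ℝ] G) (F := F →L[ℝ] E →L[ℝ] G)
    (ContinuousLinearMap.flipₗᵢ ℝ E F G)
  exact h.contDiffAt.comp x hf

/-- The tensor at `y` with components `G` in the chart around `x₀`.  The argument that is differentiated by the connection
comes first. -/
def unhatT (x₀ y : M) (G : Model n →ₗ[ℝ] EndModel n) : TM n M y →L[ℝ] EndT n M y :=
  haveI : FiniteDimensional ℝ (TM n M y) := inferInstanceAs (FiniteDimensional ℝ (Model n))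
  haveI : T2Space (TM n M y) := inferInstanceAs (T2Space (Model n))
  LinearMap.toContinuousLinearMap
    { toFun := fun w ↦ unhatE x₀ y (G (tc x₀ y w))
      map_add' := fun v w ↦ by
        ext1 X
        simp only [unhatE, ContinuousLinearMap.comp_apply, map_add, add_apply]
      map_smul' := fun c v ↦ by
        ext1 X
        simp only [unhatE, ContinuousLinearMap.comp_apply, map_smul, smul_apply, RingHom.id_apply] }

lemma unhatT_apply (x₀ y : M) (G : Model n →ₗ[ℝ] EndModel n) (w : TM n M y) :
    unhatT x₀ y G w = unhatE x₀ y (G (tc x₀ y w)) := rfl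

lemma unhatT_apply_apply (x₀ y : M) (G : Model n →ₗ[ℝ] EndModel n) (w X : TM n M y) :
    unhatT x₀ y G w X = tcInv x₀ y (G (tc x₀ y w) (tc x₀ y X)) := rfl

/-- The torsion after adding a tensor to the connection. -/
lemma torsion_add (D D' : Connection n M) {x : M} {A : TM n M x →L[ℝ] EndT n M x}
    (h : ∀ σ, D' σ x = D σ x + A (σ x)) (X Y : TM n M x) :
    D'.torsion x X Y = D.torsion x X Y + (A Y X - A X Y) := by
  have hx : x ∈ dom n x := mem_chart_source _ _
  have hX : coordVF x (tc x x X) x = X := tcoordInv_tcoord hx X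
  have hY : coordVF x (tc x x Y) x = Y := tcoordInv_tcoord hx Y
  have h1 := D.torsion_apply (smooth_coordVF hx (tc x x X)).mdiff (smooth_coordVF hx (tc x x Y)).mdiff
  have h2 := D'.torsion_apply (smooth_coordVF hx (tc x x X)).mdiff (smooth_coordVF hx (tc x x Y)).mdiff
  rw [hX, hY] at h1 h2
  rw [h1, h2, h, h, hX, hY]
  simp only [add_apply]
  abel

/-- Tensors that are characterized pointwise, and that are smooth in coordinates, can be added to a smooth connection.
Uniqueness makes the local tensors fit together. -/
lemma exists_connection_add {D : Connection n M} (hD : IsSmoothConnection D)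
    (P : ∀ x : M, (TM n M x →L[ℝ] EndT n M x) → Prop)
    (huniq : ∀ x A A', P x A → P x A' → A = A')
    (hloc : ∀ x : M, ∃ G : Model n → Model n →ₗ[ℝ] EndModel n,
      (∀ v : Model n → Model n, ContDiffAt ℝ ∞ v (crd n x x) → ContDiffAt ℝ ∞ (fun p ↦ G p (v p)) (crd n x x)) ∧
      ∀ᶠ p in 𝓝 (crd n x x), P ((crd n x).symm p) (unhatT x ((crd n x).symm p) (G p))) :
    ∃ (D' : Connection n M) (A : ∀ x, TM n M x →L[ℝ] EndT n M x), IsSmoothConnection D' ∧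
      (∀ x, P x (A x)) ∧ ∀ σ x, D' σ x = D σ x + A x (σ x) := by
  have hex : ∀ x, ∃ A, P x A := fun x ↦ by
    obtain ⟨G, -, hG⟩ := hloc x
    have h := hG.self_of_nhds
    rw [crd_symm_crd (mem_chart_source _ _)] at h
    exact ⟨_, h⟩
  choose A hA using hex
  refine ⟨D.addOneForm A, A, ⟨⟨fun {σ} hσ y _ ↦ ?_⟩⟩, hA, fun _ _ ↦ rfl⟩
  refine ContMDiffAt.contMDiffWithinAt ?_
  have hy : y ∈ dom n y := mem_chart_source _ _
  change SmoothEndAt (fun y ↦ D σ y + A y (σ y)) y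
  have hσ' : SmoothVFAt σ y := (hσ.contMDiffAt univ_mem).of_le le_self_add
  have hDσ : SmoothEndAt (fun y ↦ D σ y) y := (hD.contMDiff.contMDiff hσ).contMDiffAt univ_mem
  obtain ⟨G, hG, hGP⟩ := hloc y
  rw [smoothEndAt_iff hy] at hDσ ⊢
  rw [smoothVFAt_iff hy] at hσ'
  refine (hDσ.add (hG _ hσ')).congr_of_eventuallyEq ?_
  filter_upwards [hGP, target_mem_nhds (crd_mem_target hy)] with p hp hpt
  have hp' : (crd n y).symm p ∈ dom n y := by simpa using (crd n y).map_target hpt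
  rw [hatF, hatE_add, huniq _ _ _ (hA _) hp, unhatT_apply, hatE_unhatE hp']
  rfl

variable [T2Space M] [SigmaCompactSpace M] {Q : AlmostQuaternionicStructure n M} {D : Connection n M}

lemma QTriple.corr_comm_of_mem {t : Model n →L[ℝ] Model n →L[ℝ] Model n} {J : Fin 3 → EndModel n}
    (h : QTriple J) (h0 : ∀ X Y, obst t (J 0) X Y = 0) {K : EndModel n} (hK : K ∈ Submodule.span ℝ (range J))
    (X Y : Model n) : corr t J X (K Y) = K (corr t J X Y) := by
  obtain ⟨c, rfl⟩ := (Submodule.mem_span_range_iff_exists_fun ℝ).1 hK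
  have hsum : ∀ v, (∑ i, c i • J i) v = c 0 • J 0 v + c 1 • J 1 v + c 2 • J 2 v := fun v ↦ by
    rw [Fin.sum_univ_three]; rfl
  have hlin : ∀ (a b c : ℝ) (u v w : Model n), corr t J X (a • u + b • v + c • w) =
      a • corr t J X u + b • corr t J X v + c • corr t J X w := fun a b c u v w ↦ by
    simp only [corr, corrAux, map_add, map_smul]
    module
  rw [hsum, hsum, hlin, h.corr_comm t h0, h.corr_comm t h0, h.corr_comm t h0]

/-- The correction tensor `QTriple.corr` for skew `t`, as a linear map of the argument that is differentiated. -/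
def corrL (t : Model n →L[ℝ] Model n →L[ℝ] Model n) (J : Fin 3 → EndModel n) : Model n →ₗ[ℝ] EndModel n where
  toFun w := (1 / 2 : ℝ) • ((t w + J 0 * t w * J 0) - J 1 * (t (J 1 w) + J 0 * t (J 1 w) * J 0))
  map_add' v w := by
    ext1 X
    simp only [smul_apply, sub_apply, add_apply, mul_apply_eq_comp, map_add]
    module
  map_smul' c w := by
    ext1 X
    simp only [smul_apply, sub_apply, add_apply, mul_apply_eq_comp, map_add, map_smul, RingHom.id_apply]
    module

lemma corrL_apply {t : Model n →L[ℝ] Model n →L[ℝ] Model n} (ht : ∀ X Y, t X Y = -t Y X)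
    (J : Fin 3 → EndModel n) (w X : Model n) : corrL t J w X = QTriple.corr t J X w := by
  change (1 / 2 : ℝ) • ((t w X + J 0 (t w (J 0 X))) - J 1 (t (J 1 w) X + J 0 (t (J 1 w) (J 0 X)))) = _
  rw [QTriple.corr, QTriple.corrAux, QTriple.corrAux, ht X, ht (J 0 X), ht X, ht (J 0 X)]
  simp only [map_neg, map_add]
  module

lemma sqrt_two_mem {J : Fin 3 → EndModel n} (h : QTriple J) :
    ((√2)⁻¹ • (J 0 + J 1)) * ((√2)⁻¹ • (J 0 + J 1)) = -1 := by
  refine smul_mul_smul_eq_neg_one (s := 2) ?_ ?_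
  · have hr : ∀ {R : Type _} [Ring R] [Algebra ℝ R] {a b : R}, a * a = -1 → b * b = -1 → b * a = -(a * b) →
        (a + b) * (a + b) = (-2 : ℝ) • 1 := by
      intro R _ _ a b h1 h2 h3
      rw [add_mul, mul_add, mul_add, h1, h2, h3]
      module
    exact hr (h.sq 0) (h.sq 1) (by rw [h.mul10, h.mul01])
  · have : (√2)⁻¹ * (√2)⁻¹ = (1 / 2 : ℝ) := by
      rw [← mul_inv, Real.mul_self_sqrt (by norm_num)]; norm_num
    rw [this]; norm_num

/-- The tensor `A` turns a quaternionic connection into a torsion-free quaternionic connection, at `x`: it commutes with `𝒬`,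
and its skew part cancels the torsion. -/
def IsCorrection (Q : AlmostQuaternionicStructure n M) (D : Connection n M) (x : M)
    (A : TM n M x →L[ℝ] EndT n M x) : Prop :=
  (∀ J ∈ Q.fiber x, ∀ w X, A (J w) X = J (A w X)) ∧ ∀ X Y, A Y X - A X Y = -D.torsion x X Y

lemma isCorrection_unique (x : M) (A A' : TM n M x →L[ℝ] EndT n M x) (h : IsCorrection Q D x A)
    (h' : IsCorrection Q D x A') : A = A' := by
  have hx : x ∈ dom n x := mem_chart_source _ _
  obtain ⟨J, -, hJQ⟩ := exists_frame Q hx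
  obtain ⟨hJ0, hJs⟩ := hJQ.self_of_nhds
  have hJm : ∀ a, unhatE x x (J (crd n x x) a) ∈ Q.fiber x := fun a ↦ by
    rw [← hatE_mem_fibE hx, hatE_unhatE hx, hJs]
    exact Submodule.subset_span ⟨a, rfl⟩
  have key := hJ0.eq_zero_of_symm_of_comm
    (b := fun X Y ↦ tc x x (A (tcInv x x Y) (tcInv x x X) - A' (tcInv x x Y) (tcInv x x X)))
    (fun X Y ↦ by
      have h1 := h.2 (tcInv x x X) (tcInv x x Y)
      have h2 := h'.2 (tcInv x x X) (tcInv x x Y)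
      congr 1
      rw [sub_eq_sub_iff_sub_eq_sub, h1, h2])
    (fun a X Y ↦ by
      have e1 : tcInv x x (J (crd n x x) a Y) = unhatE x x (J (crd n x x) a) (tcInv x x Y) := by
        simp only [unhatE, ContinuousLinearMap.comp_apply, tcoord_tcoordInv hx]
      rw [e1, h.1 _ (hJm a), h'.1 _ (hJm a), ← map_sub, ← hatE_tc hx, hatE_unhatE hx])
  ext w X
  have h3 := key (tc x x X) (tc x x w)
  simp only [tcoordInv_tcoord hx] at h3
  exact sub_eq_zero.1 (tcoord_injective hx (h3.trans (map_zero _).symm))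

lemma isCorrection_corrL {x : M} {p : Model n} (hpt : p ∈ (crd n x).target) {J : Fin 3 → EndModel n}
    (hp : QTriple J) (hps : fibE Q x p = Submodule.span ℝ (range J))
    (ht : ∀ y : M, y ∈ dom n x → ∀ A, (crd n x y, A) ∈ twZ Q x → ∀ X Y,
      tE (christoffel D x) (crd n x y) A X Y = 0) :
    IsCorrection Q D ((crd n x).symm p) (unhatT x ((crd n x).symm p) (corrL (torL (christoffel D x) p) J)) := by
  have hp' : (crd n x).symm p ∈ dom n x := by simpa using (crd n x).map_target hpt
  have hpp : crd n x ((crd n x).symm p) = p := (crd n x).right_inv hpt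
  have htE := ht _ hp'
  rw [hpp] at htE
  have htE' : ∀ A ∈ fibE Q x p, A * A = -1 → ∀ X Y,
      QTriple.obst (torL (christoffel D x) p) A X Y = 0 := fun A h1 h2 X Y ↦
    (obst_torL _ _ _ _ _).trans (htE A ⟨h1, h2⟩ X Y)
  have hm : ∀ a, J a ∈ fibE Q x p := fun a ↦ by rw [hps]; exact Submodule.subset_span ⟨a, rfl⟩
  have hanti : ∀ X Y, torL (christoffel D x) p X Y = -torL (christoffel D x) p Y X := fun X Y ↦
    (neg_sub _ _).symm
  have o0 := htE' (J 0) (hm 0) (hp.sq 0)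
  have o1 := htE' (J 1) (hm 1) (hp.sq 1)
  have o2 := htE' ((√2)⁻¹ • (J 0 + J 1)) (Submodule.smul_mem _ _ (Submodule.add_mem _ (hm 0) (hm 1)))
    (sqrt_two_mem hp)
  refine ⟨fun K hK w X ↦ ?_, fun X Y ↦ ?_⟩
  · have hK' : hatE x ((crd n x).symm p) K ∈ Submodule.span ℝ (range J) := by
      rw [← hps]
      have h1 := (hatE_mem_fibE (Q := Q) hp').2 hK
      rwa [hpp] at h1
    apply tcoord_injective hp'
    rw [unhatT_apply_apply, unhatT_apply_apply, tcoord_tcoordInv hp', ← hatE_tc hp' K, ← hatE_tc hp' K,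
      tcoord_tcoordInv hp', corrL_apply hanti, corrL_apply hanti]
    exact hp.corr_comm_of_mem o0 hK' _ _
  · apply tcoord_injective hp'
    rw [unhatT_apply_apply, unhatT_apply_apply, map_sub, tcoord_tcoordInv hp', tcoord_tcoordInv hp',
      corrL_apply hanti, corrL_apply hanti, map_neg, tc_torsion D hp', hpp]
    exact hp.corr_sub _ hanti (QTriple.obst_polar _ o0 o1 o2) _ _

set_option synthInstance.maxHeartbeats 200000 in
lemma exists_local_correction (hD : Q.IsQuaternionicConnection D)
    (ht : ∀ x₀ y : M, y ∈ dom n x₀ → ∀ A, (crd n x₀ y, A) ∈ twZ Q x₀ → ∀ X Y,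
      tE (christoffel D x₀) (crd n x₀ y) A X Y = 0) (x : M) :
    ∃ G : Model n → Model n →ₗ[ℝ] EndModel n,
      (∀ v : Model n → Model n, ContDiffAt ℝ ∞ v (crd n x x) → ContDiffAt ℝ ∞ (fun p ↦ G p (v p)) (crd n x x)) ∧
      ∀ᶠ p in 𝓝 (crd n x x), IsCorrection Q D ((crd n x).symm p) (unhatT x ((crd n x).symm p) (G p)) := by
  have hx : x ∈ dom n x := mem_chart_source _ _
  obtain ⟨J, hJ, hJQ⟩ := exists_frame Q hx
  have hΓ := (contDiffOn_christoffel hD.smooth x).contDiffAt (target_mem_nhds (crd_mem_target hx))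
  refine ⟨fun p ↦ corrL (torL (christoffel D x) p) (J p), fun v hv ↦ ?_, ?_⟩
  · have hflip : ContDiffAt ℝ ∞ (fun p ↦ (christoffel D x p).flip) (crd n x x) :=
      contDiffAt_flip hΓ
    have htor : ContDiffAt ℝ ∞ (fun p ↦ torL (christoffel D x) p) (crd n x x) := hΓ.sub hflip
    have h0 := (hJ 0).self_of_nhds
    have h1 := (hJ 1).self_of_nhds
    have hS : ∀ w : Model n → Model n, ContDiffAt ℝ ∞ w (crd n x x) → ContDiffAt ℝ ∞
        (fun p ↦ torL (christoffel D x) p (w p) + J p 0 * torL (christoffel D x) p (w p) * J p 0) (crd n x x) :=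
      fun w hw ↦ (htor.clm_apply hw).add ((h0.mul (htor.clm_apply hw)).mul h0)
    exact ContDiffAt.const_smul (1 / 2 : ℝ) ((hS v hv).sub (h1.mul (hS _ (h1.clm_apply hv))))
  · filter_upwards [hJQ, target_mem_nhds (crd_mem_target hx)] with p ⟨hp, hps⟩ hpt
    exact isCorrection_corrL hpt hp hps (ht x)

/-- If the torsion condition holds, then there is a torsion-free quaternionic connection. -/
lemma isQuaternionic_of_tE_eq_zero (hD : Q.IsQuaternionicConnection D)
    (ht : ∀ x₀ y : M, y ∈ dom n x₀ → ∀ A, (crd n x₀ y, A) ∈ twZ Q x₀ → ∀ X Y,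
      tE (christoffel D x₀) (crd n x₀ y) A X Y = 0) : Q.IsQuaternionic := by
  obtain ⟨D', A, hD', hA, hDA⟩ := exists_connection_add hD.smooth (IsCorrection Q D) isCorrection_unique
    (exists_local_correction hD ht)
  refine ⟨D', ⟨hD', fun σ hσ hσQ x X ↦ ?_⟩, ?_⟩
  · obtain ⟨q, hq, hqd⟩ := hD.preserves σ hσ hσQ x X
    refine ⟨q, hq, fun Y hY ↦ ?_⟩
    rw [hDA, hDA, ← hqd Y hY]
    simp only [add_apply, map_add]
    rw [(hA x).1 _ (hσQ x)]
    abel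
  · ext x X Y
    rw [torsion_add D D' (fun σ ↦ hDA σ x), (hA x).2]
    exact add_neg_cancel _

end

section
/-! ### Hermitian metrics -/

variable {n : ℕ} {M : Type*} [TopologicalSpace M] [ChartedSpace (Model n) M]
  [IsManifold (𝓡 (4 * n)) ∞ M]

set_option synthInstance.maxHeartbeats 200000

/-- The bilinear form on the model space given by a bilinear form on `T_y M`, in the chart around `x₀`. -/
def hatB (x₀ y : M) (b : TM n M y →L[ℝ] TM n M y →L[ℝ] ℝ) : Model n →L[ℝ] Model n →L[ℝ] ℝ :=
  (ContinuousLinearMap.precomp ℝ (tcInv x₀ y)).comp (b.comp (tcInv x₀ y))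

/-- The bilinear form on `T_y M` with given components in the chart around `x₀`. -/
def unhatB (x₀ y : M) (B : Model n →L[ℝ] Model n →L[ℝ] ℝ) : TM n M y →L[ℝ] TM n M y →L[ℝ] ℝ :=
  (ContinuousLinearMap.precomp ℝ (tc x₀ y)).comp (B.comp (tc x₀ y))

lemma hatB_apply (x₀ y : M) (b : TM n M y →L[ℝ] TM n M y →L[ℝ] ℝ) (v w : Model n) :
    hatB x₀ y b v w = b (tcInv x₀ y v) (tcInv x₀ y w) := rfl

lemma unhatB_apply (x₀ y : M) (B : Model n →L[ℝ] Model n →L[ℝ] ℝ) (v w : TM n M y) :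
    unhatB x₀ y B v w = B (tc x₀ y v) (tc x₀ y w) := rfl

lemma hatB_tc {x₀ y : M} (hy : y ∈ dom n x₀) (b : TM n M y →L[ℝ] TM n M y →L[ℝ] ℝ) (v w : TM n M y) :
    hatB x₀ y b (tc x₀ y v) (tc x₀ y w) = b v w := by
  rw [hatB_apply, tcoordInv_tcoord hy, tcoordInv_tcoord hy]

lemma hatB_unhatB {x₀ y : M} (hy : y ∈ dom n x₀) (B : Model n →L[ℝ] Model n →L[ℝ] ℝ) :
    hatB x₀ y (unhatB x₀ y B) = B := by
  ext1 v
  ext1 w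
  rw [hatB_apply, unhatB_apply, tcoord_tcoordInv hy, tcoord_tcoordInv hy]

lemma contMDiffAt_bilin_iff {x₀ y : M} (hy : y ∈ dom n x₀) {b : ∀ y : M, TM n M y →L[ℝ] TM n M y →L[ℝ] ℝ} :
    ContMDiffAt (𝓡 (4 * n)) ((𝓡 (4 * n)).prod 𝓘(ℝ, Model n →L[ℝ] Model n →L[ℝ] ℝ)) ∞
      (fun y ↦ TotalSpace.mk' (Model n →L[ℝ] Model n →L[ℝ] ℝ) (E := fun y ↦ TM n M y →L[ℝ] TM n M y →L[ℝ] ℝ)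
        y (b y)) y ↔
      ContDiffAt ℝ ∞ (fun p ↦ hatB x₀ ((crd n x₀).symm p) (b ((crd n x₀).symm p))) (crd n x₀ y) := by
  have h1 := Trivialization.contMDiffAt_section_iff (IB := 𝓡 (4 * n)) (n := ∞)
    (F := Model n →L[ℝ] Model n →L[ℝ] ℝ) (E := fun y ↦ TM n M y →L[ℝ] TM n M y →L[ℝ] ℝ)
    (e := trivializationAt (Model n →L[ℝ] Model n →L[ℝ] ℝ) (fun y ↦ TM n M y →L[ℝ] TM n M y →L[ℝ] ℝ) x₀)
    (s := b) (x₀ := y) (by simpa using hy)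
  refine h1.trans ?_
  refine Iff.trans ?_ (contMDiffAt_source_iff le_rfl hy (f := fun y ↦ hatB x₀ y (b y)))
  refine Filter.EventuallyEq.contMDiffAt_iff ?_
  filter_upwards [(chartAt (Model n) x₀).open_source.mem_nhds hy] with w hw
  ext v u
  rw [hatB_apply]
  simp [hom_trivializationAt_apply, ContinuousLinearMap.inCoordinates, Trivialization.linearMapAt_apply, hw,
    tcInv, tcoordInv]

/-- Sublevel sets of positive definite quadratic forms are bounded. -/
lemma isVonNBounded_of_pos {B : Model n →L[ℝ] Model n →L[ℝ] ℝ} (hB : ∀ v, v ≠ 0 → 0 < B v v) :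
    Bornology.IsVonNBounded ℝ {v : Model n | B v v < 1} := by
  have hc : ContinuousOn (fun v ↦ B v v) (Metric.sphere (0 : Model n) 1) := by fun_prop
  obtain ⟨c, hc0, hcB⟩ := (isCompact_sphere (0 : Model n) 1).exists_forall_le' hc (a := 0) fun v hv ↦
    hB v (ne_zero_of_mem_unit_sphere ⟨v, hv⟩)
  rw [NormedSpace.isVonNBounded_iff, isBounded_iff_forall_norm_le]
  refine ⟨√(c⁻¹), fun v hv ↦ ?_⟩
  apply Real.le_sqrt_of_sq_le
  by_cases hv0 : v = 0
  · subst hv0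
    simp [hc0.le]
  have hn0 : ‖v‖ ≠ 0 := norm_ne_zero_iff.2 hv0
  have h1 := hcB (‖v‖⁻¹ • v) (by simp [norm_smul, hn0])
  simp only [map_smul, smul_apply, smul_eq_mul] at h1
  have hv' : B v v < 1 := hv
  have h2 : c * ‖v‖ ^ 2 ≤ 1 := by
    have h3 : c * ‖v‖ ^ 2 ≤ ‖v‖⁻¹ * (‖v‖⁻¹ * B v v) * ‖v‖ ^ 2 := by gcongr
    have h4 : ‖v‖⁻¹ * (‖v‖⁻¹ * B v v) * ‖v‖ ^ 2 = B v v := by field_simp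
    linarith
  rwa [le_inv_comm₀ (by positivity) hc0, le_inv_comm₀ hc0 (by positivity), ← one_div, le_div_iff₀ hc0, mul_comm]

lemma contDiffAt_precomp {E F G H : Type*} [NormedAddCommGroup E] [NormedSpace ℝ E] [NormedAddCommGroup F]
    [NormedSpace ℝ F] [NormedAddCommGroup G] [NormedSpace ℝ G] [NormedAddCommGroup H] [NormedSpace ℝ H]
    {k : ℕ∞ω} {f : H → E →L[ℝ] F} {x : H} (hf : ContDiffAt ℝ k f x) :
    ContDiffAt ℝ k (fun p ↦ (ContinuousLinearMap.precomp G (f p) : (F →L[ℝ] G) →L[ℝ] E →L[ℝ] G)) x := by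
  have h := ContinuousLinearMap.contDiff (𝕜 := ℝ) (n := k) (E := E →L[ℝ] F)
    (F := (F →L[ℝ] G) →L[ℝ] E →L[ℝ] G) (ContinuousLinearMap.compL ℝ E F G).flip
  exact h.contDiffAt.comp x hf

/-- The sum of the standard scalar product and its images under the members of the triple; the quaternionic triple is skew
for it. -/
def hermForm (J : Fin 3 → EndModel n) : Model n →L[ℝ] Model n →L[ℝ] ℝ :=
  (innerSL ℝ : Model n →L[ℝ] Model n →L[ℝ] ℝ) + ∑ a, (ContinuousLinearMap.precomp ℝ (J a)).comp
    ((innerSL ℝ : Model n →L[ℝ] Model n →L[ℝ] ℝ).comp (J a))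

lemma hermForm_apply (J : Fin 3 → EndModel n) (v w : Model n) : hermForm J v w =
    inner ℝ v w + (inner ℝ (J 0 v) (J 0 w) + inner ℝ (J 1 v) (J 1 w) + inner ℝ (J 2 v) (J 2 w)) := by
  rw [hermForm, Fin.sum_univ_three]
  rfl

lemma hermForm_skew {J : Fin 3 → EndModel n} (h : QTriple J) {K : EndModel n}
    (hK : K ∈ Submodule.span ℝ (range J)) (v w : Model n) : hermForm J (K v) w = -hermForm J v (K w) := by
  have key : ∀ a, hermForm J (J a v) w = -hermForm J v (J a w) := fun a ↦ by
    obtain ⟨e0, e1, e2, e3, e4, e5, e6, e7, e8⟩ := h.app v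
    obtain ⟨f0, f1, f2, f3, f4, f5, f6, f7, f8⟩ := h.app w
    fin_cases a
    · simp only [hermForm_apply, Fin.zero_eta, e0, e4, e7, f0, f4, f7, inner_neg_left, inner_neg_right]; ring
    · simp only [hermForm_apply, Fin.mk_one, e1, e3, e6, f1, f3, f6, inner_neg_left, inner_neg_right]; ring
    · simp only [hermForm_apply, Fin.reduceFinMk, e2, e5, e8, f2, f5, f8, inner_neg_left, inner_neg_right]; ring
  obtain ⟨c, rfl⟩ := (Submodule.mem_span_range_iff_exists_fun ℝ).1 hK
  have hsum : ∀ v, (∑ i, c i • J i) v = c 0 • J 0 v + c 1 • J 1 v + c 2 • J 2 v := fun v ↦ by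
    rw [Fin.sum_univ_three]; rfl
  rw [hsum, hsum]
  simp only [map_add, map_smul, add_apply, smul_apply, key, smul_eq_mul]
  ring

lemma contDiffAt_hermForm {J : Model n → Fin 3 → EndModel n} {p : Model n}
    (hJ : ∀ a, ContDiffAt ℝ ∞ (fun p ↦ J p a) p) : ContDiffAt ℝ ∞ (fun p ↦ hermForm (J p)) p := by
  refine contDiffAt_const.add (ContDiffAt.sum fun a _ ↦ ?_)
  exact (contDiffAt_precomp (G := ℝ) (hJ a)).clm_comp (contDiffAt_const.clm_comp (hJ a))


lemma hermForm_pos (J : Fin 3 → EndModel n) (v : Model n) (hv : v ≠ 0) : 0 < hermForm J v v := by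
  rw [hermForm_apply]
  have h := real_inner_self_nonneg (x := J 0 v)
  have h1 := real_inner_self_nonneg (x := J 1 v)
  have h2 := real_inner_self_nonneg (x := J 2 v)
  have h3 := real_inner_self_pos.2 hv
  linarith

/-- The `𝒬`-Hermitian scalar products on a tangent space. -/
def hermitianForms (Q : AlmostQuaternionicStructure n M) (y : M) : Set (TM n M y →L[ℝ] TM n M y →L[ℝ] ℝ) :=
  {b | (∀ v w, b v w = b w v) ∧ (∀ v, v ≠ 0 → 0 < b v v) ∧
    ∀ J ∈ Q.fiber y, J.comp J = -ContinuousLinearMap.id ℝ (TM n M y) → ∀ v w, b (J v) (J w) = b v w}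

lemma convex_hermitianForms (Q : AlmostQuaternionicStructure n M) (y : M) : Convex ℝ (hermitianForms Q y) := by
  intro b hb c hc s t hs ht hst
  refine ⟨fun v w ↦ ?_, fun v hv ↦ ?_, fun J hJ hJ2 v w ↦ ?_⟩
  · simp only [add_apply, smul_apply, hb.1 v w, hc.1 v w]
  · simp only [add_apply, smul_apply, smul_eq_mul]
    have h1 := hb.2.1 v hv
    have h2 := hc.2.1 v hv
    rcases hs.eq_or_lt with h | h
    · subst h
      rw [zero_add] at hst
      subst hst
      simpa using h2
    · have := mul_pos h h1
      have := mul_nonneg ht h2.le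
      linarith
  · simp only [add_apply, smul_apply, hb.2.2 J hJ hJ2, hc.2.2 J hJ hJ2]

lemma unhatB_hermForm_mem (Q : AlmostQuaternionicStructure n M) {x₀ y : M} (hy : y ∈ dom n x₀)
    {J : Fin 3 → EndModel n} (hJ : QTriple J) (hJs : fibE Q x₀ (crd n x₀ y) = Submodule.span ℝ (range J)) :
    unhatB x₀ y (hermForm J) ∈ hermitianForms Q y := by
  refine ⟨fun v w ↦ ?_, fun v hv ↦ ?_, fun K hK hK2 v w ↦ ?_⟩
  · simp only [unhatB_apply, hermForm_apply, real_inner_comm]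
  · rw [unhatB_apply]
    exact hermForm_pos J _ fun h ↦ hv (tcoord_injective hy (h.trans (map_zero _).symm))
  · have hK' := (hatE_mem_fibE (Q := Q) hy).2 hK
    rw [hJs] at hK'
    have hK3 : hatE x₀ y K * hatE x₀ y K = -1 := by
      rw [← hatE_comp hy, hK2, hatE_neg, hatE_id hy]
    rw [unhatB_apply, unhatB_apply, ← hatE_tc hy, ← hatE_tc hy, hermForm_skew hJ hK',
      apply_apply_of_sq hK3, map_neg, neg_neg]

lemma exists_local_hermitianForm (Q : AlmostQuaternionicStructure n M) (x : M) :
    ∃ U ∈ 𝓝 x, ∃ s : ∀ y : M, TM n M y →L[ℝ] TM n M y →L[ℝ] ℝ,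
      (∀ w ∈ U, ContMDiffAt (𝓡 (4 * n)) ((𝓡 (4 * n)).prod 𝓘(ℝ, Model n →L[ℝ] Model n →L[ℝ] ℝ)) ∞
        (fun y ↦ TotalSpace.mk' (Model n →L[ℝ] Model n →L[ℝ] ℝ)
          (E := fun y ↦ TM n M y →L[ℝ] TM n M y →L[ℝ] ℝ) y (s y)) w) ∧
      ∀ w ∈ U, s w ∈ hermitianForms Q w := by
  have hx : x ∈ dom n x := mem_chart_source _ _
  obtain ⟨J, hJ, hJQ⟩ := exists_frame Q hx
  have hc : ContinuousAt (crd n x) x := continuousAt_extChartAt' (by simp)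
  refine ⟨{w | w ∈ dom n x ∧ (∀ a, ContDiffAt ℝ ∞ (fun p ↦ J p a) (crd n x w)) ∧
    QTriple (J (crd n x w)) ∧ fibE Q x (crd n x w) = Submodule.span ℝ (range (J (crd n x w)))}, ?_,
    fun w ↦ unhatB x w (hermForm (J (crd n x w))), fun w hw ↦ ?_,
    fun w hw ↦ unhatB_hermForm_mem Q hw.1 hw.2.2.1 hw.2.2.2⟩
  · filter_upwards [(chartAt (Model n) x).open_source.mem_nhds hx, hc.eventually (eventually_all.2 hJ),
      hc.eventually hJQ] with w h1 h2 h3 using ⟨h1, h2, h3⟩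
  · refine (contMDiffAt_bilin_iff hw.1).2 ?_
    refine (contDiffAt_hermForm hw.2.1).congr_of_eventuallyEq ?_
    filter_upwards [target_mem_nhds (crd_mem_target hw.1)] with p hp
    have hp' : (crd n x).symm p ∈ dom n x := by simpa using (crd n x).map_target hp
    rw [hatB_unhatB hp', (crd n x).right_inv hp]

variable [T2Space M] [SigmaCompactSpace M]

set_option maxHeartbeats 1000000 in
lemma exists_hermitian_section (Q : AlmostQuaternionicStructure n M) :
    ∃ s : ∀ y : M, TM n M y →L[ℝ] TM n M y →L[ℝ] ℝ,
      (ContMDiff (𝓡 (4 * n)) ((𝓡 (4 * n)).prod 𝓘(ℝ, Model n →L[ℝ] Model n →L[ℝ] ℝ)) ∞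
        (fun y ↦ TotalSpace.mk' (Model n →L[ℝ] Model n →L[ℝ] ℝ)
          (E := fun y ↦ TM n M y →L[ℝ] TM n M y →L[ℝ] ℝ) y (s y))) ∧
      ∀ w, s w ∈ hermitianForms Q w := by
  have hloc := exists_local_hermitianForm Q
  choose U hU sl hs hsm using hloc
  obtain ⟨s, hs⟩ := exists_contMDiffSection_forall_mem_convex_of_local (n := ⊤) (𝓡 (4 * n))
    (F_fiber := Model n →L[ℝ] Model n →L[ℝ] ℝ) (fun y ↦ TM n M y →L[ℝ] TM n M y →L[ℝ] ℝ)
    (hermitianForms Q) (convex_hermitianForms Q)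
    (fun x ↦ ⟨U x, hU x, sl x, fun w hw ↦ (hs x w hw).contMDiffWithinAt, hsm x⟩)
  exact ⟨s, s.contMDiff, hs⟩

/-- Hermitian scalar products exist locally and form convex sets, hence a partition of unity gives a Hermitian metric. -/
lemma exists_hermitian_metric (Q : AlmostQuaternionicStructure n M) : ∃ g : Metric n M, Q.IsHermitian g := by
  obtain ⟨s, hs, hsm⟩ := exists_hermitian_section Q
  exact ⟨⟨s, fun y ↦ (hsm y).1, fun y ↦ (hsm y).2.1,
    fun y ↦ isVonNBounded_of_pos (n := n) (B := s y) (hsm y).2.1, hs⟩, fun y J hJ hJ2 ↦ (hsm y).2.2 J hJ hJ2⟩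

end

section
/-! ### Metrics in coordinates -/

variable {n : ℕ} {M : Type*} [TopologicalSpace M] [ChartedSpace (Model n) M]
  [IsManifold (𝓡 (4 * n)) ∞ M]

set_option synthInstance.maxHeartbeats 200000

/-- The components of a metric in the chart around `x₀`. -/
def gE (g : Metric n M) (x₀ : M) (p : Model n) : Model n →L[ℝ] Model n →L[ℝ] ℝ :=
  hatB x₀ ((crd n x₀).symm p) (g.inner ((crd n x₀).symm p))

lemma gE_tc (g : Metric n M) {x₀ y : M} (hy : y ∈ dom n x₀) (v w : TM n M y) :
    gE g x₀ (crd n x₀ y) (tc x₀ y v) (tc x₀ y w) = g.inner y v w := by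
  rw [gE, crd_symm_crd hy, hatB_tc hy]

lemma gE_symm (g : Metric n M) (x₀ : M) (p v w : Model n) : gE g x₀ p v w = gE g x₀ p w v :=
  g.symm _ _ _

lemma gE_pos (g : Metric n M) {x₀ : M} {p : Model n} (hp : p ∈ (crd n x₀).target) {v : Model n} (hv : v ≠ 0) :
    0 < gE g x₀ p v v := by
  have hp' : (crd n x₀).symm p ∈ dom n x₀ := by simpa using (crd n x₀).map_target hp
  refine g.pos _ _ fun h ↦ hv ?_
  have h1 : tc x₀ ((crd n x₀).symm p) (tcInv x₀ ((crd n x₀).symm p) v) = v := tcoord_tcoordInv hp' v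
  exact h1.symm.trans ((congrArg (tc x₀ ((crd n x₀).symm p)) h).trans (map_zero _))

lemma contDiffAt_gE (g : Metric n M) {x₀ : M} {p : Model n} (hp : p ∈ (crd n x₀).target) :
    ContDiffAt ℝ ∞ (gE g x₀) p := by
  have hp' : (crd n x₀).symm p ∈ dom n x₀ := by simpa using (crd n x₀).map_target hp
  have h := (contMDiffAt_bilin_iff (n := n) (M := M) (x₀ := x₀) (b := fun y ↦ g.inner y) hp').1 (g.contMDiff _)
  rwa [(crd n x₀).right_inv hp] at h

lemma hasFDerivAt_bilin {E F : Type*} [NormedAddCommGroup E] [NormedSpace ℝ E] [NormedAddCommGroup F]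
    [NormedSpace ℝ F] {b : E → F →L[ℝ] F →L[ℝ] ℝ} {u v : E → F} {p : E} (hb : DifferentiableAt ℝ b p)
    (hu : DifferentiableAt ℝ u p) (hv : DifferentiableAt ℝ v p) :
    DifferentiableAt ℝ (fun q ↦ b q (u q) (v q)) p ∧ ∀ X, fderiv ℝ (fun q ↦ b q (u q) (v q)) p X =
      fderiv ℝ b p X (u p) (v p) + b p (fderiv ℝ u p X) (v p) + b p (u p) (fderiv ℝ v p X) := by
  have h := (hb.hasFDerivAt.clm_apply hu.hasFDerivAt).clm_apply hv.hasFDerivAt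
  refine ⟨h.differentiableAt, fun X ↦ ?_⟩
  rw [h.fderiv]
  simp
  ring

/-- The derivative of a scalar product of vector fields, in coordinates. -/
lemma mfderiv_inner (g : Metric n M) {x₀ y : M} (hy : y ∈ dom n x₀) {Y Z : ∀ y : M, TM n M y}
    (hY : SmoothVFAt Y y) (hZ : SmoothVFAt Z y) (X : TM n M y) :
    mfderiv (𝓡 (4 * n)) 𝓘(ℝ, ℝ) (fun y ↦ g.inner y (Y y) (Z y)) y X =
      fderiv ℝ (gE g x₀) (crd n x₀ y) (tc x₀ y X) (tc x₀ y (Y y)) (tc x₀ y (Z y))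
      + gE g x₀ (crd n x₀ y) (fderiv ℝ (vfCoord (𝓡 (4 * n)) x₀ Y) (crd n x₀ y) (tc x₀ y X)) (tc x₀ y (Z y))
      + gE g x₀ (crd n x₀ y) (tc x₀ y (Y y))
        (fderiv ℝ (vfCoord (𝓡 (4 * n)) x₀ Z) (crd n x₀ y) (tc x₀ y X)) := by
  have hY' := (smoothVFAt_iff hy).1 hY
  have hZ' := (smoothVFAt_iff hy).1 hZ
  have hg := contDiffAt_gE g (crd_mem_target hy)
  have heq : (fun p ↦ g.inner ((crd n x₀).symm p) (Y ((crd n x₀).symm p)) (Z ((crd n x₀).symm p)))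
      =ᶠ[𝓝 (crd n x₀ y)] fun p ↦ gE g x₀ p (vfCoord (𝓡 (4 * n)) x₀ Y p) (vfCoord (𝓡 (4 * n)) x₀ Z p) := by
    filter_upwards [target_mem_nhds (crd_mem_target hy)] with p hp
    have hp' : (crd n x₀).symm p ∈ dom n x₀ := by simpa using (crd n x₀).map_target hp
    exact (hatB_tc hp' _ _ _).symm
  have hsm : ContMDiffAt (𝓡 (4 * n)) 𝓘(ℝ, ℝ) ∞ (fun y ↦ g.inner y (Y y) (Z y)) y := by
    rw [contMDiffAt_source_iff le_rfl hy]
    exact ((hg.clm_apply hY').clm_apply hZ').congr_of_eventuallyEq heq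
  rw [mfderiv_crd_symm hy (hsm.mdifferentiableAt (by simp)), heq.fderiv_eq,
    (hasFDerivAt_bilin (hg.differentiableAt (by simp)) (hY'.differentiableAt (by simp))
      (hZ'.differentiableAt (by simp))).2, vfCoord_crd hy, vfCoord_crd hy]

/-- Levi-Civita connections are metric, in coordinates. -/
lemma IsLeviCivita.fderiv_gE {g : Metric n M} {D : Connection n M} (h : IsLeviCivita g D) {x₀ : M} {p : Model n}
    (hp : p ∈ (crd n x₀).target) (X v w : Model n) : fderiv ℝ (gE g x₀) p X v w =
      gE g x₀ p (christoffel D x₀ p X v) w + gE g x₀ p v (christoffel D x₀ p X w) := by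
  have hy : (crd n x₀).symm p ∈ dom n x₀ := by simpa using (crd n x₀).map_target hp
  have hpp : crd n x₀ ((crd n x₀).symm p) = p := (crd n x₀).right_inv hp
  obtain ⟨y, hydef⟩ : ∃ y, y = (crd n x₀).symm p := ⟨_, rfl⟩
  rw [← hydef] at hy hpp
  have h1 := (mfderiv_inner g hy (smooth_coordVF hy v) (smooth_coordVF hy w) _).symm.trans
    (h.metric y (tcInv x₀ y X) _ _ (smooth_coordVF hy v) (smooth_coordVF hy w))
  replace h1 := h1.trans (congrArg₂ (fun a b : ℝ ↦ a + b)
    (gE_tc g hy (D (coordVF x₀ v) y (tcInv x₀ y X)) (coordVF x₀ w y)).symm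
    (gE_tc g hy (coordVF x₀ v y) (D (coordVF x₀ w) y (tcInv x₀ y X))).symm)
  rw [tc_conn_coordVF D hy, tc_conn_coordVF D hy] at h1
  have h0 : ∀ v, fderiv ℝ (vfCoord (𝓡 (4 * n)) x₀ (coordVF x₀ v)) (crd n x₀ y) = 0 := fun v ↦ by
    have h0 : vfCoord (𝓡 (4 * n)) x₀ (coordVF x₀ v) =ᶠ[𝓝 (crd n x₀ y)] fun _ ↦ v := by
      filter_upwards [target_mem_nhds (crd_mem_target hy)] with r hr using vfCoord_coordVF hr v
    rw [h0.fderiv_eq]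
    exact fderiv_const_apply v
  have e : ∀ v, tc x₀ y (coordVF x₀ v y) = v := fun v ↦ tcoord_tcoordInv hy v
  have h2 : ∀ u v, gE g x₀ p (fderiv ℝ (vfCoord (𝓡 (4 * n)) x₀ (coordVF x₀ v)) (crd n x₀ y) X) u = 0 ∧
      gE g x₀ p u (fderiv ℝ (vfCoord (𝓡 (4 * n)) x₀ (coordVF x₀ v)) (crd n x₀ y) X) = 0 := fun u v ↦ by
    rw [h0]
    constructor
    · exact (congrArg (fun L ↦ L u) (map_zero (gE g x₀ p))).trans rfl
    · exact map_zero (gE g x₀ p u)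
  simp only [e, tcoord_tcoordInv hy] at h1
  rw [hpp] at h1 h2
  rwa [(h2 _ _).1, (h2 _ _).2, add_zero, add_zero] at h1

/-! ### The Koszul formula -/

lemma gE_symm_fderiv (g : Metric n M) {x₀ : M} {p : Model n} (hp : p ∈ (crd n x₀).target) (X v w : Model n) :
    fderiv ℝ (gE g x₀) p X v w = fderiv ℝ (gE g x₀) p X w v := by
  have hg := (contDiffAt_gE g hp).differentiableAt (by simp)
  have h1 : ∀ v w, fderiv ℝ (fun q ↦ gE g x₀ q v w) p X = fderiv ℝ (gE g x₀) p X v w := fun v w ↦ by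
    rw [(hasFDerivAt_bilin hg (differentiableAt_const v) (differentiableAt_const w)).2]
    simp
  rw [← h1, ← h1]
  congr 2
  exact funext fun q ↦ gE_symm g x₀ q v w

lemma finrank_dual_model : Module.finrank ℝ (Model n) = Module.finrank ℝ (Model n →L[ℝ] ℝ) := by
  rw [← (LinearMap.toContinuousLinearMap (𝕜 := ℝ) (E := Model n) (F' := ℝ)).finrank_eq]
  exact (Subspace.dual_finrank_eq).symm

/-- A positive definite bilinear form identifies a space with its dual. -/
lemma exists_equiv_of_pos {B : Model n →L[ℝ] Model n →L[ℝ] ℝ} (hB : ∀ v, v ≠ 0 → 0 < B v v) :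
    ∃ e : Model n ≃L[ℝ] (Model n →L[ℝ] ℝ), (e : Model n →L[ℝ] Model n →L[ℝ] ℝ) = B := by
  have hinj : Function.Injective B := (injective_iff_map_eq_zero B).2 fun v hv ↦ by
    by_contra h
    have h1 := hB v h
    rw [hv] at h1
    exact lt_irrefl _ h1
  refine ⟨(LinearMap.linearEquivOfInjective (B : Model n →ₗ[ℝ] Model n →L[ℝ] ℝ) hinj
    finrank_dual_model).toContinuousLinearEquiv, ?_⟩
  ext1 v
  rfl

/-- The right-hand side of the Koszul formula: if `G` is the derivative of a metric `B` in coordinates and `Γ` are the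
Christoffel symbols of its Levi-Civita connection, then `B (Γ X w) Z = koszul G w X Z`. -/
def koszul (G : Model n →L[ℝ] Model n →L[ℝ] Model n →L[ℝ] ℝ) (w : Model n) : Model n →L[ℝ] Model n →L[ℝ] ℝ :=
  (1 / 2 : ℝ) • (G.flip w + G w - (G.flip w).flip)

lemma koszul_apply (G : Model n →L[ℝ] Model n →L[ℝ] Model n →L[ℝ] ℝ) (w X Z : Model n) :
    koszul G w X Z = (1 / 2 : ℝ) * (G X w Z + G w X Z - G Z w X) := rfl

lemma koszul_add (G : Model n →L[ℝ] Model n →L[ℝ] Model n →L[ℝ] ℝ) (v w : Model n) :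
    koszul G (v + w) = koszul G v + koszul G w := by
  refine ContinuousLinearMap.ext fun X ↦ ContinuousLinearMap.ext fun Z ↦ ?_
  have h : (koszul G v + koszul G w) X Z = koszul G v X Z + koszul G w X Z := rfl
  have h1 : G X (v + w) Z = G X v Z + G X w Z := by rw [map_add]; rfl
  have h2 : G (v + w) X Z = G v X Z + G w X Z := by rw [map_add]; rfl
  have h3 : G Z (v + w) X = G Z v X + G Z w X := by rw [map_add]; rfl
  rw [h, koszul_apply, koszul_apply, koszul_apply, h1, h2, h3]
  ring

lemma koszul_smul (G : Model n →L[ℝ] Model n →L[ℝ] Model n →L[ℝ] ℝ) (c : ℝ) (w : Model n) :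
    koszul G (c • w) = c • koszul G w := by
  refine ContinuousLinearMap.ext fun X ↦ ContinuousLinearMap.ext fun Z ↦ ?_
  have h : (c • koszul G w) X Z = c * koszul G w X Z := rfl
  have h1 : G X (c • w) Z = c * G X w Z := by rw [map_smul]; rfl
  have h2 : G (c • w) X Z = c * G w X Z := by rw [map_smul]; rfl
  have h3 : G Z (c • w) X = c * G Z w X := by rw [map_smul]; rfl
  rw [h, koszul_apply, koszul_apply, h1, h2, h3]
  ring

/-- The difference of the Levi-Civita connection of a metric `B` with derivative `G` and a connection with Christoffel
symbols `Γ`. -/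
def lcTensor (B : Model n →L[ℝ] Model n →L[ℝ] ℝ) (G : Model n →L[ℝ] Model n →L[ℝ] Model n →L[ℝ] ℝ)
    (Γ : Model n →L[ℝ] Model n →L[ℝ] Model n) : Model n →ₗ[ℝ] EndModel n where
  toFun w := B.inverse.comp (koszul G w) - Γ.flip w
  map_add' v w := by
    refine ContinuousLinearMap.ext fun X ↦ ?_
    have h1 : B.inverse (koszul G (v + w) X) = B.inverse (koszul G v X) + B.inverse (koszul G w X) := by
      rw [koszul_add, ← map_add]; rfl
    have h2 : Γ X (v + w) = Γ X v + Γ X w := map_add _ _ _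
    change B.inverse (koszul G (v + w) X) - Γ X (v + w) =
      (B.inverse (koszul G v X) - Γ X v) + (B.inverse (koszul G w X) - Γ X w)
    rw [h1, h2]
    module
  map_smul' c w := by
    refine ContinuousLinearMap.ext fun X ↦ ?_
    have h1 : B.inverse (koszul G (c • w) X) = c • B.inverse (koszul G w X) := by
      rw [koszul_smul, ← map_smul]; rfl
    have h2 : Γ X (c • w) = c • Γ X w := map_smul _ _ _
    change B.inverse (koszul G (c • w) X) - Γ X (c • w) = c • (B.inverse (koszul G w X) - Γ X w)
    rw [h1, h2]
    module

lemma lcTensor_spec {B : Model n →L[ℝ] Model n →L[ℝ] ℝ} (hB : ∀ v, v ≠ 0 → 0 < B v v)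
    (G : Model n →L[ℝ] Model n →L[ℝ] Model n →L[ℝ] ℝ) (Γ : Model n →L[ℝ] Model n →L[ℝ] Model n) (w X Z : Model n) :
    B (Γ X w + lcTensor B G Γ w X) Z = koszul G w X Z := by
  obtain ⟨e, he⟩ := exists_equiv_of_pos hB
  have h1 : lcTensor B G Γ w X = e.symm (koszul G w X) - Γ X w := by
    change B.inverse (koszul G w X) - Γ X w = _
    rw [← he, ContinuousLinearMap.inverse_equiv]
    rfl
  have h2 : ∀ φ, B (e.symm φ) = φ := fun φ ↦ by
    rw [← he]
    exact e.apply_symm_apply φ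
  rw [h1, add_sub_cancel, h2]

/-- A bilinear form that is symmetric in two arguments and skew in the last two vanishes. -/
lemma eq_zero_of_symm_of_skew {V : Type*} {φ : V → V → V → ℝ} (h1 : ∀ X Y Z, φ X Y Z = φ Y X Z)
    (h2 : ∀ X Y Z, φ X Y Z = -φ X Z Y) (X Y Z : V) : φ X Y Z = 0 := by
  have a1 := h1 X Y Z
  have a2 := h2 Y X Z
  have a3 := h1 Y Z X
  have a4 := h2 Z Y X
  have a5 := h1 Z X Y
  have a6 := h2 X Z Y
  linarith

lemma contDiffAt_inverse_model {F : Type*} [NormedAddCommGroup F] [NormedSpace ℝ F]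
    {B : F → Model n →L[ℝ] Model n →L[ℝ] ℝ} {q : F} (hB : ContDiffAt ℝ ∞ B q) (hpos : ∀ v, v ≠ 0 → 0 < B q v v) :
    ContDiffAt ℝ ∞ (fun p ↦ (B p).inverse) q := by
  obtain ⟨e, he⟩ := exists_equiv_of_pos hpos
  exact ContDiffAt.comp (g := ContinuousLinearMap.inverse) q (he ▸ contDiffAt_map_inverse e) hB

lemma contDiffAt_add_sub_flip {E F H : Type*} [NormedAddCommGroup E] [NormedSpace ℝ E] [NormedAddCommGroup F]
    [NormedSpace ℝ F] [NormedAddCommGroup H] [NormedSpace ℝ H] {k : ℕ∞ω} {G : F → E →L[ℝ] E →L[ℝ] E →L[ℝ] H}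
    {w : F → E} {q : F} (hG : ContDiffAt ℝ k G q) (hw : ContDiffAt ℝ k w q) :
    ContDiffAt ℝ k (fun p ↦ (1 / 2 : ℝ) • ((G p).flip (w p) + G p (w p) - ((G p).flip (w p)).flip)) q := by
  have h1 := (contDiffAt_flip hG).clm_apply hw
  exact ((h1.add (hG.clm_apply hw)).sub (contDiffAt_flip h1)).const_smul (1 / 2 : ℝ)

lemma contDiffAt_comp_clm {E F G H : Type*} [NormedAddCommGroup E] [NormedSpace ℝ E] [NormedAddCommGroup F]
    [NormedSpace ℝ F] [NormedAddCommGroup G] [NormedSpace ℝ G] [NormedAddCommGroup H] [NormedSpace ℝ H]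
    {k : ℕ∞ω} {f : H → F →L[ℝ] G} {g : H → E →L[ℝ] F} {x : H} (hf : ContDiffAt ℝ k f x) (hg : ContDiffAt ℝ k g x) :
    ContDiffAt ℝ k (fun p ↦ (f p).comp (g p)) x := hf.clm_comp hg

end

section
/-! ### Existence of the Levi-Civita connection -/

variable {n : ℕ} {M : Type*} [TopologicalSpace M] [ChartedSpace (Model n) M]
  [IsManifold (𝓡 (4 * n)) ∞ M]


set_option synthInstance.maxHeartbeats 200000

/-- Adding the tensor `A` to the connection `D` gives the Levi-Civita connection of `g`, at `x`. -/
def IsLCCorrection (g : Metric n M) (D : Connection n M) (x : M) (A : TM n M x →L[ℝ] EndT n M x) : Prop :=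
  (∀ X Y, A Y X - A X Y = -D.torsion x X Y) ∧
    ∀ (X : TM n M x) (Y Z : ∀ y : M, TM n M y), SmoothVFAt Y x → SmoothVFAt Z x →
      mfderiv (𝓡 (4 * n)) 𝓘(ℝ, ℝ) (fun y ↦ g.inner y (Y y) (Z y)) x X =
        g.inner x (D Y x X + A (Y x) X) (Z x) + g.inner x (Y x) (D Z x X + A (Z x) X)

lemma sub_eq_neg_sub_of_add_eq {a b c d b' d' : ℝ} (h : a + b + (c + d) = a + b' + (c + d')) : b - b' = -(d - d') := by
  linarith

lemma isLCCorrection_unique {g : Metric n M} {D : Connection n M} {x : M} {A A' : TM n M x →L[ℝ] EndT n M x}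
    (h : IsLCCorrection g D x A) (h' : IsLCCorrection g D x A') : A = A' := by
  have hx : x ∈ dom n x := mem_chart_source _ _
  have hz : ∀ X Y Z, g.inner x (A Y X - A' Y X) Z = 0 := by
    refine eq_zero_of_symm_of_skew (φ := fun X Y Z ↦ g.inner x (A Y X - A' Y X) Z) (fun X Y Z ↦ ?_) fun X Y Z ↦ ?_
    · have e : A Y X - A' Y X = A X Y - A' X Y := by
        linear_combination (norm := module) (h.1 X Y) - h'.1 X Y
      rw [e]
    · have hY : coordVF x (tc x x Y) x = Y := tcoordInv_tcoord hx Y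
      have hZ : coordVF x (tc x x Z) x = Z := tcoordInv_tcoord hx Z
      have e := (h.2 X _ _ (smooth_coordVF hx (tc x x Y)) (smooth_coordVF hx (tc x x Z))).symm.trans
        (h'.2 X _ _ (smooth_coordVF hx (tc x x Y)) (smooth_coordVF hx (tc x x Z)))
      rw [hY, hZ] at e
      have s1 : g.inner x Y (D (coordVF x (tc x x Z)) x X + A Z X) =
          g.inner x (D (coordVF x (tc x x Z)) x X + A Z X) Y := g.symm _ _ _
      have s2 : g.inner x Y (D (coordVF x (tc x x Z)) x X + A' Z X) =
          g.inner x (D (coordVF x (tc x x Z)) x X + A' Z X) Y := g.symm _ _ _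
      have l : ∀ u v w : TM n M x, g.inner x (u + v) w = g.inner x u w + g.inner x v w := fun u v w ↦ by
        rw [map_add]; rfl
      have l' : ∀ u v w : TM n M x, g.inner x (u - v) w = g.inner x u w - g.inner x v w := fun u v w ↦ by
        rw [map_sub]; rfl
      rw [s1, s2, l, l, l, l] at e
      rw [l', l']
      exact sub_eq_neg_sub_of_add_eq e
  ext Y X
  have h0 := hz X Y (A Y X - A' Y X)
  have h1 : A Y X - A' Y X = 0 := by
    by_contra hne
    exact (g.pos x _ hne).ne' h0
  exact sub_eq_zero.1 h1

/-- The Koszul formula gives a torsion-free metric connection. -/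
lemma isLCCorrection_unhatT (g : Metric n M) (D : Connection n M) {x y : M} (hy : y ∈ dom n x)
    {L : Model n →ₗ[ℝ] EndModel n} (hs : ∀ w X Z, gE g x (crd n x y) (christoffel D x (crd n x y) X w + L w X) Z =
      koszul (fderiv ℝ (gE g x) (crd n x y)) w X Z) : IsLCCorrection g D y (unhatT x y L) := by
  obtain ⟨p, hpp⟩ : ∃ p, crd n x y = p := ⟨_, rfl⟩
  have hp : p ∈ (crd n x).target := hpp ▸ crd_mem_target hy
  have l : ∀ u v w : Model n, gE g x p (u + v) w = gE g x p u w + gE g x p v w := fun u v w ↦ by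
    rw [map_add]; rfl
  have t : ∀ v w, tc x y (unhatT x y L v w) = L (tc x y v) (tc x y w) := fun v w ↦ by
    rw [unhatT_apply_apply]
    exact tcoord_tcoordInv hy _
  rw [hpp] at hs
  refine ⟨fun X Y ↦ tcoord_injective hy ?_, fun X Y Z hY hZ ↦ ?_⟩
  · have hsym : ∀ X w, christoffel D x p X w + L w X = christoffel D x p w X + L X w := fun X w ↦ by
      by_contra hne
      have l' : ∀ u v w : Model n, gE g x p (u - v) w = gE g x p u w - gE g x p v w := fun u v w ↦ by
        rw [map_sub]; rfl
      have h1 : ∀ Z, gE g x p (christoffel D x p X w + L w X - (christoffel D x p w X + L X w)) Z = 0 := fun Z ↦ by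
        rw [l', hs, hs, koszul_apply, koszul_apply, gE_symm_fderiv g hp Z w X]
        ring
      exact (gE_pos g hp (sub_ne_zero.2 hne)).ne' (h1 _)
    have h2 : tc x y (-D.torsion y X Y) = -torE (christoffel D x) p (tc x y X) (tc x y Y) := by
      rw [map_neg, tc_torsion D hy, hpp]
    have h3 : tc x y (unhatT x y L Y X - unhatT x y L X Y) = L (tc x y Y) (tc x y X) - L (tc x y X) (tc x y Y) := by
      rw [map_sub, t, t]
    refine h3.trans (Eq.trans ?_ h2.symm)
    rw [torE]
    linear_combination (norm := module) hsym (tc x y X) (tc x y Y)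
  · have hk : ∀ {Y : ∀ y : M, TM n M y}, SmoothVFAt Y y → tc x y (D Y y X + unhatT x y L (Y y) X) =
        fderiv ℝ (vfCoord (𝓡 (4 * n)) x Y) p (tc x y X) +
          (christoffel D x p (tc x y X) (tc x y (Y y)) + L (tc x y (Y y)) (tc x y X)) := fun {Y} hY ↦ by
      rw [map_add, t, tc_conn D hy hY.mdiff, hpp, add_assoc]
    have key : ∀ ξ η ζ a b : Model n, fderiv ℝ (gE g x) p ξ η ζ + gE g x p a ζ + gE g x p η b =
        gE g x p (a + (christoffel D x p ξ η + L η ξ)) ζ + gE g x p η (b + (christoffel D x p ξ ζ + L ζ ξ)) := by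
      intro ξ η ζ a b
      rw [l, map_add (gE g x p η), hs, gE_symm g x p η (christoffel D x p ξ ζ + L ζ ξ), hs, koszul_apply, koszul_apply,
        gE_symm_fderiv g hp ξ ζ η, gE_symm_fderiv g hp ζ η ξ, gE_symm_fderiv g hp η ζ ξ]
      ring
    have e1 := gE_tc g hy (D Y y X + unhatT x y L (Y y) X) (Z y)
    have e2 := gE_tc g hy (Y y) (D Z y X + unhatT x y L (Z y) X)
    rw [hk hY, hpp] at e1
    rw [hk hZ, hpp] at e2
    refine (mfderiv_inner g hy hY hZ X).trans (Eq.trans ?_ (congrArg₂ (fun a b : ℝ ↦ a + b) e1 e2))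
    rw [hpp]
    exact key _ _ _ _ _

variable [T2Space M] [SigmaCompactSpace M]

lemma exists_local_lcCorrection (g : Metric n M) {D : Connection n M} (hD : IsSmoothConnection D) (x : M) :
    ∃ G : Model n → Model n →ₗ[ℝ] EndModel n,
      (∀ v : Model n → Model n, ContDiffAt ℝ ∞ v (crd n x x) → ContDiffAt ℝ ∞ (fun p ↦ G p (v p)) (crd n x x)) ∧
      ∀ᶠ p in 𝓝 (crd n x x),
        IsLCCorrection g D ((crd n x).symm p) (unhatT x ((crd n x).symm p) (G p)) := by
  have hx : crd n x x ∈ (crd n x).target := crd_mem_target (mem_chart_source _ _)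
  refine ⟨fun p ↦ lcTensor (gE g x p) (fderiv ℝ (gE g x) p) (christoffel D x p), fun v hv ↦ ?_, ?_⟩
  · have hg : ContDiffAt ℝ ∞ (gE g x) (crd n x x) := contDiffAt_gE g hx
    have hdg : ContDiffAt ℝ ∞ (fderiv ℝ (gE g x)) (crd n x x) := hg.fderiv_right (m := ∞) (by simp)
    have hΓ : ContDiffAt ℝ ∞ (christoffel D x) (crd n x x) :=
      (contDiffOn_christoffel hD x).contDiffAt (target_mem_nhds hx)
    have h1 : ContDiffAt ℝ ∞ (fun p ↦ koszul (fderiv ℝ (gE g x) p) (v p)) (crd n x x) :=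
      contDiffAt_add_sub_flip hdg hv
    have h2 : ContDiffAt ℝ ∞ (fun p ↦ (gE g x p).inverse.comp (koszul (fderiv ℝ (gE g x) p) (v p))) (crd n x x) :=
      contDiffAt_comp_clm (contDiffAt_inverse_model hg fun v hv ↦ gE_pos g hx hv) h1
    have h3 : ContDiffAt ℝ ∞ (fun p ↦ (christoffel D x p).flip) (crd n x x) := contDiffAt_flip hΓ
    exact h2.sub (h3.clm_apply hv)
  · filter_upwards [target_mem_nhds hx] with p hp
    have hy : (crd n x).symm p ∈ dom n x := by simpa using (crd n x).map_target hp
    have hpp : crd n x ((crd n x).symm p) = p := (crd n x).right_inv hp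
    have hB : ∀ v, v ≠ 0 → 0 < gE g x p v v := fun v hv ↦ gE_pos g hp hv
    have hs := lcTensor_spec hB (fderiv ℝ (gE g x) p) (christoffel D x p)
    refine isLCCorrection_unhatT g D hy ?_
    rw [hpp]
    exact hs

/-- A Riemannian metric has a Levi-Civita connection; a smooth connection `D` serves as an origin in the affine space of
connections. -/
lemma exists_isLeviCivita (g : Metric n M) {D : Connection n M} (hD : IsSmoothConnection D) :
    ∃ D' : Connection n M, IsLeviCivita g D' := by
  obtain ⟨D', A, hD', hA, hDA⟩ := exists_connection_add hD (IsLCCorrection g D)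
    (fun _ _ _ ↦ isLCCorrection_unique) (exists_local_lcCorrection g hD)
  refine ⟨D', hD', ?_, fun x X Y Z hY hZ ↦ ?_⟩
  · ext x X Y
    rw [torsion_add D D' (fun σ ↦ hDA σ x), (hA x).1]
    exact add_neg_cancel _
  · rw [hDA, hDA]
    exact (hA x).2 X Y Z hY hZ

end

section
/-! ### Levi-Civita connections of Hermitian metrics in dimension four -/

variable {n : ℕ} {M : Type*} [TopologicalSpace M] [ChartedSpace (Model n) M]
  [IsManifold (𝓡 (4 * n)) ∞ M]


section FrameAlgebra

variable {B : Model n →L[ℝ] Model n →L[ℝ] ℝ} {J : Fin 3 → EndModel n}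

/-- The frame `(v, J₁ v, J₂ v, J₃ v)`. -/
def qframe (J : Fin 3 → EndModel n) (v : Model n) : Fin 4 → Model n := ![v, J 0 v, J 1 v, J 2 v]

/-- `B` is a scalar product for which the `J a` are skew; for `J a * J a = -1` this means that they are orthogonal. -/
structure IsHermForm (B : Model n →L[ℝ] Model n →L[ℝ] ℝ) (J : Fin 3 → EndModel n) : Prop where
  symm : ∀ v w, B v w = B w v
  pos : ∀ v, v ≠ 0 → 0 < B v v
  skew : ∀ a v w, B (J a v) w = -B v (J a w)

lemma bilin_add_left (B : Model n →L[ℝ] Model n →L[ℝ] ℝ) (u v w : Model n) : B (u + v) w = B u w + B v w := by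
  rw [map_add]; rfl

lemma bilin_sub_left (B : Model n →L[ℝ] Model n →L[ℝ] ℝ) (u v w : Model n) : B (u - v) w = B u w - B v w := by
  rw [map_sub]; rfl

lemma bilin_smul_left (B : Model n →L[ℝ] Model n →L[ℝ] ℝ) (c : ℝ) (v w : Model n) : B (c • v) w = c * B v w := by
  rw [map_smul]; rfl

lemma bilin_smul_right (B : Model n →L[ℝ] Model n →L[ℝ] ℝ) (c : ℝ) (v w : Model n) : B v (c • w) = c * B v w := by
  rw [map_smul]; rfl

lemma bilin_neg_left (B : Model n →L[ℝ] Model n →L[ℝ] ℝ) (v w : Model n) : B (-v) w = -B v w := by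
  rw [map_neg]; rfl

lemma bilin_zero_left (B : Model n →L[ℝ] Model n →L[ℝ] ℝ) (w : Model n) : B 0 w = 0 := by
  rw [map_zero]; rfl

namespace IsHermForm

/-- The structure is invariant under cyclic permutations of the triple. -/
lemma rot (h : IsHermForm B J) : IsHermForm B ![J 1, J 2, J 0] where
  symm := h.symm
  pos := h.pos
  skew a v w := by fin_cases a <;> exact h.skew _ v w

lemma app_self (h : IsHermForm B J) (a : Fin 3) (v : Model n) : B (J a v) v = 0 := by
  have h1 := h.skew a v v
  rw [h.symm v (J a v)] at h1
  linarith

lemma eq_zero (h : IsHermForm B J) {v : Model n} (hv : B v v = 0) : v = 0 := by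
  by_contra hne
  exact (h.pos v hne).ne' hv

/-- The frame `(v, J₁ v, J₂ v, J₃ v)` is orthogonal. -/
lemma qframe_inner (h : IsHermForm B J) (hJ : QTriple J) (v : Model n) (i j : Fin 4) :
    B (qframe J v i) (qframe J v j) = if i = j then B v v else 0 := by
  have hsq : ∀ a, J a (J a v) = -v := fun a ↦ (DFunLike.congr_fun (hJ.sq a) v).trans rfl
  have h01 : J 0 (J 1 v) = J 2 v := DFunLike.congr_fun hJ.mul01 v
  have h02 : J 0 (J 2 v) = -J 1 v := DFunLike.congr_fun hJ.mul02 v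
  have h12 : J 1 (J 2 v) = J 0 v := DFunLike.congr_fun hJ.mul12 v
  have hs : ∀ a, B v (J a v) = 0 := fun a ↦ by rw [h.symm, h.app_self]
  have hn : ∀ a, B (J a v) (J a v) = B v v := fun a ↦ by rw [h.skew, hsq, map_neg, neg_neg]
  have e01 : B (J 0 v) (J 1 v) = 0 := by rw [h.skew, h01, hs, neg_zero]
  have e02 : B (J 0 v) (J 2 v) = 0 := by rw [h.skew, h02, map_neg, hs, neg_zero, neg_zero]
  have e12 : B (J 1 v) (J 2 v) = 0 := by rw [h.skew, h12, hs, neg_zero]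
  have e10 := (h.symm _ _).trans e01
  have e20 := (h.symm _ _).trans e02
  have e21 := (h.symm _ _).trans e12
  fin_cases i <;> fin_cases j <;>
    first
    | exact (hs _).trans (if_neg (by decide)).symm
    | exact (h.app_self _ _).trans (if_neg (by decide)).symm
    | exact (hn _).trans (if_pos rfl).symm
    | exact e01.trans (if_neg (by decide)).symm
    | exact e02.trans (if_neg (by decide)).symm
    | exact e12.trans (if_neg (by decide)).symm
    | exact e10.trans (if_neg (by decide)).symm
    | exact e20.trans (if_neg (by decide)).symm
    | exact e21.trans (if_neg (by decide)).symm
    | exact (if_pos rfl).symm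

lemma span_qframe (h : IsHermForm B J) (hJ : QTriple J) (hn : n = 1) {v : Model n} (hv : v ≠ 0) :
    Submodule.span ℝ (range (qframe J v)) = ⊤ := by
  have hli : LinearIndependent ℝ (qframe J v) := by
    rw [Fintype.linearIndependent_iff]
    intro c hc i
    have h1 : B (∑ j, c j • qframe J v j) (qframe J v i) = c i * B v v := by
      rw [map_sum, sum_apply]
      rw [Finset.sum_eq_single i]
      · rw [bilin_smul_left, h.qframe_inner hJ, if_pos rfl]
      · intro j _ hj
        rw [bilin_smul_left, h.qframe_inner hJ, if_neg hj, mul_zero]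
      · simp
    rw [hc, bilin_zero_left] at h1
    exact (mul_eq_zero.1 h1.symm).resolve_right (h.pos v hv).ne'
  exact hli.span_eq_top_of_card_eq_finrank (by simp [hn])

/-- A vector that is orthogonal to the frame vanishes. -/
lemma eq_zero_of_qframe (h : IsHermForm B J) (hJ : QTriple J) (hn : n = 1) {v : Model n} (hv : v ≠ 0) {w : Model n}
    (hw : ∀ i, B w (qframe J v i) = 0) : w = 0 := by
  have h1 : ∀ u, B w u = 0 := fun u ↦ by
    have hu : u ∈ Submodule.span ℝ (range (qframe J v)) := by rw [h.span_qframe hJ hn hv]; trivial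
    refine Submodule.span_induction (p := fun u _ ↦ B w u = 0) ?_ ?_ ?_ ?_ hu
    · rintro _ ⟨i, rfl⟩
      exact hw i
    · exact map_zero _
    · intro x y _ _ hx hy
      rw [map_add, hx, hy, add_zero]
    · intro c x _ hx
      rw [bilin_smul_right, hx, mul_zero]
  exact h.eq_zero (h1 w)

/-- An endomorphism that vanishes on the frame vanishes. -/
lemma end_eq_zero_of_qframe (h : IsHermForm B J) (hJ : QTriple J) (hn : n = 1) {v : Model n} (hv : v ≠ 0)
    {q : EndModel n} (hq : ∀ i, q (qframe J v i) = 0) : q = 0 := by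
  refine ContinuousLinearMap.ext fun u ↦ ?_
  have hu : u ∈ Submodule.span ℝ (range (qframe J v)) := by rw [h.span_qframe hJ hn hv]; trivial
  refine Submodule.span_induction (p := fun u _ ↦ q u = 0) ?_ ?_ ?_ ?_ hu
  · rintro _ ⟨i, rfl⟩
    exact hq i
  · exact map_zero _
  · intro x y _ _ hx hy
    rw [map_add, hx, hy, add_zero]
  · intro c x _ hx
    rw [map_smul, hx, smul_zero]

lemma skew_anticomm_inner (h : IsHermForm B J) {q : EndModel n} (hs : ∀ v w, B (q v) w = -B v (q w))
    (hc : ∀ v, q (J 0 v) = -J 0 (q v)) (u : Model n) : B (q u) u = 0 ∧ B (q u) (J 0 u) = 0 := by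
  have h1 := hs u u
  rw [h.symm u (q u)] at h1
  have h2 : B (q u) (J 0 u) = -B (J 0 (q u)) u := by rw [h.skew, neg_neg]
  have h3 : B (q (J 0 u)) u = -B (J 0 (q u)) u := by rw [hc, bilin_neg_left]
  have h4 := hs (J 0 u) u
  rw [h.symm (J 0 u) (q u)] at h4
  constructor <;> linarith

/-- In dimension four, the skew endomorphisms that anticommute with `J 0` are combinations of `J 1` and `J 2`. -/
lemma mem_span_of_skew_anticomm (h : IsHermForm B J) (hJ : QTriple J) (hn : n = 1) {q : EndModel n}
    (hs : ∀ v w, B (q v) w = -B v (q w)) (hc : ∀ v, q (J 0 v) = -J 0 (q v)) :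
    q ∈ Submodule.span ℝ (range J) := by
  have : Nontrivial (Model n) := by
    subst hn
    exact Module.nontrivial_of_finrank_pos (R := ℝ) (by simp)
  obtain ⟨v, hv⟩ := exists_ne (0 : Model n)
  have hN := (h.pos v hv).ne'
  have hin := h.qframe_inner hJ v
  set γ := B (q v) (J 1 v) / B v v with hγ
  set δ := B (q v) (J 2 v) / B v v with hδ
  set r : EndModel n := q - (γ • J 1 + δ • J 2) with hr
  have hra : ∀ u, r u = q u - (γ • J 1 u + δ • J 2 u) := fun u ↦ rfl
  have h10 : ∀ u, J 1 (J 0 u) = -J 2 u := fun u ↦ (DFunLike.congr_fun hJ.mul10 u).trans rfl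
  have h01 : ∀ u, J 0 (J 1 u) = J 2 u := fun u ↦ DFunLike.congr_fun hJ.mul01 u
  have h02 : ∀ u, J 0 (J 2 u) = -J 1 u := fun u ↦ (DFunLike.congr_fun hJ.mul02 u).trans rfl
  have h20 : ∀ u, J 2 (J 0 u) = J 1 u := fun u ↦ DFunLike.congr_fun hJ.mul20 u
  have hrs : ∀ v w, B (r v) w = -B v (r w) := fun v w ↦ by
    rw [hra, hra, bilin_sub_left, bilin_add_left, bilin_smul_left, bilin_smul_left, map_sub, map_add,
      bilin_smul_right, bilin_smul_right, hs, h.skew 1, h.skew 2]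
    ring
  have hrc : ∀ v, r (J 0 v) = -J 0 (r v) := fun v ↦ by
    rw [hra, hra, hc, h10, h20, map_sub, map_add, map_smul, map_smul, h01, h02]
    module
  have i1 : ∀ i j, i ≠ j → B (qframe J v i) (qframe J v j) = 0 := fun i j hij ↦ by rw [hin, if_neg hij]
  have i2 : ∀ i, B (qframe J v i) (qframe J v i) = B v v := fun i ↦ by rw [hin, if_pos rfl]
  -- Subtracting the components of `q v` along `J 1 v` and `J 2 v` leaves a skew endomorphism `r` that anticommutes with
  -- `J 0` and vanishes on the frame.
  have hrv : r v = 0 := h.eq_zero_of_qframe hJ hn hv fun i ↦ by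
    have key := h.skew_anticomm_inner hrs hrc v
    fin_cases i
    · exact key.1
    · exact key.2
    · change B (r v) (J 1 v) = 0
      have e1 : B (J 1 v) (J 1 v) = B v v := i2 2
      have e2 : B (J 2 v) (J 1 v) = 0 := i1 3 2 (by decide)
      rw [hra, bilin_sub_left, bilin_add_left, bilin_smul_left, bilin_smul_left, e1, e2, hγ]
      field_simp
      ring
    · change B (r v) (J 2 v) = 0
      have e1 : B (J 2 v) (J 2 v) = B v v := i2 3
      have e2 : B (J 1 v) (J 2 v) = 0 := i1 2 3 (by decide)
      rw [hra, bilin_sub_left, bilin_add_left, bilin_smul_left, bilin_smul_left, e1, e2, hδ]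
      field_simp
      ring
  have hr0 : r (J 0 v) = 0 := by rw [hrc, hrv, map_zero, neg_zero]
  have hr1 : r (J 1 v) = 0 := h.eq_zero_of_qframe hJ hn hv fun i ↦ by
    have key := h.skew_anticomm_inner hrs hrc (J 1 v)
    rw [h01] at key
    fin_cases i
    · change B (r (J 1 v)) v = 0
      rw [hrs, hrv, map_zero, neg_zero]
    · change B (r (J 1 v)) (J 0 v) = 0
      rw [hrs, hr0, map_zero, neg_zero]
    · exact key.1
    · exact key.2
  have hr2 : r (J 2 v) = 0 := by rw [← h01, hrc, hr1, map_zero, neg_zero]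
  have hr00 : r = 0 := h.end_eq_zero_of_qframe hJ hn hv fun i ↦ by
    fin_cases i
    exacts [hrv, hr0, hr1, hr2]
  rw [sub_eq_zero.1 hr00]
  exact Submodule.add_mem _ (Submodule.smul_mem _ _ (Submodule.subset_span ⟨1, rfl⟩))
    (Submodule.smul_mem _ _ (Submodule.subset_span ⟨2, rfl⟩))

end IsHermForm

end FrameAlgebra

variable {Q : AlmostQuaternionicStructure n M} {D : Connection n M} {g : Metric n M}

/-- A `𝒬`-Hermitian metric in coordinates. -/
lemma AlmostQuaternionicStructure.IsHermitian.isHermForm (h : Q.IsHermitian g) {x₀ : M} {p : Model n}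
    (hp : p ∈ (crd n x₀).target) {J : Fin 3 → EndModel n} (hJ : QTriple J) (hJQ : ∀ a, J a ∈ fibE Q x₀ p) :
    IsHermForm (gE g x₀ p) J := by
  have hy : (crd n x₀).symm p ∈ dom n x₀ := by simpa using (crd n x₀).map_target hp
  have hpp : crd n x₀ ((crd n x₀).symm p) = p := (crd n x₀).right_inv hp
  refine ⟨gE_symm g x₀ p, fun v ↦ gE_pos g hp, fun a v w ↦ ?_⟩
  have hsq : ∀ u, J a (J a u) = -u := fun u ↦ (DFunLike.congr_fun (hJ.sq a) u).trans rfl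
  have key : ∀ v w, gE g x₀ p (J a v) (J a w) = gE g x₀ p v w := fun v w ↦ by
    obtain ⟨y, hydef⟩ : ∃ y, y = (crd n x₀).symm p := ⟨_, rfl⟩
    rw [← hydef] at hy hpp
    have t : ∀ v, tc x₀ y (tcInv x₀ y v) = v := fun v ↦ tcoord_tcoordInv hy v
    have h1 : unhatE x₀ y (J a) ∈ Q.fiber y := by
      rw [← hatE_mem_fibE hy, hatE_unhatE hy, hpp]
      exact hJQ a
    have h2 : (unhatE x₀ y (J a)).comp (unhatE x₀ y (J a)) = -ContinuousLinearMap.id ℝ (TM n M y) := by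
      apply hatE_injective hy
      rw [hatE_comp hy, hatE_unhatE hy, hatE_neg, hatE_id hy]
      exact hJ.sq a
    have h3 := h y _ h1 h2 (tcInv x₀ y v) (tcInv x₀ y w)
    have h4 : ∀ u, tc x₀ y (unhatE x₀ y (J a) (tcInv x₀ y u)) = J a u := fun u ↦ by
      rw [← hatE_apply, hatE_unhatE hy]
    rw [← gE_tc g hy, ← gE_tc g hy, h4, h4, t, t, hpp] at h3
    exact h3
  have h5 := key v (J a w)
  rw [hsq, map_neg] at h5
  linarith

section LeviCivita

variable {x₀ : M} {p : Model n} {K : Model n → EndModel n}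

/-- The covariant derivative of a skew field of endomorphisms is skew. -/
lemma IsLeviCivita.covE_skew (h : IsLeviCivita g D) (hp : p ∈ (crd n x₀).target) (hK : DifferentiableAt ℝ K p)
    (hs : ∀ᶠ q in 𝓝 p, ∀ v w, gE g x₀ q (K q v) w = -gE g x₀ q v (K q w)) (X v w : Model n) :
    gE g x₀ p (covE (christoffel D x₀) p (K p) X (fderiv ℝ K p X) v) w =
      -gE g x₀ p v (covE (christoffel D x₀) p (K p) X (fderiv ℝ K p X) w) := by
  have hg := (contDiffAt_gE g hp).differentiableAt (by simp)
  have hKv : ∀ v, DifferentiableAt ℝ (fun q ↦ K q v) p ∧ fderiv ℝ (fun q ↦ K q v) p X = fderiv ℝ K p X v := fun v ↦ by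
    have h1 := hK.hasFDerivAt.clm_apply (hasFDerivAt_const v p)
    refine ⟨h1.differentiableAt, ?_⟩
    rw [h1.fderiv]
    simp
  have h1 := hasFDerivAt_bilin hg (hKv v).1 (differentiableAt_const w)
  have h2 := hasFDerivAt_bilin hg (differentiableAt_const v) (hKv w).1
  have h0 : (fun q ↦ gE g x₀ q (K q v) w) =ᶠ[𝓝 p] fun q ↦ -gE g x₀ q v (K q w) := by
    filter_upwards [hs] with q hq using hq v w
  have h3 := h0.fderiv_eq (𝕜 := ℝ)
  rw [fderiv_fun_neg] at h3
  have h4 := DFunLike.congr_fun h3 X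
  rw [neg_apply, h1.2, h2.2, (hKv v).2, (hKv w).2, fderiv_const_apply, fderiv_const_apply, zero_apply, map_zero,
    bilin_zero_left, h.fderiv_gE hp, h.fderiv_gE hp] at h4
  have hsp := hs.self_of_nhds
  have e : ∀ v, covE (christoffel D x₀) p (K p) X (fderiv ℝ K p X) v =
      fderiv ℝ K p X v + (christoffel D x₀ p X (K p v) - K p (christoffel D x₀ p X v)) := fun v ↦ rfl
  rw [e, e, bilin_add_left, bilin_sub_left, map_add, map_sub, hsp (christoffel D x₀ p X v) w]
  rw [hsp v (christoffel D x₀ p X w)] at h4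
  linarith

/-- The covariant derivative of a field `K` with `K² = -1` anticommutes with `K`. -/
lemma covE_app_anticomm {Γ : Model n → Model n →L[ℝ] Model n →L[ℝ] Model n} (hK : DifferentiableAt ℝ K p)
    (hs : ∀ᶠ q in 𝓝 p, ∀ v, K q (K q v) = -v) (X v : Model n) :
    covE Γ p (K p) X (fderiv ℝ K p X) (K p v) = -K p (covE Γ p (K p) X (fderiv ℝ K p X) v) := by
  have h1 := hK.hasFDerivAt.clm_apply (hK.hasFDerivAt.clm_apply (hasFDerivAt_const v p))
  have h0 : (fun q ↦ K q (K q v)) =ᶠ[𝓝 p] fun _ ↦ -v := by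
    filter_upwards [hs] with q hq using hq v
  have h2 := DFunLike.congr_fun (h1.fderiv.symm.trans h0.fderiv_eq) X
  simp only [fderiv_fun_const, Pi.zero_apply, zero_apply, add_apply, ContinuousLinearMap.comp_apply,
    ContinuousLinearMap.flip_apply, map_zero, zero_add] at h2
  have hsp := hs.self_of_nhds
  have e : ∀ v, covE Γ p (K p) X (fderiv ℝ K p X) v = fderiv ℝ K p X v + (Γ p X (K p v) - K p (Γ p X v)) :=
    fun v ↦ rfl
  rw [e, e, map_add, map_sub, hsp, hsp, map_neg]
  linear_combination (norm := module) h2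

variable [T2Space M] [SigmaCompactSpace M]

/-- In dimension four, the Levi-Civita connection of a `𝒬`-Hermitian metric is quaternionic: the derivative of `J a` is skew
and anticommutes with `J a`. -/
lemma IsLeviCivita.isQuaternionicConnection (hn : n = 1) (h : IsLeviCivita g D) (hg : Q.IsHermitian g) :
    Q.IsQuaternionicConnection D := by
  refine ⟨h.smooth, fun σ hσ hσQ x X ↦ ?_⟩
  have hx : x ∈ dom n x := mem_chart_source _ _
  have hp := crd_mem_target hx
  obtain ⟨J, hJ, hJQ⟩ := exists_frame Q hx
  have hmem : ∀ p, fibE Q x p = Submodule.span ℝ (range (J p)) → ∀ a, J p a ∈ fibE Q x p := fun p hp a ↦ by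
    rw [hp]; exact Submodule.subset_span ⟨a, rfl⟩
  have hJd : ∀ a, DifferentiableAt ℝ (fun p ↦ J p a) (crd n x x) := fun a ↦
    (hJ a).self_of_nhds.differentiableAt (by simp)
  have h0 := hJQ.self_of_nhds
  have hform := hg.isHermForm hp h0.1 (hmem _ h0.2)
  have hs : ∀ a X v w, gE g x (crd n x x) (covE (christoffel D x) (crd n x x) (J (crd n x x) a) X
      (fderiv ℝ (fun p ↦ J p a) (crd n x x) X) v) w = -gE g x (crd n x x) v (covE (christoffel D x) (crd n x x)
      (J (crd n x x) a) X (fderiv ℝ (fun p ↦ J p a) (crd n x x) X) w) := fun a ↦ by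
    refine h.covE_skew (K := fun p ↦ J p a) hp (hJd a) ?_
    filter_upwards [hJQ, target_mem_nhds hp] with q hq hqt
    exact (hg.isHermForm hqt hq.1 (hmem _ hq.2)).skew a
  have hc : ∀ a X v, covE (christoffel D x) (crd n x x) (J (crd n x x) a) X
      (fderiv ℝ (fun p ↦ J p a) (crd n x x) X) (J (crd n x x) a v) = -J (crd n x x) a (covE (christoffel D x)
      (crd n x x) (J (crd n x x) a) X (fderiv ℝ (fun p ↦ J p a) (crd n x x) X) v) := fun a ↦ by
    refine covE_app_anticomm (K := fun p ↦ J p a) (hJd a) ?_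
    filter_upwards [hJQ] with q hq v using (DFunLike.congr_fun (hq.1.sq a) v).trans rfl
  have hr : ∀ J : Fin 3 → EndModel n, range ![J 1, J 2, J 0] = range J := fun J ↦ by
    ext B
    constructor
    · rintro ⟨a, rfl⟩
      fin_cases a
      exacts [⟨1, rfl⟩, ⟨2, rfl⟩, ⟨0, rfl⟩]
    · rintro ⟨a, rfl⟩
      fin_cases a
      exacts [⟨2, rfl⟩, ⟨0, rfl⟩, ⟨1, rfl⟩]
  have hcov : ∀ a X, covE (christoffel D x) (crd n x x) (J (crd n x x) a) X
      (fderiv ℝ (fun p ↦ J p a) (crd n x x) X) ∈ fibE Q x (crd n x x) := fun a X ↦ by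
    rw [h0.2]
    fin_cases a
    · exact hform.mem_span_of_skew_anticomm h0.1 hn (hs 0 X) (hc 0 X)
    · rw [← hr]
      exact hform.rot.mem_span_of_skew_anticomm h0.1.rot hn (hs 1 X) (hc 1 X)
    · rw [← hr, ← hr]
      exact hform.rot.rot.mem_span_of_skew_anticomm h0.1.rot.rot hn (hs 2 X) (hc 2 X)
  have hσd : ContDiffAt ℝ ∞ (hatF x σ) (crd n x x) := (smoothEndAt_iff hx).1 (hσ x)
  have hσm : ∀ᶠ q in 𝓝 (crd n x x), hatF x σ q ∈ fibE Q x q := by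
    filter_upwards [target_mem_nhds hp] with q hq
    have hy : (crd n x).symm q ∈ dom n x := by simpa using (crd n x).map_target hq
    have h1 := (hatE_mem_fibE hy).2 (hσQ ((crd n x).symm q))
    rwa [(crd n x).right_inv hq] at h1
  have hn1 : 1 ≤ n := hn.ge
  have hres := covE_mem_of_curve (Γ := christoffel D x) (hσd.differentiableAt (by simp)) hσm (tc x x X)
    fun c₁ c₂ hc₁ hc₂ h0c hQ ↦ by
      rw [← h0c] at hJd hJQ hcov ⊢
      exact covE_curve_mem_of_frame hn1 hc₁ hc₂ hJd hJQ (fun a ↦ hcov a _) hQ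
  refine ⟨unhatE x x (covE (christoffel D x) (crd n x x) (hatF x σ (crd n x x)) (tc x x X)
    (fderiv ℝ (hatF x σ) (crd n x x) (tc x x X))), ?_, ?_⟩
  · rw [← hatE_mem_fibE hx, hatE_unhatE hx]
    exact hres
  · rw [isEndCovDeriv_iff hx (hσ x), hatE_unhatE hx, hatF_crd hx]
    rfl

end LeviCivita

end

section
variable {n : ℕ} {M : Type*} [TopologicalSpace M] [ChartedSpace (Model n) M]
  [IsManifold (𝓡 (4 * n)) ∞ M]

/-! ### Curvature tensors in dimension four -/

/-- The algebraic symmetries of the components of a Riemannian curvature tensor in an orthonormal frame. -/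
structure IsCurv (r : Fin 4 → Fin 4 → Fin 4 → Fin 4 → ℝ) : Prop where
  skew_left : ∀ i j k l, r i j k l = -r j i k l
  skew_right : ∀ i j k l, r i j k l = -r i j l k
  bianchi : ∀ i j k l, r i j k l + r j k i l + r k i j l = 0

/-- The curvature form evaluated on the bivectors `e i ∧ e j + e k ∧ e l` and `e i' ∧ e j' + e k' ∧ e l'`. -/
def pairing (r : Fin 4 → Fin 4 → Fin 4 → Fin 4 → ℝ) (i j k l i' j' k' l' : Fin 4) : ℝ :=
  r i j i' j' + r i j k' l' + r k l i' j' + r k l k' l'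

/-- The components of the Ricci tensor in an orthonormal frame. -/
def ricR (r : Fin 4 → Fin 4 → Fin 4 → Fin 4 → ℝ) (j k : Fin 4) : ℝ := ∑ i, r i j k i

/-- The components of the Weyl tensor in an orthonormal frame. -/
def weylR (r : Fin 4 → Fin 4 → Fin 4 → Fin 4 → ℝ) (i j k l : Fin 4) : ℝ :=
  r i j k l - (1 / 2 : ℝ) * (ricR r j k * (if i = l then 1 else 0) - ricR r i k * (if j = l then 1 else 0)
      + (if j = k then 1 else 0) * ricR r i l - (if i = k then 1 else 0) * ricR r j l)
    + (∑ m, ricR r m m) / 6 * ((if j = k then 1 else 0) * (if i = l then 1 else 0)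
      - (if i = k then 1 else 0) * (if j = l then 1 else 0))

/-- The permutation of the indices of the frame `(v, J 0 v, J 1 v, J 2 v)` induced by `J 0`. -/
def permJ : Fin 4 → Fin 4 := ![1, 0, 3, 2]

/-- The signs that go with `permJ`. -/
def signJ : Fin 4 → ℝ := ![1, -1, 1, -1]

/-- The component along `J 1 v` of the curvature obstruction at `J 0`, applied to `v = e 0`, in the frame
`(v, J 0 v, J 1 v, J 2 v)`. -/
def obstR₂ (r : Fin 4 → Fin 4 → Fin 4 → Fin 4 → ℝ) (i j : Fin 4) : ℝ :=
  (r i j 0 3 + r i j 1 2)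
    - signJ i * signJ j * (r (permJ i) (permJ j) 0 3 + r (permJ i) (permJ j) 1 2)
    + signJ i * (r (permJ i) j 0 2 + r (permJ i) j 3 1) + signJ j * (r i (permJ j) 0 2 + r i (permJ j) 3 1)

/-- The component along `J 2 v` of the curvature obstruction at `J 0`, applied to `v = e 0`, in the frame
`(v, J 0 v, J 1 v, J 2 v)`. -/
def obstR₃ (r : Fin 4 → Fin 4 → Fin 4 → Fin 4 → ℝ) (i j : Fin 4) : ℝ :=
  -(r i j 0 2 + r i j 3 1)
    + signJ i * signJ j * (r (permJ i) (permJ j) 0 2 + r (permJ i) (permJ j) 3 1)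
    + signJ i * (r (permJ i) j 0 3 + r (permJ i) j 1 2) + signJ j * (r i (permJ j) 0 3 + r i (permJ j) 1 2)

lemma forall_fin_four {P : Fin 4 → Prop} : (∀ k, P k) ↔ P 0 ∧ P 1 ∧ P 2 ∧ P 3 :=
  ⟨fun h ↦ ⟨h 0, h 1, h 2, h 3⟩, fun h k ↦ by fin_cases k; exacts [h.1, h.2.1, h.2.2.1, h.2.2.2]⟩

namespace IsCurv

variable {r : Fin 4 → Fin 4 → Fin 4 → Fin 4 → ℝ}

/-- Pair symmetry follows from the Bianchi identity. -/
lemma pair_symm (h : IsCurv r) (i j k l : Fin 4) : r i j k l = r k l i j := by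
  have b1 := h.bianchi i j k l
  have b2 := h.bianchi j k l i
  have b3 := h.bianchi k l i j
  have b4 := h.bianchi l i j k
  have s1 := h.skew_left
  have s2 := h.skew_right
  linarith [s1 i j k l, s2 i j k l, s1 j k i l, s2 j k i l, s1 k i j l, s2 k i j l, s1 j k l i, s2 j k l i,
    s1 k l j i, s2 k l j i, s1 l j k i, s2 l j k i, s1 k l i j, s2 k l i j, s1 l i k j, s2 l i k j,
    s1 i k l j, s2 i k l j, s1 l i j k, s2 l i j k, s1 i j l k, s2 i j l k, s1 j l i k, s2 j l i k]

lemma self_left (h : IsCurv r) (i k l : Fin 4) : r i i k l = 0 := by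
  linarith [h.skew_left i i k l]

lemma self_right (h : IsCurv r) (i j k : Fin 4) : r i j k k = 0 := by
  linarith [h.skew_right i j k k]

/-- The components of a curvature tensor in dimension four are determined by twenty of them.  The pairs of indices are
`01`, `02`, `03` and their Hodge duals `23`, `31`, `12`. -/
lemma normal_form (h : IsCurv r) : (∀ k l, r 1 0 k l = -r 0 1 k l) ∧ (∀ k l, r 2 0 k l = -r 0 2 k l) ∧
    (∀ k l, r 3 0 k l = -r 0 3 k l) ∧ (∀ k l, r 2 1 k l = -r 1 2 k l) ∧ (∀ k l, r 1 3 k l = -r 3 1 k l) ∧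
    (∀ k l, r 3 2 k l = -r 2 3 k l) ∧ (∀ i j, r i j 1 0 = -r i j 0 1) ∧ (∀ i j, r i j 2 0 = -r i j 0 2) ∧
    (∀ i j, r i j 3 0 = -r i j 0 3) ∧ (∀ i j, r i j 2 1 = -r i j 1 2) ∧ (∀ i j, r i j 1 3 = -r i j 3 1) ∧
    (∀ i j, r i j 3 2 = -r i j 2 3) ∧ r 0 2 0 1 = r 0 1 0 2 ∧ r 0 3 0 1 = r 0 1 0 3 ∧ r 1 2 0 1 = r 0 1 1 2 ∧
    r 3 1 0 1 = r 0 1 3 1 ∧ r 2 3 0 1 = r 0 1 2 3 ∧ r 0 3 0 2 = r 0 2 0 3 ∧ r 1 2 0 2 = r 0 2 1 2 ∧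
    r 3 1 0 2 = r 0 2 3 1 ∧ r 2 3 0 2 = r 0 2 2 3 ∧ r 1 2 0 3 = r 0 3 1 2 ∧ r 3 1 0 3 = r 0 3 3 1 ∧
    r 2 3 0 3 = r 0 3 2 3 ∧ r 3 1 1 2 = r 1 2 3 1 ∧ r 2 3 1 2 = r 1 2 2 3 ∧ r 2 3 3 1 = r 3 1 2 3 ∧
    r 0 1 2 3 = -r 0 2 3 1 - r 0 3 1 2 := by
  have hs := h.skew_left
  have ht := h.skew_right
  have hp := h.pair_symm
  refine ⟨hs _ _, hs _ _, hs _ _, hs _ _, hs _ _, hs _ _, fun i j ↦ ht i j _ _, fun i j ↦ ht i j _ _,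
    fun i j ↦ ht i j _ _, fun i j ↦ ht i j _ _, fun i j ↦ ht i j _ _, fun i j ↦ ht i j _ _,
    hp _ _ _ _, hp _ _ _ _, hp _ _ _ _, hp _ _ _ _, hp _ _ _ _, hp _ _ _ _, hp _ _ _ _, hp _ _ _ _,
    hp _ _ _ _, hp _ _ _ _, hp _ _ _ _, hp _ _ _ _, hp _ _ _ _, hp _ _ _ _, hp _ _ _ _, ?_⟩
  linarith [h.bianchi 0 1 2 3, hp 1 2 0 3, hs 2 0 1 3, ht 0 2 1 3]

/-- `W⁺` is the trace-free part of the curvature form on self-dual bivectors.  This is its vanishing on the bivector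
`e₀ ∧ e₁ + e₂ ∧ e₃`. -/
lemma weylR_eq_zero_iff (h : IsCurv r) : (∀ k l, weylR r 0 1 k l + weylR r 2 3 k l = 0) ↔
    pairing r 0 1 2 3 0 2 3 1 = 0 ∧ pairing r 0 1 2 3 0 3 1 2 = 0 ∧
      2 * pairing r 0 1 2 3 0 1 2 3 = pairing r 0 2 3 1 0 2 3 1 + pairing r 0 3 1 2 0 3 1 2 := by
  obtain ⟨a1, a2, a3, a4, a5, a6, b1, b2, b3, b4, b5, b6, c1, c2, c3, c4, c5, c6, c7, c8, c9, d1, d2, d3, d4, d5, d6,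
    d7⟩ := h.normal_form
  simp only [forall_fin_four, weylR, ricR, pairing, Fin.sum_univ_four, Fin.isValue, Fin.reduceEq, if_true, if_false,
    a1, a2, a3, a4, a5, a6, b1, b2, b3, b4, b5, b6, c1, c2, c3, c4, c5, c6, c7, c8, c9, d1, d2, d3, d4, d5, d6, d7,
    h.self_left, h.self_right, mul_zero, mul_one, zero_add, add_zero, sub_zero]
  constructor
  · rintro ⟨⟨-, e1, e2, e3⟩, -⟩
    refine ⟨?_, ?_, ?_⟩ <;> linarith
  · rintro ⟨e1, e2, e3⟩
    refine ⟨⟨?_, ?_, ?_, ?_⟩, ⟨?_, ?_, ?_, ?_⟩, ⟨?_, ?_, ?_, ?_⟩, ?_, ?_, ?_, ?_⟩ <;> linarith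

/-- The curvature obstruction at `J 0` is the trace-free part of the curvature form on the self-dual bivectors orthogonal to
`e₀ ∧ e₁ + e₂ ∧ e₃`. -/
lemma obstR_eq_zero_iff (h : IsCurv r) : (∀ i j, obstR₂ r i j = 0 ∧ obstR₃ r i j = 0) ↔
    pairing r 0 2 3 1 0 3 1 2 = 0 ∧ pairing r 0 2 3 1 0 2 3 1 = pairing r 0 3 1 2 0 3 1 2 := by
  obtain ⟨a1, a2, a3, a4, a5, a6, b1, b2, b3, b4, b5, b6, c1, c2, c3, c4, c5, c6, c7, c8, c9, d1, d2, d3, d4, d5, d6,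
    d7⟩ := h.normal_form
  have p : permJ 0 = 1 ∧ permJ 1 = 0 ∧ permJ 2 = 3 ∧ permJ 3 = 2 := ⟨rfl, rfl, rfl, rfl⟩
  have s : signJ 0 = 1 ∧ signJ 1 = -1 ∧ signJ 2 = 1 ∧ signJ 3 = -1 := ⟨rfl, rfl, rfl, rfl⟩
  obtain ⟨p0, p1, p2, p3⟩ := p
  obtain ⟨s0, s1, s2, s3⟩ := s
  simp only [forall_fin_four, obstR₂, obstR₃, pairing, p0, p1, p2, p3, s0, s1, s2, s3,
    a1, a2, a3, a4, a5, a6, c7, c8, c9, d1, d2, d3, d4, d5, d6,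
    h.self_left]
  constructor
  · rintro ⟨⟨-, -, e2, e3⟩, -⟩
    exact ⟨by linarith, by linarith⟩
  · rintro ⟨e1, e2⟩
    refine ⟨⟨⟨?_, ?_⟩, ⟨?_, ?_⟩, ⟨?_, ?_⟩, ?_, ?_⟩, ⟨⟨?_, ?_⟩, ⟨?_, ?_⟩, ⟨?_, ?_⟩, ?_, ?_⟩,
      ⟨⟨?_, ?_⟩, ⟨?_, ?_⟩, ⟨?_, ?_⟩, ?_, ?_⟩, ⟨?_, ?_⟩, ⟨?_, ?_⟩, ⟨?_, ?_⟩, ?_, ?_⟩ <;> linarith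

end IsCurv

end

section
/-! ### The curvature in coordinates -/

variable {n : ℕ} {M : Type*} [TopologicalSpace M] [ChartedSpace (Model n) M]
  [IsManifold (𝓡 (4 * n)) ∞ M]


set_option synthInstance.maxHeartbeats 200000

section Curvature

variable {D : Connection n M} {g : Metric n M} {x₀ : M} {p : Model n}

/-- The extensions of tangent vectors in the definition of the curvature are coordinate fields. -/
lemma extendVF_eq_coordVF {x y : M} (hy : y ∈ dom n x) (v : TM n M x) : extendVF v y = coordVF x (tc x x v) y := by
  have h : tc x x v = (trivializationAt (Model n) (TangentSpace (𝓡 (4 * n))) x).continuousLinearMapAt ℝ x v := by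
    rw [← tcoord_eq_trivialization (mem_chart_source _ _)]
  have hx : x ∈ (trivializationAt (Model n) (TangentSpace (𝓡 (4 * n))) x).baseSet :=
    FiberBundle.mem_baseSet_trivializationAt' x
  have hy' : y ∈ (trivializationAt (Model n) (TangentSpace (𝓡 (4 * n))) x).baseSet := by simpa using hy
  have h2 : (trivializationAt (Model n) (TangentSpace (𝓡 (4 * n))) x).continuousLinearMapAt ℝ x v =
      (trivializationAt (Model n) (TangentSpace (𝓡 (4 * n))) x ⟨x, v⟩).2 := by
    rw [Trivialization.continuousLinearMapAt_apply, Trivialization.linearMapAt_apply, if_pos hx]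
  rw [h, h2, coordVF]
  exact (Trivialization.symmL_apply _ hy' _).symm

variable [T2Space M] [SigmaCompactSpace M]

lemma contDiffAt_christoffel (hD : IsSmoothConnection D) (hp : p ∈ (crd n x₀).target) :
    ContDiffAt ℝ ∞ (christoffel D x₀) p := (contDiffOn_christoffel hD x₀).contDiffAt (target_mem_nhds hp)

lemma vfCoord_conn_coordVF (D : Connection n M) {y : M} (hy : y ∈ dom n x₀) (v w : Model n) :
    vfCoord (𝓡 (4 * n)) x₀ (fun y ↦ D (coordVF x₀ w) y (coordVF x₀ v y)) =ᶠ[𝓝 (crd n x₀ y)]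
      fun q ↦ christoffel D x₀ q v w := by
  filter_upwards [target_mem_nhds (crd_mem_target hy)] with q hq
  have hy' : (crd n x₀).symm q ∈ dom n x₀ := by simpa using (crd n x₀).map_target hq
  have h1 := tc_conn_coordVF D hy' w (coordVF x₀ v ((crd n x₀).symm q))
  rw [coordVF, tcoord_tcoordInv hy', (crd n x₀).right_inv hq] at h1
  exact h1

lemma smooth_conn_coordVF_coordVF (hD : IsSmoothConnection D) {y : M} (hy : y ∈ dom n x₀) (v w : Model n) :
    SmoothVFAt (fun y ↦ D (coordVF x₀ w) y (coordVF x₀ v y)) y := by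
  have hΓ := contDiffAt_christoffel hD (crd_mem_target hy)
  have hd : ContDiffAt ℝ ∞ (fun q ↦ christoffel D x₀ q v w) (crd n x₀ y) :=
    (hΓ.clm_apply contDiffAt_const).clm_apply contDiffAt_const
  exact (smoothVFAt_iff hy).2 (hd.congr_of_eventuallyEq (vfCoord_conn_coordVF D hy v w))

lemma hasFDerivAt_clm_apply_apply {E F G H : Type*} [NormedAddCommGroup E] [NormedSpace ℝ E] [NormedAddCommGroup F]
    [NormedSpace ℝ F] [NormedAddCommGroup G] [NormedSpace ℝ G] [NormedAddCommGroup H] [NormedSpace ℝ H]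
    {Γ : H → E →L[ℝ] F →L[ℝ] G} {p : H} (hΓ : DifferentiableAt ℝ Γ p) (X : E) (v : F) :
    DifferentiableAt ℝ (fun q ↦ Γ q X v) p ∧ ∀ Y, fderiv ℝ (fun q ↦ Γ q X v) p Y = fderiv ℝ Γ p Y X v := by
  have h1 := (hΓ.hasFDerivAt.clm_apply (hasFDerivAt_const X p)).clm_apply (hasFDerivAt_const v p)
  refine ⟨h1.differentiableAt, fun Y ↦ ?_⟩
  rw [h1.fderiv]
  simp

/-- The second covariant derivatives of coordinate vector fields. -/
lemma tc_conn_conn_coordVF (hD : IsSmoothConnection D) {y : M} (hy : y ∈ dom n x₀) (v w : Model n) (X : TM n M y) :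
    tc x₀ y (D (fun y ↦ D (coordVF x₀ w) y (coordVF x₀ v y)) y X) =
      fderiv ℝ (christoffel D x₀) (crd n x₀ y) (tc x₀ y X) v w +
        christoffel D x₀ (crd n x₀ y) (tc x₀ y X) (christoffel D x₀ (crd n x₀ y) v w) := by
  have hΓ := contDiffAt_christoffel hD (crd_mem_target hy)
  have h2 : tc x₀ y (D (coordVF x₀ w) y (coordVF x₀ v y)) = christoffel D x₀ (crd n x₀ y) v w := by
    rw [tc_conn_coordVF D hy, coordVF, tcoord_tcoordInv hy]
  rw [tc_conn D hy (smooth_conn_coordVF_coordVF hD hy v w).mdiff, (vfCoord_conn_coordVF D hy v w).fderiv_eq,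
    (hasFDerivAt_clm_apply_apply (hΓ.differentiableAt (by simp)) v w).2, h2]

/-- The curvature in coordinates. -/
lemma curvature_eq_curE (hD : IsSmoothConnection D) (x : M) (X Y Z : TM n M x) :
    tc x x (curvature D x X Y Z) =
      curE (christoffel D x) (crd n x x) (tc x x X) (tc x x Y) (tc x x Z) := by
  have hx : x ∈ dom n x := mem_chart_source _ _
  have hev : ∀ y ∈ dom n x, ∀ v : TM n M x, ∀ᶠ w in 𝓝 y, extendVF v w = coordVF x (tc x x v) w := fun y hy v ↦ by
    filter_upwards [(chartAt (Model n) x).open_source.mem_nhds hy] with w hw using extendVF_eq_coordVF hw v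
  have h1 : ∀ y ∈ dom n x, D (extendVF Z) y = D (coordVF x (tc x x Z)) y := fun y hy ↦
    conn_congr D (smooth_coordVF hy _) (hev y hy Z)
  have h2 : ∀ v : TM n M x, D (fun y ↦ D (extendVF Z) y (extendVF v y)) x =
      D (fun y ↦ D (coordVF x (tc x x Z)) y (coordVF x (tc x x v) y)) x := fun v ↦ by
    refine conn_congr D (smooth_conn_coordVF_coordVF hD hx _ _) ?_
    filter_upwards [(chartAt (Model n) x).open_source.mem_nhds hx] with w hw
    rw [h1 w hw, extendVF_eq_coordVF hw]
  have h3 : VectorField.mlieBracket (𝓡 (4 * n)) (extendVF X) (extendVF Y) x = 0 := by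
    rw [← mlieBracket_coordVF hx (tc x x X) (tc x x Y)]
    exact Filter.EventuallyEq.mlieBracket_vectorField_eq (hev x hx X) (hev x hx Y)
  rw [curvature, h2, h2, h3, map_sub, map_sub, tc_conn_conn_coordVF hD hx, tc_conn_conn_coordVF hD hx, map_zero,
    map_zero, sub_zero, curE]
  change _ = fderiv ℝ (christoffel D x) (crd n x x) (tc x x X) (tc x x Y) (tc x x Z)
    - fderiv ℝ (christoffel D x) (crd n x x) (tc x x Y) (tc x x X) (tc x x Z)
    + (christoffel D x (crd n x x) (tc x x X) (christoffel D x (crd n x x) (tc x x Y) (tc x x Z))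
      - christoffel D x (crd n x x) (tc x x Y) (christoffel D x (crd n x x) (tc x x X) (tc x x Z)))
  abel

/-- The curvature endomorphisms of a Levi-Civita connection are skew. -/
lemma IsLeviCivita.curE_skew (h : IsLeviCivita g D) (hp : p ∈ (crd n x₀).target) (X Y v w : Model n) :
    gE g x₀ p (curE (christoffel D x₀) p X Y v) w = -gE g x₀ p v (curE (christoffel D x₀) p X Y w) := by
  have hg := contDiffAt_gE g hp
  have hΓ := contDiffAt_christoffel h.smooth hp
  have hgd := hg.differentiableAt (by simp)
  have hf : ContDiffAt ℝ ∞ (fun q ↦ gE g x₀ q v w) p := (hg.clm_apply contDiffAt_const).clm_apply contDiffAt_const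
  have hsymm : IsSymmSndFDerivAt ℝ (fun q ↦ gE g x₀ q v w) p := hf.isSymmSndFDerivAt (by
    rw [minSmoothness_of_isRCLikeNormedField]
    exact WithTop.coe_le_coe.2 (le_top : (2 : ℕ∞) ≤ ⊤))
  have hΓv := fun X v ↦ hasFDerivAt_clm_apply_apply (hΓ.differentiableAt (by simp)) X v
  have hdf : ∀ X Y, fderiv ℝ (fderiv ℝ (fun q ↦ gE g x₀ q v w)) p Y X =
      gE g x₀ p (christoffel D x₀ p Y (christoffel D x₀ p X v)) w
      + gE g x₀ p (christoffel D x₀ p X v) (christoffel D x₀ p Y w)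
      + gE g x₀ p (fderiv ℝ (christoffel D x₀) p Y X v) w
      + (gE g x₀ p (christoffel D x₀ p Y v) (christoffel D x₀ p X w)
        + gE g x₀ p v (christoffel D x₀ p Y (christoffel D x₀ p X w))
        + gE g x₀ p v (fderiv ℝ (christoffel D x₀) p Y X w)) := fun X Y ↦ by
    have h1 : (fun q ↦ fderiv ℝ (fun q ↦ gE g x₀ q v w) q X) =ᶠ[𝓝 p] fun q ↦
        gE g x₀ q (christoffel D x₀ q X v) w + gE g x₀ q v (christoffel D x₀ q X w) := by
      filter_upwards [target_mem_nhds hp] with q hq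
      have hgq := (contDiffAt_gE g hq).differentiableAt (by simp)
      rw [(hasFDerivAt_bilin hgq (differentiableAt_const v) (differentiableAt_const w)).2, fderiv_const_apply,
        fderiv_const_apply, zero_apply, map_zero, zero_apply, map_zero, h.fderiv_gE hq]
      ring
    have h2 := hasFDerivAt_bilin hgd (hΓv X v).1 (differentiableAt_const w)
    have h3 := hasFDerivAt_bilin hgd (differentiableAt_const v) (hΓv X w).1
    have h4 : DifferentiableAt ℝ (fderiv ℝ (fun q ↦ gE g x₀ q v w)) p :=
      (hf.fderiv_right (m := ∞) (by simp)).differentiableAt (by simp)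
    have h5 := h4.hasFDerivAt.clm_apply (hasFDerivAt_const X p)
    have h6 : fderiv ℝ (fun q ↦ fderiv ℝ (fun q ↦ gE g x₀ q v w) q X) p Y =
        fderiv ℝ (fderiv ℝ (fun q ↦ gE g x₀ q v w)) p Y X := by
      rw [h5.fderiv]
      simp
    rw [← h6, h1.fderiv_eq, fderiv_fun_add h2.1 h3.1, add_apply, h2.2, h3.2, (hΓv X v).2, (hΓv X w).2,
      fderiv_const_apply, fderiv_const_apply, zero_apply, map_zero, bilin_zero_left, h.fderiv_gE hp, h.fderiv_gE hp]
    ring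
  have h1 := hsymm X Y
  rw [hdf, hdf] at h1
  have e : ∀ v, curE (christoffel D x₀) p X Y v = fderiv ℝ (christoffel D x₀) p X Y v
      - fderiv ℝ (christoffel D x₀) p Y X v + (christoffel D x₀ p X (christoffel D x₀ p Y v)
        - christoffel D x₀ p Y (christoffel D x₀ p X v)) := fun v ↦ rfl
  rw [e, e, bilin_add_left, bilin_sub_left, bilin_sub_left, map_add, map_sub, map_sub]
  linarith

end Curvature

section Algebra

variable {Γ : Model n → Model n →L[ℝ] Model n →L[ℝ] Model n} {p : Model n}

lemma curE_swap (X Y : Model n) : curE Γ p X Y = -curE Γ p Y X := by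
  simp only [curE]
  abel

lemma curE_add_left (X X' Y : Model n) : curE Γ p (X + X') Y = curE Γ p X Y + curE Γ p X' Y := by
  have h1 : fderiv ℝ Γ p (X + X') Y = fderiv ℝ Γ p X Y + fderiv ℝ Γ p X' Y := by rw [map_add]; rfl
  rw [curE, curE, curE, h1, map_add, map_add, add_mul, mul_add]
  abel

lemma curE_smul_left (c : ℝ) (X Y : Model n) : curE Γ p (c • X) Y = c • curE Γ p X Y := by
  have h1 : fderiv ℝ Γ p (c • X) Y = c • fderiv ℝ Γ p X Y := by rw [map_smul]; rfl
  rw [curE, curE, h1, map_smul, map_smul, endModel_mul_smul, endModel_smul_mul]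
  module

lemma curE_smul_right (c : ℝ) (X Y : Model n) : curE Γ p X (c • Y) = c • curE Γ p X Y := by
  rw [curE_swap, curE_smul_left, curE_swap X Y]
  module

lemma obst_add {R : Type*} [Ring R] (A a b c d a' b' c' d' : R) :
    ((a + a') * A - A * (a + a')) - ((b + b') * A - A * (b + b'))
      + A * (((c + c') * A - A * (c + c')) + ((d + d') * A - A * (d + d'))) =
    ((a * A - A * a) - (b * A - A * b) + A * ((c * A - A * c) + (d * A - A * d))) +
      ((a' * A - A * a') - (b' * A - A * b') + A * ((c' * A - A * c') + (d' * A - A * d'))) := by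
  noncomm_ring

lemma obst_smul {R : Type*} [Ring R] [Algebra ℝ R] (A a b c d : R) (t : ℝ) :
    ((t • a) * A - A * (t • a)) - ((t • b) * A - A * (t • b))
      + A * (((t • c) * A - A * (t • c)) + ((t • d) * A - A * (t • d))) =
    t • ((a * A - A * a) - (b * A - A * b) + A * ((c * A - A * c) + (d * A - A * d))) := by
  simp only [mul_smul_comm, smul_mul_assoc, smul_sub, smul_add, mul_add, mul_sub]

lemma obst_neg {R : Type*} [Ring R] (A a b c d : R) :
    ((-a) * A - A * (-a)) - ((-b) * A - A * (-b)) + A * (((-d) * A - A * (-d)) + ((-c) * A - A * (-c))) =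
    -((a * A - A * a) - (b * A - A * b) + A * ((c * A - A * c) + (d * A - A * d))) := by
  noncomm_ring

lemma eE_add_left (A : EndModel n) (X X' Y : Model n) : eE Γ p A (X + X') Y = eE Γ p A X Y + eE Γ p A X' Y := by
  rw [eE, map_add, curE_add_left, curE_add_left, curE_add_left, curE_add_left]
  exact obst_add _ _ _ _ _ _ _ _ _

lemma eE_smul_left (A : EndModel n) (c : ℝ) (X Y : Model n) : eE Γ p A (c • X) Y = c • eE Γ p A X Y := by
  rw [eE, map_smul, curE_smul_left, curE_smul_left, curE_smul_left, curE_smul_left]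
  exact obst_smul _ _ _ _ _ _

lemma eE_swap (A : EndModel n) (X Y : Model n) : eE Γ p A X Y = -eE Γ p A Y X := by
  rw [eE, curE_swap X Y, curE_swap (A X) (A Y), curE_swap (A X) Y, curE_swap X (A Y)]
  exact obst_neg _ _ _ _ _

end Algebra

end

section
/-! ### The self-dual Weyl tensor and the curvature obstruction -/

variable {n : ℕ} {M : Type*} [TopologicalSpace M] [ChartedSpace (Model n) M]
  [IsManifold (𝓡 (4 * n)) ∞ M]

section FrameComponents

variable {B : Model n →L[ℝ] Model n →L[ℝ] ℝ} {J : Fin 3 → EndModel n} {e : Fin 4 → Model n}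
  {Γ : Model n → Model n →L[ℝ] Model n →L[ℝ] Model n} {p v : Model n}

/-- The components of the curvature in a frame, for a scalar product `B` and Christoffel symbols `Γ`. -/
def curvR (B : Model n →L[ℝ] Model n →L[ℝ] ℝ) (Γ : Model n → Model n →L[ℝ] Model n →L[ℝ] Model n) (p : Model n)
    (e : Fin 4 → Model n) (i j k l : Fin 4) : ℝ := B (curE Γ p (e i) (e j) (e k)) (e l)

lemma isCurv_curvR (hsymm : ∀ v w, B v w = B w v) (hs : ∀ X Y v w, B (curE Γ p X Y v) w = -B v (curE Γ p X Y w))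
    (hb : ∀ X Y Z, curE Γ p X Y Z + curE Γ p Y Z X + curE Γ p Z X Y = 0) : IsCurv (curvR B Γ p e) where
  skew_left i j k l := by
    rw [curvR, curE_swap]
    exact bilin_neg_left B _ _
  skew_right i j k l := by
    rw [curvR, curvR, hs, hsymm]
  bianchi i j k l := by
    have h := congrArg (fun u ↦ B u (e l)) (hb (e i) (e j) (e k))
    simp only [bilin_add_left, bilin_zero_left] at h
    exact h

/-- The Ricci tensor in coordinates. -/
def ricE (B : Model n →L[ℝ] Model n →L[ℝ] ℝ) (Γ : Model n → Model n →L[ℝ] Model n →L[ℝ] Model n) (p : Model n)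
    (e : Fin 4 → Model n) (Y Z : Model n) : ℝ := ∑ i, B (curE Γ p (e i) Y Z) (e i)

/-- The Weyl tensor in coordinates. -/
def weylE (B : Model n →L[ℝ] Model n →L[ℝ] ℝ) (Γ : Model n → Model n →L[ℝ] Model n →L[ℝ] Model n) (p : Model n)
    (e : Fin 4 → Model n) (X Y Z V : Model n) : ℝ :=
  B (curE Γ p X Y Z) V - (1 / 2 : ℝ) * (ricE B Γ p e Y Z * B X V - ricE B Γ p e X Z * B Y V
      + B Y Z * ricE B Γ p e X V - B X Z * ricE B Γ p e Y V)
    + (∑ i, ricE B Γ p e (e i) (e i)) / 6 * (B Y Z * B X V - B X Z * B Y V)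

lemma ricE_add (Y Z Z' : Model n) : ricE B Γ p e Y (Z + Z') = ricE B Γ p e Y Z + ricE B Γ p e Y Z' := by
  simp only [ricE, ← Finset.sum_add_distrib, ← bilin_add_left, ← map_add]

lemma ricE_smul (c : ℝ) (Y Z : Model n) : ricE B Γ p e Y (c • Z) = c * ricE B Γ p e Y Z := by
  rw [ricE, ricE, Finset.mul_sum]
  refine Finset.sum_congr rfl fun i _ ↦ ?_
  rw [← bilin_smul_left, ← map_smul]

lemma curE_inner_add (X Y Z Z' V : Model n) :
    B (curE Γ p X Y (Z + Z')) V = B (curE Γ p X Y Z) V + B (curE Γ p X Y Z') V := by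
  rw [map_add, bilin_add_left]

lemma curE_inner_smul (c : ℝ) (X Y Z V : Model n) : B (curE Γ p X Y (c • Z)) V = c * B (curE Γ p X Y Z) V := by
  rw [map_smul, bilin_smul_left]

lemma weylE_add_left (X Y Z Z' V : Model n) :
    weylE B Γ p e X Y (Z + Z') V = weylE B Γ p e X Y Z V + weylE B Γ p e X Y Z' V := by
  have h : ∀ X, B X (Z + Z') = B X Z + B X Z' := fun X ↦ map_add _ _ _
  simp only [weylE, curE_inner_add, h, ricE_add]
  ring

lemma weylE_smul_left (c : ℝ) (X Y Z V : Model n) : weylE B Γ p e X Y (c • Z) V = c * weylE B Γ p e X Y Z V := by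
  simp only [weylE, curE_inner_smul, bilin_smul_right, ricE_smul]
  ring

lemma weylE_add_right (X Y Z V V' : Model n) :
    weylE B Γ p e X Y Z (V + V') = weylE B Γ p e X Y Z V + weylE B Γ p e X Y Z V' := by
  simp only [weylE, map_add, ricE_add]
  ring

lemma weylE_smul_right (c : ℝ) (X Y Z V : Model n) : weylE B Γ p e X Y Z (c • V) = c * weylE B Γ p e X Y Z V := by
  simp only [weylE, bilin_smul_right, ricE_smul]
  ring

lemma weylE_eq_zero_of_frame {X Y X' Y' : Model n} (he : Submodule.span ℝ (range e) = ⊤)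
    (h : ∀ k l, weylE B Γ p e X Y (e k) (e l) + weylE B Γ p e X' Y' (e k) (e l) = 0) (Z V : Model n) :
    weylE B Γ p e X Y Z V + weylE B Γ p e X' Y' Z V = 0 := by
  have hmem : ∀ Z, Z ∈ Submodule.span ℝ (range e) := fun Z ↦ by rw [he]; trivial
  have h1 : ∀ k V, weylE B Γ p e X Y (e k) V + weylE B Γ p e X' Y' (e k) V = 0 := fun k V ↦ by
    refine Submodule.span_induction (p := fun V _ ↦ weylE B Γ p e X Y (e k) V + weylE B Γ p e X' Y' (e k) V = 0)
      ?_ ?_ ?_ ?_ (hmem V)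
    · rintro _ ⟨l, rfl⟩
      exact h k l
    · rw [← zero_smul ℝ (0 : Model n), weylE_smul_right, weylE_smul_right, zero_mul, zero_mul, add_zero]
    · intro V V' _ _ h1 h2
      rw [weylE_add_right, weylE_add_right]
      linarith
    · intro c V _ h1
      rw [weylE_smul_right, weylE_smul_right, ← mul_add, h1, mul_zero]
  refine Submodule.span_induction (p := fun Z _ ↦ weylE B Γ p e X Y Z V + weylE B Γ p e X' Y' Z V = 0)
    ?_ ?_ ?_ ?_ (hmem Z)
  · rintro _ ⟨k, rfl⟩
    exact h1 k V
  · rw [← zero_smul ℝ (0 : Model n), weylE_smul_left, weylE_smul_left, zero_mul, zero_mul, add_zero]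
  · intro Z Z' _ _ h1 h2
    rw [weylE_add_left, weylE_add_left]
    linarith
  · intro c Z _ h1
    rw [weylE_smul_left, weylE_smul_left, ← mul_add, h1, mul_zero]

lemma weylE_frame (he : ∀ i j, B (e i) (e j) = if i = j then 1 else 0) (i j k l : Fin 4) :
    weylE B Γ p e (e i) (e j) (e k) (e l) = weylR (curvR B Γ p e) i j k l := by
  simp only [weylE, ricE, he]
  rfl

/-- The pairing of a skew endomorphism with the bivector `e₀ ∧ e₂ + e₃ ∧ e₁`. -/
def rho₂ (B : Model n →L[ℝ] Model n →L[ℝ] ℝ) (e : Fin 4 → Model n) (R : EndModel n) : ℝ :=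
  B (R (e 0)) (e 2) + B (R (e 3)) (e 1)

/-- The pairing of a skew endomorphism with the bivector `e₀ ∧ e₃ + e₁ ∧ e₂`. -/
def rho₃ (B : Model n →L[ℝ] Model n →L[ℝ] ℝ) (e : Fin 4 → Model n) (R : EndModel n) : ℝ :=
  B (R (e 0)) (e 3) + B (R (e 1)) (e 2)

lemma rho₂_smul (c : ℝ) (R : EndModel n) : rho₂ B e (c • R) = c * rho₂ B e R := by
  rw [rho₂, rho₂, mul_add, ← bilin_smul_left, ← bilin_smul_left]
  rfl

lemma rho₃_smul (c : ℝ) (R : EndModel n) : rho₃ B e (c • R) = c * rho₃ B e R := by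
  rw [rho₃, rho₃, mul_add, ← bilin_smul_left, ← bilin_smul_left]
  rfl

namespace IsHermForm

/-- The commutator with `J 0` sees the components of a skew endomorphism along `J 1` and `J 2`. -/
lemma commutator_inner (h : IsHermForm B J) (hJ : QTriple J) {R : EndModel n} (hs : ∀ v w, B (R v) w = -B v (R w))
    (v : Model n) : B ((R * J 0 - J 0 * R) v) (J 1 v) = rho₃ B (qframe J v) R ∧
      B ((R * J 0 - J 0 * R) v) (J 2 v) = -rho₂ B (qframe J v) R := by
  have h01 : J 0 (J 1 v) = J 2 v := DFunLike.congr_fun hJ.mul01 v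
  have h02 : J 0 (J 2 v) = -J 1 v := (DFunLike.congr_fun hJ.mul02 v).trans rfl
  have hC : (R * J 0 - J 0 * R) v = R (J 0 v) - J 0 (R v) := rfl
  have r2 : rho₂ B (qframe J v) R = B (R v) (J 1 v) + B (R (J 2 v)) (J 0 v) := rfl
  have r3 : rho₃ B (qframe J v) R = B (R v) (J 2 v) + B (R (J 0 v)) (J 1 v) := rfl
  rw [hC, bilin_sub_left, bilin_sub_left, h.skew 0 (R v), h.skew 0 (R v), h01, h02, map_neg, r2, r3, hs (J 2 v),
    h.symm (J 2 v)]
  constructor <;> ring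

/-- The components of the curvature obstruction. -/
lemma eE_inner (h : IsHermForm B J) (hJ : QTriple J) (hs : ∀ X Y v w, B (curE Γ p X Y v) w = -B v (curE Γ p X Y w))
    (X Y v : Model n) :
    B (eE Γ p (J 0) X Y v) (J 1 v) = rho₃ B (qframe J v) (curE Γ p X Y)
        - rho₃ B (qframe J v) (curE Γ p (J 0 X) (J 0 Y))
        + rho₂ B (qframe J v) (curE Γ p (J 0 X) Y) + rho₂ B (qframe J v) (curE Γ p X (J 0 Y)) ∧
      B (eE Γ p (J 0) X Y v) (J 2 v) = -rho₂ B (qframe J v) (curE Γ p X Y)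
        + rho₂ B (qframe J v) (curE Γ p (J 0 X) (J 0 Y))
        + rho₃ B (qframe J v) (curE Γ p (J 0 X) Y) + rho₃ B (qframe J v) (curE Γ p X (J 0 Y)) := by
  have h01 : J 0 (J 1 v) = J 2 v := DFunLike.congr_fun hJ.mul01 v
  have h02 : J 0 (J 2 v) = -J 1 v := (DFunLike.congr_fun hJ.mul02 v).trans rfl
  have c := fun X Y ↦ h.commutator_inner hJ (hs X Y) v
  have hE : eE Γ p (J 0) X Y v = (curE Γ p X Y * J 0 - J 0 * curE Γ p X Y) v
      - (curE Γ p (J 0 X) (J 0 Y) * J 0 - J 0 * curE Γ p (J 0 X) (J 0 Y)) v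
      + J 0 ((curE Γ p (J 0 X) Y * J 0 - J 0 * curE Γ p (J 0 X) Y) v
        + (curE Γ p X (J 0 Y) * J 0 - J 0 * curE Γ p X (J 0 Y)) v) := rfl
  rw [hE, bilin_add_left, bilin_add_left, bilin_sub_left, bilin_sub_left, h.skew 0, h.skew 0, h01, h02, map_neg,
    bilin_add_left, bilin_add_left, (c _ _).1, (c _ _).1, (c _ _).1, (c _ _).1, (c _ _).2, (c _ _).2, (c _ _).2,
    (c _ _).2]
  constructor <;> ring

lemma app_qframe (hJ : QTriple J) (v : Model n) (i : Fin 4) :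
    J 0 (qframe J v i) = signJ i • qframe J v (permJ i) := by
  have h00 : J 0 (J 0 v) = -v := (DFunLike.congr_fun (hJ.sq 0) v).trans rfl
  have h01 : J 0 (J 1 v) = J 2 v := DFunLike.congr_fun hJ.mul01 v
  have h02 : J 0 (J 2 v) = -J 1 v := (DFunLike.congr_fun hJ.mul02 v).trans rfl
  fin_cases i
  · exact (one_smul ℝ (J 0 v)).symm
  · exact h00.trans (neg_one_smul ℝ v).symm
  · exact h01.trans (one_smul ℝ (J 2 v)).symm
  · exact h02.trans (neg_one_smul ℝ (J 1 v)).symm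

/-- The components of the curvature obstruction in the frame. -/
lemma eE_inner_qframe (h : IsHermForm B J) (hJ : QTriple J)
    (hs : ∀ X Y v w, B (curE Γ p X Y v) w = -B v (curE Γ p X Y w)) (v : Model n) (i j : Fin 4) :
    B (eE Γ p (J 0) (qframe J v i) (qframe J v j) v) (J 1 v) = obstR₂ (curvR B Γ p (qframe J v)) i j ∧
      B (eE Γ p (J 0) (qframe J v i) (qframe J v j) v) (J 2 v) = obstR₃ (curvR B Γ p (qframe J v)) i j := by
  have h1 := h.eE_inner hJ hs (qframe J v i) (qframe J v j) v
  rw [app_qframe hJ, app_qframe hJ, curE_smul_left, curE_smul_left, curE_smul_right, curE_smul_right, rho₂_smul,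
    rho₂_smul, rho₂_smul, rho₂_smul, rho₃_smul, rho₃_smul, rho₃_smul, rho₃_smul] at h1
  refine ⟨h1.1.trans ?_, h1.2.trans ?_⟩
  · simp only [obstR₂, curvR, rho₂, rho₃]
    ring
  · simp only [obstR₃, curvR, rho₂, rho₃]
    ring

lemma pairing_of_eE_eq_zero (h : IsHermForm B J) (hJ : QTriple J)
    (hs : ∀ X Y v w, B (curE Γ p X Y v) w = -B v (curE Γ p X Y w))
    (hb : ∀ X Y Z, curE Γ p X Y Z + curE Γ p Y Z X + curE Γ p Z X Y = 0) (hE : ∀ X Y, eE Γ p (J 0) X Y = 0)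
    (v : Model n) :
    pairing (curvR B Γ p (qframe J v)) 0 2 3 1 0 3 1 2 = 0 ∧ pairing (curvR B Γ p (qframe J v)) 0 2 3 1 0 2 3 1 =
      pairing (curvR B Γ p (qframe J v)) 0 3 1 2 0 3 1 2 := by
  refine (isCurv_curvR h.symm hs hb).obstR_eq_zero_iff.1 fun i j ↦ ?_
  have h1 := h.eE_inner_qframe hJ hs v i j
  rw [hE] at h1
  exact ⟨h1.1.symm.trans (bilin_zero_left B _), h1.2.symm.trans (bilin_zero_left B _)⟩

lemma eE_eq_zero_of_pairing (h : IsHermForm B J) (hJ : QTriple J) (hn : n = 1)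
    (hs : ∀ X Y v w, B (curE Γ p X Y v) w = -B v (curE Γ p X Y w))
    (hb : ∀ X Y Z, curE Γ p X Y Z + curE Γ p Y Z X + curE Γ p Z X Y = 0)
    (hE : ∀ X Y, ∃ k l : ℝ, ∀ Z, eE Γ p (J 0) X Y Z = k • J 1 Z + l • J 2 Z) {v : Model n} (hv : v ≠ 0)
    (h1 : pairing (curvR B Γ p (qframe J v)) 0 2 3 1 0 3 1 2 = 0)
    (h2 : pairing (curvR B Γ p (qframe J v)) 0 2 3 1 0 2 3 1 = pairing (curvR B Γ p (qframe J v)) 0 3 1 2 0 3 1 2)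
    (X Y : Model n) : eE Γ p (J 0) X Y = 0 := by
  have h3 := (isCurv_curvR (e := qframe J v) h.symm hs hb).obstR_eq_zero_iff.2 ⟨h1, h2⟩
  have hN := (h.pos v hv).ne'
  have hin := h.qframe_inner hJ v
  have e11 : B (J 1 v) (J 1 v) = B v v := (hin 2 2).trans (if_pos rfl)
  have e22 : B (J 2 v) (J 2 v) = B v v := (hin 3 3).trans (if_pos rfl)
  have e12 : B (J 1 v) (J 2 v) = 0 := (hin 2 3).trans (if_neg (by decide))
  have e21 : B (J 2 v) (J 1 v) = 0 := (hin 3 2).trans (if_neg (by decide))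
  have h4 : ∀ i j, eE Γ p (J 0) (qframe J v i) (qframe J v j) = 0 := fun i j ↦ by
    obtain ⟨k, l, hkl⟩ := hE (qframe J v i) (qframe J v j)
    have h5 := h.eE_inner_qframe hJ hs v i j
    rw [hkl, bilin_add_left, bilin_add_left, bilin_smul_left, bilin_smul_left, bilin_smul_left, bilin_smul_left,
      e11, e22, e12, e21, (h3 i j).1, (h3 i j).2, mul_zero, mul_zero, add_zero, zero_add] at h5
    have hk := (mul_eq_zero.1 h5.1).resolve_right hN
    have hl := (mul_eq_zero.1 h5.2).resolve_right hN
    refine ContinuousLinearMap.ext fun Z ↦ ?_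
    rw [hkl, hk, hl, zero_smul, zero_smul, add_zero]
    rfl
  have hmem : ∀ X, X ∈ Submodule.span ℝ (range (qframe J v)) := fun X ↦ by
    rw [h.span_qframe hJ hn hv]; trivial
  have hz : ∀ Y, eE Γ p (J 0) 0 Y = 0 := fun Y ↦ by
    have h6 := eE_add_left (Γ := Γ) (p := p) (J 0) 0 0 Y
    rw [add_zero] at h6
    exact left_eq_add.1 h6
  have h5 : ∀ X j, eE Γ p (J 0) X (qframe J v j) = 0 := fun X j ↦ by
    refine Submodule.span_induction (p := fun X _ ↦ eE Γ p (J 0) X (qframe J v j) = 0) ?_ (hz _) ?_ ?_ (hmem X)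
    · rintro _ ⟨i, rfl⟩
      exact h4 i j
    · intro X X' _ _ h1 h2
      rw [eE_add_left, h1, h2, add_zero]
    · intro c X _ h1
      rw [eE_smul_left, h1]
      exact smul_zero c
  rw [eE_swap]
  refine neg_eq_zero.2 ?_
  refine Submodule.span_induction (p := fun Y _ ↦ eE Γ p (J 0) Y X = 0) ?_ (hz _) ?_ ?_ (hmem Y)
  · rintro _ ⟨i, rfl⟩
    rw [eE_swap, h5]
    exact neg_zero
  · intro X X' _ _ h1 h2
    rw [eE_add_left, h1, h2, add_zero]
  · intro c X _ h1
    rw [eE_smul_left, h1]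
    exact smul_zero c

lemma weylE_eq_zero_iff (h : IsHermForm B J) (hJ : QTriple J) (hn : n = 1)
    (hs : ∀ X Y v w, B (curE Γ p X Y v) w = -B v (curE Γ p X Y w))
    (hb : ∀ X Y Z, curE Γ p X Y Z + curE Γ p Y Z X + curE Γ p Z X Y = 0) {v : Model n} (hv : B v v = 1) :
    (∀ Z V, weylE B Γ p (qframe J v) (qframe J v 0) (qframe J v 1) Z V +
        weylE B Γ p (qframe J v) (qframe J v 2) (qframe J v 3) Z V = 0) ↔
      pairing (curvR B Γ p (qframe J v)) 0 1 2 3 0 2 3 1 = 0 ∧ pairing (curvR B Γ p (qframe J v)) 0 1 2 3 0 3 1 2 = 0 ∧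
      2 * pairing (curvR B Γ p (qframe J v)) 0 1 2 3 0 1 2 3 =
        pairing (curvR B Γ p (qframe J v)) 0 2 3 1 0 2 3 1 + pairing (curvR B Γ p (qframe J v)) 0 3 1 2 0 3 1 2 := by
  have hv0 : v ≠ 0 := fun h0 ↦ by
    rw [h0, bilin_zero_left] at hv
    exact zero_ne_one hv
  have he : ∀ i j, B (qframe J v i) (qframe J v j) = if i = j then 1 else 0 := fun i j ↦ by
    rw [h.qframe_inner hJ, hv]
  rw [← (isCurv_curvR (e := qframe J v) h.symm hs hb).weylR_eq_zero_iff]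
  simp only [← weylE_frame he]
  exact ⟨fun h k l ↦ h _ _, weylE_eq_zero_of_frame (h.span_qframe hJ hn hv0)⟩

end IsHermForm

end FrameComponents

section AntiSelfDual

variable [T2Space M] [SigmaCompactSpace M] {Q : AlmostQuaternionicStructure n M} {D : Connection n M} {g : Metric n M}

lemma inner_eq_gE (g : Metric n M) (x : M) (X Y : TM n M x) : g.inner x X Y = gE g x (crd n x x) X Y := by
  have h := gE_tc g (mem_chart_source _ x) X Y
  rw [tcoord_self, tcoord_self] at h
  exact h.symm

lemma curv_eq (hD : IsSmoothConnection D) (x : M) (X Y Z V : TM n M x) :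
    curv g D x X Y Z V = gE g x (crd n x x) (curE (christoffel D x) (crd n x x) X Y Z) V := by
  have h := curvature_eq_curE hD x X Y Z
  rw [tcoord_self, tcoord_self, tcoord_self, tcoord_self] at h
  rw [curv, inner_eq_gE, h]

lemma weyl_eq (hD : IsSmoothConnection D) (x : M) (e : Fin 4 → TM n M x) (X Y Z V : TM n M x) :
    weyl g D x e X Y Z V = weylE (gE g x (crd n x x)) (christoffel D x) (crd n x x) e X Y Z V := by
  simp only [weyl, scal, ricci, curv_eq hD, inner_eq_gE]
  rfl

lemma IsLeviCivita.curE_bianchi (h : IsLeviCivita g D) {x₀ : M} {p : Model n} (hp : p ∈ (crd n x₀).target)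
    (X Y Z : Model n) : curE (christoffel D x₀) p X Y Z + curE (christoffel D x₀) p Y Z X
      + curE (christoffel D x₀) p Z X Y = 0 := by
  refine AlmostQuaternionic.curE_bianchi ((contDiffAt_christoffel h.smooth hp).differentiableAt (by simp)) ?_ X Y Z
  filter_upwards [target_mem_nhds hp] with r hr using torE_eq_zero h.torsion_free hr

/-- In dimension four, the self-dual Weyl tensor vanishes if and only if the curvature obstruction does: both conditions,
for all quaternionic triples, say that the curvature form on self-dual bivectors is a multiple of the identity. -/
lemma IsLeviCivita.selfDualWeylVanishes_iff (hn : n = 1) (h : IsLeviCivita g D) (hg : Q.IsHermitian g) :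
    Q.SelfDualWeylVanishes g D ↔ ∀ (x : M) (A : EndModel n), (crd n x x, A) ∈ twZ Q x → ∀ X Y : Model n,
      eE (christoffel D x) (crd n x x) A X Y = 0 := by
  have hx : ∀ x : M, x ∈ dom n x := fun x ↦ mem_chart_source _ _
  have hp : ∀ x : M, crd n x x ∈ (crd n x).target := fun x ↦ crd_mem_target (hx x)
  have hs := fun x ↦ h.curE_skew (hp x)
  have hb := fun x ↦ h.curE_bianchi (hp x)
  constructor
  · intro hW x A hA
    obtain ⟨J, hJ, rfl, hJs⟩ := exists_adapted_frame hn.ge (hx x) hA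
    have hJm : ∀ a, J a ∈ fibE Q x (crd n x x) := fun a ↦ by
      rw [hJs]; exact Submodule.subset_span ⟨a, rfl⟩
    have hform := hg.isHermForm (hp x) hJ hJm
    have hform' := hform.rot
    have hJ' := hJ.rot
    obtain ⟨v, hv⟩ : ∃ v, gE g x (crd n x x) v v = 1 := by
      have : Nontrivial (Model n) := by
        subst hn
        exact Module.nontrivial_of_finrank_pos (R := ℝ) (by simp)
      obtain ⟨w, hw⟩ := exists_ne (0 : Model n)
      have hw' := hform.pos w hw
      refine ⟨(Real.sqrt (gE g x (crd n x x) w w))⁻¹ • w, ?_⟩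
      rw [bilin_smul_left, bilin_smul_right]
      have h1 := Real.mul_self_sqrt hw'.le
      have h2 := (Real.sqrt_pos.2 hw').ne'
      field_simp
      rw [sq, h1]
    have hv0 : v ≠ 0 := fun h0 ↦ by
      rw [h0, bilin_zero_left] at hv
      exact zero_ne_one hv
    have hmem : ∀ a, (J a : EndT n M x) ∈ Q.fiber x := fun a ↦
      (hatE_mem_fibE (hx x)).1 (by
        have e : hatE (n := n) x x (J a) = J a := hatE_self x (J a)
        rw [e]
        exact hJm a)
    have key : ∀ K : Fin 3 → EndModel n, QTriple K → (∀ a, (K a : EndT n M x) ∈ Q.fiber x) → ∀ Z V,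
        weylE (gE g x (crd n x x)) (christoffel D x) (crd n x x) (qframe K v) (qframe K v 0) (qframe K v 1) Z V +
        weylE (gE g x (crd n x x)) (christoffel D x) (crd n x x) (qframe K v) (qframe K v 2) (qframe K v 3) Z V = 0 := by
      intro K hK hKm Z V
      have h1 := hW x K hKm ⟨hK.sq, hK.mul01, hK.mul10⟩ v ((inner_eq_gE g x v v).trans hv) Z V
      exact (congrArg₂ (fun a b : ℝ ↦ a + b) (weyl_eq h.smooth x _ _ _ _ _) (weyl_eq h.smooth x _ _ _ _ _)).symm.trans h1
    -- The obstruction at `J 0` concerns the second and third bivector of the frame; the Weyl condition for the first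
    -- bivector is combined with the one for the cyclically permuted triple.
    have k1 := (hform.weylE_eq_zero_iff hJ hn (hs x) (hb x) hv).1 (key J hJ hmem)
    have k2 := (hform'.weylE_eq_zero_iff hJ' hn (hs x) (hb x) hv).1 (key _ hJ' fun a ↦ by
      fin_cases a
      exacts [hmem 1, hmem 2, hmem 0])
    obtain ⟨-, -, k3⟩ := k1
    have k4 : pairing (curvR (gE g x (crd n x x)) (christoffel D x) (crd n x x) (qframe J v)) 0 2 3 1 0 3 1 2 = 0 := k2.1
    have k5 : 2 * pairing (curvR (gE g x (crd n x x)) (christoffel D x) (crd n x x) (qframe J v)) 0 2 3 1 0 2 3 1 =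
        pairing (curvR (gE g x (crd n x x)) (christoffel D x) (crd n x x) (qframe J v)) 0 3 1 2 0 3 1 2 +
        pairing (curvR (gE g x (crd n x x)) (christoffel D x) (crd n x x) (qframe J v)) 0 1 2 3 0 1 2 3 := k2.2.2
    refine hform.eE_eq_zero_of_pairing hJ hn (hs x) (hb x)
      (exists_eE_eq hn.ge (h.isQuaternionicConnection hn hg) (hx x) hJ hA hJs) hv0 k4 (by linarith)
  · intro hE x J hJm hJ X hX Z V
    have hJ' : QTriple (A := EndModel n) J := ⟨hJ.sq, hJ.mul, hJ.mul_swap⟩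
    have hJm' : ∀ a, (J a : EndModel n) ∈ fibE Q x (crd n x x) := fun a ↦ by
      have h1 := (hatE_mem_fibE (hx x)).2 (hJm a)
      rwa [hatE_self] at h1
    have hform := hg.isHermForm (hp x) hJ' hJm'
    have hv : gE g x (crd n x x) X X = 1 := (inner_eq_gE g x X X).symm.trans hX
    have hE' : ∀ a X Y, eE (christoffel D x) (crd n x x) (J a) X Y = 0 := fun a ↦ hE x (J a) ⟨hJm' a, hJ'.sq a⟩
    -- The obstructions at `J 0`, `J 1` and `J 2` give the three rows of the curvature form.
    have p1 := hform.pairing_of_eE_eq_zero hJ' (hs x) (hb x) (hE' 0) X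
    have p2 := hform.rot.pairing_of_eE_eq_zero hJ'.rot (hs x) (hb x) (hE' 1) X
    have p3 := hform.rot.rot.pairing_of_eE_eq_zero hJ'.rot.rot (hs x) (hb x) (hE' 2) X
    have hc := isCurv_curvR (e := qframe (n := n) J X) hform.symm (hs x) (hb x)
    have q2 : pairing (curvR (gE g x (crd n x x)) (christoffel D x) (crd n x x) (qframe (n := n) J X)) 0 3 1 2 0 1 2 3 = 0
        ∧ pairing (curvR (gE g x (crd n x x)) (christoffel D x) (crd n x x) (qframe (n := n) J X)) 0 3 1 2 0 3 1 2 =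
          pairing (curvR (gE g x (crd n x x)) (christoffel D x) (crd n x x) (qframe (n := n) J X)) 0 1 2 3 0 1 2 3 := p2
    have q3 : pairing (curvR (gE g x (crd n x x)) (christoffel D x) (crd n x x) (qframe (n := n) J X)) 0 1 2 3 0 2 3 1 = 0
        ∧ pairing (curvR (gE g x (crd n x x)) (christoffel D x) (crd n x x) (qframe (n := n) J X)) 0 1 2 3 0 1 2 3 =
          pairing (curvR (gE g x (crd n x x)) (christoffel D x) (crd n x x) (qframe (n := n) J X)) 0 2 3 1 0 2 3 1 := p3
    have hk := (hform.weylE_eq_zero_iff hJ' hn (hs x) (hb x) hv).2 ⟨q3.1, by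
      rw [← q2.1]
      simp only [pairing]
      rw [hc.pair_symm 0 1 0 3, hc.pair_symm 0 1 1 2, hc.pair_symm 2 3 0 3, hc.pair_symm 2 3 1 2]
      ring, by linarith [q2.2, q3.2]⟩ Z V
    rw [weyl_eq h.smooth, weyl_eq h.smooth]
    exact hk

end AntiSelfDual

end

section
/-! ### Torsion-free connections and the integrable structure -/

variable {n : ℕ} {M : Type*} [TopologicalSpace M] [ChartedSpace (Model n) M]
  [IsManifold (𝓡 (4 * n)) ∞ M]

variable [T2Space M] [SigmaCompactSpace M] {Q : AlmostQuaternionicStructure n M} {D : Connection n M}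

/-- The function `tE` represents a component of the torsion tensor. -/
lemma tE_eq_tc (D : Connection n M) {x₀ y : M} (hy : y ∈ dom n x₀) (a : EndT n M y) (X Y : TM n M y) :
    tE (christoffel D x₀) (crd n x₀ y) (hatE x₀ y a) (tc x₀ y X) (tc x₀ y Y) =
      tc x₀ y (D.torsion y (a X) (a Y) - D.torsion y X Y - a (D.torsion y (a X) Y) - a (D.torsion y X (a Y))) := by
  rw [tE, hatE_tc hy, hatE_tc hy, ← tc_torsion D hy, ← tc_torsion D hy, ← tc_torsion D hy, ← tc_torsion D hy,
    hatE_tc hy, hatE_tc hy, map_sub, map_sub, map_sub]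

/-- The torsion condition may be checked in the charts around the points, or in all charts. -/
lemma tE_eq_zero_of_twistorSpace (ht : ∀ z ∈ Q.twistorSpace, ∀ X Y : Model n,
      tE (christoffel D z.1) (endCrd z.1 z).1 (endCrd z.1 z).2 X Y = 0) {x₀ y : M} (hy : y ∈ dom n x₀)
    {A : EndModel n} (hA : (crd n x₀ y, A) ∈ twZ Q x₀) (X Y : Model n) :
    tE (christoffel D x₀) (crd n x₀ y) A X Y = 0 := by
  have hyy : y ∈ dom n y := mem_chart_source _ _
  have hz : (⟨y, unhatE x₀ y A⟩ : EndTM n M) ∈ Q.twistorSpace := by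
    rw [mem_twistorSpace_iff (x₀ := x₀) hy, endCrd_eq hy]
    change (crd n x₀ y, hatE x₀ y (unhatE x₀ y A)) ∈ twZ Q x₀
    rwa [hatE_unhatE hy]
  have h1 := ht _ hz (tc y y (tcInv x₀ y X)) (tc y y (tcInv x₀ y Y))
  rw [endCrd_eq hyy] at h1
  have h2 := (tE_eq_tc D hyy (unhatE x₀ y A) _ _).symm.trans h1
  have h3 := tcoord_injective hyy (h2.trans (map_zero _).symm)
  have h4 := tE_eq_tc D hy (unhatE x₀ y A) (tcInv x₀ y X) (tcInv x₀ y Y)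
  have t : ∀ v, tc x₀ y (tcInv x₀ y v) = v := fun v ↦ tcoord_tcoordInv hy v
  rw [h3, map_zero, hatE_unhatE hy, t, t] at h4
  exact h4

lemma tE_eq_zero_of_torsion (h : D.torsion = 0) {x₀ : M} {p : Model n} (hp : p ∈ (crd n x₀).target) (A : EndModel n)
    (X Y : Model n) : tE (christoffel D x₀) p A X Y = 0 := by
  rw [tE, torE_eq_zero h hp, torE_eq_zero h hp, torE_eq_zero h hp, torE_eq_zero h hp, map_zero, sub_zero, sub_zero,
    sub_zero]

/-- A torsion-free quaternionic connection for which the curvature obstruction vanishes defines the only integrable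
structure `I₁`. -/
lemma existsUnique_isIntegrable (hn : 1 ≤ n) (hD : Q.IsQuaternionicConnection D) (h : D.torsion = 0)
    (hE : ∀ (x : M) (A : EndModel n), (crd n x x, A) ∈ twZ Q x → ∀ X Y : Model n,
      eE (christoffel D x) (crd n x x) A X Y = 0) :
    ∃! I : Q.TwistorAlmostComplexStructure, I.IsIntegrable ∧
      ∃ D : Connection n M, Q.IsQuaternionicConnection D ∧ I.IsI₁ D := by
  have hI := twistorACS_isI₁ hn hD
  have ht : ∀ z ∈ Q.twistorSpace, ∀ X Y : Model n,
      tE (christoffel D z.1) (endCrd z.1 z).1 (endCrd z.1 z).2 X Y = 0 := fun z _ X Y ↦ by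
    rw [endCrd_eq (mem_chart_source _ _)]
    exact tE_eq_zero_of_torsion h (crd_mem_target (mem_chart_source _ _)) _ X Y
  refine ⟨twistorACS hn hD, ⟨(isIntegrable_iff hn hD hI).2 fun z hz X Y ↦ ⟨ht z hz X Y, ?_⟩, D, hD, hI⟩, ?_⟩
  · have h1 := (mem_twistorSpace_iff (mem_chart_source _ z.1)).1 hz
    rw [endCrd_eq (mem_chart_source _ _)] at h1 ⊢
    exact hE z.1 _ h1 X Y
  · rintro I' ⟨hI'i, D', hD', hI'⟩
    exact isI₁_unique hn hD hD' hI hI' ht fun z hz X Y ↦ ((isIntegrable_iff hn hD' hI').1 hI'i z hz X Y).1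

end

end

end AlmostQuaternionic

open AlmostQuaternionic

theorem mainTheorem2 {n : ℕ} (hn : 1 ≤ n) {M : Type*} [TopologicalSpace M] [T2Space M]
    [SigmaCompactSpace M] [ChartedSpace (AlmostQuaternionic.Model n) M]
    [IsManifold (𝓡 (4 * n)) ∞ M]
    (Q : AlmostQuaternionic.AlmostQuaternionicStructure n M) :
    ((2 ≤ n ∧ Q.IsQuaternionic) ∨ (n = 1 ∧ Q.IsAntiSelfDual)) ↔
      ∃! I : Q.TwistorAlmostComplexStructure,
        I.IsIntegrable ∧
          ∃ D : AlmostQuaternionic.Connection n M, Q.IsQuaternionicConnection D ∧ I.IsI₁ D := by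
  constructor
  · rintro (⟨hn2, D, hD, h⟩ | ⟨hn1, g, D, hg, hD, hW⟩)
    · exact existsUnique_isIntegrable hn hD h fun x A hA X Y ↦
        eE_eq_zero_of_torsion hn2 hD h (mem_chart_source _ x) hA X Y
    · exact existsUnique_isIntegrable hn (hD.isQuaternionicConnection hn1 hg) hD.torsion_free
        ((hD.selfDualWeylVanishes_iff hn1 hg).1 hW)
  · rintro ⟨I, ⟨hint, D, hD, hI⟩, -⟩
    have ht := fun z hz X Y ↦ ((isIntegrable_iff hn hD hI).1 hint z hz X Y).1
    rcases hn.lt_or_eq with hn2 | hn1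
    · exact Or.inl ⟨hn2, isQuaternionic_of_tE_eq_zero hD fun x₀ y hy A hA ↦ tE_eq_zero_of_twistorSpace ht hy hA⟩
    · refine Or.inr ⟨hn1.symm, ?_⟩
      obtain ⟨g, hg⟩ := exists_hermitian_metric Q
      obtain ⟨D', hD'⟩ := exists_isLeviCivita g hD.smooth
      have hQ := hD'.isQuaternionicConnection hn1.symm hg
      -- The Levi-Civita connection is torsion-free, hence it defines the same structure `I₁` as `D`.
      have hI' : twistorACS hn hQ = I := isI₁_unique hn hD hQ hI (twistorACS_isI₁ hn hQ) ht fun z _ X Y ↦ by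
        rw [endCrd_eq (mem_chart_source _ _)]
        exact tE_eq_zero_of_torsion hD'.torsion_free (crd_mem_target (mem_chart_source _ _)) _ X Y
      refine ⟨g, D', hg, hD', (hD'.selfDualWeylVanishes_iff hn1.symm hg).2 fun x A hA X Y ↦ ?_⟩
      have hx : x ∈ dom n x := mem_chart_source _ _
      have hz : (⟨x, unhatE x x A⟩ : EndTM n M) ∈ Q.twistorSpace := by
        rw [mem_twistorSpace_iff (x₀ := x) hx, endCrd_eq hx]
        change (crd n x x, hatE x x (unhatE x x A)) ∈ twZ Q x
        rwa [hatE_unhatE hx]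
      have h1 := ((isIntegrable_iff hn hQ (twistorACS_isI₁ hn hQ)).1 (hI' ▸ hint) _ hz X Y).2
      rw [endCrd_eq hx] at h1
      change eE (christoffel D' x) (crd n x x) (hatE x x (unhatE x x A)) X Y = 0 at h1
      rwa [hatE_unhatE hx] at h1
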